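/- Manifolds are smooth, finite-dimensional, Hausdorff and second countable, without boundary; vector bundles are smooth, real and of finite rank. Let $n\ge 0$ be an integer. An *$n$-coalgebra bundle* $(\mathbf E\to M,\mu)$ is a graded vector bundle $\mathbf E=\bigoplus_{i=-n}^{-1}E_i$ over a manifold $M$ with a smooth degree-preserving bundle map $\mu:\mathbf E\to\mathbf E\otimes\mathbf E$ over $\mathrm{id}_M$ that is coassociative, $(\mathrm{id}\otimes\mu)\mu=(\mu\otimes\mathrm{id})\mu$, and graded cocommutative, $\tau\mu=\mu$, where $\tau(e\otimes e')=(-1)^{|e||e'|}e'\otimes e$. A morphism $(\mathbf E\to M,\mu)\to(\mathbf F\to N,\nu)$ is a degree-preserving smooth vector bundle map $\Phi:\mathbf E\to\mathbf F$, over a smooth map $\phi:M\to N$, with $\nu\circ\Phi=(\Phi\otimes\Phi)\circ\mu$. Put $\mu^0=\mathrm{id}$ and $\mu^{k+1}=(\mathrm{id}\otimes\mu^k)\circ\mu:\mathbf E\to\mathbf E^{\otimes(k+2)}$. Let $\mathbf K^\mu\subseteq\mathbf E\otimes\mathbf E$ consist of all $e$ such that $$\sigma\cdot(\mu^k\otimes\mu^\ell)(e)=\sigma'\cdot(\mu^{k'}\otimes\mu^{\ell'})(e)$$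 for all $k,\ell,k',\ell'\ge 0$ with $k+\ell=k'+\ell'$ and all $\sigma,\sigma'\in S_{k+\ell+2}$, which act on the tensor power by permuting the factors with Koszul signs. The bundle $(\mathbf E,\mu)$ is *admissible* if, at each point of $M$, $\mu(E_i)$ is the degree $i$ part $K^\mu_i$ of $\mathbf K^\mu$, for $i=-n,\dots,-2$. An *$\mathbb N$-manifold of degree $n$* is a ringed space $(M,C)$ where $M$ is a manifold and $C$ is a sheaf of ($\mathbb N$-)graded commutative $\mathbb R$-algebras, such that for some finite-dimensional graded vector space $\mathbf V=\bigoplus_{i=1}^nV_i$ each point of $M$ has an open neighbourhood $U$ on which $C|_U$ is isomorphic, as a sheaf of graded algebras, to the sheafification of $U'\mapsto C^\infty(U')\otimes\mathrm{Sym}\,\mathbf V$, with $\mathrm{Sym}$ the graded symmetric algebra. A morphism $(M,C)\to(N,D)$ is a morphism of ringed spaces $(\psi,\psi^\sharp)$ with $\psi:M\to N$ smooth and $\psi^\sharp:D\to\psi_*C$ a degree-preserving morphism of sheaves of algebras. For an $n$-coalgebra bundle let $\mu^*:\Gamma_{\mathbf E^*}\times\Gamma_{\mathbf E^*}\to\Gamma_{\mathbf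 E^*}$ be the product dual to $\mu$, where $\mathbf E^*=\bigoplus_{i=1}^nE_{-i}^*$ with $E_{-i}^*$ in degree $i$, and let $\mathcal I_\mu\subseteq\Gamma_{\mathrm{Sym}\,\mathbf E^*}$ be the sheaf of ideals generated by $\omega\cdot\eta-\mu^*(\omega,\eta)$ for homogeneous local sections $\omega,\eta$ of $\mathbf E^*$ with $|\omega|+|\eta|\le n$. Put $$\mathcal F(\mathbf E\to M,\mu)=(M,\Gamma_{\mathrm{Sym}\,\mathbf E^*}/\mathcal I_\mu),\qquad \mathcal F(\Phi)=(\phi,\phi^\sharp),$$ where $\phi^\sharp$ is induced by the pullback of sections along $\Phi$. **Theorem.** For each integer $n\ge 0$: if $(\mathbf E,\mu)$ is an admissible $n$-coalgebra bundle, then $\mathcal F(\mathbf E,\mu)$ is an $\mathbb N$-manifold of degree $n$; and the resulting functor $\mathcal F$ from the category of admissible $n$-coalgebra bundles to the category of $\mathbb N$-manifolds of degree $n$ is an equivalence of categories. -/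

import Mathlib

open CategoryTheory TopologicalSpace Opposite
open scoped Manifold ContDiff TensorProduct

noncomputable section

namespace NMan

/-! ### Graded linear algebra

A finite family `V : Fin n → Type` of vector spaces is a graded vector space; the index `i : Fin n`
has weight `wt i = i + 1`.  For a coalgebra bundle `V i` sits in degree `-(wt i)`, for its dual and
for the generators of the functions on a graded manifold `V i` sits in degree `wt i`. -/

/-- The weight `1, …, n` of the index `i : Fin n`. -/
def wt {n : ℕ} (i : Fin n) : ℕ := i + 1

section Linear

variable {n : ℕ} (V : Fin n → Type) [∀ i, AddCommGroup (V i)] [∀ i, Module ℝ (V i)]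

/-- The total space `⊕ᵢ Vᵢ` of a (finite) graded vector space. -/
abbrev Tot : Type := ∀ i, V i

/-- The inclusion of the `i`-th component in the total space. -/
abbrev inc (i : Fin n) : V i →ₗ[ℝ] Tot V := LinearMap.single ℝ V i

/-- The projection of the total space to the `i`-th component. -/
abbrev prj (i : Fin n) : Tot V →ₗ[ℝ] V i := LinearMap.proj i

/-- The part of weight `l` of `V ⊗ V`. -/
def tensorWt (l : ℕ) : Submodule ℝ (Tot V ⊗[ℝ] Tot V) :=
  Submodule.span ℝ {z | ∃ (i j : Fin n) (a : V i) (b : V j),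
    wt i + wt j = l ∧ z = inc V i a ⊗ₜ[ℝ] inc V j b}

/-- The graded braiding of `V ⊗ V`: on homogeneous elements,
`e ⊗ e' ↦ (-1)^(|e||e'|) e' ⊗ e`. -/
def braid : Tot V ⊗[ℝ] Tot V →ₗ[ℝ] Tot V ⊗[ℝ] Tot V :=
  ∑ i : Fin n, ∑ j : Fin n, ((-1 : ℝ) ^ (wt i * wt j)) •
    ((TensorProduct.comm ℝ (Tot V) (Tot V)).toLinearMap ∘ₗ
      TensorProduct.map (inc V i ∘ₗ prj V i) (inc V j ∘ₗ prj V j))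

/-- The Koszul sign of the permutation `v₁ ⊗ ⋯ ⊗ v_N ↦ v_{σ(1)} ⊗ ⋯ ⊗ v_{σ(N)}` where `v_p` is
homogeneous of degree `± d p`: a factor `(-1)^(|v||w|)` for each pair that changes its order. -/
def koszulSign {N : ℕ} (σ : Equiv.Perm (Fin N)) (d : Fin N → ℕ) : ℝ :=
  ∏ p : Fin N × Fin N,
    if p.1 < p.2 ∧ σ p.2 < σ p.1 then (-1 : ℝ) ^ (d (σ p.1) * d (σ p.2)) else 1

/-- The graded braiding action of a permutation on `⊗^N V`: on homogeneous elements,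
`σ · (v₁ ⊗ ⋯ ⊗ v_N) = ε(σ) v_{σ(1)} ⊗ ⋯ ⊗ v_{σ(N)}` with `ε(σ)` the Koszul sign. -/
def permAct {N : ℕ} (σ : Equiv.Perm (Fin N)) :
    TensorPower ℝ N (Tot V) →ₗ[ℝ] TensorPower ℝ N (Tot V) :=
  PiTensorProduct.lift (∑ d : Fin N → Fin n, koszulSign σ (fun p => wt (d p)) •
    (((PiTensorProduct.tprod ℝ : MultilinearMap ℝ (fun _ : Fin N => Tot V)
        (TensorPower ℝ N (Tot V))).domDomCongr σ).compLinearMap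
      (fun p => inc V (d p) ∘ₗ prj V (d p))))

/-- The identification of `⊗^1 V` with `V`. -/
def oneEquiv : TensorPower ℝ 1 (Tot V) ≃ₗ[ℝ] Tot V :=
  PiTensorProduct.subsingletonEquiv (0 : Fin 1)

variable {V}

/-- Degree preserving, coassociative and graded cocommutative comultiplications
`μ : V → V ⊗ V` on a graded vector space (no counit). -/
structure IsCoalg (μ : Tot V →ₗ[ℝ] Tot V ⊗[ℝ] Tot V) : Prop where
  degree : ∀ (i : Fin n) (v : V i), μ (inc V i v) ∈ tensorWt V (wt i)
  coassoc : (TensorProduct.assoc ℝ (Tot V) (Tot V) (Tot V)).toLinearMap ∘ₗ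
    μ.rTensor (Tot V) ∘ₗ μ = μ.lTensor (Tot V) ∘ₗ μ
  cocomm : braid V ∘ₗ μ = μ

/-- The iterated comultiplication `μ^k : V → ⊗^(k+1) V`,
`μ^0 = id` and `μ^(k+1) = (id ⊗ μ^k) ∘ μ`, that is
`μ^k = (id ⊗ ⋯ ⊗ id ⊗ μ) ∘ ⋯ ∘ (id ⊗ μ) ∘ μ`. -/
def iterComul (μ : Tot V →ₗ[ℝ] Tot V ⊗[ℝ] Tot V) :
    (k : ℕ) → Tot V →ₗ[ℝ] TensorPower ℝ (k + 1) (Tot V)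
  | 0 => (oneEquiv V).symm.toLinearMap
  | k + 1 =>
    (TensorPower.cast ℝ (Tot V) (Nat.add_comm 1 (k + 1))).toLinearMap ∘ₗ
      (TensorPower.mulEquiv (R := ℝ) (M := Tot V) (n := 1) (m := k + 1)).toLinearMap ∘ₗ
        TensorProduct.map (oneEquiv V).symm.toLinearMap (iterComul μ k) ∘ₗ μ

/-- The map `μ^k ⊗ μ^l : V ⊗ V → ⊗^(k+l+2) V`. -/
def iterPair (μ : Tot V →ₗ[ℝ] Tot V ⊗[ℝ] Tot V) (k l : ℕ) :
    Tot V ⊗[ℝ] Tot V →ₗ[ℝ] TensorPower ℝ (k + 1 + (l + 1)) (Tot V) :=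
  (TensorPower.mulEquiv (R := ℝ) (M := Tot V) (n := k + 1) (m := l + 1)).toLinearMap ∘ₗ
    TensorProduct.map (iterComul μ k) (iterComul μ l)

/-- The space `K^μ ⊆ V ⊗ V` of all `e` with
`τ · (μ^k ⊗ μ^l)(e) = τ' · (μ^k' ⊗ μ^l')(e)` for all `k + l = k' + l'` and all permutations
`τ, τ'` of the `k + l + 2` tensor factors. -/
def coassocSpace (μ : Tot V →ₗ[ℝ] Tot V ⊗[ℝ] Tot V) : Submodule ℝ (Tot V ⊗[ℝ] Tot V) where
  carrier := {e | ∀ (k l k' l' : ℕ) (h : k + l = k' + l')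
    (τ τ' : Equiv.Perm (Fin (k + 1 + (l + 1)))),
    permAct V τ (iterPair μ k l e) =
      permAct V τ' (TensorPower.cast ℝ (Tot V)
        (show k' + 1 + (l' + 1) = k + 1 + (l + 1) by omega) (iterPair μ k' l' e))}
  add_mem' := by
    intro a b ha hb k l k' l' h τ τ'
    simp only [map_add, ha k l k' l' h τ τ', hb k l k' l' h τ τ']
  zero_mem' := by
    intro k l k' l' h τ τ'
    simp only [map_zero]
  smul_mem' := by
    intro c a ha k l k' l' h τ τ'
    simp only [map_smul, ha k l k' l' h τ τ']

/-- The product on the dual of a coalgebra, in components: for `ξ ∈ (V i)*` and `η ∈ (V j)*`, the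
component in `(V k)*` of `μ*(ξ, η) = (ξ ⊗ η) ∘ μ`. -/
def dualMul (μ : Tot V →ₗ[ℝ] Tot V ⊗[ℝ] Tot V) (i j k : Fin n)
    (ξ : Module.Dual ℝ (V i)) (η : Module.Dual ℝ (V j)) : Module.Dual ℝ (V k) :=
  LinearMap.mul' ℝ ℝ ∘ₗ TensorProduct.map (ξ ∘ₗ prj V i) (η ∘ₗ prj V j) ∘ₗ μ ∘ₗ inc V k

variable (V)

/-- The defining relations of the graded symmetric algebra. -/
inductive SymRel : TensorAlgebra ℝ (Tot V) → TensorAlgebra ℝ (Tot V) → Prop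
  | comm (i j : Fin n) (v : V i) (w : V j) :
      SymRel (TensorAlgebra.ι ℝ (inc V i v) * TensorAlgebra.ι ℝ (inc V j w))
        (((-1 : ℝ) ^ (wt i * wt j)) •
          (TensorAlgebra.ι ℝ (inc V j w) * TensorAlgebra.ι ℝ (inc V i v)))

/-- The graded symmetric algebra of the graded vector space `V`, with `V i` in degree `wt i`: the
tensor algebra modulo `v w = (-1)^(|v||w|) w v`. -/
def GSym : Type := RingQuot (SymRel V)

instance : Ring (GSym V) := inferInstanceAs (Ring (RingQuot (SymRel V)))

instance : Algebra ℝ (GSym V) := inferInstanceAs (Algebra ℝ (RingQuot (SymRel V)))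

variable {V}

/-- The quotient map from the tensor algebra to the graded symmetric algebra. -/
def GSym.mk : TensorAlgebra ℝ (Tot V) →ₐ[ℝ] GSym V := RingQuot.mkAlgHom ℝ (SymRel V)

/-- The inclusion of the generators in the graded symmetric algebra. -/
def GSym.ι (i : Fin n) : V i →ₗ[ℝ] GSym V :=
  GSym.mk.toLinearMap ∘ₗ TensorAlgebra.ι ℝ ∘ₗ inc V i

variable (V)

/-- The homogeneous part of degree `l` of the graded symmetric algebra, spanned by the products of
homogeneous generators of total degree `l`. -/
def GSym.deg (l : ℕ) : Submodule ℝ (GSym V) :=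
  Submodule.span ℝ {z | ∃ L : List (Σ i, V i),
    (L.map (fun p => wt p.1)).sum = l ∧ z = (L.map (fun p => GSym.ι p.1 p.2)).prod}

variable {V}

theorem GSym.ι_mul_ι (i j : Fin n) (v : V i) (w : V j) :
    GSym.ι i v * GSym.ι j w = ((-1 : ℝ) ^ (wt i * wt j)) • (GSym.ι j w * GSym.ι i v) := by
  have h : GSym.mk _ = GSym.mk _ := RingQuot.mkAlgHom_rel ℝ (SymRel.comm i j v w)
  simp only [map_mul, map_smul] at h
  exact h

theorem GSym.ι_mem (i : Fin n) (v : V i) : GSym.ι i v ∈ GSym.deg V (wt i) :=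
  Submodule.subset_span ⟨[⟨i, v⟩], by simp, by simp⟩

theorem GSym.one_mem : (1 : GSym V) ∈ GSym.deg V 0 :=
  Submodule.subset_span ⟨[], by simp, by simp⟩

theorem GSym.mul_mem {k l : ℕ} {a b : GSym V} (ha : a ∈ GSym.deg V k) (hb : b ∈ GSym.deg V l) :
    a * b ∈ GSym.deg V (k + l) := by
  induction ha, hb using Submodule.span_induction₂ with
  | mem_mem x y hx hy =>
    obtain ⟨L, rfl, rfl⟩ := hx
    obtain ⟨L', rfl, rfl⟩ := hy
    exact Submodule.subset_span ⟨L ++ L', by simp, by simp⟩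
  | zero_left y hy => simp
  | zero_right x hx => simp
  | add_left x y z hx hy hz h₁ h₂ => rw [add_mul]; exact add_mem h₁ h₂
  | add_right x y z hx hy hz h₁ h₂ => rw [mul_add]; exact add_mem h₁ h₂
  | smul_left r x y hx hy h => rw [smul_mul_assoc]; exact Submodule.smul_mem _ _ h
  | smul_right r x y hx hy h => rw [mul_smul_comm]; exact Submodule.smul_mem _ _ h

theorem GSym.ι_mul_prod (i : Fin n) (v : V i) (L : List (Σ i, V i)) :
    GSym.ι i v * (L.map (fun p => GSym.ι p.1 p.2)).prod =
      ((-1 : ℝ) ^ (wt i * (L.map (fun p => wt p.1)).sum)) •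
        ((L.map (fun p => GSym.ι p.1 p.2)).prod * GSym.ι i v) := by
  induction L with
  | nil => simp
  | cons q L ih =>
    simp only [List.map_cons, List.prod_cons, List.sum_cons]
    rw [← mul_assoc, GSym.ι_mul_ι, smul_mul_assoc, mul_assoc, ih, mul_smul_comm, smul_smul,
      ← pow_add, ← mul_add, mul_assoc]

theorem GSym.prod_mul_prod (L L' : List (Σ i, V i)) :
    (L.map (fun p => GSym.ι p.1 p.2)).prod * (L'.map (fun p => GSym.ι p.1 p.2)).prod =
      ((-1 : ℝ) ^ ((L.map (fun p => wt p.1)).sum * (L'.map (fun p => wt p.1)).sum)) •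
        ((L'.map (fun p => GSym.ι p.1 p.2)).prod * (L.map (fun p => GSym.ι p.1 p.2)).prod) := by
  induction L with
  | nil => simp
  | cons q L ih =>
    simp only [List.map_cons, List.prod_cons, List.sum_cons]
    rw [mul_assoc, ih, mul_smul_comm, ← mul_assoc, GSym.ι_mul_prod, smul_mul_assoc, smul_smul,
      ← pow_add, ← add_mul, mul_assoc, add_comm]

theorem GSym.mul_comm' {k l : ℕ} {a b : GSym V} (ha : a ∈ GSym.deg V k)
    (hb : b ∈ GSym.deg V l) : a * b = ((-1 : ℝ) ^ (k * l)) • (b * a) := by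
  induction ha, hb using Submodule.span_induction₂ with
  | mem_mem x y hx hy =>
    obtain ⟨L, rfl, rfl⟩ := hx
    obtain ⟨L', rfl, rfl⟩ := hy
    exact GSym.prod_mul_prod L L'
  | zero_left y hy => simp
  | zero_right x hx => simp
  | add_left x y z hx hy hz h₁ h₂ => rw [add_mul, mul_add, smul_add, h₁, h₂]
  | add_right x y z hx hy hz h₁ h₂ => rw [add_mul, mul_add, smul_add, h₁, h₂]
  | smul_left r x y hx hy h => rw [smul_mul_assoc, mul_smul_comm, h, smul_comm]
  | smul_right r x y hx hy h => rw [smul_mul_assoc, mul_smul_comm, h, smul_comm]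

variable {W : Fin n → Type} [∀ i, AddCommGroup (W i)] [∀ i, Module ℝ (W i)]
variable {X : Fin n → Type} [∀ i, AddCommGroup (X i)] [∀ i, Module ℝ (X i)]

/-- The map of total spaces induced by a family of linear maps. -/
def totMap (f : ∀ i, V i →ₗ[ℝ] W i) : Tot V →ₗ[ℝ] Tot W :=
  LinearMap.pi (fun i => f i ∘ₗ prj V i)

theorem totMap_inc (f : ∀ i, V i →ₗ[ℝ] W i) (i : Fin n) (v : V i) :
    totMap f (inc V i v) = inc W i (f i v) := by
  ext j
  by_cases h : j = i
  · subst h; simp [totMap]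
  · simp [totMap, Pi.single_eq_of_ne h]

theorem prj_comp_totMap (f : ∀ i, V i →ₗ[ℝ] W i) (i : Fin n) :
    prj W i ∘ₗ totMap f = f i ∘ₗ prj V i := rfl

/-- The algebra morphism between graded symmetric algebras induced by linear maps. -/
def GSym.map (f : ∀ i, V i →ₗ[ℝ] W i) : GSym V →ₐ[ℝ] GSym W :=
  RingQuot.liftAlgHom ℝ ⟨TensorAlgebra.lift ℝ
      (GSym.mk.toLinearMap ∘ₗ TensorAlgebra.ι ℝ ∘ₗ totMap f), by
    rintro _ _ ⟨i, j, v, w⟩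
    simp only [map_mul, map_smul, TensorAlgebra.lift_ι_apply]
    simp only [LinearMap.comp_apply, totMap_inc]
    exact GSym.ι_mul_ι i j (f i v) (f j w)⟩

theorem GSym.map_mk (f : ∀ i, V i →ₗ[ℝ] W i) (t : TensorAlgebra ℝ (Tot V)) :
    GSym.map f (GSym.mk t) =
      TensorAlgebra.lift ℝ (GSym.mk.toLinearMap ∘ₗ TensorAlgebra.ι ℝ ∘ₗ totMap f) t :=
  RingQuot.liftAlgHom_mkAlgHom_apply ℝ _ _ t

theorem GSym.map_ι (f : ∀ i, V i →ₗ[ℝ] W i) (i : Fin n) (v : V i) :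
    GSym.map f (GSym.ι i v) = GSym.ι i (f i v) := by
  refine (GSym.map_mk f _).trans ?_
  rw [LinearMap.comp_apply, TensorAlgebra.lift_ι_apply]
  simp only [LinearMap.comp_apply, totMap_inc, GSym.ι]

theorem GSym.hom_ext {A : Type*} [Semiring A] [Algebra ℝ A] {f g : GSym V →ₐ[ℝ] A}
    (h : ∀ i v, f (GSym.ι i v) = g (GSym.ι i v)) : f = g := by
  apply RingQuot.ringQuot_ext'
  apply TensorAlgebra.hom_ext
  apply LinearMap.pi_ext
  intro i v
  exact h i v

theorem GSym.map_id : GSym.map (fun i => LinearMap.id (R := ℝ) (M := V i)) = AlgHom.id ℝ _ :=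
  GSym.hom_ext fun i v => by rw [GSym.map_ι]; rfl

theorem GSym.map_comp (g : ∀ i, W i →ₗ[ℝ] X i) (f : ∀ i, V i →ₗ[ℝ] W i) :
    GSym.map (fun i => g i ∘ₗ f i) = (GSym.map g).comp (GSym.map f) :=
  GSym.hom_ext fun i v => by simp [GSym.map_ι]

theorem GSym.map_mem (f : ∀ i, V i →ₗ[ℝ] W i) {l : ℕ} {a : GSym V} (ha : a ∈ GSym.deg V l) :
    GSym.map f a ∈ GSym.deg W l := by
  induction ha using Submodule.span_induction with
  | mem x hx =>
    obtain ⟨L, rfl, rfl⟩ := hx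
    refine Submodule.subset_span ⟨L.map (fun p => ⟨p.1, f p.1 p.2⟩), ?_, ?_⟩
    · simp [Function.comp_def]
    · rw [map_list_prod, List.map_map, List.map_map]
      congr 1
      apply List.map_congr_left
      intro p _
      exact GSym.map_ι f p.1 p.2
  | zero => simp
  | add x y hx hy h₁ h₂ => rw [map_add]; exact add_mem h₁ h₂
  | smul r x hx h => rw [map_smul]; exact Submodule.smul_mem _ _ h

/-- Rescaling the generators of degree `i` by `2^i` multiplies the elements of degree `l` by
`2^l`. -/
theorem GSym.map_scale {l : ℕ} {a : GSym V} (ha : a ∈ GSym.deg V l) :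
    GSym.map (fun i => ((2 : ℝ) ^ wt i) • LinearMap.id (R := ℝ) (M := V i)) a
      = ((2 : ℝ) ^ l) • a := by
  induction ha using Submodule.span_induction with
  | mem x hx =>
    obtain ⟨L, rfl, rfl⟩ := hx
    induction L with
    | nil => simp
    | cons q L ih =>
      simp only [List.map_cons, List.prod_cons, List.sum_cons, map_mul, ih, GSym.map_ι]
      rw [LinearMap.smul_apply, LinearMap.id_apply, map_smul, smul_mul_smul_comm, pow_add]
  | zero => simp
  | add x y hx hy h₁ h₂ => rw [map_add, smul_add, h₁, h₂]
  | smul r x hx h => rw [map_smul, h, smul_comm]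

/-- The components of the dual product are natural for morphisms of coalgebras. -/
theorem dualMul_comp {μ : Tot V →ₗ[ℝ] Tot V ⊗[ℝ] Tot V} {ν : Tot W →ₗ[ℝ] Tot W ⊗[ℝ] Tot W}
    {f : ∀ i, V i →ₗ[ℝ] W i}
    (hf : ∀ v, ν (totMap f v) = TensorProduct.map (totMap f) (totMap f) (μ v)) (i j k : Fin n)
    (ξ : Module.Dual ℝ (W i)) (η : Module.Dual ℝ (W j)) :
    dualMul ν i j k ξ η ∘ₗ f k = dualMul μ i j k (ξ ∘ₗ f i) (η ∘ₗ f j) := by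
  ext v
  simp only [dualMul, LinearMap.comp_apply]
  rw [← totMap_inc, hf, ← LinearMap.comp_apply (TensorProduct.map _ _) (TensorProduct.map _ _),
    ← TensorProduct.map_comp]
  rfl

end Linear

/-! ### Coalgebra bundles -/

/-- Smooth manifolds: finite-dimensional, without boundary, Hausdorff and second countable. -/
structure Mfd : Type 1 where
  carrier : Type
  dim : ℕ
  [top : TopologicalSpace carrier]
  [charted : ChartedSpace (EuclideanSpace ℝ (Fin dim)) carrier]
  [isManifold : IsManifold (𝓡 dim) ∞ carrier]
  [t2 : T2Space carrier]
  [secondCountable : SecondCountableTopology carrier]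

attribute [instance] Mfd.top Mfd.charted Mfd.isManifold Mfd.t2 Mfd.secondCountable

/-- Smooth real vector bundles of finite rank. -/
structure VBundle (M : Mfd) : Type 1 where
  rank : ℕ
  fiber : M.carrier → Type
  [addCommGroup : ∀ x, AddCommGroup (fiber x)]
  [module : ∀ x, Module ℝ (fiber x)]
  [topFiber : ∀ x, TopologicalSpace (fiber x)]
  [topTotal : TopologicalSpace (Bundle.TotalSpace (EuclideanSpace ℝ (Fin rank)) fiber)]
  [fiberBundle : FiberBundle (EuclideanSpace ℝ (Fin rank)) fiber]
  [vectorBundle : VectorBundle ℝ (EuclideanSpace ℝ (Fin rank)) fiber]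
  [contMDiff : ContMDiffVectorBundle ∞ (EuclideanSpace ℝ (Fin rank)) fiber (𝓡 M.dim)]

attribute [instance] VBundle.addCommGroup VBundle.module VBundle.topFiber VBundle.topTotal
  VBundle.fiberBundle VBundle.vectorBundle VBundle.contMDiff

namespace VBundle

variable {M : Mfd} (E : VBundle M)

/-- The total space of a vector bundle. -/
abbrev Total : Type := Bundle.TotalSpace (EuclideanSpace ℝ (Fin E.rank)) E.fiber

/-- The model with corners of the total space of a vector bundle. -/
abbrev model : ModelWithCorners ℝ
    (EuclideanSpace ℝ (Fin M.dim) × EuclideanSpace ℝ (Fin E.rank))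
    (ModelProd (EuclideanSpace ℝ (Fin M.dim)) (EuclideanSpace ℝ (Fin E.rank))) :=
  (𝓡 M.dim).prod 𝓘(ℝ, EuclideanSpace ℝ (Fin E.rank))

/-- The part of the total space over an open set of the base. -/
def totalOver (U : Opens M.carrier) : Opens E.Total :=
  ⟨Bundle.TotalSpace.proj ⁻¹' U,
    U.isOpen.preimage (FiberBundle.continuous_proj (EuclideanSpace ℝ (Fin E.rank)) E.fiber)⟩

/-- Smoothness of a section over `U` of the dual bundle: the section is regarded as a
fibrewise linear function on the part of the total space over `U`. -/
def IsSmoothDual (U : Opens M.carrier) (ξ : ∀ x : U, Module.Dual ℝ (E.fiber x)) : Prop :=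
  ContMDiff E.model 𝓘(ℝ, ℝ) ∞ (fun p : E.totalOver U => ξ ⟨p.1.proj, p.2⟩ p.1.snd)

variable {E}

theorem IsSmoothDual.restrict {U V : Opens M.carrier} (h : V ≤ U)
    {ξ : ∀ x : U, Module.Dual ℝ (E.fiber x)} (hξ : E.IsSmoothDual U ξ) :
    E.IsSmoothDual V (fun x => ξ ⟨x, h x.2⟩) :=
  ContMDiff.comp (g := fun p : E.totalOver U => ξ ⟨p.1.proj, p.2⟩ p.1.snd) hξ
    (contMDiff_inclusion (U := E.totalOver V) (V := E.totalOver U) (fun _ hp => h hp))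

end VBundle

/-- Coalgebra bundles of degree `n`: graded vector bundles `E = ⊕ᵢ Eᵢ`, `Eᵢ` in degree `-(wt i)`,
with a smooth bundle map `μ : E → E ⊗ E` over the identity that is degree preserving,
coassociative and graded cocommutative.  Smoothness of `μ` is expressed by the smoothness of
`(ξ ⊗ η) ∘ μ` for smooth local sections `ξ`, `η` of the dual bundles. -/
structure CoalgBundle (n : ℕ) : Type 1 where
  M : Mfd
  E : Fin n → VBundle M
  μ : ∀ x : M.carrier, Tot (fun i => (E i).fiber x) →ₗ[ℝ]
    Tot (fun i => (E i).fiber x) ⊗[ℝ] Tot (fun i => (E i).fiber x)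
  isCoalg : ∀ x, IsCoalg (μ x)
  smooth_μ : ∀ (U : Opens M.carrier) (i j k : Fin n)
    (ξ : ∀ x : U, Module.Dual ℝ ((E i).fiber x)) (η : ∀ x : U, Module.Dual ℝ ((E j).fiber x)),
    (E i).IsSmoothDual U ξ → (E j).IsSmoothDual U η →
      (E k).IsSmoothDual U (fun x => dualMul (μ x) i j k (ξ x) (η x))

namespace CoalgBundle

variable {n : ℕ}

/-- Morphisms of coalgebra bundles: smooth degree preserving vector bundle maps, over a smooth map
of the bases, that intertwine the comultiplications. -/
structure Hom (X Y : CoalgBundle n) where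
  base : X.M.carrier → Y.M.carrier
  smooth_base : ContMDiff (𝓡 X.M.dim) (𝓡 Y.M.dim) ∞ base
  map : ∀ (i : Fin n) (x : X.M.carrier), (X.E i).fiber x →ₗ[ℝ] (Y.E i).fiber (base x)
  smooth_map : ∀ i, ContMDiff (X.E i).model (Y.E i).model ∞
    (fun p : (X.E i).Total => (⟨base p.proj, map i p.proj p.snd⟩ : (Y.E i).Total))
  comul : ∀ x v, Y.μ (base x) (totMap (fun i => map i x) v) =
    TensorProduct.map (totMap (fun i => map i x)) (totMap (fun i => map i x)) (X.μ x v)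

instance : Category (CoalgBundle n) where
  Hom := Hom
  id X :=
    { base := fun x => x
      smooth_base := contMDiff_id
      map := fun _ _ => LinearMap.id
      smooth_map := fun _ => contMDiff_id
      comul := fun x v => by
        have h : totMap (fun i => LinearMap.id (R := ℝ) (M := (X.E i).fiber x)) =
          LinearMap.id := rfl
        rw [h, TensorProduct.map_id]
        rfl }
  comp {X Y Z} f g :=
    { base := fun x => g.base (f.base x)
      smooth_base := g.smooth_base.comp f.smooth_base
      map := fun i x => g.map i (f.base x) ∘ₗ f.map i x
      smooth_map := fun i => (g.smooth_map i).comp (f.smooth_map i)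
      comul := fun x v => by
        have h : totMap (fun i => g.map i (f.base x) ∘ₗ f.map i x) =
          totMap (fun i => g.map i (f.base x)) ∘ₗ totMap (fun i => f.map i x) := rfl
        rw [h, TensorProduct.map_comp, LinearMap.comp_apply, LinearMap.comp_apply, g.comul,
          f.comul] }

/-- Admissible coalgebra bundles: in each point and for all degrees `-n, …, -2`, the image of
the component `μᵢ` is the part `K^μ_i` of the subspace `K^μ ⊆ E ⊗ E`. -/
def IsAdmissible (n : ℕ) : ObjectProperty (CoalgBundle n) := fun X =>
  ∀ (x : X.M.carrier) (i : Fin n), 2 ≤ wt i →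
    LinearMap.range (X.μ x ∘ₗ inc (fun i => (X.E i).fiber x) i) =
      coassocSpace (X.μ x) ⊓ tensorWt (fun i => (X.E i).fiber x) (wt i)

/-! ### The sheaf of functions of a coalgebra bundle -/

variable (X : CoalgBundle n)

/-- The fibre at `x` of `Sym E*`. -/
abbrev symFiber (x : X.M.carrier) : Type := GSym (fun i => Module.Dual ℝ ((X.E i).fiber x))

/-- All sections over `U` of `Sym E*`, without smoothness. -/
abbrev AllSec (U : Opens X.M.carrier) : Type := ∀ x : U, X.symFiber x

/-- A function as a section of `Sym E*`. -/
def funSec {U : Opens X.M.carrier} (f : U → ℝ) : X.AllSec U :=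
  fun x => algebraMap ℝ (X.symFiber x) (f x)

/-- A section of the dual bundle as a section of `Sym E*`. -/
def genSec {U : Opens X.M.carrier} (i : Fin n) (ξ : ∀ x : U, Module.Dual ℝ ((X.E i).fiber x)) :
    X.AllSec U :=
  fun x => GSym.ι (V := fun i => Module.Dual ℝ ((X.E i).fiber x)) i (ξ x)

/-- Restriction of sections of `Sym E*`. -/
def restrictSec {U V : Opens X.M.carrier} (h : V ≤ U) : X.AllSec U →ₐ[ℝ] X.AllSec V where
  toFun s x := s ⟨x, h x.2⟩
  map_one' := rfl
  map_mul' _ _ := rfl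
  map_zero' := rfl
  map_add' _ _ := rfl
  commutes' _ := rfl

/-- The sections of `Sym E*` over `U` that are polynomials in smooth sections of `E*`, with smooth
functions as coefficients. -/
def polySec (U : Opens X.M.carrier) : Subalgebra ℝ (X.AllSec U) :=
  Algebra.adjoin ℝ ({s | ∃ f : U → ℝ, ContMDiff (𝓡 X.M.dim) 𝓘(ℝ, ℝ) ∞ f ∧ s = X.funSec f} ∪
    {s | ∃ i ξ, (X.E i).IsSmoothDual U ξ ∧ s = X.genSec i ξ})

theorem restrictSec_polySec {U V : Opens X.M.carrier} (h : V ≤ U) {s : X.AllSec U}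
    (hs : s ∈ X.polySec U) : X.restrictSec h s ∈ X.polySec V := by
  have : X.polySec U ≤ (X.polySec V).comap (X.restrictSec h) := by
    apply Algebra.adjoin_le
    rintro s (⟨f, hf, rfl⟩ | ⟨i, ξ, hξ, rfl⟩)
    · exact Algebra.subset_adjoin (Or.inl ⟨_, hf.comp (contMDiff_inclusion h), rfl⟩)
    · exact Algebra.subset_adjoin (Or.inr ⟨i, _, hξ.restrict h, rfl⟩)
  exact this hs

/-- The smooth sections of `Sym E*` over `U`: those that locally are polynomials in smooth sections
of `E*`, with smooth functions as coefficients. -/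
def symSec (U : Opens X.M.carrier) : Subalgebra ℝ (X.AllSec U) where
  carrier := {s | ∀ x ∈ U, ∃ (V : Opens X.M.carrier) (h : V ≤ U), x ∈ V ∧
    X.restrictSec h s ∈ X.polySec V}
  mul_mem' := by
    intro s t hs ht x hx
    obtain ⟨V, hV, hxV, hsV⟩ := hs x hx
    obtain ⟨W, hW, hxW, htW⟩ := ht x hx
    refine ⟨V ⊓ W, inf_le_left.trans hV, ⟨hxV, hxW⟩, ?_⟩
    rw [map_mul]
    exact mul_mem (X.restrictSec_polySec inf_le_left hsV)
      (X.restrictSec_polySec inf_le_right htW)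
  add_mem' := by
    intro s t hs ht x hx
    obtain ⟨V, hV, hxV, hsV⟩ := hs x hx
    obtain ⟨W, hW, hxW, htW⟩ := ht x hx
    refine ⟨V ⊓ W, inf_le_left.trans hV, ⟨hxV, hxW⟩, ?_⟩
    rw [map_add]
    exact add_mem (X.restrictSec_polySec inf_le_left hsV)
      (X.restrictSec_polySec inf_le_right htW)
  algebraMap_mem' := by
    intro r x hx
    exact ⟨U, le_rfl, hx, by rw [AlgHom.commutes]; exact algebraMap_mem _ r⟩

theorem restrictSec_symSec {U V : Opens X.M.carrier} (h : V ≤ U) {s : X.AllSec U}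
    (hs : s ∈ X.symSec U) : X.restrictSec h s ∈ X.symSec V := by
  intro x hx
  obtain ⟨W, hW, hxW, hsW⟩ := hs x (h hx)
  exact ⟨V ⊓ W, inf_le_left, ⟨hx, hxW⟩, X.restrictSec_polySec (V := V ⊓ W) inf_le_right hsW⟩

/-- The generators `ξ · η - μ*(ξ, η)` of the ideal `I_μ(U)`, as a relation: `ξ` and `η`
run through the homogeneous smooth sections of `E*` over `U` of total degree at most `n`. -/
def IdealRel (U : Opens X.M.carrier) (s t : X.symSec U) : Prop :=
  ∃ (i j k : Fin n) (ξ : ∀ x : U, Module.Dual ℝ ((X.E i).fiber x))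
    (η : ∀ x : U, Module.Dual ℝ ((X.E j).fiber x)),
    wt i + wt j = wt k ∧ (X.E i).IsSmoothDual U ξ ∧ (X.E j).IsSmoothDual U η ∧
      s.1 = X.genSec i ξ * X.genSec j η ∧
      t.1 = X.genSec k (fun x => dualMul (X.μ x) i j k (ξ x) (η x))

/-- The quotient algebra `Γ(U, Sym E*) / I_μ(U)`. -/
def Quot (U : Opens X.M.carrier) : Type := RingQuot (X.IdealRel U)

instance (U : Opens X.M.carrier) : Ring (X.Quot U) :=
  inferInstanceAs (Ring (RingQuot (X.IdealRel U)))

instance (U : Opens X.M.carrier) : Algebra ℝ (X.Quot U) :=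
  inferInstanceAs (Algebra ℝ (RingQuot (X.IdealRel U)))

/-- The quotient map `Γ(U, Sym E*) → Γ(U, Sym E*) / I_μ(U)`. -/
def quotMk (U : Opens X.M.carrier) : X.symSec U →ₐ[ℝ] X.Quot U :=
  RingQuot.mkAlgHom ℝ (X.IdealRel U)

theorem quotMk_surjective (U : Opens X.M.carrier) : Function.Surjective (X.quotMk U) :=
  RingQuot.mkAlgHom_surjective ℝ (X.IdealRel U)

variable {X}

theorem quot_hom_ext {U : Opens X.M.carrier} {A : Type*} [Semiring A] [Algebra ℝ A]
    {f g : X.Quot U →ₐ[ℝ] A} (h : ∀ s, f (X.quotMk U s) = g (X.quotMk U s)) : f = g := by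
  ext a
  obtain ⟨s, rfl⟩ := X.quotMk_surjective U a
  exact h s

/-- Descent of an algebra morphism to the quotient `Γ(U, Sym E*) / I_μ(U)`. -/
def quotLift {U : Opens X.M.carrier} {A : Type} [Ring A] [Algebra ℝ A]
    (f : X.symSec U →ₐ[ℝ] A) (hf : ∀ s t, X.IdealRel U s t → f s = f t) : X.Quot U →ₐ[ℝ] A :=
  RingQuot.liftAlgHom ℝ ⟨f, fun s t h => hf s t h⟩

theorem quotLift_mk {U : Opens X.M.carrier} {A : Type} [Ring A] [Algebra ℝ A]
    (f : X.symSec U →ₐ[ℝ] A) (hf : ∀ s t, X.IdealRel U s t → f s = f t) (s : X.symSec U) :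
    quotLift f hf (X.quotMk U s) = f s :=
  RingQuot.liftAlgHom_mkAlgHom_apply ℝ _ _ s

theorem quotMk_eq {U : Opens X.M.carrier} {s t : X.symSec U} (h : X.IdealRel U s t) :
    X.quotMk U s = X.quotMk U t :=
  RingQuot.mkAlgHom_rel ℝ h

section Pullback

variable {Y Z : CoalgBundle n} (f : X ⟶ Y)

/-- The preimage of an open set under the base map of a morphism. -/
abbrev pre (f : X ⟶ Y) (U : Opens Y.M.carrier) : Opens X.M.carrier :=
  ⟨f.base ⁻¹' U, U.isOpen.preimage f.smooth_base.continuous⟩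

/-- The pullback of sections of `Sym F*` along a morphism of coalgebra bundles. -/
def pullAll (U : Opens Y.M.carrier) : Y.AllSec U →ₐ[ℝ] X.AllSec (pre f U) where
  toFun s x := GSym.map (V := fun i => Module.Dual ℝ ((Y.E i).fiber (f.base x)))
    (fun i => (f.map i x).dualMap) (s ⟨f.base x, x.2⟩)
  map_one' := by funext x; simp
  map_mul' s t := by funext x; simp
  map_zero' := by funext x; simp
  map_add' s t := by funext x; simp
  commutes' r := by funext x; simp

theorem contMDiff_pullDual {U : Opens Y.M.carrier} {i : Fin n}
    {ξ : ∀ y : U, Module.Dual ℝ ((Y.E i).fiber y)} (hξ : (Y.E i).IsSmoothDual U ξ) :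
    (X.E i).IsSmoothDual (pre f U)
      (fun x => (f.map i x).dualMap (ξ ⟨f.base x, x.2⟩)) := by
  refine ContMDiff.comp (g := fun p : (Y.E i).totalOver U => ξ ⟨p.1.proj, p.2⟩ p.1.snd) hξ
    (f := fun p : (X.E i).totalOver (pre f U) =>
      (⟨⟨f.base p.1.proj, f.map i p.1.proj p.1.snd⟩, p.2⟩ : (Y.E i).totalOver U)) ?_
  rw [← ContMDiff.subtypeVal_comp_iff]
  exact (f.smooth_map i).comp contMDiff_subtype_val

theorem contMDiff_pullFun {U : Opens Y.M.carrier} {a : U → ℝ}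
    (ha : ContMDiff (𝓡 Y.M.dim) 𝓘(ℝ, ℝ) ∞ a) :
    ContMDiff (𝓡 X.M.dim) 𝓘(ℝ, ℝ) ∞ (fun x : pre f U => a ⟨f.base x, x.2⟩) := by
  refine ContMDiff.comp ha (f := fun x : pre f U => (⟨f.base x, x.2⟩ : U)) ?_
  rw [← ContMDiff.subtypeVal_comp_iff]
  exact f.smooth_base.comp contMDiff_subtype_val

theorem pullAll_genSec {U : Opens Y.M.carrier} (i : Fin n)
    (ξ : ∀ y : U, Module.Dual ℝ ((Y.E i).fiber y)) :
    pullAll f U (Y.genSec i ξ) =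
      X.genSec i (fun x => (f.map i x).dualMap (ξ ⟨f.base x, x.2⟩)) := by
  funext x
  exact GSym.map_ι (V := fun i => Module.Dual ℝ ((Y.E i).fiber (f.base x))) _ i _

theorem pullAll_funSec {U : Opens Y.M.carrier} (a : U → ℝ) :
    pullAll f U (Y.funSec a) = X.funSec (fun x : pre f U => a ⟨f.base x, x.2⟩) := by
  funext x
  exact AlgHom.commutes _ _

theorem pullAll_polySec {U : Opens Y.M.carrier} {s : Y.AllSec U} (hs : s ∈ Y.polySec U) :
    pullAll f U s ∈ X.polySec (pre f U) := by
  have : Y.polySec U ≤ (X.polySec (pre f U)).comap (pullAll f U) := by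
    apply Algebra.adjoin_le
    rintro s (⟨a, ha, rfl⟩ | ⟨i, ξ, hξ, rfl⟩)
    · exact Algebra.subset_adjoin (Or.inl ⟨_, contMDiff_pullFun f ha, pullAll_funSec f a⟩)
    · exact Algebra.subset_adjoin (Or.inr ⟨i, _, contMDiff_pullDual f hξ, pullAll_genSec f i ξ⟩)
  exact this hs

theorem pullAll_symSec {U : Opens Y.M.carrier} {s : Y.AllSec U} (hs : s ∈ Y.symSec U) :
    pullAll f U s ∈ X.symSec (pre f U) := by
  intro x hx
  obtain ⟨V, hV, hxV, hsV⟩ := hs (f.base x) hx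
  exact ⟨pre f V, fun y hy => hV hy, hxV, pullAll_polySec f hsV⟩

/-- The pullback of smooth sections of `Sym F*` along a morphism of coalgebra bundles. -/
def pullSym (U : Opens Y.M.carrier) : Y.symSec U →ₐ[ℝ] X.symSec (pre f U) :=
  ((pullAll f U).comp (Y.symSec U).val).codRestrict _ (fun s => pullAll_symSec f s.2)

theorem pullSym_rel (U : Opens Y.M.carrier) (s t : Y.symSec U) (h : Y.IdealRel U s t) :
    X.IdealRel (pre f U) (pullSym f U s) (pullSym f U t) := by
  obtain ⟨i, j, k, ξ, η, hk, hξ, hη, hs, ht⟩ := h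
  refine ⟨i, j, k, _, _, hk, contMDiff_pullDual f hξ, contMDiff_pullDual f hη, ?_, ?_⟩
  · change pullAll f U s.1 = _
    rw [hs, map_mul, pullAll_genSec, pullAll_genSec]
  · change pullAll f U t.1 = _
    rw [ht, pullAll_genSec]
    congr 1
    funext x
    exact dualMul_comp (fun v => f.comul x v) i j k _ _

/-- The map `Γ(U, Sym F*) / I_ν(U) → Γ(f⁻¹ U, Sym E*) / I_μ(f⁻¹ U)` induced by a morphism of
coalgebra bundles. -/
def pullQuot (U : Opens Y.M.carrier) : Y.Quot U →ₐ[ℝ] X.Quot (pre f U) :=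
  quotLift ((X.quotMk (pre f U)).comp (pullSym f U))
    (fun s t h => quotMk_eq (pullSym_rel f U s t h))

theorem pullQuot_mk (U : Opens Y.M.carrier) (s : Y.symSec U) :
    pullQuot f U (Y.quotMk U s) = X.quotMk (pre f U) (pullSym f U s) :=
  quotLift_mk _ _ s

/-- Restriction of smooth sections of `Sym E*`. -/
def restrictSym {U V : Opens X.M.carrier} (h : V ≤ U) : X.symSec U →ₐ[ℝ] X.symSec V :=
  ((X.restrictSec h).comp (X.symSec U).val).codRestrict _ (fun s => X.restrictSec_symSec h s.2)

theorem restrictSym_rel {U V : Opens X.M.carrier} (h : V ≤ U) (s t : X.symSec U)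
    (hst : X.IdealRel U s t) : X.IdealRel V (restrictSym h s) (restrictSym h t) := by
  obtain ⟨i, j, k, ξ, η, hk, hξ, hη, hs, ht⟩ := hst
  refine ⟨i, j, k, _, _, hk, hξ.restrict h, hη.restrict h, ?_, ?_⟩
  · change X.restrictSec h s.1 = _
    rw [hs, map_mul]
    rfl
  · change X.restrictSec h t.1 = _
    rw [ht]
    rfl

/-- Restriction maps of the quotients `Γ(U, Sym E*) / I_μ(U)`. -/
def restrictQuot {U V : Opens X.M.carrier} (h : V ≤ U) : X.Quot U →ₐ[ℝ] X.Quot V :=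
  quotLift ((X.quotMk V).comp (restrictSym h))
    (fun s t hst => quotMk_eq (restrictSym_rel h s t hst))

theorem restrictQuot_mk {U V : Opens X.M.carrier} (h : V ≤ U) (s : X.symSec U) :
    restrictQuot h (X.quotMk U s) = X.quotMk V (restrictSym h s) :=
  quotLift_mk _ _ s

theorem restrictQuot_comp {U V W : Opens X.M.carrier} (h : W ≤ V) (g : V ≤ U) :
    restrictQuot (X := X) (h.trans g) = (restrictQuot h).comp (restrictQuot g) := by
  refine quot_hom_ext fun s => ?_
  rw [AlgHom.comp_apply, restrictQuot_mk, restrictQuot_mk, restrictQuot_mk]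
  rfl

end Pullback

variable (X)

/-- The presheaf of algebras `U ↦ Γ(U, Sym E*) / I_μ(U)`. -/
def quotPresheaf : TopCat.Presheaf (AlgCat.{0} ℝ) (TopCat.of X.M.carrier) where
  obj U := AlgCat.of ℝ (X.Quot U.unop)
  map h := AlgCat.ofHom (restrictQuot h.unop.le)
  map_id U := by
    apply AlgCat.hom_ext
    exact quot_hom_ext fun s => restrictQuot_mk _ s
  map_comp g h := by
    apply AlgCat.hom_ext
    exact restrictQuot_comp h.unop.le g.unop.le

/-- The homogeneous sections of degree `l` of the presheaf `U ↦ Γ(U, Sym E*) / I_μ(U)`: the classes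
of the sections of `Sym E*` that are homogeneous of degree `l` in each point. -/
def quotDeg (l : ℕ) (U : Opens X.M.carrier) : Submodule ℝ (X.Quot U) :=
  Submodule.map (X.quotMk U).toLinearMap
    { carrier := {s | ∀ x, s.1 x ∈ GSym.deg _ l}
      add_mem' := fun hs ht x => add_mem (hs x) (ht x)
      zero_mem' := fun _ => zero_mem _
      smul_mem' := fun r _ hs x => Submodule.smul_mem _ r (hs x) }

end CoalgBundle

/-! ### Graded manifolds -/

/-- A section of the sheafification of the presheaf `P` that locally comes from sections of `P`
lying in `d`. -/
def LocallyIn {T : TopCat.{0}} (P : TopCat.Presheaf (AlgCat.{0} ℝ) T)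
    (d : ∀ U : Opens T, Submodule ℝ (P.obj (op U))) (U : Opens T)
    (s : (sheafify (Opens.grothendieckTopology T) P).obj (op U)) : Prop :=
  ∀ x ∈ U, ∃ (V : Opens T) (i : V ≤ U), x ∈ V ∧ ∃ p ∈ d V,
    ((sheafify (Opens.grothendieckTopology T) P).map (homOfLE i).op).hom s =
      ((toSheafify (Opens.grothendieckTopology T) P).app (op V)).hom p

/-- The structure of a sheaf of graded commutative algebras on a sheaf of algebras `C`: subsheaves
`C^l` (`l : ℕ`) of homogeneous sections, with `C = ⊕_l C^l` as sheaves, `1 ∈ C^0`,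
`C^k C^l ⊆ C^(k+l)` and `a b = (-1)^(kl) b a` for `a ∈ C^k`, `b ∈ C^l`. -/
structure SheafGrading {T : TopCat.{0}} (C : TopCat.Sheaf (AlgCat.{0} ℝ) T) where
  deg : ℕ → ∀ U : Opens T, Submodule ℝ (C.obj.obj (op U))
  restrict_mem : ∀ (l : ℕ) (U V : Opens T) (i : V ≤ U) (s : C.obj.obj (op U)), s ∈ deg l U →
    (C.obj.map (homOfLE i).op).hom s ∈ deg l V
  mem_of_locally_mem : ∀ (l : ℕ) (U : Opens T) (s : C.obj.obj (op U)),
    (∀ x ∈ U, ∃ (V : Opens T) (i : V ≤ U), x ∈ V ∧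
      (C.obj.map (homOfLE i).op).hom s ∈ deg l V) → s ∈ deg l U
  one_mem : ∀ U : Opens T, (1 : C.obj.obj (op U)) ∈ deg 0 U
  mul_mem : ∀ (k l : ℕ) (U : Opens T) (a b : C.obj.obj (op U)), a ∈ deg k U → b ∈ deg l U →
    a * b ∈ deg (k + l) U
  graded_comm : ∀ (k l : ℕ) (U : Opens T) (a b : C.obj.obj (op U)), a ∈ deg k U → b ∈ deg l U →
    a * b = ((-1 : ℝ) ^ (k * l)) • (b * a)
  independent : ∀ U : Opens T, iSupIndep (fun l => deg l U)
  locally_sum : ∀ (U : Opens T) (s : C.obj.obj (op U)), ∀ x ∈ U, ∃ (V : Opens T) (i : V ≤ U),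
    x ∈ V ∧ (C.obj.map (homOfLE i).op).hom s ∈ ⨆ l, deg l V

/-- A smooth manifold together with a sheaf of graded commutative real algebras. -/
structure GrMfd : Type 1 where
  M : Mfd
  C : TopCat.Sheaf (AlgCat.{0} ℝ) (TopCat.of M.carrier)
  grading : SheafGrading C

namespace GrMfd

/-- The underlying ringed space. -/
def toSheafedSpace (X : GrMfd) : AlgebraicGeometry.SheafedSpace (AlgCat.{0} ℝ) where
  carrier := TopCat.of X.M.carrier
  presheaf := X.C.obj
  IsSheaf := X.C.property

/-- The map of manifolds underlying a morphism of ringed spaces. -/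
def baseMap {X Y : GrMfd} (f : X.toSheafedSpace ⟶ Y.toSheafedSpace) :
    X.M.carrier → Y.M.carrier :=
  fun x => f.hom.base x

/-- Morphisms: the morphisms of ringed spaces `(ψ, ψ♯)` with `ψ` smooth and `ψ♯` degree
preserving. -/
structure Hom (X Y : GrMfd) where
  toHom : X.toSheafedSpace ⟶ Y.toSheafedSpace
  smooth : ContMDiff (𝓡 X.M.dim) (𝓡 Y.M.dim) ∞ (baseMap toHom)
  deg_mem : ∀ (l : ℕ) (U : Opens Y.M.carrier) (s : Y.C.obj.obj (op U)), s ∈ Y.grading.deg l U →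
    (toHom.hom.c.app (op U)).hom s ∈ X.grading.deg l ((Opens.map toHom.hom.base).obj U)

theorem Hom.ext' {X Y : GrMfd} {f g : Hom X Y} (h : f.toHom = g.toHom) : f = g := by
  cases f; cases g; cases h; rfl

instance : Category GrMfd where
  Hom := Hom
  id _ :=
    { toHom := 𝟙 _
      smooth := contMDiff_id
      deg_mem := fun _ _ _ hs => hs }
  comp f g :=
    { toHom := f.toHom ≫ g.toHom
      smooth := g.smooth.comp f.smooth
      deg_mem := fun l U s hs => f.deg_mem l _ _ (g.deg_mem l U s hs) }
  id_comp f := Hom.ext' (Category.id_comp f.toHom)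
  comp_id f := Hom.ext' (Category.comp_id f.toHom)
  assoc f g h := Hom.ext' (Category.assoc f.toHom g.toHom h.toHom)

/-- The restriction `C^∞(V) → C^∞(U)` of smooth functions. -/
def restrictSmooth (M : Mfd) {U V : Opens M.carrier} (h : U ≤ V) :
    C^∞⟮𝓡 M.dim, V; 𝓘(ℝ, ℝ), ℝ⟯ →ₐ[ℝ] C^∞⟮𝓡 M.dim, U; 𝓘(ℝ, ℝ), ℝ⟯ where
  toRingHom := ContMDiffMap.restrictRingHom (𝓡 M.dim) 𝓘(ℝ, ℝ) ℝ h
  commutes' _ := rfl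

/-- The presheaf `U ↦ C^∞(U) ⊗ Sym V` on a manifold, for the graded vector space `V = ⊕ Vᵢ`
with `Vᵢ = ℝ^(mᵢ)` in degree `wt i`. -/
def modelPresheaf (M : Mfd) {n : ℕ} (m : Fin n → ℕ) :
    TopCat.Presheaf (AlgCat.{0} ℝ) (TopCat.of M.carrier) where
  obj U := AlgCat.of ℝ
    (C^∞⟮𝓡 M.dim, (U.unop : Opens M.carrier); 𝓘(ℝ, ℝ), ℝ⟯ ⊗[ℝ] GSym (fun i => Fin (m i) → ℝ))
  map h := AlgCat.ofHom
    (Algebra.TensorProduct.map (restrictSmooth M h.unop.le) (AlgHom.id ℝ _))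
  map_id U := by
    apply AlgCat.hom_ext
    apply Algebra.TensorProduct.ext'
    intro a b
    rfl
  map_comp g h := by
    apply AlgCat.hom_ext
    apply Algebra.TensorProduct.ext'
    intro a b
    rfl

/-- The homogeneous part `C^∞(U) ⊗ S^l V` of degree `l` of `C^∞(U) ⊗ Sym V`. -/
def modelDeg (M : Mfd) {n : ℕ} (m : Fin n → ℕ) (l : ℕ) (U : Opens M.carrier) :
    Submodule ℝ
      (C^∞⟮𝓡 M.dim, U; 𝓘(ℝ, ℝ), ℝ⟯ ⊗[ℝ] GSym (fun i => Fin (m i) → ℝ)) :=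
  Submodule.span ℝ {z | ∃ (f : C^∞⟮𝓡 M.dim, U; 𝓘(ℝ, ℝ), ℝ⟯)
    (v : GSym (fun i => Fin (m i) → ℝ)), v ∈ GSym.deg _ l ∧ z = f ⊗ₜ[ℝ] v}

/-- The functor from the open subsets of the open set `U` to the open subsets of the manifold. -/
abbrev openFunctor {M : Mfd} (U : Opens M.carrier) :
    Opens (TopCat.of U) ⥤ Opens (TopCat.of M.carrier) :=
  (Opens.isOpenEmbedding (X := TopCat.of M.carrier) U).isOpenMap.functor

/-- The restriction of a presheaf to an open subset. -/
abbrev restrictTo {M : Mfd} (P : TopCat.Presheaf (AlgCat.{0} ℝ) (TopCat.of M.carrier))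
    (U : Opens M.carrier) : TopCat.Presheaf (AlgCat.{0} ℝ) (TopCat.of U) :=
  (openFunctor U).op ⋙ P

/-- Graded manifolds of degree `n`: for some graded vector space `V = ⊕ᵢ Vᵢ`, in degrees
`1, …, n`, each point has a neighbourhood `U` with an isomorphism, of sheaves of graded algebras on
`U`, of `C|_U` with the sheafification of `U' ↦ C^∞(U') ⊗ Sym V`. -/
def IsNMfd (n : ℕ) : ObjectProperty GrMfd := fun X =>
  ∃ m : Fin n → ℕ, ∀ x : X.M.carrier, ∃ U : Opens X.M.carrier, x ∈ U ∧
    ∃ e : restrictTo X.C.obj U ≅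
      sheafify (Opens.grothendieckTopology (TopCat.of U)) (restrictTo (modelPresheaf X.M m) U),
      ∀ (l : ℕ) (W : Opens (TopCat.of U)) (s : (restrictTo X.C.obj U).obj (op W)),
        s ∈ X.grading.deg l ((openFunctor U).obj W) ↔
          LocallyIn (restrictTo (modelPresheaf X.M m) U)
            (fun W' => modelDeg X.M m l ((openFunctor U).obj W')) W
            ((e.hom.app (op W)).hom s)

end GrMfd

/-! ### Gradings on sheafifications -/

section Sheafify

variable {T : TopCat.{0}}

/-- Restriction of sections of a presheaf of algebras. -/
abbrev res (P : TopCat.Presheaf (AlgCat.{0} ℝ) T) {U V : Opens T} (i : V ≤ U) :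
    P.obj (op U) →ₐ[ℝ] P.obj (op V) := (P.map (homOfLE i).op).hom

/-- The sheafification of a presheaf of algebras. -/
abbrev shf (P : TopCat.Presheaf (AlgCat.{0} ℝ) T) : TopCat.Presheaf (AlgCat.{0} ℝ) T :=
  sheafify (Opens.grothendieckTopology T) P

/-- The map from a presheaf of algebras to its sheafification, on sections. -/
abbrev toShf (P : TopCat.Presheaf (AlgCat.{0} ℝ) T) (U : Opens T) :
    P.obj (op U) →ₐ[ℝ] (shf P).obj (op U) :=
  ((toSheafify (Opens.grothendieckTopology T) P).app (op U)).hom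

theorem res_res (P : TopCat.Presheaf (AlgCat.{0} ℝ) T) {U V W : Opens T} (i : V ≤ U) (j : W ≤ V)
    (s : P.obj (op U)) : res P j (res P i s) = res P (j.trans i) s := by
  have h : P.map (homOfLE (j.trans i)).op = P.map (homOfLE i).op ≫ P.map (homOfLE j).op := by
    rw [← P.map_comp]; rfl
  simp only [res, h]
  rfl

theorem app_res {P Q : TopCat.Presheaf (AlgCat.{0} ℝ) T} (f : P ⟶ Q) {U V : Opens T} (i : V ≤ U)
    (s : P.obj (op U)) : (f.app (op V)).hom (res P i s) = res Q i ((f.app (op U)).hom s) :=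
  DFunLike.congr_fun (congrArg AlgCat.Hom.hom (f.naturality (homOfLE i).op)) s

theorem exists_locally_eq_toShf (P : TopCat.Presheaf (AlgCat.{0} ℝ) T) {U : Opens T}
    (s : (shf P).obj (op U)) {x : T} (hx : x ∈ U) :
    ∃ (V : Opens T) (i : V ≤ U), x ∈ V ∧ ∃ p, res (shf P) i s = toShf P V p := by
  have h : Presheaf.IsLocallySurjective (Opens.grothendieckTopology T)
    (toSheafify (Opens.grothendieckTopology T) P) := inferInstance
  obtain ⟨V, i, ⟨p, hp⟩, hxV⟩ := h.imageSieve_mem s x hx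
  exact ⟨V, leOfHom i, hxV, p, hp.symm⟩

theorem eq_of_locally_eq (C : TopCat.Sheaf (AlgCat.{0} ℝ) T) {U : Opens T}
    (s t : C.obj.obj (op U))
    (h : ∀ x ∈ U, ∃ (V : Opens T) (i : V ≤ U), x ∈ V ∧ res C.obj i s = res C.obj i t) :
    s = t := by
  choose! V i hx he using h
  refine TopCat.Sheaf.eq_of_locally_eq' C (fun x : U => V x) U (fun x => homOfLE (i x x.2)) ?_ s t
    (fun x => he x x.2)
  intro x hxU
  exact Opens.mem_iSup.2 ⟨⟨x, hxU⟩, hx x hxU⟩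

variable {P : TopCat.Presheaf (AlgCat.{0} ℝ) T}

theorem locallyIn_toShf {d : ∀ U : Opens T, Submodule ℝ (P.obj (op U))} {U : Opens T}
    {p : P.obj (op U)} (hp : p ∈ d U) : LocallyIn P d U (toShf P U p) := fun x hx =>
  ⟨U, le_rfl, hx, p, hp, by
    change res (shf P) le_rfl _ = _
    have : res (shf P) (le_refl U) = AlgHom.id ℝ _ := by
      have h : (shf P).map (homOfLE (le_refl U)).op = 𝟙 _ := (shf P).map_id _
      simp only [res, h]
      rfl
    rw [this]
    rfl⟩

theorem LocallyIn.common {d d' : ∀ U : Opens T, Submodule ℝ (P.obj (op U))}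
    (hd : ∀ (U V : Opens T) (i : V ≤ U) (p), p ∈ d U → res P i p ∈ d V)
    (hd' : ∀ (U V : Opens T) (i : V ≤ U) (p), p ∈ d' U → res P i p ∈ d' V)
    {U : Opens T} {s t : (shf P).obj (op U)} (hs : LocallyIn P d U s) (ht : LocallyIn P d' U t)
    {x : T} (hx : x ∈ U) : ∃ (V : Opens T) (i : V ≤ U), x ∈ V ∧ ∃ p ∈ d V, ∃ q ∈ d' V,
      res (shf P) i s = toShf P V p ∧ res (shf P) i t = toShf P V q := by
  obtain ⟨V, i, hxV, p, hp, hsp⟩ := hs x hx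
  obtain ⟨W, j, hxW, q, hq, htq⟩ := ht x hx
  refine ⟨V ⊓ W, inf_le_left.trans i, ⟨hxV, hxW⟩, res P inf_le_left p, hd _ _ _ _ hp,
    res P inf_le_right q, hd' _ _ _ _ hq, ?_, ?_⟩
  · rw [← res_res _ i inf_le_left]
    change res (shf P) _ (((shf P).map (homOfLE i).op).hom s) = _
    rw [hsp]
    exact (app_res (toSheafify (Opens.grothendieckTopology T) P) _ p).symm
  · rw [← res_res _ j inf_le_right]
    change res (shf P) _ (((shf P).map (homOfLE j).op).hom t) = _
    rw [htq]
    exact (app_res (toSheafify (Opens.grothendieckTopology T) P) _ q).symm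

/-- The homogeneous sections of the sheafification of a presheaf `P`, given submodules of homogeneous
sections of `P`. -/
def shfDeg (d : ℕ → ∀ U : Opens T, Submodule ℝ (P.obj (op U)))
    (hd : ∀ l (U V : Opens T) (i : V ≤ U) (p), p ∈ d l U → res P i p ∈ d l V)
    (l : ℕ) (U : Opens T) : Submodule ℝ ((shf P).obj (op U)) where
  carrier := {s | LocallyIn P (d l) U s}
  add_mem' := by
    intro s t hs ht x hx
    obtain ⟨V, i, hxV, p, hp, q, hq, h₁, h₂⟩ := hs.common (hd l) (hd l) ht hx
    refine ⟨V, i, hxV, p + q, add_mem hp hq, ?_⟩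
    change res (shf P) i _ = toShf P V _
    rw [map_add, map_add, h₁, h₂]
  zero_mem' := fun x hx => ⟨U, le_rfl, hx, 0, zero_mem _, by rw [map_zero, map_zero]⟩
  smul_mem' := by
    intro r s hs x hx
    obtain ⟨V, i, hxV, p, hp, h⟩ := hs x hx
    exact ⟨V, i, hxV, r • p, Submodule.smul_mem _ r hp, by rw [map_smul, map_smul, h]⟩

/-- A grading on a presheaf of algebras induces a grading on its sheafification. -/
def shfGrading (d : ℕ → ∀ U : Opens T, Submodule ℝ (P.obj (op U)))
    (hd : ∀ l (U V : Opens T) (i : V ≤ U) (p), p ∈ d l U → res P i p ∈ d l V)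
    (hone : ∀ U, 1 ∈ d 0 U)
    (hmul : ∀ k l U a b, a ∈ d k U → b ∈ d l U → a * b ∈ d (k + l) U)
    (hcomm : ∀ k l U a b, a ∈ d k U → b ∈ d l U → a * b = ((-1 : ℝ) ^ (k * l)) • (b * a))
    (hsum : ∀ (U : Opens T) (p : P.obj (op U)), ∀ x ∈ U, ∃ (V : Opens T) (i : V ≤ U),
      x ∈ V ∧ res P i p ∈ ⨆ l, d l V)
    (θ : P ⟶ P)
    (hθ : ∀ l U p, p ∈ d l U → (θ.app (op U)).hom p = ((2 : ℝ) ^ l) • p) :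
    SheafGrading ((presheafToSheaf (Opens.grothendieckTopology T) (AlgCat.{0} ℝ)).obj P) where
  deg := shfDeg d hd
  restrict_mem := by
    intro l U V i s hs x hx
    obtain ⟨W, j, hxW, p, hp, h⟩ := hs x (i hx)
    refine ⟨V ⊓ W, inf_le_left, ⟨hx, hxW⟩, res P inf_le_right p, hd _ _ _ _ _ hp, ?_⟩
    refine (res_res (shf P) i _ s).trans ?_
    refine (res_res (shf P) j (inf_le_right : V ⊓ W ≤ W) s).symm.trans ?_
    change res (shf P) _ (((shf P).map (homOfLE j).op).hom s) = _
    rw [h]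
    exact (app_res (toSheafify (Opens.grothendieckTopology T) P) _ p).symm
  mem_of_locally_mem := by
    intro l U s h x hx
    obtain ⟨V, i, hxV, hs⟩ := h x hx
    obtain ⟨W, j, hxW, p, hp, h⟩ := hs x hxV
    exact ⟨W, j.trans i, hxW, p, hp, (res_res (shf P) i j s).symm.trans h⟩
  one_mem := fun U x hx => ⟨U, le_rfl, hx, 1, hone U, by rw [map_one, map_one]⟩
  mul_mem := by
    intro k l U s t hs ht x hx
    obtain ⟨V, i, hxV, p, hp, q, hq, h₁, h₂⟩ := LocallyIn.common (hd k) (hd l) hs ht hx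
    refine ⟨V, i, hxV, p * q, hmul _ _ _ _ _ hp hq, ?_⟩
    change res (shf P) i (s * t) = toShf P V _
    rw [map_mul, map_mul, h₁, h₂]
  graded_comm := by
    intro k l U s t hs ht
    apply eq_of_locally_eq
    intro x hx
    obtain ⟨V, i, hxV, p, hp, q, hq, h₁, h₂⟩ := LocallyIn.common (hd k) (hd l) hs ht hx
    refine ⟨V, i, hxV, ?_⟩
    change res (shf P) i (s * t) = res (shf P) i (((-1 : ℝ) ^ (k * l)) • (t * s))
    rw [map_smul, map_mul, map_mul, h₁, h₂, ← map_mul, ← map_mul, ← map_smul,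
      hcomm k l V p q hp hq]
  independent := by
    intro U
    have hinj : Function.Injective (fun l : ℕ => (2 : ℝ) ^ l) :=
      pow_right_injective₀ (by norm_num) (by norm_num)
    let Θ := sheafifyMap (Opens.grothendieckTopology T) θ
    refine ((Module.End.eigenspaces_iSupIndep
      ((Θ.app (op U)).hom.toLinearMap : Module.End ℝ ((shf P).obj (op U)))).comp hinj).mono ?_
    intro l s hs
    rw [Function.comp_apply, Module.End.mem_eigenspace_iff]
    apply eq_of_locally_eq
      ((presheafToSheaf (Opens.grothendieckTopology T) (AlgCat.{0} ℝ)).obj P)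
    intro x hx
    obtain ⟨V, i, hxV, p, hp, h⟩ := hs x hx
    replace h : res (shf P) i s = toShf P V p := h
    refine ⟨V, i, hxV, ?_⟩
    change res (shf P) i ((Θ.app (op U)).hom s) = res (shf P) i (((2 : ℝ) ^ l) • s)
    rw [← app_res Θ i s, map_smul, h, ← map_smul, ← hθ l V p hp]
    exact (DFunLike.congr_fun (congrArg AlgCat.Hom.hom (congrArg (fun f => f.app (op V))
      (toSheafify_naturality (Opens.grothendieckTopology T) θ))) p).symm
  locally_sum := by
    intro U s x hx
    obtain ⟨V, i, hxV, p, h⟩ := exists_locally_eq_toShf P s hx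
    obtain ⟨W, j, hxW, hp⟩ := hsum V p x hxV
    refine ⟨W, j.trans i, hxW, ?_⟩
    have h' : res (shf P) (j.trans i) s = toShf P W (res P j p) := by
      rw [← res_res (shf P) i j, h]
      exact (app_res (toSheafify (Opens.grothendieckTopology T) P) j p).symm
    change res (shf P) (j.trans i) s ∈ ⨆ l, shfDeg d hd l W
    rw [h']
    have hm : Submodule.map (toShf P W).toLinearMap (⨆ l, d l W) ≤ ⨆ l, shfDeg d hd l W := by
      rw [Submodule.map_iSup]
      refine iSup_mono fun l => ?_
      rintro _ ⟨q, hq, rfl⟩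
      exact locallyIn_toShf hq
    exact hm ⟨_, hp, rfl⟩

end Sheafify

namespace CoalgBundle

variable {n : ℕ}

/-! ### The grading on the sheaf of functions of a coalgebra bundle -/

section Grading

variable (X : CoalgBundle n)

theorem mem_quotDeg {l : ℕ} {U : Opens X.M.carrier} {s : X.symSec U}
    (hs : ∀ x, s.1 x ∈ GSym.deg _ l) : X.quotMk U s ∈ X.quotDeg l U :=
  ⟨s, hs, rfl⟩

theorem restrictQuot_mem {l : ℕ} {U V : Opens X.M.carrier} (i : V ≤ U) {p : X.Quot U}
    (hp : p ∈ X.quotDeg l U) : restrictQuot i p ∈ X.quotDeg l V := by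
  obtain ⟨s, hs, rfl⟩ := hp
  refine ⟨restrictSym i s, fun x => hs ⟨x, i x.2⟩, ?_⟩
  exact (restrictQuot_mk i s).symm

theorem pullQuot_mem {Y : CoalgBundle n} (f : X ⟶ Y) {l : ℕ} {U : Opens Y.M.carrier} {p : Y.Quot U}
    (hp : p ∈ Y.quotDeg l U) : pullQuot f U p ∈ X.quotDeg l (pre f U) := by
  obtain ⟨s, hs, rfl⟩ := hp
  refine ⟨pullSym f U s, fun x => GSym.map_mem _ (hs ⟨f.base x, x.2⟩), ?_⟩
  exact (pullQuot_mk f U s).symm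

theorem quotDeg_one (U : Opens X.M.carrier) : (1 : X.Quot U) ∈ X.quotDeg 0 U :=
  ⟨1, fun _ => GSym.one_mem, map_one (X.quotMk U)⟩

theorem quotDeg_mul {k l : ℕ} {U : Opens X.M.carrier} {a b : X.Quot U}
    (ha : a ∈ X.quotDeg k U) (hb : b ∈ X.quotDeg l U) : a * b ∈ X.quotDeg (k + l) U := by
  obtain ⟨s, hs, rfl⟩ := ha
  obtain ⟨t, ht, rfl⟩ := hb
  exact ⟨s * t, fun x => GSym.mul_mem (hs x) (ht x), map_mul (X.quotMk U) s t⟩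

theorem quotDeg_comm {k l : ℕ} {U : Opens X.M.carrier} {a b : X.Quot U}
    (ha : a ∈ X.quotDeg k U) (hb : b ∈ X.quotDeg l U) :
    a * b = ((-1 : ℝ) ^ (k * l)) • (b * a) := by
  obtain ⟨s, hs, rfl⟩ := ha
  obtain ⟨t, ht, rfl⟩ := hb
  have h : s * t = ((-1 : ℝ) ^ (k * l)) • (t * s) := by
    apply Subtype.ext
    funext x
    exact GSym.mul_comm' (hs x) (ht x)
  change X.quotMk U s * X.quotMk U t = _ • (X.quotMk U t * X.quotMk U s)
  rw [← map_mul, ← map_mul, ← map_smul, h]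

theorem polySec_le_symSec (U : Opens X.M.carrier) : X.polySec U ≤ X.symSec U :=
  fun _ hs _ hx => ⟨U, le_rfl, hx, hs⟩

theorem quotMk_polySec_mem (U : Opens X.M.carrier) (s : X.AllSec U) (hs : s ∈ X.polySec U) :
    X.quotMk U ⟨s, X.polySec_le_symSec U hs⟩ ∈ ⨆ l, X.quotDeg l U := by
  induction hs using Algebra.adjoin_induction with
  | mem s hs =>
    rcases hs with ⟨f, hf, rfl⟩ | ⟨i, ξ, hξ, rfl⟩
    · refine Submodule.mem_iSup_of_mem 0 (X.mem_quotDeg fun x => ?_)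
      change algebraMap ℝ (X.symFiber x) (f x) ∈ _
      rw [Algebra.algebraMap_eq_smul_one]
      exact Submodule.smul_mem _ _ GSym.one_mem
    · exact Submodule.mem_iSup_of_mem (wt i) (X.mem_quotDeg fun x => GSym.ι_mem i _)
  | algebraMap r =>
    refine Submodule.mem_iSup_of_mem 0 (X.mem_quotDeg fun x => ?_)
    change algebraMap ℝ (X.symFiber x) r ∈ _
    rw [Algebra.algebraMap_eq_smul_one]
    exact Submodule.smul_mem _ _ GSym.one_mem
  | add s t hs ht h₁ h₂ =>
    have h := add_mem h₁ h₂
    rw [← map_add] at h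
    exact h
  | mul s t hs ht h₁ h₂ =>
    have key : ∀ a ∈ ⨆ l, X.quotDeg l U, ∀ b ∈ ⨆ l, X.quotDeg l U,
        a * b ∈ ⨆ l, X.quotDeg l U := by
      intro a ha b hb
      induction ha using Submodule.iSup_induction' with
      | mem k a ha =>
        induction hb using Submodule.iSup_induction' with
        | mem l b hb => exact Submodule.mem_iSup_of_mem (k + l) (X.quotDeg_mul ha hb)
        | zero => rw [mul_zero]; exact zero_mem _
        | add b c hb hc h₁ h₂ => rw [mul_add]; exact add_mem h₁ h₂
      | zero => rw [zero_mul]; exact zero_mem _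
      | add a c ha hc h₁ h₂ => rw [add_mul]; exact add_mem h₁ h₂
    have h := key _ h₁ _ h₂
    rw [← map_mul] at h
    exact h

theorem quotDeg_locally_sum {U : Opens X.M.carrier} (p : X.Quot U) (x : X.M.carrier)
    (hx : x ∈ U) : ∃ (V : Opens X.M.carrier) (i : V ≤ U), x ∈ V ∧
      restrictQuot i p ∈ ⨆ l, X.quotDeg l V := by
  obtain ⟨s, rfl⟩ := X.quotMk_surjective U p
  obtain ⟨V, i, hxV, hs⟩ := s.2 x hx
  refine ⟨V, i, hxV, ?_⟩
  rw [restrictQuot_mk]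
  exact X.quotMk_polySec_mem V _ hs

/-- The morphism of presheaves of algebras induced by a morphism of coalgebra bundles. -/
def pullPresheaf {X Y : CoalgBundle n} (f : X ⟶ Y) : Y.quotPresheaf ⟶
    (TopCat.Presheaf.pushforward _
      (TopCat.ofHom ⟨f.base, f.smooth_base.continuous⟩ :
        TopCat.of X.M.carrier ⟶ TopCat.of Y.M.carrier)).obj X.quotPresheaf where
  app U := AlgCat.ofHom (pullQuot f U.unop)
  naturality U V i := by
    apply AlgCat.hom_ext
    change (pullQuot f V.unop).comp (restrictQuot i.unop.le) =
      (restrictQuot (U := pre f U.unop) (V := pre f V.unop) (fun x hx => i.unop.le hx)).comp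
        (pullQuot f U.unop)
    refine quot_hom_ext fun s => ?_
    rw [AlgHom.comp_apply, AlgHom.comp_apply, restrictQuot_mk, pullQuot_mk, pullQuot_mk,
      restrictQuot_mk]
    rfl

theorem map_scale_tensorWt {V : Fin n → Type} [∀ i, AddCommGroup (V i)] [∀ i, Module ℝ (V i)]
    {l : ℕ} {z : Tot V ⊗[ℝ] Tot V} (hz : z ∈ tensorWt V l) :
    TensorProduct.map (totMap (fun i => ((2 : ℝ) ^ wt i) • LinearMap.id (R := ℝ) (M := V i)))
      (totMap (fun i => ((2 : ℝ) ^ wt i) • LinearMap.id (R := ℝ) (M := V i))) z =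
      ((2 : ℝ) ^ l) • z := by
  induction hz using Submodule.span_induction with
  | mem z hz =>
    obtain ⟨i, j, a, b, rfl, rfl⟩ := hz
    rw [TensorProduct.map_tmul, totMap_inc, totMap_inc]
    simp only [LinearMap.smul_apply, LinearMap.id_apply, map_smul]
    rw [TensorProduct.smul_tmul_smul, pow_add]
  | zero => simp
  | add x y hx hy h₁ h₂ => rw [map_add, smul_add, h₁, h₂]
  | smul r x hx h => rw [map_smul, h, smul_comm]

theorem contMDiff_smul {M : Mfd} (E : VBundle M) (c : ℝ) :
    ContMDiff E.model E.model ∞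
      (fun p : E.Total => (⟨p.proj, c • p.snd⟩ : E.Total)) := by
  intro p
  rw [Bundle.contMDiffAt_totalSpace]
  refine ⟨Bundle.contMDiffAt_proj E.fiber, ?_⟩
  have h₁ : ContMDiffAt E.model 𝓘(ℝ, EuclideanSpace ℝ (Fin E.rank)) ∞
      (fun q : E.Total =>
        (trivializationAt (EuclideanSpace ℝ (Fin E.rank)) E.fiber p.proj q).2) p :=
    ((Bundle.contMDiffAt_totalSpace).1 (contMDiffAt_id (x := p))).2
  have h₂ := contMDiffAt_const (c := c) (I := E.model) (I' := 𝓘(ℝ, ℝ)) (n := ∞) (x := p)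
  refine (h₂.smul h₁).congr_of_eventuallyEq ?_
  have hopen : (Bundle.TotalSpace.proj ⁻¹'
      (trivializationAt (EuclideanSpace ℝ (Fin E.rank)) E.fiber p.proj).baseSet : Set E.Total) ∈
      nhds p :=
    ((trivializationAt (EuclideanSpace ℝ (Fin E.rank)) E.fiber p.proj).open_baseSet.preimage
      (FiberBundle.continuous_proj (EuclideanSpace ℝ (Fin E.rank)) E.fiber)).mem_nhds
      (FiberBundle.mem_baseSet_trivializationAt' p.proj)
  filter_upwards [hopen] with q hq
  exact ((trivializationAt (EuclideanSpace ℝ (Fin E.rank)) E.fiber p.proj).linear ℝ hq).map_smul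
    c q.snd

/-- The endomorphism of a coalgebra bundle that multiplies the elements of degree `-i` by `2^i`. -/
def scale : X ⟶ X where
  base x := x
  smooth_base := contMDiff_id
  map i _ := ((2 : ℝ) ^ wt i) • LinearMap.id
  smooth_map i := contMDiff_smul (X.E i) ((2 : ℝ) ^ wt i)
  comul x v := by
    rw [← Finset.univ_sum_single v]
    simp only [map_sum]
    refine Finset.sum_congr rfl fun i _ => ?_
    have h := totMap_inc (V := fun i => (X.E i).fiber x)
      (fun i => ((2 : ℝ) ^ wt i) • LinearMap.id) i (v i)
    have h' : totMap (fun i => ((2 : ℝ) ^ wt i) • LinearMap.id (R := ℝ) (M := (X.E i).fiber x))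
        (Pi.single i (v i)) = ((2 : ℝ) ^ wt i) • inc (fun i => (X.E i).fiber x) i (v i) := by
      refine h.trans ?_
      rw [LinearMap.smul_apply, LinearMap.id_apply, map_smul]
    refine (congrArg (X.μ x) h').trans ?_
    rw [map_smul]
    exact (map_scale_tensorWt ((X.isCoalg x).degree i (v i))).symm

/-- The endomorphism of the presheaf `U ↦ Γ(U, Sym E*) / I_μ(U)` that multiplies the homogeneous
sections of degree `l` by `2^l`. -/
def scalePresheaf : X.quotPresheaf ⟶ X.quotPresheaf := pullPresheaf X.scale

theorem scalePresheaf_apply {l : ℕ} {U : Opens X.M.carrier} {p : X.Quot U}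
    (hp : p ∈ X.quotDeg l U) : pullQuot X.scale U p = ((2 : ℝ) ^ l) • p := by
  obtain ⟨s, hs, rfl⟩ := hp
  refine (pullQuot_mk X.scale U s).trans ?_
  change X.quotMk U _ = ((2 : ℝ) ^ l) • X.quotMk U s
  rw [← map_smul]
  congr 1
  apply Subtype.ext
  funext x
  have h : (fun i => (((2 : ℝ) ^ wt i) • LinearMap.id (R := ℝ) (M := (X.E i).fiber x)).dualMap) =
      fun i => ((2 : ℝ) ^ wt i) • LinearMap.id (R := ℝ) (M := Module.Dual ℝ ((X.E i).fiber x)) := by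
    funext i
    ext a v
    simp
  exact (congrArg (fun a => GSym.map a (s.1 x)) h).trans (GSym.map_scale (hs x))

/-- The grading of the sheaf `Γ_{Sym E*} / I_μ`. -/
def sheafGrading : SheafGrading
    ((presheafToSheaf (Opens.grothendieckTopology (TopCat.of X.M.carrier)) (AlgCat.{0} ℝ)).obj
      X.quotPresheaf) :=
  shfGrading (T := TopCat.of X.M.carrier) (P := X.quotPresheaf) X.quotDeg
    (fun _ _ _ i _ hp => X.restrictQuot_mem i hp)
    (fun U => X.quotDeg_one U)
    (fun _ _ _ _ _ ha hb => X.quotDeg_mul ha hb)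
    (fun _ _ _ _ _ ha hb => X.quotDeg_comm ha hb)
    (fun _ p x hx => X.quotDeg_locally_sum p x hx)
    X.scalePresheaf
    (fun _ _ _ hp => X.scalePresheaf_apply hp)

end Grading

/-! ### The functor -/

/-- The manifold `M` with the sheaf `Γ_{Sym E*} / I_μ`, for a coalgebra bundle `(E → M, μ)`. -/
def toGrMfd (X : CoalgBundle n) : GrMfd where
  M := X.M
  C := (presheafToSheaf (Opens.grothendieckTopology (TopCat.of X.M.carrier)) (AlgCat.{0} ℝ)).obj
    X.quotPresheaf
  grading := X.sheafGrading

variable {X Y Z : CoalgBundle n}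

/-- The base map of a morphism of coalgebra bundles as a continuous map. -/
def baseHom (f : X ⟶ Y) : TopCat.of X.M.carrier ⟶ TopCat.of Y.M.carrier :=
  TopCat.ofHom ⟨f.base, f.smooth_base.continuous⟩

/-- The morphism of sheaves `Γ_{Sym F*} / I_ν → φ_* (Γ_{Sym E*} / I_μ)` induced by a morphism of
coalgebra bundles over `φ`. -/
def pullSheaf (f : X ⟶ Y) : shf Y.quotPresheaf ⟶
    (TopCat.Presheaf.pushforward _ (baseHom f)).obj (shf X.quotPresheaf) :=
  sheafifyLift (Opens.grothendieckTopology (TopCat.of Y.M.carrier))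
    (pullPresheaf f ≫ (TopCat.Presheaf.pushforward _ (baseHom f)).map
      (toSheafify (Opens.grothendieckTopology (TopCat.of X.M.carrier)) X.quotPresheaf))
    (TopCat.Sheaf.pushforward_sheaf_of_sheaf (baseHom f) X.toGrMfd.C.property)

theorem pullSheaf_toShf (f : X ⟶ Y) (U : Opens Y.M.carrier) (p : Y.Quot U) :
    ((pullSheaf f).app (op U)).hom (toShf Y.quotPresheaf U p) =
      toShf X.quotPresheaf (pre f U) (pullQuot f U p) :=
  congrArg (fun g : Y.quotPresheaf ⟶
      (TopCat.Presheaf.pushforward _ (baseHom f)).obj (shf X.quotPresheaf) =>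
        (g.app (op U)).hom p) (toSheafify_sheafifyLift (Opens.grothendieckTopology (TopCat.of Y.M.carrier))
    (pullPresheaf f ≫ (TopCat.Presheaf.pushforward _ (baseHom f)).map
      (toSheafify (Opens.grothendieckTopology (TopCat.of X.M.carrier)) X.quotPresheaf))
    (TopCat.Sheaf.pushforward_sheaf_of_sheaf (baseHom f) X.toGrMfd.C.property))

theorem pullSheaf_mem (f : X ⟶ Y) (l : ℕ) (U : Opens Y.M.carrier)
    (s : (shf Y.quotPresheaf).obj (op U)) (hs : LocallyIn Y.quotPresheaf (Y.quotDeg l) U s) :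
    LocallyIn X.quotPresheaf (X.quotDeg l) (pre f U) (((pullSheaf f).app (op U)).hom s) := by
  intro x hx
  obtain ⟨V, i, hxV, p, hp, h⟩ := hs (f.base x) hx
  refine ⟨pre f V, fun y hy => i hy, hxV, pullQuot f V p, X.pullQuot_mem f hp, ?_⟩
  refine Eq.trans ?_ (pullSheaf_toShf f V p)
  refine Eq.trans ?_ (congrArg _ h)
  exact (app_res (pullSheaf f) i s).symm

theorem pullQuot_id (U : Opens X.M.carrier) (p : X.Quot U) : pullQuot (𝟙 X) U p = p := by
  obtain ⟨s, rfl⟩ := X.quotMk_surjective U p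
  refine (pullQuot_mk (𝟙 X) U s).trans ?_
  change X.quotMk U _ = X.quotMk U s
  congr 1
  apply Subtype.ext
  funext x
  exact DFunLike.congr_fun (GSym.map_id (V := fun i => Module.Dual ℝ ((X.E i).fiber x))) (s.1 x)

theorem pullQuot_comp (f : X ⟶ Y) (g : Y ⟶ Z) (U : Opens Z.M.carrier) (p : Z.Quot U) :
    pullQuot (f ≫ g) U p = pullQuot f (pre g U) (pullQuot g U p) := by
  obtain ⟨s, rfl⟩ := Z.quotMk_surjective U p
  refine (pullQuot_mk (f ≫ g) U s).trans ?_
  rw [pullQuot_mk g U s, pullQuot_mk f (pre g U) (pullSym g U s)]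
  change X.quotMk (pre f (pre g U)) _ = X.quotMk (pre f (pre g U)) _
  congr 1
  apply Subtype.ext
  funext x
  exact DFunLike.congr_fun (GSym.map_comp (fun i => (f.map i x).dualMap)
    (fun i => (g.map i (f.base x)).dualMap)) (s.1 ⟨g.base (f.base x), x.2⟩)

theorem hom_ext_of_toShf {T : TopCat.{0}} {P Q : TopCat.Presheaf (AlgCat.{0} ℝ) T}
    (hQ : Presheaf.IsSheaf (Opens.grothendieckTopology T) Q) {a b : shf P ⟶ Q}
    (h : ∀ U p, (a.app (op U)).hom (toShf P U p) = (b.app (op U)).hom (toShf P U p)) : a = b := by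
  apply sheafify_hom_ext (Opens.grothendieckTopology T) a b hQ
  apply NatTrans.ext
  funext U
  apply AlgCat.hom_ext
  apply AlgHom.ext
  intro p
  exact h U.unop p

/-- The morphism of graded ringed manifolds induced by a morphism of coalgebra bundles. -/
def toGrMfdMap (f : X ⟶ Y) : X.toGrMfd ⟶ Y.toGrMfd where
  toHom := InducedCategory.homMk ⟨baseHom f, pullSheaf f⟩
  smooth := f.smooth_base
  deg_mem l U s hs := pullSheaf_mem f l U s hs

/-- The geometrization functor `(E → M, μ) ↦ (M, Γ_{Sym E*} / I_μ)`, on all coalgebra bundles of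
degree `n`, with values in the manifolds with a sheaf of graded commutative algebras. -/
def geometrization (n : ℕ) : CoalgBundle n ⥤ GrMfd where
  obj X := X.toGrMfd
  map f := toGrMfdMap f
  map_id X := by
    apply GrMfd.Hom.ext'
    apply InducedCategory.hom_ext
    refine AlgebraicGeometry.PresheafedSpace.hext _ _ rfl (heq_of_eq ?_)
    refine hom_ext_of_toShf X.toGrMfd.C.property ?_
    intro U p
    refine (pullSheaf_toShf (𝟙 X) U p).trans ?_
    exact congrArg (toShf X.quotPresheaf U) (pullQuot_id U p)
  map_comp {X Y Z} f g := by
    apply GrMfd.Hom.ext'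
    apply InducedCategory.hom_ext
    refine AlgebraicGeometry.PresheafedSpace.hext _ _ rfl (heq_of_eq ?_)
    refine hom_ext_of_toShf (TopCat.Sheaf.pushforward_sheaf_of_sheaf (baseHom (f ≫ g))
      X.toGrMfd.C.property) ?_
    intro U p
    refine (pullSheaf_toShf (f ≫ g) U p).trans ?_
    refine (congrArg (toShf X.quotPresheaf (pre (f ≫ g) U)) (pullQuot_comp f g U p)).trans ?_
    refine Eq.trans ?_ (congrArg ((pullSheaf f).app (op (pre g U))).hom
      (pullSheaf_toShf g U p)).symm
    exact (pullSheaf_toShf f (pre g U) (pullQuot g U p)).symm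

end CoalgBundle

end NMan

end

/-!
The dual of a coalgebra `E` of degrees `-n, …, -1`, with a unit adjoined, is a graded commutative
algebra `ℝ ⊕ E*` (`DualAlg`), in which products of degree larger than `n` vanish. An element `e` of
`E ⊗ E` belongs to `K^μ` if and only if the values of `e` on iterated products of functionals depend
neither on the brackets nor, up to Koszul signs, on the order. Hence admissibility says that in
degrees at most `n` the dual algebra has no relations besides those of every graded commutative
algebra: it is freely generated by a complement of its decomposable elements, that is, a graded
symmetric algebra `Sym V` maps to it isomorphically in the degrees `1, …, n`. In one direction
(`toDualDeg_bijective`), a functional on `Sym V` that separates an element of the kernel of this map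
from zero gives an element of `K^μ` outside the image of `μ`. In the other direction
(`coassocSpace_le_range`), an element of `K^μ` extends to a functional on `Sym V`, so it comes from
a vector of `E`.

Consequently, near each point of an admissible bundle there are sections of the dual bundles that
freely generate the fibrewise dual algebras up to degree `n` (`exists_frame`), and the polynomials in
them with smooth coefficients are the functions `Γ_{Sym E*} / I_μ`: the ideal expresses each
section of a dual bundle by the generators, and no further relation appears (`exists_chart`). In
this and in other comparisons, a section of a sheaf is described by its values at the points, which
lie in finitely generated algebras, so that morphisms and isomorphisms of sheaves can be found
locally (`shfVal`, `exists_iso_of_locally`).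

The functor is fully faithful because the bundle is visible in its functions: those of degree zero
are the smooth functions on the base (`exists_eq_funQ`), and those of degree `i ≤ n` are the sections
of the dual of `E_{-i}` (`exists_eq_genQ`), with the product dual to `μ`. A morphism of the algebras
of functions is thus a pullback of sections that is linear over the smooth functions, which gives a
map of fibres. That it acts on functions of degree zero by composition with the map of the bases
follows from invertibility: a function that differs from `c` at a point is not mapped to a function
with value `c` there (`eq_of_map_eq_algebraMap`).

It is essentially surjective because the transition maps of the charts of a graded manifold act on
the homogeneous parts of degree `1, …, n` of the model algebra `Sym V`. These finite-dimensional
parts glue to vector bundles, and the product of `Sym V` in degrees at most `n` dualizes to a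
coalgebra structure on the dual bundles (`exists_isCoalg`), which is admissible by
`coassocSpace_le_range`. The functions of the resulting coalgebra bundle and the given ones have
values in the same algebras and agree locally (`Atlas.exists_iso`).
-/

noncomputable section

namespace NMan

/-! ### The graded symmetric algebra -/

section GSymBasics

variable {n : ℕ} {V : Fin n → Type} [∀ i, AddCommGroup (V i)] [∀ i, Module ℝ (V i)]

theorem wt_pos (i : Fin n) : 0 < wt i := Nat.succ_pos _

theorem wt_injective : Function.Injective (wt : Fin n → ℕ) := fun _ _ h =>
  Fin.ext (Nat.succ_injective h)

theorem exists_wt_eq {l : ℕ} (h0 : 0 < l) (hl : l ≤ n) : ∃ i : Fin n, wt i = l :=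
  ⟨⟨l - 1, by omega⟩, by simp only [wt]; omega⟩

theorem wt_le (i : Fin n) : wt i ≤ n := i.2

/-- The universal property of the graded symmetric algebra. -/
def GSym.lift {A : Type} [Ring A] [Algebra ℝ A] (f : ∀ i, V i →ₗ[ℝ] A)
    (hf : ∀ i j v w, f i v * f j w = ((-1 : ℝ) ^ (wt i * wt j)) • (f j w * f i v)) :
    GSym V →ₐ[ℝ] A :=
  RingQuot.liftAlgHom ℝ ⟨TensorAlgebra.lift ℝ (∑ i, f i ∘ₗ prj V i), by
    have key : ∀ i (v : V i), (∑ k, f k ∘ₗ prj V k) (inc V i v) = f i v := by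
      intro i v
      rw [LinearMap.sum_apply, Finset.sum_eq_single i]
      · simp
      · intro j _ hj; simp [Pi.single_eq_of_ne hj]
      · simp
    rintro _ _ ⟨i, j, v, w⟩
    simp only [map_mul, map_smul, TensorAlgebra.lift_ι_apply, key]
    exact hf i j v w⟩

theorem GSym.lift_ι {A : Type} [Ring A] [Algebra ℝ A] (f : ∀ i, V i →ₗ[ℝ] A)
    (hf : ∀ i j v w, f i v * f j w = ((-1 : ℝ) ^ (wt i * wt j)) • (f j w * f i v))
    (i : Fin n) (v : V i) : GSym.lift f hf (GSym.ι i v) = f i v := by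
  refine (RingQuot.liftAlgHom_mkAlgHom_apply ℝ _ _ _).trans ?_
  rw [LinearMap.comp_apply, TensorAlgebra.lift_ι_apply, LinearMap.sum_apply,
    Finset.sum_eq_single i]
  · simp
  · intro j _ hj; simp [Pi.single_eq_of_ne hj]
  · simp

theorem GSym.induction {p : GSym V → Prop} (one : p 1)
    (ι_mul : ∀ i v x, p x → p (GSym.ι i v * x)) (add : ∀ x y, p x → p y → p (x + y))
    (smul : ∀ (r : ℝ) x, p x → p (r • x)) (x : GSym V) : p x := by
  obtain ⟨t, rfl⟩ : ∃ t, GSym.mk t = x := RingQuot.mkAlgHom_surjective ℝ (SymRel V) x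
  have zero : p 0 := by simpa using smul 0 1 one
  suffices ∀ y, p y → p (GSym.mk t * y) by simpa using this 1 one
  induction t using TensorAlgebra.induction with
  | algebraMap r =>
    intro y hy
    rw [AlgHom.commutes, ← Algebra.smul_def]
    exact smul r y hy
  | ι v =>
    intro y hy
    have hv : GSym.mk (TensorAlgebra.ι ℝ v) = ∑ i, GSym.ι i (v i) := by
      simp only [GSym.ι, LinearMap.comp_apply]
      rw [← map_sum, ← map_sum]
      exact congrArg (fun w => GSym.mk (TensorAlgebra.ι ℝ w)) (Finset.univ_sum_single v).symm
    rw [hv, Finset.sum_mul]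
    exact Finset.sum_induction _ p add zero (fun i _ => ι_mul i _ _ hy)
  | mul a b ha hb =>
    intro y hy
    rw [map_mul, mul_assoc]
    exact ha _ (hb _ hy)
  | add a b ha hb =>
    intro y hy
    rw [map_add, add_mul]
    exact add _ _ (ha _ hy) (hb _ hy)

theorem GSym.iSup_deg : ⨆ l, GSym.deg V l = ⊤ := by
  rw [eq_top_iff]
  rintro x -
  induction x using GSym.induction with
  | one => exact Submodule.mem_iSup_of_mem 0 GSym.one_mem
  | ι_mul i v x hx =>
    induction hx using Submodule.iSup_induction' with
    | mem k a ha => exact Submodule.mem_iSup_of_mem _ (GSym.mul_mem (GSym.ι_mem i v) ha)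
    | zero => rw [mul_zero]; exact zero_mem _
    | add a b ha hb h₁ h₂ => rw [mul_add]; exact add_mem h₁ h₂
  | add x y hx hy => exact add_mem hx hy
  | smul r x hx => exact Submodule.smul_mem _ _ hx

theorem GSym.iSupIndep_deg : iSupIndep (GSym.deg V) := by
  -- The homogeneous parts lie in the eigenspaces, for the distinct eigenvalues `2 ^ l`, of the
  -- endomorphism that multiplies the generators of degree `i` by `2 ^ i`.
  have hinj : Function.Injective (fun l : ℕ => (2 : ℝ) ^ l) :=
    pow_right_injective₀ (by norm_num) (by norm_num)
  refine ((Module.End.eigenspaces_iSupIndep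
    ((GSym.map (fun i => ((2 : ℝ) ^ wt i) • LinearMap.id (R := ℝ) (M := V i))).toLinearMap :
      Module.End ℝ (GSym V))).comp hinj).mono ?_
  intro l s hs
  rw [Function.comp_apply, Module.End.mem_eigenspace_iff]
  exact GSym.map_scale hs

theorem GSym.deg_zero : GSym.deg V 0 = Submodule.span ℝ {1} := by
  apply le_antisymm
  · refine Submodule.span_le.2 ?_
    rintro _ ⟨L, hL, rfl⟩
    cases L with
    | nil => exact Submodule.subset_span (by simp)
    | cons q L =>
      have := wt_pos q.1
      simp only [List.map_cons, List.sum_cons] at hL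
      omega
  · rw [Submodule.span_singleton_le_iff_mem]
    exact GSym.one_mem

theorem GSym.mem_deg_zero {x : GSym V} (hx : x ∈ GSym.deg V 0) : ∃ c : ℝ, x = algebraMap ℝ _ c := by
  rw [GSym.deg_zero, Submodule.mem_span_singleton] at hx
  obtain ⟨c, rfl⟩ := hx
  exact ⟨c, (Algebra.algebraMap_eq_smul_one c).symm⟩

/-- An induction principle for the homogeneous elements of positive degree. -/
theorem GSym.deg_induction {l : ℕ} (hl : 0 < l) {p : GSym V → Prop}
    (ι_mul : ∀ i v k x, wt i + k = l → x ∈ GSym.deg V k → p (GSym.ι i v * x))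
    (zero : p 0) (add : ∀ x y, p x → p y → p (x + y)) {x : GSym V} (hx : x ∈ GSym.deg V l) :
    p x := by
  have key : ∀ x ∈ GSym.deg V l, p x ∧ ∀ r : ℝ, p (r • x) := by
    intro x hx
    induction hx using Submodule.span_induction with
    | mem x hx =>
      obtain ⟨L, hL, rfl⟩ := hx
      cases L with
      | nil => simp at hL; omega
      | cons q L =>
        simp only [List.map_cons, List.sum_cons, List.prod_cons] at hL ⊢
        have h := Submodule.subset_span (R := ℝ) (s := {z | ∃ L' : List (Σ i, V i),
          (L'.map (fun p => wt p.1)).sum = (L.map (fun p => wt p.1)).sum ∧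
            z = (L'.map (fun p => GSym.ι p.1 p.2)).prod}) ⟨L, rfl, rfl⟩
        refine ⟨ι_mul _ _ _ _ hL h, fun r => ?_⟩
        rw [← smul_mul_assoc, ← map_smul]
        exact ι_mul _ _ _ _ hL h
    | zero => exact ⟨zero, fun r => by rwa [smul_zero]⟩
    | add x y hx hy h₁ h₂ =>
      exact ⟨add _ _ h₁.1 h₂.1, fun r => by rw [smul_add]; exact add _ _ (h₁.2 r) (h₂.2 r)⟩
    | smul r x hx h => exact ⟨h.2 r, fun s => by rw [smul_smul]; exact h.2 _⟩
  exact (key x hx).1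

instance GSym.finiteDimensional_deg [∀ i, FiniteDimensional ℝ (V i)] (l : ℕ) :
    FiniteDimensional ℝ (GSym.deg V l) := by
  induction l using Nat.strong_induction_on with
  | _ l ih =>
    refine Module.finite_def.2 ((Submodule.fg_top _).2 ?_)
    rcases Nat.eq_zero_or_pos l with rfl | hl
    · rw [GSym.deg_zero]
      exact Submodule.fg_span_singleton 1
    · have hle : GSym.deg V l = ⨆ i : {i : Fin n // wt i ≤ l},
          LinearMap.range (GSym.ι (V := V) i.1) * GSym.deg V (l - wt i.1) := by
        apply le_antisymm
        · intro x hx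
          refine GSym.deg_induction hl (fun i v k x h hx => ?_) (zero_mem _)
            (fun x y hx hy => add_mem hx hy) hx
          refine Submodule.mem_iSup_of_mem ⟨i, by omega⟩ (Submodule.mul_mem_mul ⟨v, rfl⟩ ?_)
          have hk : l - wt i = k := by omega
          change x ∈ GSym.deg V (l - wt i)
          rwa [hk]
        · refine iSup_le fun i => Submodule.mul_le.2 ?_
          rintro _ ⟨v, rfl⟩ y hy
          have := GSym.mul_mem (GSym.ι_mem i.1 v) hy
          rwa [Nat.add_sub_cancel' i.2] at this
      rw [hle]
      refine Submodule.fg_iSup _ fun i => Submodule.FG.mul ?_ ?_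
      · rw [LinearMap.range_eq_map]
        exact Submodule.FG.map _ (Module.finite_def.1 inferInstance)
      · have := ih (l - wt i.1) (by have := wt_pos i.1; omega)
        exact Submodule.fg_top _ |>.1 (Module.finite_def.1 this)

theorem GSym.exists_sum_deg (x : GSym V) : ∃ (s : ℕ → GSym V) (N : ℕ),
    (∀ l, s l ∈ GSym.deg V l) ∧ x = ∑ l ∈ Finset.range N, s l := by
  have hx : x ∈ ⨆ l, GSym.deg V l := by rw [GSym.iSup_deg]; trivial
  rw [Submodule.mem_iSup_iff_exists_finsupp] at hx
  obtain ⟨f, hf, rfl⟩ := hx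
  refine ⟨f, f.support.sup id + 1, hf, ?_⟩
  rw [Finsupp.sum]
  refine Finset.sum_subset ?_ ?_
  · intro l hl
    exact Finset.mem_range.2 (Nat.lt_succ_of_le (Finset.le_sup (f := id) hl))
  · intro l _ hl
    simpa using hl

end GSymBasics

/-- If a finite sum of elements of independent submodules lies in one of them, the other summands
vanish. -/
theorem iSupIndep.eq_of_sum_mem {A : Type*} [AddCommGroup A] [Module ℝ A] {d : ℕ → Submodule ℝ A}
    (hd : iSupIndep d) {s : ℕ → A} (hs : ∀ l, s l ∈ d l) {N k : ℕ}
    (h : ∑ l ∈ Finset.range N, s l ∈ d k) {l : ℕ} (hl : l ∈ Finset.range N) (hlk : l ≠ k) :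
    s l = 0 := by
  have hmem : s l ∈ ⨆ j, ⨆ (_ : j ≠ l), d j := by
    have h' : s l = ∑ l ∈ Finset.range N, s l - ∑ j ∈ (Finset.range N).erase l, s j := by
      rw [← Finset.add_sum_erase _ _ hl, add_sub_cancel_right]
    rw [h']
    refine sub_mem (Submodule.mem_iSup_of_mem k (Submodule.mem_iSup_of_mem hlk.symm h)) ?_
    refine Submodule.sum_mem _ fun j hj => ?_
    exact Submodule.mem_iSup_of_mem j (Submodule.mem_iSup_of_mem (Finset.ne_of_mem_erase hj) (hs j))
  exact (Submodule.disjoint_def.1 (hd l)) _ (hs l) hmem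

/-! ### Koszul signs -/

section Koszul

variable {R : Type} [Ring R] [Algebra ℝ R]

theorem mul_prod_succAbove {N : ℕ} (a : Fin (N + 1) → R) (d : Fin (N + 1) → ℕ)
    (h : ∀ p q, a p * a q = ((-1 : ℝ) ^ (d p * d q)) • (a q * a p)) (p : Fin (N + 1)) :
    a p * (List.ofFn fun k => a (p.succAbove k)).prod =
      (∏ k, if p.succAbove k < p then (-1 : ℝ) ^ (d p * d (p.succAbove k)) else 1) •
        (List.ofFn a).prod := by
  induction N with
  | zero =>
    have : p = 0 := Fin.fin_one_eq_zero p
    subst this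
    simp
  | succ N ih =>
    refine Fin.cases ?_ (fun p => ?_) p
    · simp [List.ofFn_succ]
    · have ih' := ih (fun k => a k.succ) (fun k => d k.succ) (fun _ _ => h _ _) p
      have hlt : ∀ k : Fin N, (p.succ.succAbove k.succ < p.succ ↔ p.succAbove k < p) := fun k => by
        rw [Fin.succ_succAbove_succ, Fin.succ_lt_succ_iff]
      rw [List.ofFn_succ, List.prod_cons, ← mul_assoc, Fin.prod_univ_succ]
      simp only [Fin.succ_succAbove_zero, hlt]
      simp only [Fin.succ_succAbove_succ]
      rw [h, smul_mul_assoc, mul_assoc, ih', List.ofFn_succ (f := a), List.prod_cons,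
        mul_smul_comm, smul_smul, if_pos (Fin.succ_pos p)]

/-- Permuting the factors of a product of pairwise graded commuting elements produces the Koszul
sign of the permutation. -/
theorem koszul_prod {N : ℕ} (a : Fin N → R) (d : Fin N → ℕ)
    (h : ∀ p q, a p * a q = ((-1 : ℝ) ^ (d p * d q)) • (a q * a p)) (σ : Equiv.Perm (Fin N)) :
    (List.ofFn fun p => a (σ p)).prod = koszulSign σ d • (List.ofFn a).prod := by
  induction N with
  | zero => simp [koszulSign]
  | succ N ih =>
    set p := σ 0 with hp
    have hne : ∀ j : Fin N, σ j.succ ≠ p := fun j hj => Fin.succ_ne_zero j (σ.injective hj)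
    choose σ' hσ' using fun j => Fin.exists_succAbove_eq (hne j)
    have hinj : Function.Injective σ' := by
      intro j k hjk
      have : σ j.succ = σ k.succ := by rw [← hσ' j, ← hσ' k, hjk]
      exact Fin.succ_injective _ (σ.injective this)
    let τ : Equiv.Perm (Fin N) := Equiv.ofBijective σ' (Finite.injective_iff_bijective.1 hinj)
    have hτ : ∀ j, p.succAbove (τ j) = σ j.succ := hσ'
    have ih' := ih (fun k => a (p.succAbove k)) (fun k => d (p.succAbove k)) (fun _ _ => h _ _) τ
    simp only [hτ] at ih'
    rw [List.ofFn_succ, List.prod_cons, ih', mul_smul_comm, ← hp, mul_prod_succAbove a d h p,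
      smul_smul]
    congr 1
    rw [koszulSign, koszulSign, Fintype.prod_prod_type, Fintype.prod_prod_type, Fin.prod_univ_succ,
      Fin.prod_univ_succ, mul_comm]
    congr 1
    · simp only [lt_irrefl, false_and, if_false, one_mul, Fin.succ_pos, true_and, ← hp, ← hτ]
      exact (Equiv.prod_comp τ _).symm
    · refine Finset.prod_congr rfl fun j _ => ?_
      rw [Fin.prod_univ_succ]
      simp only [Fin.not_lt_zero, false_and, if_false, one_mul, Fin.succ_lt_succ_iff, hτ]
      refine Finset.prod_congr rfl fun k _ => ?_
      have hlt : τ k < τ j ↔ σ k.succ < σ j.succ := by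
        rw [← hτ, ← hτ, Fin.succAbove_lt_succAbove_iff]
      simp only [hlt]

end Koszul

/-! ### The algebra dual to a coalgebra -/

section Pairing

variable {M N K : Type} [AddCommGroup M] [Module ℝ M] [AddCommGroup N] [Module ℝ N]
  [AddCommGroup K] [Module ℝ K]

/-- The functional `ξ ⊗ η` on `M ⊗ N`. -/
def pair₂ (ξ : Module.Dual ℝ M) (η : Module.Dual ℝ N) : M ⊗[ℝ] N →ₗ[ℝ] ℝ :=
  LinearMap.mul' ℝ ℝ ∘ₗ TensorProduct.map ξ η

@[simp] theorem pair₂_tmul (ξ : Module.Dual ℝ M) (η : Module.Dual ℝ N) (a : M) (b : N) :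
    pair₂ ξ η (a ⊗ₜ b) = ξ a * η b := by simp [pair₂]

theorem pair₂_add_left (ξ ξ' : Module.Dual ℝ M) (η : Module.Dual ℝ N) :
    pair₂ (ξ + ξ') η = pair₂ ξ η + pair₂ ξ' η := by
  apply TensorProduct.ext'; intro a b; simp [add_mul]

theorem pair₂_add_right (ξ : Module.Dual ℝ M) (η η' : Module.Dual ℝ N) :
    pair₂ ξ (η + η') = pair₂ ξ η + pair₂ ξ η' := by
  apply TensorProduct.ext'; intro a b; simp [mul_add]

theorem pair₂_smul_left (r : ℝ) (ξ : Module.Dual ℝ M) (η : Module.Dual ℝ N) :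
    pair₂ (r • ξ) η = r • pair₂ ξ η := by
  apply TensorProduct.ext'; intro a b; simp [mul_assoc]

theorem pair₂_smul_right (r : ℝ) (ξ : Module.Dual ℝ M) (η : Module.Dual ℝ N) :
    pair₂ ξ (r • η) = r • pair₂ ξ η := by
  apply TensorProduct.ext'; intro a b; simp [mul_left_comm]

theorem pair₂_zero_left (η : Module.Dual ℝ N) : pair₂ (0 : Module.Dual ℝ M) η = 0 := by
  apply TensorProduct.ext'; intro a b; simp

theorem pair₂_zero_right (ξ : Module.Dual ℝ M) : pair₂ ξ (0 : Module.Dual ℝ N) = 0 := by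
  apply TensorProduct.ext'; intro a b; simp

theorem pair₂_map {M' N' : Type} [AddCommGroup M'] [Module ℝ M'] [AddCommGroup N'] [Module ℝ N']
    (f : M' →ₗ[ℝ] M) (g : N' →ₗ[ℝ] N) (ξ : Module.Dual ℝ M) (η : Module.Dual ℝ N)
    (z : M' ⊗[ℝ] N') : pair₂ ξ η (TensorProduct.map f g z) = pair₂ (ξ ∘ₗ f) (η ∘ₗ g) z := by
  induction z with
  | zero => simp
  | tmul a b => simp
  | add x y hx hy => simp only [map_add, hx, hy]

theorem pair₂_assoc (a : Module.Dual ℝ M) (b : Module.Dual ℝ N) (c : Module.Dual ℝ K)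
    (z : (M ⊗[ℝ] N) ⊗[ℝ] K) :
    pair₂ (pair₂ a b) c z = pair₂ a (pair₂ b c) (TensorProduct.assoc ℝ M N K z) := by
  have : pair₂ (pair₂ a b) c =
      pair₂ a (pair₂ b c) ∘ₗ (TensorProduct.assoc ℝ M N K).toLinearMap := by
    apply TensorProduct.ext_threefold
    intro x y z
    simp [mul_assoc]
  rw [this]; rfl

end Pairing

section DualAlg

variable {n : ℕ} {E : Fin n → Type} [∀ i, AddCommGroup (E i)] [∀ i, Module ℝ (E i)]
variable {μ : Tot E →ₗ[ℝ] Tot E ⊗[ℝ] Tot E}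

/-- A functional on the `i`-th component as a functional on the total space. -/
abbrev ext₁ (i : Fin n) (ξ : Module.Dual ℝ (E i)) : Module.Dual ℝ (Tot E) := ξ ∘ₗ prj E i

theorem ext₁_inc_self (i : Fin n) (ξ : Module.Dual ℝ (E i)) : ext₁ i ξ ∘ₗ inc E i = ξ := by
  ext v; simp

theorem ext₁_inc_ne {i k : Fin n} (h : k ≠ i) (ξ : Module.Dual ℝ (E i)) :
    ext₁ i ξ ∘ₗ inc E k = 0 := by
  ext v; simp [Pi.single_eq_of_ne h.symm]

theorem dual_tot_ext {a b : Module.Dual ℝ (Tot E)} (h : ∀ k, a ∘ₗ inc E k = b ∘ₗ inc E k) :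
    a = b := by
  apply LinearMap.pi_ext
  intro k v
  exact LinearMap.congr_fun (h k) v

/-- An element of weight `l` of `E ⊗ E` pairs to zero with functionals of any other total weight. -/
theorem pair₂_tensorWt {l : ℕ} {z : Tot E ⊗[ℝ] Tot E} (hz : z ∈ tensorWt E l) {i j : Fin n}
    (h : wt i + wt j ≠ l) (ξ : Module.Dual ℝ (E i)) (η : Module.Dual ℝ (E j)) :
    pair₂ (ext₁ i ξ) (ext₁ j η) z = 0 := by
  induction hz using Submodule.span_induction with
  | mem z hz =>
    obtain ⟨i', j', a, b, hl, rfl⟩ := hz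
    by_cases hi : i' = i
    · by_cases hj : j' = j
      · subst hi hj; exact absurd hl h
      · simp [Pi.single_eq_of_ne (Ne.symm hj)]
    · simp [Pi.single_eq_of_ne (Ne.symm hi)]
  | zero => simp
  | add x y hx hy h₁ h₂ => rw [map_add, h₁, h₂, add_zero]
  | smul r x hx h => rw [map_smul, h, smul_zero]

theorem pair₂_braid (i j : Fin n) (ξ : Module.Dual ℝ (E i)) (η : Module.Dual ℝ (E j))
    (z : Tot E ⊗[ℝ] Tot E) : pair₂ (ext₁ i ξ) (ext₁ j η) (braid E z) =
      (-1 : ℝ) ^ (wt i * wt j) * pair₂ (ext₁ j η) (ext₁ i ξ) z := by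
  induction z with
  | zero => simp
  | add x y hx hy => rw [map_add, map_add, map_add, hx, hy, mul_add]
  | tmul a b =>
    simp only [braid, LinearMap.sum_apply, map_sum, LinearMap.smul_apply, map_smul,
      LinearMap.comp_apply, TensorProduct.map_tmul, LinearEquiv.coe_coe, TensorProduct.comm_tmul,
      pair₂_tmul, smul_eq_mul]
    rw [Finset.sum_eq_single j, Finset.sum_eq_single i]
    · simp [mul_comm (wt i)]; ring
    · intro k _ hk; simp [Pi.single_eq_of_ne hk.symm]
    · simp
    · intro k _ hk
      refine Finset.sum_eq_zero fun l _ => ?_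
      simp [Pi.single_eq_of_ne hk.symm]
    · simp

/-- The convolution product on the dual of the total space. -/
def conv (μ : Tot E →ₗ[ℝ] Tot E ⊗[ℝ] Tot E) (a b : Module.Dual ℝ (Tot E)) :
    Module.Dual ℝ (Tot E) := pair₂ a b ∘ₗ μ

theorem conv_add_left (a a' b : Module.Dual ℝ (Tot E)) :
    conv μ (a + a') b = conv μ a b + conv μ a' b := by
  simp only [conv, pair₂_add_left, LinearMap.add_comp]

theorem conv_add_right (a b b' : Module.Dual ℝ (Tot E)) :
    conv μ a (b + b') = conv μ a b + conv μ a b' := by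
  simp only [conv, pair₂_add_right, LinearMap.add_comp]

theorem conv_smul_left (r : ℝ) (a b : Module.Dual ℝ (Tot E)) :
    conv μ (r • a) b = r • conv μ a b := by
  simp only [conv, pair₂_smul_left, LinearMap.smul_comp]

theorem conv_smul_right (r : ℝ) (a b : Module.Dual ℝ (Tot E)) :
    conv μ a (r • b) = r • conv μ a b := by
  simp only [conv, pair₂_smul_right, LinearMap.smul_comp]

theorem conv_zero_left (b : Module.Dual ℝ (Tot E)) : conv μ 0 b = 0 := by
  simpa using conv_smul_left (μ := μ) 0 0 b

theorem conv_zero_right (a : Module.Dual ℝ (Tot E)) : conv μ a 0 = 0 := by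
  simpa using conv_smul_right (μ := μ) 0 a 0

theorem pair₂_conv_left (a b : Module.Dual ℝ (Tot E)) (c : Module.Dual ℝ (Tot E))
    (z : Tot E ⊗[ℝ] Tot E) :
    pair₂ (conv μ a b) c z = pair₂ (pair₂ a b) c (μ.rTensor (Tot E) z) := by
  rw [LinearMap.rTensor, pair₂_map]; rfl

theorem pair₂_conv_right (a b : Module.Dual ℝ (Tot E)) (c : Module.Dual ℝ (Tot E))
    (z : Tot E ⊗[ℝ] Tot E) :
    pair₂ a (conv μ b c) z = pair₂ a (pair₂ b c) (μ.lTensor (Tot E) z) := by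
  rw [LinearMap.lTensor, pair₂_map]; rfl

theorem conv_assoc (h : IsCoalg μ) (a b c : Module.Dual ℝ (Tot E)) :
    conv μ (conv μ a b) c = conv μ a (conv μ b c) := by
  refine LinearMap.ext fun v => ?_
  change pair₂ (conv μ a b) c (μ v) = pair₂ a (conv μ b c) (μ v)
  rw [pair₂_conv_left, pair₂_conv_right, pair₂_assoc]
  exact congrArg _ (LinearMap.congr_fun h.coassoc v)

theorem conv_comm (h : IsCoalg μ) (i j : Fin n) (ξ : Module.Dual ℝ (E i))
    (η : Module.Dual ℝ (E j)) :
    conv μ (ext₁ i ξ) (ext₁ j η) = ((-1 : ℝ) ^ (wt i * wt j)) • conv μ (ext₁ j η) (ext₁ i ξ) := by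
  refine LinearMap.ext fun v => ?_
  change pair₂ _ _ (μ v) = _
  rw [← LinearMap.congr_fun h.cocomm v, LinearMap.comp_apply, pair₂_braid]
  rw [LinearMap.smul_apply, smul_eq_mul]
  congr 1

theorem dualMul_eq (i j k : Fin n) (ξ : Module.Dual ℝ (E i)) (η : Module.Dual ℝ (E j)) :
    dualMul μ i j k ξ η = conv μ (ext₁ i ξ) (ext₁ j η) ∘ₗ inc E k := rfl

theorem dualMul_eq_zero (h : IsCoalg μ) {i j k : Fin n} (hk : wt i + wt j ≠ wt k)
    (ξ : Module.Dual ℝ (E i)) (η : Module.Dual ℝ (E j)) : dualMul μ i j k ξ η = 0 := by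
  ext v
  exact pair₂_tensorWt (h.degree k v) hk ξ η

theorem conv_ext₁ (h : IsCoalg μ) {i j k : Fin n} (hk : wt i + wt j = wt k)
    (ξ : Module.Dual ℝ (E i)) (η : Module.Dual ℝ (E j)) :
    conv μ (ext₁ i ξ) (ext₁ j η) = ext₁ k (dualMul μ i j k ξ η) := by
  refine dual_tot_ext fun l => ?_
  rw [← dualMul_eq]
  by_cases hl : l = k
  · subst hl; rw [ext₁_inc_self]
  · rw [ext₁_inc_ne hl, dualMul_eq_zero h]
    rw [hk]; exact fun h' => hl (wt_injective h').symm

/-- The algebra `ℝ ⊕ E*` dual to a coalgebra `E`: the convolution product with a unit adjoined. -/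
@[ext]
structure DualAlg (h : IsCoalg μ) : Type where
  /-- The scalar component. -/
  fst : ℝ
  /-- The component in `E*`. -/
  snd : Module.Dual ℝ (Tot E)

namespace DualAlg

/-- The elements of the dual algebra as pairs. -/
def equivProd (h : IsCoalg μ) : DualAlg h ≃ ℝ × Module.Dual ℝ (Tot E) where
  toFun u := (u.fst, u.snd)
  invFun p := ⟨p.1, p.2⟩
  left_inv _ := rfl
  right_inv _ := rfl

variable (h : IsCoalg μ)

instance : AddCommGroup (DualAlg h) := (equivProd h).addCommGroup

instance : Module ℝ (DualAlg h) := (equivProd h).module ℝ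

instance : Mul (DualAlg h) := ⟨fun u v => ⟨u.1 * v.1, u.1 • v.2 + v.1 • u.2 + conv μ u.2 v.2⟩⟩

instance : One (DualAlg h) := ⟨⟨1, 0⟩⟩

variable {h}

theorem mul_fst (u v : DualAlg h) : (u * v).1 = u.1 * v.1 := rfl

theorem mul_snd (u v : DualAlg h) : (u * v).2 = u.1 • v.2 + v.1 • u.2 + conv μ u.2 v.2 := rfl

theorem one_fst : (1 : DualAlg h).1 = 1 := rfl

theorem one_snd : (1 : DualAlg h).2 = 0 := rfl

theorem zero_fst : (0 : DualAlg h).1 = 0 := rfl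

theorem zero_snd : (0 : DualAlg h).2 = 0 := rfl

theorem add_fst (u v : DualAlg h) : (u + v).1 = u.1 + v.1 := rfl

theorem add_snd (u v : DualAlg h) : (u + v).2 = u.2 + v.2 := rfl

theorem smul_fst (r : ℝ) (v : DualAlg h) : (r • v).1 = r * v.1 := rfl

theorem smul_snd (r : ℝ) (v : DualAlg h) : (r • v).2 = r • v.2 := rfl

variable (h)

instance : Ring (DualAlg h) :=
  { (inferInstance : AddCommGroup (DualAlg h)), (inferInstance : Mul (DualAlg h)),
    (inferInstance : One (DualAlg h)) with
    left_distrib := fun a b c => DualAlg.ext (by simp only [mul_fst, add_fst, mul_add]) (by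
      simp only [mul_snd, add_snd, add_fst, smul_add, add_smul, conv_add_right]; abel)
    right_distrib := fun a b c => DualAlg.ext (by simp only [mul_fst, add_fst, add_mul]) (by
      simp only [mul_snd, add_snd, add_fst, smul_add, add_smul, conv_add_left]; abel)
    zero_mul := fun a => DualAlg.ext (by simp only [mul_fst, zero_fst, zero_mul]) (by
      simp only [mul_snd, zero_snd, zero_fst, zero_smul, smul_zero, conv_zero_left, add_zero])
    mul_zero := fun a => DualAlg.ext (by simp only [mul_fst, zero_fst, mul_zero]) (by
      simp only [mul_snd, zero_snd, zero_fst, zero_smul, smul_zero, conv_zero_right, add_zero])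
    one_mul := fun a => DualAlg.ext (by simp only [mul_fst, one_fst, one_mul]) (by
      simp only [mul_snd, one_snd, one_fst, one_smul, smul_zero, conv_zero_left, add_zero])
    mul_one := fun a => DualAlg.ext (by simp only [mul_fst, one_fst, mul_one]) (by
      simp only [mul_snd, one_snd, one_fst, one_smul, smul_zero, conv_zero_right, add_zero,
        zero_add])
    mul_assoc := fun a b c => DualAlg.ext (by simp only [mul_fst, mul_assoc]) (by
      simp only [mul_snd, mul_fst, conv_add_left, conv_add_right, conv_smul_left,
        conv_smul_right, conv_assoc h]
      module) }

instance : Algebra ℝ (DualAlg h) :=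
  Algebra.ofModule
    (fun r a b => DualAlg.ext (by simp only [mul_fst, smul_fst, mul_assoc]) (by
      simp only [mul_snd, smul_fst, smul_snd, conv_smul_left, smul_add, smul_smul, mul_comm]))
    (fun r a b => DualAlg.ext (by simp only [mul_fst, smul_fst, mul_left_comm]) (by
      simp only [mul_snd, smul_fst, smul_snd, conv_smul_right, smul_add, smul_smul, mul_comm]))

instance : Nontrivial (DualAlg h) :=
  ⟨1, 0, fun H => one_ne_zero (congrArg fst H : (1 : ℝ) = 0)⟩

/-- The inclusion of `(E i)*` in the dual algebra. -/
def gen (i : Fin n) : Module.Dual ℝ (E i) →ₗ[ℝ] DualAlg h where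
  toFun ξ := ⟨0, ext₁ i ξ⟩
  map_add' _ _ := DualAlg.ext (add_zero _).symm rfl
  map_smul' r _ := DualAlg.ext (mul_zero r).symm rfl

/-- The component of an element of the dual algebra in `(E k)*`. -/
def comp (k : Fin n) : DualAlg h →ₗ[ℝ] Module.Dual ℝ (E k) where
  toFun u := u.2 ∘ₗ inc E k
  map_add' _ _ := rfl
  map_smul' _ _ := rfl

/-- The homogeneous elements of degree `l` of the dual algebra. -/
def deg (l : ℕ) : Submodule ℝ (DualAlg h) where
  carrier := {u | (l ≠ 0 → u.1 = 0) ∧ ∀ i, wt i ≠ l → comp h i u = 0}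
  add_mem' := fun ha hb => ⟨fun hl => by rw [add_fst, ha.1 hl, hb.1 hl, add_zero],
    fun i hi => by rw [map_add, ha.2 i hi, hb.2 i hi, add_zero]⟩
  zero_mem' := ⟨fun _ => rfl, fun _ _ => rfl⟩
  smul_mem' := fun r a ha => ⟨fun hl => by rw [smul_fst, ha.1 hl, mul_zero],
    fun i hi => by rw [map_smul, ha.2 i hi, smul_zero]⟩

variable {h}

theorem comp_gen_self (i : Fin n) (ξ : Module.Dual ℝ (E i)) : comp h i (gen h i ξ) = ξ :=
  ext₁_inc_self i ξ

theorem comp_gen_ne {i k : Fin n} (hk : k ≠ i) (ξ : Module.Dual ℝ (E i)) :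
    comp h k (gen h i ξ) = 0 :=
  ext₁_inc_ne hk ξ

theorem gen_comp_of_mem {k : Fin n} {u : DualAlg h} (hu : u ∈ deg h (wt k)) :
    gen h k (comp h k u) = u := by
  refine DualAlg.ext (hu.1 (wt_pos k).ne').symm ?_
  refine dual_tot_ext fun i => ?_
  by_cases hi : i = k
  · subst hi; exact ext₁_inc_self i _
  · exact (ext₁_inc_ne hi _).trans (hu.2 i fun h' => hi (wt_injective h')).symm

theorem gen_mem (i : Fin n) (ξ : Module.Dual ℝ (E i)) : gen h i ξ ∈ deg h (wt i) :=
  ⟨fun _ => rfl, fun _ hk => comp_gen_ne (fun h' => hk (by rw [h'])) ξ⟩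

theorem mem_deg_zero {u : DualAlg h} (hu : u ∈ deg h 0) : u = u.1 • 1 := by
  refine DualAlg.ext (mul_one u.1).symm (dual_tot_ext fun i => ?_)
  rw [smul_snd, one_snd, smul_zero]
  exact hu.2 i (wt_pos i).ne'

theorem one_mem : (1 : DualAlg h) ∈ deg h 0 := ⟨fun h' => absurd rfl h', fun _ _ => rfl⟩

theorem gen_mul_gen {i j k : Fin n} (hk : wt i + wt j = wt k) (ξ : Module.Dual ℝ (E i))
    (η : Module.Dual ℝ (E j)) : gen h i ξ * gen h j η = gen h k (dualMul μ i j k ξ η) := by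
  refine DualAlg.ext (mul_zero _) ?_
  rw [mul_snd]
  change (0 : ℝ) • _ + (0 : ℝ) • _ + _ = _
  rw [zero_smul, zero_smul, zero_add, zero_add]
  exact conv_ext₁ h hk ξ η

theorem comp_gen_mul_gen (i j k : Fin n) (ξ : Module.Dual ℝ (E i)) (η : Module.Dual ℝ (E j)) :
    comp h k (gen h i ξ * gen h j η) = dualMul μ i j k ξ η := by
  change (gen h i ξ * gen h j η).2 ∘ₗ inc E k = _
  rw [mul_snd]
  change ((0 : ℝ) • _ + (0 : ℝ) • _ + _) ∘ₗ inc E k = _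
  rw [zero_smul, zero_smul, zero_add, zero_add]
  rfl

theorem gen_comm (i j : Fin n) (ξ : Module.Dual ℝ (E i)) (η : Module.Dual ℝ (E j)) :
    gen h i ξ * gen h j η = ((-1 : ℝ) ^ (wt i * wt j)) • (gen h j η * gen h i ξ) := by
  refine DualAlg.ext (by rw [smul_fst, mul_fst, mul_fst]; change (0 : ℝ) * 0 = _ * (0 * 0); simp) ?_
  rw [smul_snd, mul_snd, mul_snd]
  change (0 : ℝ) • _ + (0 : ℝ) • _ + _ = _ • ((0 : ℝ) • _ + (0 : ℝ) • _ + _)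
  simp only [zero_smul, zero_add]
  exact conv_comm h i j ξ η

theorem mul_mem {k l : ℕ} {a b : DualAlg h} (ha : a ∈ deg h k) (hb : b ∈ deg h l) :
    a * b ∈ deg h (k + l) := by
  rcases Nat.eq_zero_or_pos k with rfl | hk
  · rw [mem_deg_zero ha, smul_mul_assoc, one_mul, zero_add]
    exact Submodule.smul_mem _ _ hb
  rcases Nat.eq_zero_or_pos l with rfl | hl
  · rw [mem_deg_zero hb, mul_smul_comm, mul_one, add_zero]
    exact Submodule.smul_mem _ _ ha
  have hpos : ∀ {m : ℕ} {u : DualAlg h}, 0 < m → u ∈ deg h m →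
      u = 0 ∨ ∃ (i : Fin n) (ξ : Module.Dual ℝ (E i)), wt i = m ∧ u = gen h i ξ := by
    intro m u hm hu
    by_cases hmn : m ≤ n
    · obtain ⟨i, rfl⟩ := exists_wt_eq hm hmn
      exact Or.inr ⟨i, _, rfl, (gen_comp_of_mem hu).symm⟩
    · left
      refine DualAlg.ext (hu.1 hm.ne') (dual_tot_ext fun i => ?_)
      exact hu.2 i fun h' => hmn (h' ▸ wt_le i)
  rcases hpos hk ha with rfl | ⟨i, ξ, rfl, rfl⟩
  · rw [zero_mul]; exact zero_mem _
  rcases hpos hl hb with rfl | ⟨j, η, rfl, rfl⟩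
  · rw [mul_zero]; exact zero_mem _
  refine ⟨fun _ => mul_zero _, fun m hm => ?_⟩
  rw [comp_gen_mul_gen, dualMul_eq_zero h hm.symm]

end DualAlg

/-- The morphism from the graded symmetric algebra of `V` to the algebra dual to the coalgebra `E`
induced by linear maps `V i → (E i)*`. -/
def toDual {V : Fin n → Type} [∀ i, AddCommGroup (V i)] [∀ i, Module ℝ (V i)] (h : IsCoalg μ)
    (j : ∀ i, V i →ₗ[ℝ] Module.Dual ℝ (E i)) : GSym V →ₐ[ℝ] DualAlg h :=
  GSym.lift (fun i => DualAlg.gen h i ∘ₗ j i) fun _ _ _ _ => DualAlg.gen_comm _ _ _ _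

section toDual

variable {V : Fin n → Type} [∀ i, AddCommGroup (V i)] [∀ i, Module ℝ (V i)] {h : IsCoalg μ}
  {j : ∀ i, V i →ₗ[ℝ] Module.Dual ℝ (E i)}

theorem toDual_ι (i : Fin n) (v : V i) : toDual h j (GSym.ι i v) = DualAlg.gen h i (j i v) :=
  GSym.lift_ι _ _ i v

theorem toDual_mem {l : ℕ} {x : GSym V} (hx : x ∈ GSym.deg V l) :
    toDual h j x ∈ DualAlg.deg h l := by
  induction hx using Submodule.span_induction with
  | mem x hx =>
    obtain ⟨L, rfl, rfl⟩ := hx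
    induction L with
    | nil => simpa using DualAlg.one_mem
    | cons q L ih =>
      simp only [List.map_cons, List.prod_cons, List.sum_cons, map_mul, toDual_ι]
      exact DualAlg.mul_mem (DualAlg.gen_mem _ _) ih
  | zero => rw [map_zero]; exact zero_mem _
  | add x y hx hy h₁ h₂ => rw [map_add]; exact add_mem h₁ h₂
  | smul r x hx h => rw [map_smul]; exact Submodule.smul_mem _ _ h

end toDual

/-- The component `S^i V → (E i)*` of the morphism `toDual`. -/
def toDualDeg {V : Fin n → Type} [∀ i, AddCommGroup (V i)] [∀ i, Module ℝ (V i)] (h : IsCoalg μ)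
    (j : ∀ i, V i →ₗ[ℝ] Module.Dual ℝ (E i)) (i : Fin n) :
    GSym.deg V (wt i) →ₗ[ℝ] Module.Dual ℝ (E i) :=
  DualAlg.comp h i ∘ₗ (toDual h j).toLinearMap ∘ₗ (GSym.deg V (wt i)).subtype

section toDual

variable {V : Fin n → Type} [∀ i, AddCommGroup (V i)] [∀ i, Module ℝ (V i)] {h : IsCoalg μ}
  {j : ∀ i, V i →ₗ[ℝ] Module.Dual ℝ (E i)}

theorem gen_toDualDeg {i : Fin n} (s : GSym.deg V (wt i)) :
    DualAlg.gen h i (toDualDeg h j i s) = toDual h j s.1 :=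
  DualAlg.gen_comp_of_mem (toDual_mem s.2)

theorem toDualDeg_ι (i : Fin n) (v : V i) :
    toDualDeg h j i ⟨GSym.ι i v, GSym.ι_mem i v⟩ = j i v := by
  change DualAlg.comp h i (toDual h j (GSym.ι i v)) = _
  rw [toDual_ι, DualAlg.comp_gen_self]

theorem toDualDeg_mul {a b c : Fin n} (hc : wt a + wt b = wt c) (s : GSym.deg V (wt a))
    (t : GSym.deg V (wt b)) :
    toDualDeg h j c ⟨s.1 * t.1, hc ▸ GSym.mul_mem s.2 t.2⟩ =
      dualMul μ a b c (toDualDeg h j a s) (toDualDeg h j b t) := by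
  change DualAlg.comp h c (toDual h j (s.1 * t.1)) = _
  rw [map_mul, ← gen_toDualDeg, ← gen_toDualDeg, DualAlg.comp_gen_mul_gen]

end toDual

end DualAlg

/-! ### Functionals on tensor powers -/

section TensorPowers

variable {n : ℕ} {E : Fin n → Type} [∀ i, AddCommGroup (E i)] [∀ i, Module ℝ (E i)]
variable {μ : Tot E →ₗ[ℝ] Tot E ⊗[ℝ] Tot E}

/-- The functional `ξ₁ ⊗ ⋯ ⊗ ξ_N` on the tensor power. -/
def pairN {N : ℕ} (ξ : Fin N → Module.Dual ℝ (Tot E)) : TensorPower ℝ N (Tot E) →ₗ[ℝ] ℝ :=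
  PiTensorProduct.lift ((MultilinearMap.mkPiAlgebra ℝ (Fin N) ℝ).compLinearMap ξ)

@[simp] theorem pairN_tprod {N : ℕ} (ξ : Fin N → Module.Dual ℝ (Tot E)) (v : Fin N → Tot E) :
    pairN ξ (PiTensorProduct.tprod ℝ v) = ∏ p, ξ p (v p) := by
  simp [pairN, PiTensorProduct.lift.tprod]

theorem tensorPower_hom_ext {N : ℕ} {f g : TensorPower ℝ N (Tot E) →ₗ[ℝ] ℝ}
    (h : ∀ v, f (PiTensorProduct.tprod ℝ v) = g (PiTensorProduct.tprod ℝ v)) : f = g :=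
  PiTensorProduct.ext (MultilinearMap.ext h)

theorem tensorPower_ext [∀ i, FiniteDimensional ℝ (E i)] {N : ℕ} {s t : TensorPower ℝ N (Tot E)}
    (h : ∀ (d : Fin N → Fin n) (ξ : ∀ p, Module.Dual ℝ (E (d p))),
      pairN (fun p => ext₁ (d p) (ξ p)) s = pairN (fun p => ext₁ (d p) (ξ p)) t) : s = t := by
  let b := Pi.basis fun i => Module.finBasis ℝ (E i)
  apply (Basis.piTensorProduct fun _ : Fin N => b).repr.injective
  ext c
  have key : ∀ s, (Basis.piTensorProduct fun _ : Fin N => b).repr s c =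
      pairN (fun p => ext₁ (c p).1 ((Module.finBasis ℝ (E (c p).1)).coord (c p).2)) s := by
    intro s
    have : Finsupp.lapply c ∘ₗ (Basis.piTensorProduct fun _ : Fin N => b).repr.toLinearMap =
        pairN (fun p => ext₁ (c p).1 ((Module.finBasis ℝ (E (c p).1)).coord (c p).2)) := by
      refine tensorPower_hom_ext fun v => ?_
      rw [pairN_tprod]
      refine (Basis.piTensorProduct_repr_tprod_apply _ _ _).trans ?_
      refine Finset.prod_congr rfl fun p _ => ?_
      exact Pi.basis_repr _ _ _
    exact LinearMap.congr_fun this s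
  rw [key, key]
  exact h _ _

theorem tensor_ext [∀ i, FiniteDimensional ℝ (E i)] {s t : Tot E ⊗[ℝ] Tot E}
    (h : ∀ (i j : Fin n) (ξ : Module.Dual ℝ (E i)) (η : Module.Dual ℝ (E j)),
      pair₂ (ext₁ i ξ) (ext₁ j η) s = pair₂ (ext₁ i ξ) (ext₁ j η) t) : s = t := by
  let b := Pi.basis fun i => Module.finBasis ℝ (E i)
  apply (b.tensorProduct b).repr.injective
  ext ⟨c, d⟩
  have key : ∀ s, (b.tensorProduct b).repr s (c, d) =
      pair₂ (ext₁ c.1 ((Module.finBasis ℝ (E c.1)).coord c.2))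
        (ext₁ d.1 ((Module.finBasis ℝ (E d.1)).coord d.2)) s := by
    intro s
    have : Finsupp.lapply (c, d) ∘ₗ (b.tensorProduct b).repr.toLinearMap =
      pair₂ (ext₁ c.1 ((Module.finBasis ℝ (E c.1)).coord c.2))
        (ext₁ d.1 ((Module.finBasis ℝ (E d.1)).coord d.2)) := by
      apply TensorProduct.ext'
      intro x y
      rw [pair₂_tmul]
      refine (Module.Basis.tensorProduct_repr_tmul_apply b b x y c d).trans ?_
      rw [smul_eq_mul, mul_comm]
      exact congrArg₂ _ (Pi.basis_repr _ _ _) (Pi.basis_repr _ _ _)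
    exact LinearMap.congr_fun this s
  rw [key, key]
  exact h _ _ _ _

/-- Elements of `E ⊗ E` with prescribed values of the functionals `ξ ⊗ η`. -/
theorem exists_tensor [∀ i, FiniteDimensional ℝ (E i)]
    (B : ∀ i j, Module.Dual ℝ (E i) →ₗ[ℝ] Module.Dual ℝ (E j) →ₗ[ℝ] ℝ) :
    ∃ e : Tot E ⊗[ℝ] Tot E,
      (∀ i j ξ η, pair₂ (ext₁ i ξ) (ext₁ j η) e = B i j ξ η) ∧
      ∀ l, (∀ i j, wt i + wt j ≠ l → B i j = 0) → e ∈ tensorWt E l := by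
  let b := fun i => Module.finBasis ℝ (E i)
  refine ⟨∑ i, ∑ j, ∑ a, ∑ c, (B i j ((b i).coord a) ((b j).coord c)) •
    (inc E i (b i a) ⊗ₜ[ℝ] inc E j (b j c)), fun i j ξ η => ?_, fun l hl => ?_⟩
  · simp only [map_sum, map_smul, pair₂_tmul, smul_eq_mul]
    rw [Finset.sum_eq_single i, Finset.sum_eq_single j]
    · have hξ : ξ = ∑ a, ξ (b i a) • (b i).coord a := by
        refine (b i).ext fun a => ?_
        simp
      have hη : η = ∑ a, η (b j a) • (b j).coord a := by
        refine (b j).ext fun a => ?_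
        simp
      conv_rhs => rw [hξ, hη]
      simp only [map_sum, map_smul, LinearMap.sum_apply, LinearMap.smul_apply, smul_eq_mul,
        LinearMap.comp_apply, LinearMap.proj_apply, LinearMap.single_apply, Pi.single_eq_same,
        Finset.mul_sum]
      rw [Finset.sum_comm]
      refine Finset.sum_congr rfl fun c _ => Finset.sum_congr rfl fun a _ => ?_
      ring
    · intro k _ hk
      refine Finset.sum_eq_zero fun a _ => Finset.sum_eq_zero fun c _ => ?_
      simp [Pi.single_eq_of_ne hk.symm]
    · simp
    · intro k _ hk
      refine Finset.sum_eq_zero fun l _ => Finset.sum_eq_zero fun a _ =>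
        Finset.sum_eq_zero fun c _ => ?_
      simp [Pi.single_eq_of_ne hk.symm]
    · simp
  · refine Submodule.sum_mem _ fun i _ => Submodule.sum_mem _ fun j _ =>
      Submodule.sum_mem _ fun a _ => Submodule.sum_mem _ fun c _ => ?_
    by_cases hij : wt i + wt j = l
    · exact Submodule.smul_mem _ _ (Submodule.subset_span ⟨i, j, _, _, hij, rfl⟩)
    · rw [hl i j hij]; simp

theorem pairN_cast {N N' : ℕ} (h : N = N') (ξ : Fin N' → Module.Dual ℝ (Tot E))
    (t : TensorPower ℝ N (Tot E)) :
    pairN ξ (TensorPower.cast ℝ (Tot E) h t) = pairN (fun p => ξ (Fin.cast h p)) t := by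
  subst h
  simp

theorem pairN_mulEquiv {N N' : ℕ} (ξ : Fin (N + N') → Module.Dual ℝ (Tot E))
    (t : TensorPower ℝ N (Tot E) ⊗[ℝ] TensorPower ℝ N' (Tot E)) :
    pairN ξ (TensorPower.mulEquiv t) = pair₂ (pairN fun p => ξ (Fin.castAdd N' p))
      (pairN fun p => ξ (Fin.natAdd N p)) t := by
  have : pairN ξ ∘ₗ (TensorPower.mulEquiv (R := ℝ) (M := Tot E) (n := N) (m := N')).toLinearMap =
      pair₂ (pairN fun p => ξ (Fin.castAdd N' p)) (pairN fun p => ξ (Fin.natAdd N p)) := by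
    apply TensorProduct.ext
    apply PiTensorProduct.ext
    refine MultilinearMap.ext fun a => ?_
    refine tensorPower_hom_ext fun b => ?_
    change pairN ξ (TensorPower.mulEquiv (PiTensorProduct.tprod ℝ a ⊗ₜ[ℝ] PiTensorProduct.tprod ℝ b))
      = pair₂ (pairN fun p => ξ (Fin.castAdd N' p)) (pairN fun p => ξ (Fin.natAdd N p))
        (PiTensorProduct.tprod ℝ a ⊗ₜ[ℝ] PiTensorProduct.tprod ℝ b)
    rw [← TensorPower.gMul_def, TensorPower.tprod_mul_tprod, pair₂_tmul, pairN_tprod, pairN_tprod,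
      pairN_tprod, Fin.prod_univ_add]
    simp
  exact LinearMap.congr_fun this t

/-- Permuting the factors of a tensor permutes the functionals, up to the Koszul sign. -/
theorem pairN_permAct {N : ℕ} (τ : Equiv.Perm (Fin N)) (d : Fin N → Fin n)
    (ξ : ∀ p, Module.Dual ℝ (E (d p))) (t : TensorPower ℝ N (Tot E)) :
    pairN (fun p => ext₁ (d p) (ξ p)) (permAct E τ t) =
      koszulSign τ (fun p => wt (d (τ.symm p))) *
        pairN (fun p => ext₁ (d (τ.symm p)) (ξ (τ.symm p))) t := by
  have : pairN (fun p => ext₁ (d p) (ξ p)) ∘ₗ permAct E τ =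
      koszulSign τ (fun p => wt (d (τ.symm p))) •
        pairN (fun p => ext₁ (d (τ.symm p)) (ξ (τ.symm p))) := by
    refine tensorPower_hom_ext fun v => ?_
    rw [LinearMap.comp_apply, permAct, PiTensorProduct.lift.tprod, sum_apply,
      map_sum, Finset.sum_eq_single (fun p => d (τ.symm p))]
    · rw [smul_apply, map_smul, LinearMap.smul_apply]
      congr 1
      rw [MultilinearMap.compLinearMap_apply, MultilinearMap.domDomCongr_apply, pairN_tprod,
        pairN_tprod]
      conv_rhs => rw [← Equiv.prod_comp τ]
      refine Finset.prod_congr rfl fun p _ => ?_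
      have h : ∀ q r : Fin N, q = r → ext₁ (d r) (ξ r) (inc E (d q) (prj E (d q) (v (τ p)))) =
          ext₁ (d q) (ξ q) (v (τ p)) := by
        rintro q r rfl; simp
      exact h _ p (τ.symm_apply_apply p)
    · intro c _ hc
      obtain ⟨q, hq⟩ := Function.ne_iff.1 hc
      rw [smul_apply, map_smul, MultilinearMap.compLinearMap_apply,
        MultilinearMap.domDomCongr_apply, pairN_tprod,
        Finset.prod_eq_zero (Finset.mem_univ (τ.symm q)), smul_zero]
      change ξ (τ.symm q) (Pi.single (c (τ (τ.symm q))) _ (d (τ.symm q))) = 0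
      rw [Pi.single_eq_of_ne (by rw [Equiv.apply_symm_apply]; exact hq.symm), map_zero]
    · simp
  exact LinearMap.congr_fun this t

theorem pairN_oneEquiv (ξ : Fin 1 → Module.Dual ℝ (Tot E)) (v : Tot E) :
    pairN ξ ((oneEquiv E).symm v) = ξ 0 v := by
  rw [oneEquiv, PiTensorProduct.subsingletonEquiv_symm_apply, pairN_tprod]
  simp

/-- A functional on the total space as an element of the dual algebra. -/
def DualAlg.of (h : IsCoalg μ) (ξ : Module.Dual ℝ (Tot E)) : DualAlg h := ⟨0, ξ⟩

/-- The iterated comultiplication is dual to products in the dual algebra. -/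
theorem pairN_iterComul (h : IsCoalg μ) (k : ℕ) (ξ : Fin (k + 1) → Module.Dual ℝ (Tot E)) :
    pairN ξ ∘ₗ iterComul μ k = ((List.ofFn fun p => DualAlg.of h (ξ p)).prod).snd := by
  induction k with
  | zero =>
    refine LinearMap.ext fun v => ?_
    rw [List.ofFn_succ, List.ofFn_zero, List.prod_singleton]
    exact pairN_oneEquiv ξ v
  | succ k ih =>
    refine LinearMap.ext fun v => ?_
    have hfst : ((List.ofFn fun p : Fin (k + 1) => DualAlg.of h (ξ p.succ)).prod).fst = 0 := by
      rw [List.ofFn_succ, List.prod_cons, DualAlg.mul_fst]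
      exact zero_mul _
    rw [List.ofFn_succ, List.prod_cons, DualAlg.mul_snd, hfst, ← ih]
    simp only [iterComul, LinearMap.comp_apply, LinearEquiv.coe_coe]
    rw [pairN_cast, pairN_mulEquiv, pair₂_map]
    change _ = ((0 : ℝ) • _ + (0 : ℝ) • _ + conv μ _ _) v
    rw [zero_smul, zero_smul, zero_add, zero_add]
    change _ = pair₂ (ξ 0) (pairN (fun p => ξ p.succ) ∘ₗ iterComul μ k) (μ v)
    congr 2
    · refine LinearMap.ext fun w => ?_
      exact pairN_oneEquiv _ w
    · congr 2
      funext p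
      congr 1
      ext
      simp

theorem pairN_iterPair (h : IsCoalg μ) (k l : ℕ)
    (ξ : Fin (k + 1 + (l + 1)) → Module.Dual ℝ (Tot E)) (e : Tot E ⊗[ℝ] Tot E) :
    pairN ξ (iterPair μ k l e) =
      pair₂ ((List.ofFn fun p => DualAlg.of h (ξ (Fin.castAdd (l + 1) p))).prod).snd
        ((List.ofFn fun p => DualAlg.of h (ξ (Fin.natAdd (k + 1) p))).prod).snd e := by
  simp only [iterPair, LinearMap.comp_apply, LinearEquiv.coe_coe]
  rw [pairN_mulEquiv, pair₂_map, pairN_iterComul h, pairN_iterComul h]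

end TensorPowers

/-! ### Membership in the space `K^μ` -/

section CoassocSpace

variable {n : ℕ} {E : Fin n → Type} [∀ i, AddCommGroup (E i)] [∀ i, Module ℝ (E i)]
variable {μ : Tot E →ₗ[ℝ] Tot E ⊗[ℝ] Tot E}

/-- If `κ` turns products of degree less than `N` into products in an algebra `R`, then every product
of generators of degree less than `N` is a generator, with `κ` given by the product in `R`. -/
theorem exists_gen_eq_prod (h : IsCoalg μ) {N : ℕ} {R : Type} [Ring R]
    {κ : ∀ i, Module.Dual ℝ (E i) → R} (hN : N ≤ n + 1)
    (hmul : ∀ i j k ξ η, wt i + wt j = wt k → wt k < N →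
      κ k (dualMul μ i j k ξ η) = κ i ξ * κ j η)
    (l : List (Σ i, Module.Dual ℝ (E i))) (hl : l ≠ [])
    (hs : (l.map fun q => wt q.1).sum < N) :
    ∃ (i : Fin n) (ζ : Module.Dual ℝ (E i)), wt i = (l.map fun q => wt q.1).sum ∧
      (l.map fun q => DualAlg.gen h q.1 q.2).prod = DualAlg.gen h i ζ ∧
      κ i ζ = (l.map fun q => κ q.1 q.2).prod := by
  induction l with
  | nil => exact absurd rfl hl
  | cons q l ih =>
    rcases eq_or_ne l [] with rfl | hl'
    · exact ⟨q.1, q.2, by simp, by simp, by simp⟩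
    · simp only [List.map_cons, List.sum_cons, List.prod_cons] at hs ⊢
      obtain ⟨j, ζ, hj, h₁, h₂⟩ := ih hl' (by omega)
      obtain ⟨k, hk⟩ := exists_wt_eq (n := n) (l := wt q.1 + wt j)
        (by have := wt_pos j; omega) (by omega)
      refine ⟨k, dualMul μ q.1 j k q.2 ζ, by omega, ?_, ?_⟩
      · rw [h₁, DualAlg.gen_mul_gen hk.symm]
      · rw [hmul _ _ _ _ _ hk.symm (by omega), h₂]

/-- A sufficient condition for `e ∈ K^μ`: the values of `e` on homogeneous functionals are a linear
functional of products in a graded commutative algebra `R`. -/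
theorem mem_coassocSpace [∀ i, FiniteDimensional ℝ (E i)] (h : IsCoalg μ) {L : Fin n}
    {e : Tot E ⊗[ℝ] Tot E} (he : e ∈ tensorWt E (wt L)) {R : Type} [Ring R] [Algebra ℝ R]
    (κ : ∀ i, Module.Dual ℝ (E i) → R) (Λ : R →ₗ[ℝ] ℝ)
    (hcomm : ∀ i j ξ η, κ i ξ * κ j η = ((-1 : ℝ) ^ (wt i * wt j)) • (κ j η * κ i ξ))
    (hmul : ∀ i j k ξ η, wt i + wt j = wt k → wt k < wt L →
      κ k (dualMul μ i j k ξ η) = κ i ξ * κ j η)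
    (hΛ : ∀ i j ξ η, wt i + wt j = wt L →
      pair₂ (ext₁ i ξ) (ext₁ j η) e = Λ (κ i ξ * κ j η)) : e ∈ coassocSpace μ := by
  have hL : wt L ≤ n + 1 := (wt_le L).trans (Nat.le_succ n)
  have wtpos : ∀ l : List (Σ i, Module.Dual ℝ (E i)), l ≠ [] →
      0 < (l.map fun q => wt q.1).sum := by
    intro l hl
    cases l with
    | nil => exact absurd rfl hl
    | cons q l => have := wt_pos q.1; simp only [List.map_cons, List.sum_cons]; omega
  -- the value of `e` on two products of generators
  have key : ∀ l l' : List (Σ i, Module.Dual ℝ (E i)), l ≠ [] → l' ≠ [] →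
      pair₂ (l.map fun q => DualAlg.gen h q.1 q.2).prod.snd
        (l'.map fun q => DualAlg.gen h q.1 q.2).prod.snd e =
      if ((l ++ l').map fun q => wt q.1).sum = wt L then
        Λ ((l ++ l').map fun q => κ q.1 q.2).prod else 0 := by
    intro l l' hl hl'
    have hp := wtpos l hl
    have hp' := wtpos l' hl'
    split_ifs with hs
    · rw [List.map_append, List.sum_append] at hs
      obtain ⟨i, ζ, hi, h₁, h₂⟩ := exists_gen_eq_prod h hL hmul l hl (by omega)
      obtain ⟨j, ζ', hj, h₁', h₂'⟩ := exists_gen_eq_prod h hL hmul l' hl' (by omega)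
      rw [h₁, h₁', List.map_append, List.prod_append, ← h₂, ← h₂']
      exact hΛ i j ζ ζ' (by omega)
    · rw [List.map_append, List.sum_append] at hs
      have hgen : ∀ l : List (Σ i, Module.Dual ℝ (E i)), l ≠ [] →
          (l.map fun q => DualAlg.gen h q.1 q.2).prod.snd = 0 ∨
          ∃ (i : Fin n) (ζ : Module.Dual ℝ (E i)), wt i = (l.map fun q => wt q.1).sum ∧
          (l.map fun q => DualAlg.gen h q.1 q.2).prod.snd = ext₁ i ζ := by
        intro l hl
        have hmem : (l.map fun q => DualAlg.gen h q.1 q.2).prod ∈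
            DualAlg.deg h (l.map fun q => wt q.1).sum := by
          clear hl
          induction l with
          | nil => simpa using DualAlg.one_mem
          | cons q l ih =>
            simp only [List.map_cons, List.prod_cons, List.sum_cons]
            exact DualAlg.mul_mem (DualAlg.gen_mem _ _) ih
        have hp := wtpos l hl
        by_cases hn : (l.map fun q => wt q.1).sum ≤ n
        · right
          obtain ⟨i, hi⟩ := exists_wt_eq hp hn
          rw [← hi] at hmem
          exact ⟨i, _, hi, congrArg DualAlg.snd (DualAlg.gen_comp_of_mem hmem).symm⟩
        · left
          refine dual_tot_ext fun i => ?_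
          exact hmem.2 i fun h' => hn (h' ▸ wt_le i)
      rcases hgen l hl with h₁ | ⟨i, ζ, hi, h₁⟩
      · rw [h₁]
        rw [pair₂_zero_left]; rfl
      rcases hgen l' hl' with h₁' | ⟨j, ζ', hj, h₁'⟩
      · rw [h₁']
        rw [pair₂_zero_right]; rfl
      rw [h₁, h₁', pair₂_tensorWt he (by omega)]
  have key' : ∀ (k l : ℕ) (d : Fin (k + 1 + (l + 1)) → Fin n)
      (ξ : ∀ p, Module.Dual ℝ (E (d p))),
      pairN (fun p => ext₁ (d p) (ξ p)) (iterPair μ k l e) =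
      if ∑ p, wt (d p) = wt L then Λ (List.ofFn fun p => κ (d p) (ξ p)).prod else 0 := by
    intro k l d ξ
    have hk := key (List.ofFn fun p : Fin (k + 1) => ⟨d (Fin.castAdd (l + 1) p), ξ _⟩)
      (List.ofFn fun p : Fin (l + 1) => ⟨d (Fin.natAdd (k + 1) p), ξ _⟩) (by simp) (by simp)
    rw [← List.ofFn_fin_append, List.map_ofFn, List.map_ofFn, List.map_ofFn, List.map_ofFn,
      List.sum_ofFn] at hk
    have happ : ∀ p, Fin.append (fun p : Fin (k + 1) => (⟨d (Fin.castAdd (l + 1) p), ξ _⟩ :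
        Σ i, Module.Dual ℝ (E i))) (fun p : Fin (l + 1) => ⟨d (Fin.natAdd (k + 1) p), ξ _⟩) p =
        ⟨d p, ξ p⟩ := by
      intro p
      refine Fin.addCases (fun p => ?_) (fun p => ?_) p <;> simp
    rw [funext happ] at hk
    rw [pairN_iterPair h]
    exact hk
  have key'' : ∀ (k l : ℕ) (τ : Equiv.Perm (Fin (k + 1 + (l + 1))))
      (d : Fin (k + 1 + (l + 1)) → Fin n) (ξ : ∀ p, Module.Dual ℝ (E (d p))),
      pairN (fun p => ext₁ (d p) (ξ p)) (permAct E τ (iterPair μ k l e)) =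
      if ∑ p, wt (d p) = wt L then Λ (List.ofFn fun p => κ (d p) (ξ p)).prod else 0 := by
    intro k l τ d ξ
    rw [pairN_permAct, key' k l (fun p => d (τ.symm p)) (fun p => ξ (τ.symm p)),
      Equiv.sum_comp τ.symm (fun p => wt (d p))]
    have hko := koszul_prod (fun p => κ (d (τ.symm p)) (ξ (τ.symm p)))
      (fun p => wt (d (τ.symm p))) (fun p q => hcomm _ _ _ _) τ
    have hcast : (fun p => κ (d (τ.symm (τ p))) (ξ (τ.symm (τ p)))) = fun p => κ (d p) (ξ p) := by
      funext p
      rw [Equiv.symm_apply_apply]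
    rw [hcast] at hko
    split_ifs with hs
    · rw [← smul_eq_mul, ← map_smul, ← hko]
    · rw [mul_zero]
  intro k l k' l' hkl τ τ'
  refine tensorPower_ext fun d ξ => ?_
  rw [key'']
  have hperm : ∀ {N N' : ℕ} (hN : N = N') (τ' : Equiv.Perm (Fin N'))
      (t : TensorPower ℝ N (Tot E)), permAct E τ' (TensorPower.cast ℝ (Tot E) hN t) =
        TensorPower.cast ℝ (Tot E) hN (permAct E ((finCongr hN).trans
          (τ'.trans (finCongr hN).symm)) t) := by
    intro N N' hN τ' t
    subst hN
    simp
  rw [hperm, pairN_cast]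
  refine Eq.trans ?_ (key'' k' l' _ (fun p => d (Fin.cast _ p)) (fun p => ξ (Fin.cast _ p))).symm
  have hN : k' + 1 + (l' + 1) = k + 1 + (l + 1) := by omega
  have h₁ : ∑ p, wt (d (Fin.cast hN p)) = ∑ p, wt (d p) :=
    Equiv.sum_comp (finCongr hN) (fun p => wt (d p))
  have h₂ : (List.ofFn fun p => κ (d (Fin.cast hN p)) (ξ (Fin.cast hN p))) =
      List.ofFn fun p => κ (d p) (ξ p) := by
    rw [List.ofFn_congr hN]
    rfl
  rw [h₁, h₂]

end CoassocSpace

/-! ### Admissible coalgebras -/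

section Decomposables

variable {n : ℕ} {V : Fin n → Type} [∀ i, AddCommGroup (V i)] [∀ i, Module ℝ (V i)]

/-- The decomposable elements of degree `wt i` of the graded symmetric algebra. -/
def GSym.dec (V : Fin n → Type) [∀ i, AddCommGroup (V i)] [∀ i, Module ℝ (V i)] (i : Fin n) :
    Submodule ℝ (GSym V) :=
  Submodule.span ℝ {z | ∃ (a b : Fin n) (x y : GSym V), wt a + wt b = wt i ∧
    x ∈ GSym.deg V (wt a) ∧ y ∈ GSym.deg V (wt b) ∧ z = x * y}

theorem GSym.dec_le_deg (i : Fin n) : GSym.dec V i ≤ GSym.deg V (wt i) := by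
  refine Submodule.span_le.2 ?_
  rintro _ ⟨a, b, x, y, h, hx, hy, rfl⟩
  exact h ▸ GSym.mul_mem hx hy

/-- A homogeneous element of degree `1, …, n` is a generator up to decomposable elements. -/
theorem GSym.exists_sub_ι_mem_dec {i : Fin n} {s : GSym V} (hs : s ∈ GSym.deg V (wt i)) :
    ∃ v, s - GSym.ι i v ∈ GSym.dec V i := by
  refine GSym.deg_induction (p := fun s => ∃ v, s - GSym.ι i v ∈ GSym.dec V i) (wt_pos i)
    (fun a v k x hk hx => ?_) ⟨0, by simp⟩ ?_ hs
  · rcases Nat.eq_zero_or_pos k with rfl | hk'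
    · obtain rfl : a = i := wt_injective hk
      obtain ⟨c, rfl⟩ := GSym.mem_deg_zero hx
      refine ⟨c • v, ?_⟩
      rw [map_smul, Algebra.algebraMap_eq_smul_one, mul_smul_comm, mul_one, sub_self]
      exact zero_mem _
    · have := wt_le i
      obtain ⟨b, rfl⟩ := exists_wt_eq (n := n) hk' (by omega)
      refine ⟨0, ?_⟩
      rw [map_zero, sub_zero]
      exact Submodule.subset_span ⟨a, b, _, x, hk, GSym.ι_mem a v, hx, rfl⟩
  · rintro x y ⟨v, hv⟩ ⟨w, hw⟩
    refine ⟨v + w, ?_⟩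
    rw [map_add, add_sub_add_comm]
    exact add_mem hv hw

variable {E : Fin n → Type} [∀ i, AddCommGroup (E i)] [∀ i, Module ℝ (E i)]
variable {μ : Tot E →ₗ[ℝ] Tot E ⊗[ℝ] Tot E}

/-- The decomposable elements of `(E i)*` for the product dual to the comultiplication. -/
def dualDec (μ : Tot E →ₗ[ℝ] Tot E ⊗[ℝ] Tot E) (i : Fin n) : Submodule ℝ (Module.Dual ℝ (E i)) :=
  Submodule.span ℝ {z | ∃ (a b : Fin n) (ξ : Module.Dual ℝ (E a)) (η : Module.Dual ℝ (E b)),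
    wt a + wt b = wt i ∧ z = dualMul μ a b i ξ η}

theorem comp_toDual_mul {h : IsCoalg μ} {j : ∀ i, V i →ₗ[ℝ] Module.Dual ℝ (E i)} {a b i : Fin n}
    {x y : GSym V} (hx : x ∈ GSym.deg V (wt a))
    (hy : y ∈ GSym.deg V (wt b)) : DualAlg.comp h i (toDual h j (x * y)) =
      dualMul μ a b i (toDualDeg h j a ⟨x, hx⟩) (toDualDeg h j b ⟨y, hy⟩) := by
  rw [map_mul, ← gen_toDualDeg ⟨x, hx⟩, ← gen_toDualDeg ⟨y, hy⟩, DualAlg.comp_gen_mul_gen]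

theorem comp_toDual_mem_dualDec {h : IsCoalg μ} {j : ∀ i, V i →ₗ[ℝ] Module.Dual ℝ (E i)}
    {i : Fin n} {s : GSym V} (hs : s ∈ GSym.dec V i) :
    DualAlg.comp h i (toDual h j s) ∈ dualDec μ i := by
  induction hs using Submodule.span_induction with
  | mem s hs =>
    obtain ⟨a, b, x, y, hi, hx, hy, rfl⟩ := hs
    rw [comp_toDual_mul hx hy]
    exact Submodule.subset_span ⟨a, b, _, _, hi, rfl⟩
  | zero => simp
  | add x y _ _ hx hy => rw [map_add, map_add]; exact add_mem hx hy
  | smul r x _ hx => rw [map_smul, map_smul]; exact Submodule.smul_mem _ _ hx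

end Decomposables

section Admissible

variable {n : ℕ} {V : Fin n → Type} [∀ i, AddCommGroup (V i)] [∀ i, Module ℝ (V i)]
variable {E : Fin n → Type} [∀ i, AddCommGroup (E i)] [∀ i, Module ℝ (E i)]
variable {μ : Tot E →ₗ[ℝ] Tot E ⊗[ℝ] Tot E}

/-- One inclusion in the condition of admissibility holds in every coalgebra: the values of `μ v` on
`ξ ⊗ η` depend only on the product `ξ η` in the dual algebra, which is associative and graded
commutative. -/
theorem range_le_coassocSpace [∀ i, FiniteDimensional ℝ (E i)] (h : IsCoalg μ) (i : Fin n) :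
    LinearMap.range (μ ∘ₗ inc E i) ≤ coassocSpace μ ⊓ tensorWt E (wt i) := by
  rintro _ ⟨v, rfl⟩
  refine ⟨?_, h.degree i v⟩
  let Λ : DualAlg h →ₗ[ℝ] ℝ := LinearMap.applyₗ v ∘ₗ DualAlg.comp h i
  refine mem_coassocSpace h (h.degree i v) (fun i => DualAlg.gen h i) Λ
    (fun i j ξ η => DualAlg.gen_comm i j ξ η)
    (fun a b c ξ η hc _ => (DualAlg.gen_mul_gen hc ξ η).symm) fun a b ξ η _ => ?_
  change dualMul μ a b i ξ η v = DualAlg.comp h i (DualAlg.gen h a ξ * DualAlg.gen h b η) v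
  rw [DualAlg.comp_gen_mul_gen]

theorem koszulSign_one {N : ℕ} (d : Fin N → ℕ) : koszulSign 1 d = 1 := by
  refine Finset.prod_eq_one fun p _ => if_neg ?_
  rintro ⟨h₁, h₂⟩
  exact lt_asymm h₁ h₂

theorem permAct_one [∀ i, FiniteDimensional ℝ (E i)] {N : ℕ} (t : TensorPower ℝ N (Tot E)) :
    permAct E 1 t = t := by
  refine tensorPower_ext fun d ξ => ?_
  rw [pairN_permAct, koszulSign_one, one_mul]
  rfl

/-- An element of `K^μ` is a balanced functional on pairs: this is the condition
`(μ ⊗ id) e = (id ⊗ μ) e`, read on the dual spaces. -/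
theorem pair₂_conv_of_mem [∀ i, FiniteDimensional ℝ (E i)] (h : IsCoalg μ)
    {e : Tot E ⊗[ℝ] Tot E} (he : e ∈ coassocSpace μ) (a b c : Module.Dual ℝ (Tot E)) :
    pair₂ (conv μ a b) c e = pair₂ a (conv μ b c) e := by
  have h₁ := he 1 0 0 1 rfl 1 1
  rw [permAct_one, permAct_one] at h₁
  let ξ : Fin (1 + 1 + (0 + 1)) → Module.Dual ℝ (Tot E) :=
    (![a, b, c] : Fin 3 → Module.Dual ℝ (Tot E))
  have h₂ := (pairN_iterPair h 1 0 ξ e).symm.trans (congrArg (pairN ξ) h₁)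
  have hprod : ∀ a b : Module.Dual ℝ (Tot E), (DualAlg.of h a * DualAlg.of h b).snd =
      conv μ a b := by
    intro a b
    rw [DualAlg.mul_snd]
    change (0 : ℝ) • _ + (0 : ℝ) • _ + conv μ a b = _
    rw [zero_smul, zero_smul, zero_add, zero_add]
  rw [pairN_cast, pairN_iterPair h] at h₂
  simp only [List.ofFn_succ, List.ofFn_zero, List.prod_cons, List.prod_nil, mul_one] at h₂
  rw [hprod, hprod] at h₂
  exact h₂

/-- An element of `K^μ` is a graded symmetric functional on pairs. -/
theorem pair₂_comm_of_mem [∀ i, FiniteDimensional ℝ (E i)] (h : IsCoalg μ)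
    {e : Tot E ⊗[ℝ] Tot E} (he : e ∈ coassocSpace μ) (i j : Fin n) (ξ : Module.Dual ℝ (E i))
    (η : Module.Dual ℝ (E j)) : pair₂ (ext₁ i ξ) (ext₁ j η) e =
      (-1 : ℝ) ^ (wt i * wt j) * pair₂ (ext₁ j η) (ext₁ i ξ) e := by
  have h₁ := he 0 0 0 0 rfl 1 (Equiv.swap 0 1)
  rw [permAct_one] at h₁
  let q : Fin 2 → Σ i, Module.Dual ℝ (E i) := ![⟨i, ξ⟩, ⟨j, η⟩]
  have h₂ := congrArg (pairN (N := 0 + 1 + (0 + 1)) fun p => ext₁ (q p).1 (q p).2) h₁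
  rw [pairN_permAct (Equiv.swap 0 1) (fun p => (q p).1) (fun p => (q p).2), pairN_cast,
    pairN_iterPair h, pairN_iterPair h] at h₂
  simp only [List.ofFn_succ, List.ofFn_zero, List.prod_cons, List.prod_nil, mul_one] at h₂
  have hs : koszulSign (Equiv.swap (0 : Fin 2) 1) (fun p => wt (q ((Equiv.swap 0 1).symm p)).1) =
      (-1 : ℝ) ^ (wt i * wt j) := by
    simp [koszulSign, Fintype.prod_prod_type, Fin.prod_univ_two, q]
  refine h₂.trans ?_
  refine congrArg₂ (· * ·) hs ?_
  rfl

/-- If the graded symmetric algebra of `V` maps isomorphically to the dual of the coalgebra in the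
degrees `1, …, n`, then the coalgebra is admissible. -/
theorem coassocSpace_le_range [∀ i, FiniteDimensional ℝ (E i)] (h : IsCoalg μ)
    (j : ∀ i, V i →ₗ[ℝ] Module.Dual ℝ (E i))
    (hJ : ∀ i, Function.Bijective (toDualDeg h j i)) (L : Fin n) :
    coassocSpace μ ⊓ tensorWt E (wt L) ≤ LinearMap.range (μ ∘ₗ inc E L) := by
  rintro e ⟨heK, heL⟩
  -- The operators `T_v (s, c) = (v s, e(v, s))` on `Sym V ⊕ ℝ` commute in the graded sense, and
  -- evaluating them on `(1, 0)` gives the functional `v₁ ⋯ v_N ↦ e(v₁, v₂ ⋯ v_N)`.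
  let T : ∀ i, V i →ₗ[ℝ] Module.End ℝ (GSym V × ℝ) := fun i =>
    LinearMap.mk₂ ℝ (fun v p => (GSym.ι i v * p.1, pair₂ (ext₁ i (j i v)) (toDual h j p.1).snd e))
      (fun v w p => by
        refine Prod.ext (by simp [add_mul]) ?_
        change pair₂ (ext₁ i (j i (v + w))) _ e = pair₂ _ _ e + pair₂ _ _ e
        rw [map_add, ← LinearMap.add_apply, ← pair₂_add_left]; rfl)
      (fun r v p => by
        refine Prod.ext (by simp) ?_
        change pair₂ (ext₁ i (j i (r • v))) _ e = r • pair₂ _ _ e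
        rw [(j i).map_smul]
        exact LinearMap.congr_fun (pair₂_smul_left r (ext₁ i (j i v)) _) e)
      (fun v p q => by
        refine Prod.ext (by simp [mul_add]) ?_
        change pair₂ _ (toDual h j (p.1 + q.1)).snd e = pair₂ _ _ e + pair₂ _ _ e
        rw [map_add, ← LinearMap.add_apply, ← pair₂_add_right]; rfl)
      (fun r v p => by
        refine Prod.ext (by simp) ?_
        change pair₂ _ (toDual h j (r • p.1)).snd e = r • pair₂ _ _ e
        rw [map_smul, ← LinearMap.smul_apply, ← pair₂_smul_right]; rfl)
  have hT : ∀ i v p, T i v p =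
      (GSym.ι i v * p.1, pair₂ (ext₁ i (j i v)) (toDual h j p.1).snd e) := fun _ _ _ => rfl
  have hsnd : ∀ i v s, (toDual h j (GSym.ι i v * s)).snd =
      (toDual h j s).fst • ext₁ i (j i v) + conv μ (ext₁ i (j i v)) (toDual h j s).snd := by
    intro i v s
    rw [map_mul, toDual_ι, DualAlg.mul_snd]
    change (0 : ℝ) • _ + _ + _ = _
    rw [zero_smul, zero_add]
    rfl
  have hval : ∀ i v k w s, pair₂ (ext₁ i (j i v)) (toDual h j (GSym.ι k w * s)).snd e =
      (toDual h j s).fst * pair₂ (ext₁ i (j i v)) (ext₁ k (j k w)) e +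
        pair₂ (conv μ (ext₁ i (j i v)) (ext₁ k (j k w))) (toDual h j s).snd e := by
    intro i v k w s
    rw [hsnd, pair₂_add_right, LinearMap.add_apply, pair₂_smul_right, LinearMap.smul_apply,
      smul_eq_mul, pair₂_conv_of_mem h heK]
  let Θ : GSym V →ₐ[ℝ] Module.End ℝ (GSym V × ℝ) := GSym.lift T (by
    intro i k v w
    refine LinearMap.ext fun p => ?_
    rw [LinearMap.smul_apply, Module.End.mul_apply, Module.End.mul_apply, hT, hT, hT, hT]
    refine Prod.ext ?_ ?_
    · change GSym.ι i v * (GSym.ι k w * p.1) = _ • (GSym.ι k w * (GSym.ι i v * p.1))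
      rw [← mul_assoc, GSym.ι_mul_ι, smul_mul_assoc, mul_assoc]
    · change pair₂ _ (toDual h j (GSym.ι k w * p.1)).snd e =
        _ • pair₂ _ (toDual h j (GSym.ι i v * p.1)).snd e
      rw [hval, hval, pair₂_comm_of_mem h heK, conv_comm h, pair₂_smul_left,
        LinearMap.smul_apply, smul_eq_mul, smul_eq_mul]
      ring)
  have hΘ₁ : ∀ x p, (Θ x p).1 = x * p.1 := by
    intro x p
    induction x using GSym.induction generalizing p with
    | one => simp
    | ι_mul i v x hx =>
      rw [map_mul, Module.End.mul_apply]
      have : Θ (GSym.ι i v) = T i v := GSym.lift_ι _ _ i v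
      rw [this, hT, hx, mul_assoc]
    | add x y hx hy => rw [map_add, LinearMap.add_apply, Prod.fst_add, hx, hy, add_mul]
    | smul r x hx => rw [map_smul, LinearMap.smul_apply, Prod.smul_fst, hx, smul_mul_assoc]
  -- The functional `Λ` satisfies `Λ (x y) = e(x, y)` for `x`, `y` of positive degree; in degree
  -- `wt L` it is the evaluation in a vector `v` of `E L`, because of `hJ`, and `μ v = e`.
  let Λ : GSym V →ₗ[ℝ] ℝ := LinearMap.snd ℝ (GSym V) ℝ ∘ₗ LinearMap.applyₗ (1, 0) ∘ₗ Θ.toLinearMap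
  have hΛι : ∀ i v s, Λ (GSym.ι i v * s) = pair₂ (ext₁ i (j i v)) (toDual h j s).snd e := by
    intro i v s
    change (Θ (GSym.ι i v * s) (1, 0)).2 = _
    rw [map_mul, Module.End.mul_apply]
    have : Θ (GSym.ι i v) = T i v := GSym.lift_ι _ _ i v
    rw [this, hT, hΘ₁, mul_one]
  have hΛ : ∀ {k l : ℕ} {x y : GSym V}, 0 < k → 0 < l → x ∈ GSym.deg V k → y ∈ GSym.deg V l →
      Λ (x * y) = pair₂ (toDual h j x).snd (toDual h j y).snd e := by
    intro k l x y hk hl hx hy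
    have hy₀ : (toDual h j y).fst = 0 := (toDual_mem (h := h) (j := j) hy).1 hl.ne'
    refine GSym.deg_induction (p := fun x =>
      Λ (x * y) = pair₂ (toDual h j x).snd (toDual h j y).snd e) hk (fun i v m x hm hx => ?_) ?_ ?_ hx
    · rw [mul_assoc, hΛι, hsnd, map_mul, DualAlg.mul_snd, hy₀, zero_smul, add_zero,
        pair₂_add_left, pair₂_smul_left, pair₂_add_right, pair₂_smul_right, LinearMap.add_apply,
        LinearMap.add_apply, pair₂_conv_of_mem h heK]
    · rw [zero_mul, map_zero, map_zero, DualAlg.zero_snd, pair₂_zero_left]; rfl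
    · intro x x' hx hx'
      rw [add_mul, map_add, hx, hx', map_add, DualAlg.add_snd, pair₂_add_left,
        LinearMap.add_apply]
  let Je : GSym.deg V (wt L) ≃ₗ[ℝ] Module.Dual ℝ (E L) :=
    LinearEquiv.ofBijective (toDualDeg h j L) (hJ L)
  let v : E L := (Module.evalEquiv ℝ (E L)).symm
    (Λ ∘ₗ (GSym.deg V (wt L)).subtype ∘ₗ Je.symm.toLinearMap)
  have hv : ∀ ζ : Module.Dual ℝ (E L), ζ v = Λ (Je.symm ζ).1 := by
    intro ζ
    have := LinearMap.congr_fun ((Module.evalEquiv ℝ (E L)).apply_symm_apply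
      (Λ ∘ₗ (GSym.deg V (wt L)).subtype ∘ₗ Je.symm.toLinearMap)) ζ
    exact this
  refine ⟨v, tensor_ext fun a b ξ η => ?_⟩
  by_cases hab : wt a + wt b = wt L
  · obtain ⟨x, rfl⟩ := (hJ a).2 ξ
    obtain ⟨y, rfl⟩ := (hJ b).2 η
    change dualMul μ a b L _ _ v = _
    have hxy := toDualDeg_mul (h := h) (j := j) hab x y
    rw [← hxy, hv]
    have hsymm : Je.symm (toDualDeg h j L ⟨x.1 * y.1, hab ▸ GSym.mul_mem x.2 y.2⟩) =
        ⟨x.1 * y.1, hab ▸ GSym.mul_mem x.2 y.2⟩ := Je.symm_apply_apply _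
    rw [hsymm, hΛ (wt_pos a) (wt_pos b) x.2 y.2, ← gen_toDualDeg, ← gen_toDualDeg]
    rfl
  · rw [pair₂_tensorWt heL hab]
    exact pair₂_tensorWt (h.degree L v) hab ξ η

/-- For an admissible coalgebra, the graded symmetric algebra on a complement of the decomposable
functionals maps isomorphically to the dual of the coalgebra in the degrees `1, …, n`. -/
theorem toDualDeg_bijective [∀ i, FiniteDimensional ℝ (E i)] (h : IsCoalg μ)
    (hadm : ∀ i : Fin n, 2 ≤ wt i →
      coassocSpace μ ⊓ tensorWt E (wt i) ≤ LinearMap.range (μ ∘ₗ inc E i))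
    (j : ∀ i, V i →ₗ[ℝ] Module.Dual ℝ (E i))
    (hinj : ∀ i v, j i v ∈ dualDec μ i → v = 0)
    (hspan : ∀ i, LinearMap.range (j i) ⊔ dualDec μ i = ⊤) (i : Fin n) :
    Function.Bijective (toDualDeg h j i) := by
  suffices H : ∀ l, ∀ i : Fin n, wt i = l → Function.Bijective (toDualDeg h j i) from H _ i rfl
  clear i
  intro l
  induction l using Nat.strong_induction_on with
  | _ l ih =>
  rintro i rfl
  have ih' : ∀ a : Fin n, wt a < wt i → Function.Bijective (toDualDeg h j a) :=
    fun a ha => ih _ ha a rfl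
  clear ih
  constructor
  · rw [injective_iff_map_eq_zero]
    rintro ⟨s, hs⟩ hs0
    replace hs0 : DualAlg.comp h i (toDual h j s) = 0 := hs0
    have hsdec : s ∈ GSym.dec V i := by
      obtain ⟨v, hv⟩ := GSym.exists_sub_ι_mem_dec hs
      have hv' := comp_toDual_mem_dualDec (h := h) (j := j) hv
      rw [map_sub, map_sub, hs0, toDual_ι, DualAlg.comp_gen_self, zero_sub, neg_mem_iff] at hv'
      rw [hinj i v hv'] at hv
      simpa using hv
    -- A nonzero `s` in the kernel is detected by a functional `Λ`. By the isomorphisms in lower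
    -- degrees, `e(ξ, η) = Λ (ξ η)` defines an element of `K^μ`, which is `μ w` by admissibility; so
    -- `Λ` is the pullback of the evaluation in `w` on decomposable elements, and `Λ s = 0`.
    by_contra hne
    replace hne : s ≠ 0 := fun h0 => hne (Subtype.ext h0)
    by_cases h2 : 2 ≤ wt i
    · obtain ⟨Λ, hΛ⟩ : ∃ Λ : Module.Dual ℝ (GSym V), Λ s ≠ 0 := by
        by_contra! hall
        exact hne ((Module.forall_dual_apply_eq_zero_iff ℝ s).1 hall)
      let κ : ∀ a, Module.Dual ℝ (E a) →ₗ[ℝ] GSym V := fun a =>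
        if ha : wt a < wt i then (GSym.deg V (wt a)).subtype ∘ₗ
          (LinearEquiv.ofBijective (toDualDeg h j a) (ih' a ha)).symm.toLinearMap
        else 0
      have hκmem : ∀ a ξ, κ a ξ ∈ GSym.deg V (wt a) := by
        intro a ξ
        by_cases ha : wt a < wt i
        · simp only [κ, dif_pos ha]
          exact Subtype.property _
        · simp only [κ, dif_neg ha]
          exact zero_mem _
      have hκJ : ∀ a, wt a < wt i → ∀ x : GSym.deg V (wt a), κ a (toDualDeg h j a x) = x.1 := by
        intro a ha x
        simp only [κ, dif_pos ha]
        exact congrArg Subtype.val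
          ((LinearEquiv.ofBijective (toDualDeg h j a) (ih' a ha)).symm_apply_apply x)
      let B : ∀ a b, Module.Dual ℝ (E a) →ₗ[ℝ] Module.Dual ℝ (E b) →ₗ[ℝ] ℝ := fun a b =>
        if wt a + wt b = wt i then
          ((LinearMap.mul ℝ (GSym V)).compl₁₂ (κ a) (κ b)).compr₂ Λ else 0
      obtain ⟨e, he, hwt⟩ := exists_tensor B
      have heL : e ∈ tensorWt E (wt i) := hwt _ fun a b hab => if_neg hab
      have hval : ∀ a b ξ η, wt a + wt b = wt i →
          pair₂ (ext₁ a ξ) (ext₁ b η) e = Λ (κ a ξ * κ b η) := by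
        intro a b ξ η hab
        rw [he]
        simp only [B, if_pos hab]
        rfl
      have heK : e ∈ coassocSpace μ := by
        refine mem_coassocSpace h heL (fun a => κ a) Λ
          (fun a b ξ η => GSym.mul_comm' (hκmem a ξ) (hκmem b η)) ?_ hval
        intro a b c ξ η hc hci
        obtain ⟨x, rfl⟩ := (ih' a (by omega)).2 ξ
        obtain ⟨y, rfl⟩ := (ih' b (by omega)).2 η
        rw [← toDualDeg_mul hc, hκJ c hci, hκJ a (by omega), hκJ b (by omega)]
      obtain ⟨w, hw⟩ := hadm i h2 ⟨heK, heL⟩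
      have hdec : ∀ s ∈ GSym.dec V i, Λ s = DualAlg.comp h i (toDual h j s) w := by
        intro s hs
        induction hs using Submodule.span_induction with
        | mem s hs =>
          obtain ⟨a, b, x, y, hi, hx, hy, rfl⟩ := hs
          have := wt_pos a
          have := wt_pos b
          rw [comp_toDual_mul hx hy]
          change _ = pair₂ _ _ ((μ ∘ₗ inc E i) w)
          rw [hw]
          refine Eq.trans ?_ (hval a b _ _ hi).symm
          rw [hκJ a (by omega), hκJ b (by omega)]
        | zero => simp
        | add x y _ _ hx hy => simp only [map_add, hx, hy, LinearMap.add_apply]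
        | smul r x _ hx => simp only [map_smul, hx, LinearMap.smul_apply]
      exact hΛ (by rw [hdec s hsdec, hs0, LinearMap.zero_apply])
    · have hbot : GSym.dec V i ≤ ⊥ := by
        refine Submodule.span_le.2 ?_
        rintro _ ⟨a, b, x, y, hi, -⟩
        have := wt_pos a
        have := wt_pos b
        omega
      exact hne (by simpa using hbot hsdec)
  · rw [← LinearMap.range_eq_top, eq_top_iff, ← hspan i, sup_le_iff]
    constructor
    · rintro _ ⟨v, rfl⟩
      exact ⟨_, toDualDeg_ι i v⟩
    · refine Submodule.span_le.2 ?_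
      rintro _ ⟨a, b, ξ, η, hi, rfl⟩
      have := wt_pos a
      have := wt_pos b
      obtain ⟨x, rfl⟩ := (ih' a (by omega)).2 ξ
      obtain ⟨y, rfl⟩ := (ih' b (by omega)).2 η
      exact ⟨_, toDualDeg_mul hi x y⟩

/-- Complements of the decomposable functionals. -/
theorem exists_complement_dualDec [∀ i, FiniteDimensional ℝ (E i)]
    (μ : Tot E →ₗ[ℝ] Tot E ⊗[ℝ] Tot E) :
    ∃ (m : Fin n → ℕ) (j : ∀ i, (Fin (m i) → ℝ) →ₗ[ℝ] Module.Dual ℝ (E i)),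
      (∀ i v, j i v ∈ dualDec μ i → v = 0) ∧ ∀ i, LinearMap.range (j i) ⊔ dualDec μ i = ⊤ := by
  have hex : ∀ i, ∃ C : Submodule ℝ (Module.Dual ℝ (E i)), IsCompl (dualDec μ i) C :=
    fun i => Submodule.exists_isCompl (dualDec μ i)
  choose C hC using hex
  have hfree : ∀ i, Module.Free ℝ (C i) := fun i => Module.Free.of_divisionRing ℝ (C i)
  refine ⟨fun i => Module.finrank ℝ (C i), fun i =>
    (C i).subtype ∘ₗ (Module.finBasis ℝ (C i)).equivFun.symm.toLinearMap, ?_, ?_⟩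
  · intro i v hv
    have h0 := (Submodule.disjoint_def.1 (hC i).disjoint) _ hv (Subtype.property _)
    have h1 : (Module.finBasis ℝ (C i)).equivFun.symm v = 0 := Subtype.ext h0
    exact (LinearEquiv.map_eq_zero_iff _).1 h1
  · intro i
    have : LinearMap.range ((C i).subtype ∘ₗ
        (Module.finBasis ℝ (C i)).equivFun.symm.toLinearMap) = C i := by
      rw [LinearMap.range_comp_of_range_eq_top _ (LinearEquiv.range _), Submodule.range_subtype]
    rw [this, sup_comm]
    exact (hC i).sup_eq_top

end Admissible

/-! ### The dimensions of the generators are determined by the dimensions of the algebra -/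

section Dimensions

variable {n : ℕ} {V : Fin n → Type} [∀ i, AddCommGroup (V i)] [∀ i, Module ℝ (V i)]

theorem IsCoalg.zero {E : Fin n → Type} [∀ i, AddCommGroup (E i)] [∀ i, Module ℝ (E i)] :
    IsCoalg (0 : Tot E →ₗ[ℝ] Tot E ⊗[ℝ] Tot E) :=
  ⟨fun _ _ => zero_mem _, by simp, by simp⟩

theorem GSym.eq_zero_of_ι_mem_dec {i : Fin n} {v : V i} (hv : GSym.ι i v ∈ GSym.dec V i) :
    v = 0 := by
  let j : ∀ i, V i →ₗ[ℝ] Module.Dual ℝ (Module.Dual ℝ (V i)) := fun i => Module.Dual.eval ℝ (V i)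
  have h := comp_toDual_mem_dualDec (h := IsCoalg.zero (E := fun i => Module.Dual ℝ (V i)))
    (j := j) hv
  rw [toDual_ι, DualAlg.comp_gen_self] at h
  have hbot : dualDec (0 : Tot (fun i => Module.Dual ℝ (V i)) →ₗ[ℝ] _) i ≤ ⊥ := by
    refine Submodule.span_le.2 ?_
    rintro _ ⟨a, b, ξ, η, -, rfl⟩
    simp [dualMul]
  exact (Module.eval_apply_eq_zero_iff ℝ v).1 (by simpa using hbot h)

theorem GSym.map_eq_self {f : ∀ i, V i →ₗ[ℝ] V i} {l : ℕ}
    (hf : ∀ i, wt i ≤ l → f i = LinearMap.id) {x : GSym V} (hx : x ∈ GSym.deg V l) :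
    GSym.map f x = x := by
  induction hx using Submodule.span_induction with
  | mem x hx =>
    obtain ⟨L, rfl, rfl⟩ := hx
    induction L with
    | nil => simp
    | cons q L ih =>
      simp only [List.map_cons, List.prod_cons, List.sum_cons] at hf ⊢
      rw [map_mul, GSym.map_ι, hf q.1 (by omega), LinearMap.id_apply,
        ih fun i hi => hf i (by omega)]
  | zero => simp
  | add x y _ _ hx hy => rw [map_add, hx, hy]
  | smul r x _ hx => rw [map_smul, hx]

theorem GSym.finrank_deg (m : Fin n → ℕ) (i : Fin n) :
    Module.finrank ℝ (GSym.deg (fun i => Fin (m i) → ℝ) (wt i)) =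
      m i + Module.finrank ℝ (GSym.dec (fun i => Fin (m i) → ℝ) i) := by
  let V : Fin n → Type := fun i => Fin (m i) → ℝ
  have hfin : FiniteDimensional ℝ (GSym.dec V i) :=
    Submodule.finiteDimensional_of_le (GSym.dec_le_deg i)
  let f : (V i × GSym.dec V i) →ₗ[ℝ] GSym.deg V (wt i) :=
    LinearMap.coprod ((GSym.ι (V := V) i).codRestrict _ fun v => GSym.ι_mem i v)
      (Submodule.inclusion (GSym.dec_le_deg i))
  have hf : Function.Bijective f := by
    constructor
    · rw [injective_iff_map_eq_zero]
      rintro ⟨v, s, hs⟩ h0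
      have h1 : GSym.ι i v + s = 0 := congrArg Subtype.val h0
      have hv : v = 0 := GSym.eq_zero_of_ι_mem_dec (by
        rw [eq_neg_of_add_eq_zero_left h1]; exact neg_mem hs)
      subst hv
      simp only [map_zero, zero_add] at h1
      subst h1
      rfl
    · rintro ⟨s, hs⟩
      obtain ⟨v, hv⟩ := GSym.exists_sub_ι_mem_dec hs
      exact ⟨(v, ⟨_, hv⟩), Subtype.ext (add_sub_cancel _ _)⟩
  rw [← (LinearEquiv.ofBijective f hf).finrank_eq, Module.finrank_prod]
  simp [V]

theorem GSym.finrank_dec_le {m m' : Fin n → ℕ} (i : Fin n)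
    (h : ∀ a, wt a < wt i → m a = m' a) :
    Module.finrank ℝ (GSym.dec (fun i => Fin (m i) → ℝ) i) ≤
      Module.finrank ℝ (GSym.dec (fun i => Fin (m' i) → ℝ) i) := by
  have hfin : FiniteDimensional ℝ (GSym.dec (fun i => Fin (m' i) → ℝ) i) :=
    Submodule.finiteDimensional_of_le (GSym.dec_le_deg i)
  let f : ∀ a, (Fin (m a) → ℝ) →ₗ[ℝ] (Fin (m' a) → ℝ) := fun a =>
    if ha : wt a < wt i then (LinearEquiv.funCongrLeft ℝ ℝ (finCongr (h a ha).symm)).toLinearMap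
    else 0
  let g : ∀ a, (Fin (m' a) → ℝ) →ₗ[ℝ] (Fin (m a) → ℝ) := fun a =>
    if ha : wt a < wt i then (LinearEquiv.funCongrLeft ℝ ℝ (finCongr (h a ha))).toLinearMap
    else 0
  have hgf : ∀ a, wt a < wt i → g a ∘ₗ f a = LinearMap.id := by
    intro a ha
    simp only [f, g, dif_pos ha]
    ext v k
    simp [LinearMap.funLeft]
  have hmem : ∀ s ∈ GSym.dec (fun i => Fin (m i) → ℝ) i,
      GSym.map f s ∈ GSym.dec (fun i => Fin (m' i) → ℝ) i := by
    intro s hs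
    induction hs using Submodule.span_induction with
    | mem s hs =>
      obtain ⟨a, b, x, y, hi, hx, hy, rfl⟩ := hs
      rw [map_mul]
      exact Submodule.subset_span ⟨a, b, _, _, hi, GSym.map_mem f hx, GSym.map_mem f hy, rfl⟩
    | zero => rw [map_zero]; exact zero_mem _
    | add x y _ _ hx hy => rw [map_add]; exact add_mem hx hy
    | smul r x _ hx => rw [map_smul]; exact Submodule.smul_mem _ _ hx
  have hid : ∀ s ∈ GSym.dec (fun i => Fin (m i) → ℝ) i,
      GSym.map (fun a => g a ∘ₗ f a) s = s := by
    intro s hs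
    induction hs using Submodule.span_induction with
    | mem s hs =>
      obtain ⟨a, b, x, y, hi, hx, hy, rfl⟩ := hs
      have := wt_pos a
      have := wt_pos b
      rw [map_mul, GSym.map_eq_self (fun c hc => hgf c (by omega)) hx,
        GSym.map_eq_self (fun c hc => hgf c (by omega)) hy]
    | zero => rw [map_zero]
    | add x y _ _ hx hy => rw [map_add, hx, hy]
    | smul r x _ hx => rw [map_smul, hx]
  refine LinearMap.finrank_le_finrank_of_injective
    (f := (GSym.map f).toLinearMap.restrict hmem) ?_
  rw [injective_iff_map_eq_zero]
  rintro ⟨s, hs⟩ h0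
  have h1 : GSym.map f s = 0 := congrArg Subtype.val h0
  have h2 := hid s hs
  rw [GSym.map_comp, AlgHom.comp_apply, h1, map_zero] at h2
  exact Subtype.ext h2.symm

theorem GSym.eq_of_finrank_deg_eq {m m' : Fin n → ℕ}
    (h : ∀ i : Fin n, Module.finrank ℝ (GSym.deg (fun i => Fin (m i) → ℝ) (wt i)) =
      Module.finrank ℝ (GSym.deg (fun i => Fin (m' i) → ℝ) (wt i))) : m = m' := by
  funext i
  induction hl : wt i using Nat.strong_induction_on generalizing i with
  | _ l ih =>
  subst hl
  have h₁ := GSym.finrank_dec_le (m := m) (m' := m') i fun a ha => ih _ ha a rfl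
  have h₂ := GSym.finrank_dec_le (m := m') (m' := m) i fun a ha => (ih _ ha a rfl).symm
  have := h i
  rw [GSym.finrank_deg, GSym.finrank_deg] at this
  omega

end Dimensions

/-! ### Smooth sections of dual bundles -/

/-- Smoothness at a point of a function on an open subset can be tested on a smaller open subset. -/
theorem contMDiffAt_of_comp_inclusion {F H N : Type*} [NormedAddCommGroup F] [NormedSpace ℝ F]
    [TopologicalSpace H] {I : ModelWithCorners ℝ F H} [TopologicalSpace N] [ChartedSpace H N]
    {U V : Opens N} (hVU : V ≤ U) {f : U → ℝ} {x : V}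
    (h : ContMDiffAt I 𝓘(ℝ, ℝ) ∞ (fun y : V => f (Set.inclusion hVU y)) x) :
    ContMDiffAt I 𝓘(ℝ, ℝ) ∞ f (Set.inclusion hVU x) :=
  ((contDiffWithinAt_localInvariantProp (I := I) (I' := 𝓘(ℝ, ℝ)) ∞).liftPropAt_iff_comp_inclusion
    hVU f x).2 h

/-- Smoothness of functions on open subsets is local. -/
theorem contMDiff_of_locally {M : Mfd} {U : Opens M.carrier} {f : U → ℝ}
    (h : ∀ x ∈ U, ∃ (V : Opens M.carrier) (hV : V ≤ U), x ∈ V ∧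
      ContMDiff (𝓡 M.dim) 𝓘(ℝ, ℝ) ∞ (fun y : V => f ⟨y, hV y.2⟩)) :
    ContMDiff (𝓡 M.dim) 𝓘(ℝ, ℝ) ∞ f := by
  intro x
  obtain ⟨V, hV, hx, hf⟩ := h x x.2
  exact contMDiffAt_of_comp_inclusion hV (hf ⟨x, hx⟩)

namespace VBundle

variable {M : Mfd} {E : VBundle M}

/-- The local trivializations of a vector bundle. -/
abbrev Triv (E : VBundle M) : Type :=
  Bundle.Trivialization (EuclideanSpace ℝ (Fin E.rank))
    (Bundle.TotalSpace.proj : E.Total → M.carrier)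

section Frames

variable (e : E.Triv) [MemTrivializationAtlas e]

/-- The local frame of a trivialization. -/
def frameVec (y : M.carrier) (k : Fin E.rank) : E.fiber y :=
  e.symm y (EuclideanSpace.single k 1)

/-- The local frame of the dual bundle given by a trivialization. -/
def coframe (y : M.carrier) (k : Fin E.rank) : Module.Dual ℝ (E.fiber y) :=
  (EuclideanSpace.proj (𝕜 := ℝ) k).toLinearMap ∘ₗ e.linearMapAt ℝ y

variable {e}

theorem coframe_apply {y : M.carrier} (hy : y ∈ e.baseSet) (k : Fin E.rank) (v : E.fiber y) :
    coframe e y k v = (e ⟨y, v⟩).2 k := by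
  simp [coframe, Bundle.Trivialization.coe_linearMapAt_of_mem e hy]

theorem eq_sum_coframe {y : M.carrier} (hy : y ∈ e.baseSet) (ξ : Module.Dual ℝ (E.fiber y)) :
    ξ = ∑ k, ξ (frameVec e y k) • coframe e y k := by
  have key : ξ ∘ₗ (e.linearEquivAt ℝ y hy).symm.toLinearMap =
      ∑ k, ξ (frameVec e y k) • (EuclideanSpace.proj (𝕜 := ℝ) k).toLinearMap := by
    refine (EuclideanSpace.basisFun (Fin E.rank) ℝ).toBasis.ext fun k => ?_
    rw [LinearMap.sum_apply, Finset.sum_eq_single k]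
    · simp [frameVec]
    · intro l _ hl
      simp [hl]
    · simp
  refine LinearMap.ext fun v => ?_
  have h := LinearMap.congr_fun key (e.linearEquivAt ℝ y hy v)
  rw [LinearMap.comp_apply, LinearEquiv.coe_coe, LinearEquiv.symm_apply_apply] at h
  rw [h, LinearMap.sum_apply, LinearMap.sum_apply]
  refine Finset.sum_congr rfl fun k _ => ?_
  rw [LinearMap.smul_apply, LinearMap.smul_apply, coframe_apply hy]
  simp

instance (y : M.carrier) : FiniteDimensional ℝ (E.fiber y) :=
  ((trivializationAt (EuclideanSpace ℝ (Fin E.rank)) E.fiber y).linearEquivAt ℝ y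
    (FiberBundle.mem_baseSet_trivializationAt' y)).symm.finiteDimensional

theorem finrank_fiber (y : M.carrier) : Module.finrank ℝ (E.fiber y) = E.rank := by
  rw [((trivializationAt (EuclideanSpace ℝ (Fin E.rank)) E.fiber y).linearEquivAt ℝ y
    (FiberBundle.mem_baseSet_trivializationAt' y)).finrank_eq]
  simp

theorem isSmoothDual_coframe {U : Opens M.carrier} (hU : (U : Set M.carrier) ⊆ e.baseSet)
    (k : Fin E.rank) : E.IsSmoothDual U (fun x => coframe e x k) := by
  have h : ContMDiff E.model 𝓘(ℝ, EuclideanSpace ℝ (Fin E.rank)) ∞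
      (fun p : E.totalOver U => (e p.1).2) :=
    ((e.contMDiff_iff (IB := 𝓡 M.dim) (f := fun p : E.totalOver U => p.1)
      fun p => e.mem_source.2 (hU p.2)).1 contMDiff_subtype_val).2
  have h' := (EuclideanSpace.proj k : EuclideanSpace ℝ (Fin E.rank) →L[ℝ] ℝ).contMDiff.comp h
  refine h'.congr fun p => ?_
  exact coframe_apply (hU p.2) k p.1.snd

theorem IsSmoothDual.contMDiff_frameVec {U : Opens M.carrier}
    (hU : (U : Set M.carrier) ⊆ e.baseSet) {ξ : ∀ x : U, Module.Dual ℝ (E.fiber x)}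
    (hξ : E.IsSmoothDual U ξ) (k : Fin E.rank) :
    ContMDiff (𝓡 M.dim) 𝓘(ℝ, ℝ) ∞ (fun x : U => ξ x (frameVec e x k)) := by
  refine ContMDiff.comp (g := fun p : E.totalOver U => ξ ⟨p.1.proj, p.2⟩ p.1.snd) hξ
    (f := fun x : U => (⟨⟨x, frameVec e x k⟩, x.2⟩ : E.totalOver U)) ?_
  rw [← ContMDiff.subtypeVal_comp_iff]
  refine (e.contMDiff_iff (IB := 𝓡 M.dim) fun x => e.mem_source.2 (hU x.2)).2
    ⟨contMDiff_subtype_val, ?_⟩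
  refine (contMDiff_const (c := EuclideanSpace.single k (1 : ℝ))).congr fun x => ?_
  change (e ⟨x, e.symm x _⟩).2 = _
  rw [e.apply_mk_symm (hU x.2)]

end Frames

section Operations

variable {U : Opens M.carrier}

theorem contMDiff_totalOver_proj {f : U → ℝ} (hf : ContMDiff (𝓡 M.dim) 𝓘(ℝ, ℝ) ∞ f) :
    ContMDiff E.model 𝓘(ℝ, ℝ) ∞ (fun p : E.totalOver U => f ⟨p.1.proj, p.2⟩) := by
  refine ContMDiff.comp (g := f) hf (f := fun p : E.totalOver U => (⟨p.1.proj, p.2⟩ : U)) ?_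
  rw [← ContMDiff.subtypeVal_comp_iff]
  exact (Bundle.contMDiff_proj E.fiber).comp contMDiff_subtype_val

theorem IsSmoothDual.add {ξ η : ∀ x : U, Module.Dual ℝ (E.fiber x)} (hξ : E.IsSmoothDual U ξ)
    (hη : E.IsSmoothDual U η) : E.IsSmoothDual U (fun x => ξ x + η x) :=
  ContMDiff.add hξ hη

theorem isSmoothDual_zero : E.IsSmoothDual U (fun _ => 0) :=
  contMDiff_const (c := (0 : ℝ))

theorem IsSmoothDual.smul {f : U → ℝ} {ξ : ∀ x : U, Module.Dual ℝ (E.fiber x)}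
    (hf : ContMDiff (𝓡 M.dim) 𝓘(ℝ, ℝ) ∞ f) (hξ : E.IsSmoothDual U ξ) :
    E.IsSmoothDual U (fun x => f x • ξ x) :=
  ContMDiff.smul (contMDiff_totalOver_proj hf) hξ

theorem IsSmoothDual.const_smul {c : ℝ} {ξ : ∀ x : U, Module.Dual ℝ (E.fiber x)}
    (hξ : E.IsSmoothDual U ξ) : E.IsSmoothDual U (fun x => c • ξ x) :=
  IsSmoothDual.smul (f := fun _ => c) contMDiff_const hξ

theorem isSmoothDual_sum {κ : Type*} (s : Finset κ) {ξ : κ → ∀ x : U, Module.Dual ℝ (E.fiber x)}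
    (hξ : ∀ k ∈ s, E.IsSmoothDual U (ξ k)) : E.IsSmoothDual U (fun x => ∑ k ∈ s, ξ k x) := by
  classical
  induction s using Finset.induction_on with
  | empty => simpa using isSmoothDual_zero
  | insert a s ha ih =>
    simp only [Finset.sum_insert ha]
    exact (hξ a (by simp)).add (ih fun k hk => hξ k (by simp [hk]))

theorem isSmoothDual_of_locally {ξ : ∀ x : U, Module.Dual ℝ (E.fiber x)}
    (h : ∀ x ∈ U, ∃ (V : Opens M.carrier) (hV : V ≤ U), x ∈ V ∧
      E.IsSmoothDual V (fun y => ξ ⟨y, hV y.2⟩)) : E.IsSmoothDual U ξ := by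
  intro p
  obtain ⟨V, hV, hxV, hξ⟩ := h p.1.proj p.2
  have hincl : E.totalOver V ≤ E.totalOver U := fun q hq => hV hq
  exact contMDiffAt_of_comp_inclusion (N := E.Total) (U := E.totalOver U) (V := E.totalOver V) hincl
    (f := fun q : E.totalOver U => ξ ⟨q.1.proj, q.2⟩ q.1.snd) (x := ⟨p.1, hxV⟩) (hξ ⟨p.1, hxV⟩)

end Operations

section Frames

variable {U : Opens M.carrier} {κ : Type} [Fintype κ] [DecidableEq κ] (e : E.Triv)
  [MemTrivializationAtlas e]

theorem contMDiff_det {A : U → Matrix κ κ ℝ}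
    (h : ∀ k l, ContMDiff (𝓡 M.dim) 𝓘(ℝ, ℝ) ∞ (fun y => A y k l)) :
    ContMDiff (𝓡 M.dim) 𝓘(ℝ, ℝ) ∞ (fun y => (A y).det) := by
  simp only [Matrix.det_apply]
  refine contMDiff_finsetSum fun σ _ => ?_
  simp only [Units.smul_def, zsmul_eq_mul]
  exact contMDiff_const.mul (contMDiff_finsetProd fun k _ => h _ _)

variable {e}

/-- Linear independence of `rank E` functionals is the nonvanishing of the determinant of their
coordinates. -/
theorem linearIndependent_iff_det (σ : κ ≃ Fin E.rank) {y : M.carrier} (hy : y ∈ e.baseSet)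
    (ξ : κ → Module.Dual ℝ (E.fiber y)) : LinearIndependent ℝ ξ ↔
      (Matrix.of fun k l => ξ k (frameVec e y (σ l))).det ≠ 0 := by
  let T : Module.Dual ℝ (E.fiber y) →ₗ[ℝ] κ → ℝ :=
    LinearMap.pi fun l => Module.Dual.eval ℝ _ (frameVec e y (σ l))
  have hT : LinearMap.ker T = ⊥ := by
    rw [LinearMap.ker_eq_bot']
    intro ζ hζ
    rw [eq_sum_coframe hy ζ]
    refine Finset.sum_eq_zero fun k _ => ?_
    have : ζ (frameVec e y (σ (σ.symm k))) = 0 := congrFun hζ (σ.symm k)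
    rw [σ.apply_symm_apply] at this
    rw [this, zero_smul]
  rw [← LinearMap.linearIndependent_iff T hT, ← isUnit_iff_ne_zero, ← Matrix.isUnit_iff_isUnit_det,
    ← Matrix.linearIndependent_rows_iff_isUnit]
  rfl

/-- Near a point of linear independence, smooth sections are linearly independent. -/
theorem exists_linearIndependent (ξ : κ → ∀ x : U, Module.Dual ℝ (E.fiber x))
    (hξ : ∀ k, E.IsSmoothDual U (ξ k)) (hκ : Fintype.card κ = E.rank) {x₀ : U}
    (h : LinearIndependent ℝ fun k => ξ k x₀) :
    ∃ V : Opens M.carrier, ∃ hV : V ≤ U, x₀.1 ∈ V ∧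
      ∀ y : V, LinearIndependent ℝ fun k => ξ k ⟨y, hV y.2⟩ := by
  let e : E.Triv := trivializationAt (EuclideanSpace ℝ (Fin E.rank)) E.fiber x₀.1
  let σ : κ ≃ Fin E.rank := Fintype.equivFinOfCardEq hκ
  let W : Opens M.carrier := U ⊓ ⟨e.baseSet, e.open_baseSet⟩
  have hWU : W ≤ U := inf_le_left
  have hWe : (W : Set M.carrier) ⊆ e.baseSet := fun y hy => hy.2
  have hx₀ : x₀.1 ∈ W := ⟨x₀.2, FiberBundle.mem_baseSet_trivializationAt' x₀.1⟩
  let A : W → Matrix κ κ ℝ := fun y =>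
    Matrix.of fun k l => ξ k ⟨y, hWU y.2⟩ (frameVec e y (σ l))
  have hA : Continuous fun y => (A y).det := (contMDiff_det fun k l =>
    ((hξ k).restrict hWU).contMDiff_frameVec hWe (σ l)).continuous
  have hopen : IsOpen {y : W | (A y).det ≠ 0} := isOpen_ne_fun hA continuous_const
  refine ⟨⟨Subtype.val '' {y : W | (A y).det ≠ 0}, W.isOpen.isOpenMap_subtype_val _ hopen⟩,
    ?_, ⟨⟨x₀.1, hx₀⟩, ?_, rfl⟩, ?_⟩
  · rintro _ ⟨y, -, rfl⟩
    exact hWU y.2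
  · exact (linearIndependent_iff_det σ hx₀.2 _).1 h
  · rintro ⟨_, y, hy, rfl⟩
    exact (linearIndependent_iff_det σ y.2.2 _).2 hy

/-- The coefficients of a smooth section with respect to a smooth frame are smooth. -/
theorem contMDiff_coeff (ξ : κ → ∀ x : U, Module.Dual ℝ (E.fiber x))
    (hξ : ∀ k, E.IsSmoothDual U (ξ k)) (hκ : Fintype.card κ = E.rank)
    (h : ∀ y, LinearIndependent ℝ fun k => ξ k y) {ζ : ∀ x : U, Module.Dual ℝ (E.fiber x)}
    (hζ : E.IsSmoothDual U ζ) {f : κ → U → ℝ} (hf : ∀ y, ζ y = ∑ k, f k y • ξ k y) (k : κ) :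
    ContMDiff (𝓡 M.dim) 𝓘(ℝ, ℝ) ∞ (f k) := by
  refine contMDiff_of_locally fun x₀ hx₀U => ?_
  let e : E.Triv := trivializationAt (EuclideanSpace ℝ (Fin E.rank)) E.fiber x₀
  let σ : κ ≃ Fin E.rank := Fintype.equivFinOfCardEq hκ
  let W : Opens M.carrier := U ⊓ ⟨e.baseSet, e.open_baseSet⟩
  have hWU : W ≤ U := inf_le_left
  have hWe : (W : Set M.carrier) ⊆ e.baseSet := fun y hy => hy.2
  refine ⟨W, hWU, ⟨hx₀U, FiberBundle.mem_baseSet_trivializationAt' x₀⟩, ?_⟩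
  let A : W → Matrix κ κ ℝ := fun y =>
    Matrix.of fun k l => ξ k ⟨y, hWU y.2⟩ (frameVec e y (σ l))
  let b : W → κ → ℝ := fun y l => ζ ⟨y, hWU y.2⟩ (frameVec e y (σ l))
  have hA : ∀ k l, ContMDiff (𝓡 M.dim) 𝓘(ℝ, ℝ) ∞ fun y => A y k l := fun k l =>
    ((hξ k).restrict hWU).contMDiff_frameVec hWe (σ l)
  have hb : ∀ l, ContMDiff (𝓡 M.dim) 𝓘(ℝ, ℝ) ∞ fun y => b y l := fun l =>
    (hζ.restrict hWU).contMDiff_frameVec hWe (σ l)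
  have hadj : ∀ k l, ContMDiff (𝓡 M.dim) 𝓘(ℝ, ℝ) ∞ fun y => (A y).adjugate k l := by
    intro k l
    simp only [Matrix.adjugate_apply]
    refine contMDiff_det fun k' l' => ?_
    by_cases hk : k' = l
    · subst hk
      simpa using contMDiff_const
    · simpa [hk] using hA k' l'
  have hdet : ∀ y, (A y).det ≠ 0 := fun y =>
    (linearIndependent_iff_det σ y.2.2 _).1 (h ⟨y, hWU y.2⟩)
  have key : ∀ y : W, f k ⟨y, hWU y.2⟩ = (A y).det⁻¹ * ∑ l, b y l * (A y).adjugate l k := by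
    intro y
    have h₁ : Matrix.vecMul (fun k => f k ⟨y, hWU y.2⟩) (A y) = b y := by
      funext l
      change ∑ k, f k ⟨y, hWU y.2⟩ * ξ k ⟨y, hWU y.2⟩ (frameVec e y (σ l)) =
        ζ ⟨y, hWU y.2⟩ (frameVec e y (σ l))
      rw [hf ⟨y, hWU y.2⟩, LinearMap.sum_apply]
      rfl
    have h₂ := congrArg (fun c => Matrix.vecMul c (A y).adjugate) h₁
    simp only [Matrix.vecMul_vecMul, Matrix.mul_adjugate, Matrix.vecMul_smul,
      Matrix.vecMul_one] at h₂
    have h₃ : (A y).det * f k ⟨y, hWU y.2⟩ = ∑ l, b y l * (A y).adjugate l k := congrFun h₂ k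
    rw [← h₃, inv_mul_cancel_left₀ (hdet y)]
  refine ContMDiff.congr ?_ key
  exact ((contMDiff_det hA).inv₀ hdet).mul
    (contMDiff_finsetSum fun l _ => (hb l).mul (hadj l k))

end Frames


end VBundle

/-! ### Sheaves of functions with values in a family of algebras -/

section FunPresheaf

variable {T : TopCat.{0}} (R : T → Type) [∀ x, Ring (R x)] [∀ x, Algebra ℝ (R x)]

/-- The presheaf of all functions `x ↦ R x`, without continuity. -/
def funPresheaf : TopCat.Presheaf (AlgCat.{0} ℝ) T where
  obj U := AlgCat.of ℝ (∀ x : U.unop, R x)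
  map {U V} h := AlgCat.ofHom (AlgHom.pi (R := ℝ) fun x : V.unop =>
    Pi.evalAlgHom ℝ (fun y : U.unop => R y) ⟨x, h.unop.le x.2⟩)
  map_id _ := rfl
  map_comp _ _ := rfl

theorem funPresheaf_isSheaf : TopCat.Presheaf.IsSheaf (funPresheaf R) := by
  rw [TopCat.Presheaf.isSheaf_iff_isSheaf_comp (forget (AlgCat.{0} ℝ))]
  exact TopCat.Presheaf.toTypes_isSheaf T R

variable {R}

/-- The value of a function at a point. -/
def evalAt {U : Opens T} (x : U) : (funPresheaf R).obj (op U) →ₐ[ℝ] R x :=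
  Pi.evalAlgHom ℝ (fun y : U => R y) x

variable {P : TopCat.Presheaf (AlgCat.{0} ℝ) T}

/-- The morphism to the presheaf of functions given by values at the points that are compatible
with restriction. -/
def toFunPresheaf (v : ∀ (U : Opens T) (x : U), P.obj (op U) →ₐ[ℝ] R x)
    (hv : ∀ (U V : Opens T) (i : V ≤ U) (x : V) (s : P.obj (op U)),
      v V x (res P i s) = v U ⟨x, i x.2⟩ s) : P ⟶ funPresheaf R where
  app U := AlgCat.ofHom (AlgHom.pi (R := ℝ) fun x : U.unop => v U.unop x)
  naturality U V i := by
    apply AlgCat.hom_ext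
    apply AlgHom.ext
    intro s
    funext x
    exact hv U.unop V.unop i.unop.le x s

/-- The value at a point of a section of the sheafification of `P`, given the values of the
sections of `P`. -/
def shfVal (v : ∀ (U : Opens T) (x : U), P.obj (op U) →ₐ[ℝ] R x)
    (hv : ∀ (U V : Opens T) (i : V ≤ U) (x : V) (s : P.obj (op U)),
      v V x (res P i s) = v U ⟨x, i x.2⟩ s) (U : Opens T) (x : U) :
    (shf P).obj (op U) →ₐ[ℝ] R x :=
  (evalAt x).comp ((sheafifyLift (Opens.grothendieckTopology T) (toFunPresheaf v hv)
    (funPresheaf_isSheaf R)).app (op U)).hom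

variable {v : ∀ (U : Opens T) (x : U), P.obj (op U) →ₐ[ℝ] R x}
    {hv : ∀ (U V : Opens T) (i : V ≤ U) (x : V) (s : P.obj (op U)),
      v V x (res P i s) = v U ⟨x, i x.2⟩ s}

theorem shfVal_toShf (U : Opens T) (x : U) (p : P.obj (op U)) :
    shfVal v hv U x (toShf P U p) = v U x p :=
  congrArg (fun g : P ⟶ funPresheaf R => evalAt x ((g.app (op U)).hom p))
    (toSheafify_sheafifyLift (Opens.grothendieckTopology T) (toFunPresheaf v hv)
      (funPresheaf_isSheaf R))

theorem shfVal_res {U V : Opens T} (i : V ≤ U) (x : V) (s : (shf P).obj (op U)) :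
    shfVal v hv V x (res (shf P) i s) = shfVal v hv U ⟨x, i x.2⟩ s := by
  change evalAt x (((sheafifyLift (Opens.grothendieckTopology T) (toFunPresheaf v hv)
    (funPresheaf_isSheaf R)).app (op V)).hom _) = _
  rw [app_res]
  rfl

end FunPresheaf

section Sheafify

variable {T : TopCat.{0}}

theorem shf_eq_of_locally_eq {P : TopCat.Presheaf (AlgCat.{0} ℝ) T} {U : Opens T}
    (s t : (shf P).obj (op U))
    (h : ∀ x ∈ U, ∃ (V : Opens T) (i : V ≤ U), x ∈ V ∧ res (shf P) i s = res (shf P) i t) :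
    s = t :=
  eq_of_locally_eq ((presheafToSheaf (Opens.grothendieckTopology T) (AlgCat.{0} ℝ)).obj P) s t h

theorem res_toShf {P : TopCat.Presheaf (AlgCat.{0} ℝ) T} {U V : Opens T} (i : V ≤ U)
    (p : P.obj (op U)) : res (shf P) i (toShf P U p) = toShf P V (res P i p) :=
  (app_res (toSheafify (Opens.grothendieckTopology T) P) i p).symm

end Sheafify

/-! ### Degree zero functions -/

/-- If a character of the germs of smooth functions at a point, with values in a nontrivial algebra,
maps `f` to a scalar `c`, then `c` is the value of `f` at the point: otherwise `f - c` is invertible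
near the point and maps to zero. -/
theorem eq_of_map_eq_algebraMap {M : Mfd} {y : M.carrier} {R : Type} [Ring R] [Algebra ℝ R]
    [Nontrivial R]
    (v : ∀ U : Opens M.carrier, y ∈ U → C^∞⟮𝓡 M.dim, U; 𝓘(ℝ, ℝ), ℝ⟯ →ₐ[ℝ] R)
    (hv : ∀ (U V : Opens M.carrier) (i : V ≤ U) (hy : y ∈ V) f,
      v V hy (GrMfd.restrictSmooth M i f) = v U (i hy) f)
    {U : Opens M.carrier} (hy : y ∈ U) (f : C^∞⟮𝓡 M.dim, U; 𝓘(ℝ, ℝ), ℝ⟯) {c : ℝ}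
    (h : v U hy f = algebraMap ℝ R c) : c = f ⟨y, hy⟩ := by
  by_contra hne
  have hopen : IsOpen {x : U | f x - c ≠ 0} :=
    isOpen_ne_fun (f.contMDiff.continuous.sub continuous_const) continuous_const
  let V : Opens M.carrier := ⟨Subtype.val '' {x : U | f x - c ≠ 0},
    U.isOpen.isOpenMap_subtype_val _ hopen⟩
  have hVU : V ≤ U := by rintro _ ⟨x, -, rfl⟩; exact x.2
  have hyV : y ∈ V := ⟨⟨y, hy⟩, sub_ne_zero.2 (Ne.symm hne), rfl⟩
  let g : C^∞⟮𝓡 M.dim, V; 𝓘(ℝ, ℝ), ℝ⟯ :=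
    GrMfd.restrictSmooth M hVU f - algebraMap ℝ _ c
  have hg : ∀ x : V, g x ≠ 0 := by
    rintro ⟨_, x, hx, rfl⟩
    exact hx
  let g' : C^∞⟮𝓡 M.dim, V; 𝓘(ℝ, ℝ), ℝ⟯ := ⟨fun x => (g x)⁻¹, g.contMDiff.inv₀ hg⟩
  have hgg : g * g' = 1 := by
    ext x
    exact mul_inv_cancel₀ (hg x)
  have h₀ : v V hyV g = 0 := by
    rw [map_sub, hv, h, AlgHom.commutes, sub_self]
  have h₁ := congrArg (v V hyV) hgg
  rw [map_mul, h₀, zero_mul, map_one] at h₁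
  exact zero_ne_one h₁

/-! ### Modules of smooth sections of the dual bundles -/

/-- The module of smooth sections over `U` of the dual bundle. -/
def VBundle.smoothDual {M : Mfd} (E : VBundle M) (U : Opens M.carrier) :
    Submodule ℝ (∀ x : U, Module.Dual ℝ (E.fiber x)) where
  carrier := {ξ | E.IsSmoothDual U ξ}
  add_mem' h h' := VBundle.IsSmoothDual.add h h'
  zero_mem' := VBundle.isSmoothDual_zero
  smul_mem' _ _ h := VBundle.IsSmoothDual.const_smul h

namespace VBundle

variable {M : Mfd} {E : VBundle M}

/-- Restriction of smooth sections of the dual bundle. -/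
def resDual {U V : Opens M.carrier} (i : V ≤ U) : E.smoothDual U →ₗ[ℝ] E.smoothDual V where
  toFun ξ := ⟨fun x => ξ.1 ⟨x, i x.2⟩, IsSmoothDual.restrict i ξ.2⟩
  map_add' _ _ := rfl
  map_smul' _ _ := rfl

/-- The product of a smooth function and a smooth section of the dual bundle. -/
def funSmul {U : Opens M.carrier} (f : C^∞⟮𝓡 M.dim, U; 𝓘(ℝ, ℝ), ℝ⟯) (ξ : E.smoothDual U) :
    E.smoothDual U :=
  ⟨fun x => f x • ξ.1 x, IsSmoothDual.smul f.contMDiff ξ.2⟩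

end VBundle

namespace CoalgBundle

variable {n : ℕ} {X : CoalgBundle n}

/-! ### Functions and sections of the dual bundles as elements of the quotient algebras -/

/-- The algebra of smooth functions on an open subset of the base. -/
abbrev Fun (X : CoalgBundle n) (U : Opens X.M.carrier) : Type :=
  C^∞⟮𝓡 X.M.dim, U; 𝓘(ℝ, ℝ), ℝ⟯

/-- Smooth functions as smooth sections of `Sym E*`. -/
def funSym (U : Opens X.M.carrier) : X.Fun U →ₐ[ℝ] X.symSec U where
  toFun f := ⟨X.funSec f, X.polySec_le_symSec U
    (Algebra.subset_adjoin (Or.inl ⟨f, f.contMDiff, rfl⟩))⟩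
  map_one' := Subtype.ext (funext fun x => map_one (algebraMap ℝ (X.symFiber x)))
  map_mul' f g := Subtype.ext (funext fun x => map_mul (algebraMap ℝ (X.symFiber x)) (f x) (g x))
  map_zero' := Subtype.ext (funext fun x => map_zero (algebraMap ℝ (X.symFiber x)))
  map_add' f g := Subtype.ext (funext fun x => map_add (algebraMap ℝ (X.symFiber x)) (f x) (g x))
  commutes' _ := rfl

/-- Smooth sections of the dual bundles as smooth sections of `Sym E*`. -/
def genSym (U : Opens X.M.carrier) (i : Fin n) : (X.E i).smoothDual U →ₗ[ℝ] X.symSec U where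
  toFun ξ := ⟨X.genSec i ξ.1, X.polySec_le_symSec U
    (Algebra.subset_adjoin (Or.inr ⟨i, ξ.1, ξ.2, rfl⟩))⟩
  map_add' ξ η := Subtype.ext (funext fun x =>
    map_add (GSym.ι (V := fun i => Module.Dual ℝ ((X.E i).fiber x)) i) (ξ.1 x) (η.1 x))
  map_smul' r ξ := Subtype.ext (funext fun x =>
    map_smul (GSym.ι (V := fun i => Module.Dual ℝ ((X.E i).fiber x)) i) r (ξ.1 x))

theorem funSym_mul_genSym {U : Opens X.M.carrier} {i : Fin n} (f : X.Fun U)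
    (ξ : (X.E i).smoothDual U) : funSym U f * genSym U i ξ = genSym U i (VBundle.funSmul f ξ) := by
  apply Subtype.ext
  funext x
  change algebraMap ℝ (X.symFiber x) (f x) * GSym.ι i (ξ.1 x) = GSym.ι i (f x • ξ.1 x)
  rw [map_smul, Algebra.smul_def]

theorem funSym_comm {U : Opens X.M.carrier} (f : X.Fun U) (s : X.symSec U) :
    funSym U f * s = s * funSym U f :=
  Subtype.ext (funext fun x => Algebra.commutes (f x) (s.1 x))

/-- Smooth functions as elements of the quotient algebra. -/
def funQ (U : Opens X.M.carrier) : X.Fun U →ₐ[ℝ] X.Quot U := (X.quotMk U).comp (funSym U)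

/-- Smooth sections of the dual bundles as elements of the quotient algebra. -/
def genQ (U : Opens X.M.carrier) (i : Fin n) : (X.E i).smoothDual U →ₗ[ℝ] X.Quot U :=
  (X.quotMk U).toLinearMap ∘ₗ genSym U i

theorem funQ_mul_genQ {U : Opens X.M.carrier} {i : Fin n} (f : X.Fun U)
    (ξ : (X.E i).smoothDual U) : funQ U f * genQ U i ξ = genQ U i (VBundle.funSmul f ξ) :=
  (map_mul (X.quotMk U) _ _).symm.trans (congrArg (X.quotMk U) (funSym_mul_genSym f ξ))

theorem funQ_comm {U : Opens X.M.carrier} (f : X.Fun U) (p : X.Quot U) :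
    funQ U f * p = p * funQ U f := by
  obtain ⟨s, rfl⟩ := X.quotMk_surjective U p
  exact (map_mul (X.quotMk U) _ _).symm.trans
    ((congrArg (X.quotMk U) (funSym_comm f s)).trans (map_mul (X.quotMk U) _ _))

theorem genQ_mul_genQ {U : Opens X.M.carrier} {i j k : Fin n} (hk : wt i + wt j = wt k)
    (ξ : (X.E i).smoothDual U) (η : (X.E j).smoothDual U) :
    genQ U i ξ * genQ U j η = genQ U k ⟨fun x => dualMul (X.μ x) i j k (ξ.1 x) (η.1 x),
      X.smooth_μ U i j k ξ.1 η.1 ξ.2 η.2⟩ :=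
  (map_mul (X.quotMk U) _ _).symm.trans
    (quotMk_eq ⟨i, j, k, ξ.1, η.1, hk, ξ.2, η.2, rfl, rfl⟩)

theorem genQ_comm {U : Opens X.M.carrier} (i j : Fin n) (ξ : (X.E i).smoothDual U)
    (η : (X.E j).smoothDual U) :
    genQ U i ξ * genQ U j η = ((-1 : ℝ) ^ (wt i * wt j)) • (genQ U j η * genQ U i ξ) :=
  X.quotDeg_comm (X.mem_quotDeg fun _ => GSym.ι_mem i _) (X.mem_quotDeg fun _ => GSym.ι_mem j _)

theorem funQ_mem (U : Opens X.M.carrier) (f : X.Fun U) : funQ U f ∈ X.quotDeg 0 U := by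
  refine X.mem_quotDeg fun x => ?_
  change algebraMap ℝ (X.symFiber x) (f x) ∈ _
  rw [Algebra.algebraMap_eq_smul_one]
  exact Submodule.smul_mem _ _ GSym.one_mem

theorem genQ_mem (U : Opens X.M.carrier) (i : Fin n) (ξ : (X.E i).smoothDual U) :
    genQ U i ξ ∈ X.quotDeg (wt i) U :=
  X.mem_quotDeg fun _ => GSym.ι_mem i _

theorem res_funQ {U V : Opens X.M.carrier} (i : V ≤ U) (f : X.Fun U) :
    res X.quotPresheaf i (funQ U f) = funQ V (GrMfd.restrictSmooth X.M i f) :=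
  restrictQuot_mk i _

theorem res_genQ {U V : Opens X.M.carrier} (i : V ≤ U) (k : Fin n) (ξ : (X.E k).smoothDual U) :
    res X.quotPresheaf i (genQ U k ξ) = genQ V k (VBundle.resDual i ξ) :=
  restrictQuot_mk i _

/-! ### Values at a point -/

/-- The value at a point of the elements of the quotient algebra, in the algebra dual to the
coalgebra in that point. -/
def quotVal (U : Opens X.M.carrier) (x : U) : X.Quot U →ₐ[ℝ] DualAlg (X.isCoalg x) :=
  quotLift ((toDual (X.isCoalg x) fun _ => LinearMap.id).comp
    ((Pi.evalAlgHom ℝ (fun y : U => X.symFiber y) x).comp (X.symSec U).val)) (by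
    rintro s t ⟨i, j, k, ξ, η, hk, -, -, hs, ht⟩
    change toDual (X.isCoalg x) (fun _ => LinearMap.id) (s.1 x) =
      toDual (X.isCoalg x) (fun _ => LinearMap.id) (t.1 x)
    rw [hs, ht]
    change toDual (X.isCoalg x) (fun _ => LinearMap.id) (GSym.ι i (ξ x) * GSym.ι j (η x)) =
      toDual (X.isCoalg x) (fun _ => LinearMap.id) (GSym.ι k _)
    rw [map_mul, toDual_ι, toDual_ι, toDual_ι]
    exact DualAlg.gen_mul_gen hk _ _)

theorem quotVal_mk (U : Opens X.M.carrier) (x : U) (s : X.symSec U) :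
    quotVal U x (X.quotMk U s) = toDual (X.isCoalg x) (fun _ => LinearMap.id) (s.1 x) :=
  quotLift_mk _ _ s

theorem quotVal_res {U V : Opens X.M.carrier} (i : V ≤ U) (x : V) (p : X.Quot U) :
    quotVal V x (restrictQuot i p) = quotVal U ⟨x, i x.2⟩ p := by
  obtain ⟨s, rfl⟩ := X.quotMk_surjective U p
  rw [restrictQuot_mk, quotVal_mk, quotVal_mk]
  rfl

theorem quotVal_funQ (U : Opens X.M.carrier) (x : U) (f : X.Fun U) :
    quotVal U x (funQ U f) = algebraMap ℝ _ (f x) :=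
  (quotVal_mk U x _).trans (AlgHom.commutes _ _)

theorem quotVal_genQ (U : Opens X.M.carrier) (x : U) (i : Fin n) (ξ : (X.E i).smoothDual U) :
    quotVal U x (genQ U i ξ) = DualAlg.gen (X.isCoalg x) i (ξ.1 x) :=
  (quotVal_mk U x _).trans (toDual_ι i _)

/-- The value at a point of the sections of the sheaf `Γ_{Sym E*} / I_μ`. -/
def val (U : Opens X.M.carrier) (x : U) :
    (shf X.quotPresheaf).obj (op U) →ₐ[ℝ] DualAlg (X.isCoalg x) :=
  shfVal (T := TopCat.of X.M.carrier) (P := X.quotPresheaf)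
    (R := fun x => DualAlg (X.isCoalg x)) (fun U x => quotVal U x)
    (fun _ _ i x s => quotVal_res i x s) U x

theorem val_res {U V : Opens X.M.carrier} (i : V ≤ U) (x : V)
    (s : (shf X.quotPresheaf).obj (op U)) :
    val V x (res (shf X.quotPresheaf) i s) = val U ⟨x, i x.2⟩ s :=
  shfVal_res (T := TopCat.of X.M.carrier) (P := X.quotPresheaf)
    (R := fun x => DualAlg (X.isCoalg x)) (v := fun U x => quotVal U x)
    (hv := fun _ _ i x s => quotVal_res i x s) i x s

theorem val_toShf (U : Opens X.M.carrier) (x : U) (p : X.Quot U) :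
    val U x (toShf X.quotPresheaf U p) = quotVal U x p :=
  shfVal_toShf (T := TopCat.of X.M.carrier) (P := X.quotPresheaf)
    (R := fun x => DualAlg (X.isCoalg x)) (v := fun U x => quotVal U x)
    (hv := fun _ _ i x s => quotVal_res i x s) U x p

theorem val_funQ (U : Opens X.M.carrier) (x : U) (f : X.Fun U) :
    val U x (toShf X.quotPresheaf U (funQ U f)) = algebraMap ℝ _ (f x) :=
  (val_toShf U x _).trans (quotVal_funQ U x f)

theorem val_genQ (U : Opens X.M.carrier) (x : U) (i : Fin n) (ξ : (X.E i).smoothDual U) :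
    val U x (toShf X.quotPresheaf U (genQ U i ξ)) = DualAlg.gen (X.isCoalg x) i (ξ.1 x) :=
  (val_toShf U x _).trans (quotVal_genQ U x i ξ)

/-- The relations of `I_μ` hold in the fibrewise dual algebras, in which the duals of the fibres are
embedded; so no section of a dual bundle is killed in the quotient. -/
theorem genQ_injective {U : Opens X.M.carrier} {i : Fin n} {ξ η : (X.E i).smoothDual U}
    (h : toShf X.quotPresheaf U (genQ U i ξ) = toShf X.quotPresheaf U (genQ U i η)) : ξ = η := by
  apply Subtype.ext
  funext x
  have h' := (val_genQ U x i ξ).symm.trans ((congrArg (val U x) h).trans (val_genQ U x i η))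
  rw [← DualAlg.comp_gen_self (h := X.isCoalg x) i (ξ.1 x), h', DualAlg.comp_gen_self]

end CoalgBundle

namespace CoalgBundle

variable {n : ℕ} {X : CoalgBundle n}

/-! ### Homogeneous sections -/

/-- The span of the monomials of degree `l` in smooth sections of the dual bundles, with smooth
functions as coefficients. -/
def monSym (X : CoalgBundle n) (l : ℕ) (U : Opens X.M.carrier) : Submodule ℝ (X.symSec U) :=
  Submodule.span ℝ {t | ∃ (f : X.Fun U) (L : List (Σ i, (X.E i).smoothDual U)),
    (L.map fun q => wt q.1).sum = l ∧ t = funSym U f * (L.map fun q => genSym U q.1 q.2).prod}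

theorem monSym_mul {k l : ℕ} {U : Opens X.M.carrier} {a b : X.symSec U} (ha : a ∈ X.monSym k U)
    (hb : b ∈ X.monSym l U) : a * b ∈ X.monSym (k + l) U := by
  induction ha, hb using Submodule.span_induction₂ with
  | mem_mem x y hx hy =>
    obtain ⟨f, L, rfl, rfl⟩ := hx
    obtain ⟨g, L', rfl, rfl⟩ := hy
    refine Submodule.subset_span ⟨f * g, L ++ L', by simp, ?_⟩
    rw [List.map_append, List.prod_append, map_mul]
    exact Commute.mul_mul_mul_comm (funSym_comm g _).symm _ _
  | zero_left y hy => simp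
  | zero_right x hx => simp
  | add_left x y z hx hy hz h₁ h₂ => rw [add_mul]; exact add_mem h₁ h₂
  | add_right x y z hx hy hz h₁ h₂ => rw [mul_add]; exact add_mem h₁ h₂
  | smul_left r x y hx hy h => rw [smul_mul_assoc]; exact Submodule.smul_mem _ _ h
  | smul_right r x y hx hy h => rw [mul_smul_comm]; exact Submodule.smul_mem _ _ h

theorem monSym_deg {l : ℕ} {U : Opens X.M.carrier} {a : X.symSec U} (ha : a ∈ X.monSym l U)
    (x : U) : a.1 x ∈ GSym.deg (fun i => Module.Dual ℝ ((X.E i).fiber x)) l := by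
  induction ha using Submodule.span_induction with
  | mem a ha =>
    obtain ⟨f, L, rfl, rfl⟩ := ha
    have h : (L.map fun q => genSym U q.1 q.2).prod.1 x ∈
        GSym.deg (fun i => Module.Dual ℝ ((X.E i).fiber x)) (L.map fun q => wt q.1).sum := by
      induction L with
      | nil => exact GSym.one_mem
      | cons q L ih =>
        exact GSym.mul_mem (V := fun i => Module.Dual ℝ ((X.E i).fiber x))
          (GSym.ι_mem (V := fun i => Module.Dual ℝ ((X.E i).fiber x)) q.1 (q.2.1 x)) ih
    change algebraMap ℝ (X.symFiber x) (f x) * _ ∈ _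
    rw [← Algebra.smul_def]
    exact Submodule.smul_mem _ _ h
  | zero => exact zero_mem _
  | add a b _ _ h₁ h₂ => exact add_mem h₁ h₂
  | smul r a _ h => exact Submodule.smul_mem _ r h

theorem mem_iSup_monSym {U : Opens X.M.carrier} {s : X.AllSec U} (hs : s ∈ X.polySec U) :
    (⟨s, X.polySec_le_symSec U hs⟩ : X.symSec U) ∈ ⨆ l, X.monSym l U := by
  have hfun : ∀ f : X.Fun U, funSym U f ∈ ⨆ l, X.monSym l U := fun f =>
    Submodule.mem_iSup_of_mem 0 (Submodule.subset_span ⟨f, [], rfl, by simp⟩)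
  induction hs using Algebra.adjoin_induction with
  | mem s hs =>
    rcases hs with ⟨f, hf, rfl⟩ | ⟨i, ξ, hξ, rfl⟩
    · exact hfun ⟨f, hf⟩
    · refine Submodule.mem_iSup_of_mem (wt i)
        (Submodule.subset_span ⟨1, [⟨i, ξ, hξ⟩], by simp, ?_⟩)
      rw [map_one, one_mul, List.map_singleton, List.prod_singleton]
      rfl
  | algebraMap r => exact hfun (algebraMap ℝ _ r)
  | add s t hs ht h₁ h₂ => exact add_mem h₁ h₂
  | mul s t hs ht h₁ h₂ =>
    have key : ∀ a ∈ ⨆ l, X.monSym l U, ∀ b ∈ ⨆ l, X.monSym l U,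
        a * b ∈ ⨆ l, X.monSym l U := by
      intro a ha b hb
      induction ha using Submodule.iSup_induction' with
      | mem k a ha =>
        induction hb using Submodule.iSup_induction' with
        | mem l b hb => exact Submodule.mem_iSup_of_mem (k + l) (monSym_mul ha hb)
        | zero => rw [mul_zero]; exact zero_mem _
        | add b c hb hc h₁ h₂ => rw [mul_add]; exact add_mem h₁ h₂
      | zero => rw [zero_mul]; exact zero_mem _
      | add a c ha hc h₁ h₂ => rw [add_mul]; exact add_mem h₁ h₂
    exact key _ h₁ _ h₂

/-- A polynomial section that is homogeneous in each point is a sum of homogeneous monomials. -/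
theorem mem_monSym {l : ℕ} {U : Opens X.M.carrier} {s : X.symSec U}
    (hs : s ∈ ⨆ l, X.monSym l U)
    (hd : ∀ x : U, s.1 x ∈ GSym.deg (fun i => Module.Dual ℝ ((X.E i).fiber x)) l) :
    s ∈ X.monSym l U := by
  obtain ⟨f, hf, hsum⟩ := (Submodule.mem_iSup_iff_exists_finsupp _ _).1 hs
  let N : ℕ := f.support.sup id + 1
  have hN : ∑ k ∈ Finset.range N, f k = s := by
    rw [← hsum]
    refine (Finsupp.sum_of_support_subset f (fun k hk => Finset.mem_range.2
      (Nat.lt_succ_of_le (Finset.le_sup (f := id) hk))) (fun _ y => y) (fun _ _ => rfl)).symm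
  have hzero : ∀ k ∈ Finset.range N, k ≠ l → f k = 0 := by
    intro k hk hkl
    apply Subtype.ext
    funext x
    refine iSupIndep.eq_of_sum_mem GSym.iSupIndep_deg (s := fun k => (f k).1 x)
      (fun k => monSym_deg (hf k) x) (k := l) (N := N) ?_ hk hkl
    have h := hd x
    rw [← hN] at h
    have h' : (∑ k ∈ Finset.range N, f k).1 x = ∑ k ∈ Finset.range N, (f k).1 x :=
      map_sum ((Pi.evalAlgHom ℝ (fun y : U => X.symFiber y) x).comp (X.symSec U).val) f _
    rwa [h'] at h
  rw [← hN]
  refine Submodule.sum_mem _ fun k hk => ?_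
  by_cases hkl : k = l
  · exact hkl ▸ hf k
  · rw [hzero k hk hkl]
    exact zero_mem _

/-- Sections of degree zero of `Sym E*` are smooth functions. -/
theorem exists_funQ_eq {U : Opens X.M.carrier} {s : X.symSec U} (hs : s ∈ X.monSym 0 U) :
    ∃ f, X.quotMk U s = funQ U f := by
  induction hs using Submodule.span_induction with
  | mem a ha =>
    obtain ⟨f, L, hL, rfl⟩ := ha
    cases L with
    | nil => exact ⟨f, by simp [funQ]⟩
    | cons q L =>
      have := wt_pos q.1
      simp only [List.map_cons, List.sum_cons] at hL
      omega
  | zero => exact ⟨0, by simp⟩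
  | add a b _ _ h₁ h₂ =>
    obtain ⟨f, hf⟩ := h₁
    obtain ⟨g, hg⟩ := h₂
    exact ⟨f + g, by rw [map_add, map_add, hf, hg]⟩
  | smul r a _ h =>
    obtain ⟨f, hf⟩ := h
    exact ⟨r • f, by rw [map_smul, map_smul, hf]⟩

/-- Modulo the ideal, a product of sections of the dual bundles of total degree at most `n` is
a section of a dual bundle. -/
theorem exists_prod_eq_genQ {U : Opens X.M.carrier} (L : List (Σ i, (X.E i).smoothDual U))
    (k : Fin n) (hL : (L.map fun q => wt q.1).sum = wt k) :
    ∃ ξ, (L.map fun q => genQ U q.1 q.2).prod = genQ U k ξ := by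
  induction L generalizing k with
  | nil =>
    have := wt_pos k
    simp only [List.map_nil, List.sum_nil] at hL
    omega
  | cons q L ih =>
    simp only [List.map_cons, List.sum_cons, List.prod_cons] at hL ⊢
    rcases Nat.eq_zero_or_pos (L.map fun q => wt q.1).sum with h0 | h0
    · have hnil : L = [] := by
        cases L with
        | nil => rfl
        | cons q' L =>
          have := wt_pos q'.1
          simp only [List.map_cons, List.sum_cons] at h0
          omega
      subst hnil
      obtain ⟨i, ξ⟩ := q
      obtain rfl : i = k := wt_injective (by simpa using hL)
      exact ⟨ξ, by simp⟩
    · obtain ⟨k', hk'⟩ := exists_wt_eq (n := n) h0 (by have := wt_le k; omega)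
      obtain ⟨ξ, hξ⟩ := ih k' hk'.symm
      rw [hξ]
      exact ⟨_, genQ_mul_genQ (by omega) q.2 ξ⟩

/-- Modulo the ideal, a section of degree `wt k` of `Sym E*` is a section of the `k`-th dual bundle. -/
theorem exists_genQ_eq {U : Opens X.M.carrier} {k : Fin n} {s : X.symSec U}
    (hs : s ∈ X.monSym (wt k) U) : ∃ ξ, X.quotMk U s = genQ U k ξ := by
  induction hs using Submodule.span_induction with
  | mem a ha =>
    obtain ⟨f, L, hL, rfl⟩ := ha
    obtain ⟨ξ, hξ⟩ := exists_prod_eq_genQ L k hL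
    refine ⟨VBundle.funSmul f ξ, ?_⟩
    rw [← funQ_mul_genQ, ← hξ, map_mul, map_list_prod, List.map_map]
    rfl
  | zero => exact ⟨0, by simp⟩
  | add a b _ _ h₁ h₂ =>
    obtain ⟨f, hf⟩ := h₁
    obtain ⟨g, hg⟩ := h₂
    exact ⟨f + g, by rw [map_add, map_add, hf, hg]⟩
  | smul r a _ h =>
    obtain ⟨f, hf⟩ := h
    exact ⟨r • f, by rw [map_smul, map_smul, hf]⟩

/-- The map from the quotient algebra to the sections of the sheaf `Γ_{Sym E*} / I_μ`. -/
def toS (U : Opens X.M.carrier) : X.Quot U →ₐ[ℝ] (shf X.quotPresheaf).obj (op U) :=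
  toShf X.quotPresheaf U

/-- Homogeneous sections of the sheafification are locally represented by combinations of monomials of
the same degree. -/
theorem exists_locally_mem_monSym {l : ℕ} {U : Opens X.M.carrier}
    {s : (shf X.quotPresheaf).obj (op U)} (hs : s ∈ X.sheafGrading.deg l U) {x : X.M.carrier}
    (hx : x ∈ U) : ∃ (V : Opens X.M.carrier) (i : V ≤ U), x ∈ V ∧ ∃ t ∈ X.monSym l V,
      res (shf X.quotPresheaf) i s = toShf X.quotPresheaf V (X.quotMk V t) := by
  obtain ⟨V, i, hxV, p, ⟨t, ht, rfl⟩, hp⟩ := hs x hx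
  obtain ⟨W, j, hxW, htW⟩ := t.2 x hxV
  refine ⟨W, j.trans i, hxW, restrictSym j t,
    mem_monSym (mem_iSup_monSym htW) (fun y => ht ⟨y, j y.2⟩), ?_⟩
  refine (res_res (shf X.quotPresheaf) i j s).symm.trans ?_
  refine (congrArg (res (shf X.quotPresheaf) j) hp).trans ?_
  refine (res_toShf (P := X.quotPresheaf) j _).trans ?_
  exact congrArg (toShf X.quotPresheaf W) (restrictQuot_mk j t)

/-- The sections of degree zero are the smooth functions. -/
theorem exists_eq_funQ {U : Opens X.M.carrier} {s : (shf X.quotPresheaf).obj (op U)}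
    (hs : s ∈ X.sheafGrading.deg 0 U) : ∃ f, s = toShf X.quotPresheaf U (funQ U f) := by
  have hloc : ∀ x ∈ U, ∃ (V : Opens X.M.carrier) (i : V ≤ U), x ∈ V ∧ ∃ f,
      res (shf X.quotPresheaf) i s = toShf X.quotPresheaf V (funQ V f) := by
    intro x hx
    obtain ⟨V, i, hxV, t, ht, h⟩ := exists_locally_mem_monSym hs hx
    obtain ⟨f, hf⟩ := exists_funQ_eq ht
    exact ⟨V, i, hxV, f, h.trans (congrArg (toShf X.quotPresheaf V) hf)⟩
  have hval : ∀ (V : Opens X.M.carrier) (i : V ≤ U) (f : X.Fun V),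
      res (shf X.quotPresheaf) i s = toShf X.quotPresheaf V (funQ V f) → ∀ y : V,
        (val U ⟨y, i y.2⟩ s).1 = f y := by
    intro V i f hf y
    have h := (val_res i y s).symm.trans ((congrArg (val V y) hf).trans (val_funQ V y f))
    rw [h, Algebra.algebraMap_eq_smul_one, DualAlg.smul_fst, DualAlg.one_fst, mul_one]
  refine ⟨⟨fun x => (val U x s).1, contMDiff_of_locally fun x hx => ?_⟩, ?_⟩
  · obtain ⟨V, i, hxV, f, hf⟩ := hloc x hx
    exact ⟨V, i, hxV, f.contMDiff.congr fun y => hval V i f hf y⟩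
  · refine shf_eq_of_locally_eq (T := TopCat.of X.M.carrier) _ _ fun x hx => ?_
    obtain ⟨V, i, hxV, f, hf⟩ := hloc x hx
    refine ⟨V, i, hxV, hf.trans ?_⟩
    refine Eq.trans ?_ (res_toShf (P := X.quotPresheaf) i _).symm
    refine congrArg (toShf X.quotPresheaf V) (Eq.trans ?_ (res_funQ i _).symm)
    congr 1
    ext y
    exact (hval V i f hf y).symm

/-- The sections of degree `wt k` are the smooth sections of the `k`-th dual bundle. -/
theorem exists_eq_genQ {U : Opens X.M.carrier} {k : Fin n} {s : (shf X.quotPresheaf).obj (op U)}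
    (hs : s ∈ X.sheafGrading.deg (wt k) U) :
    ∃ ξ, s = toShf X.quotPresheaf U (genQ U k ξ) := by
  have hloc : ∀ x ∈ U, ∃ (V : Opens X.M.carrier) (i : V ≤ U), x ∈ V ∧ ∃ ξ,
      res (shf X.quotPresheaf) i s = toShf X.quotPresheaf V (genQ V k ξ) := by
    intro x hx
    obtain ⟨V, i, hxV, t, ht, h⟩ := exists_locally_mem_monSym hs hx
    obtain ⟨f, hf⟩ := exists_genQ_eq ht
    exact ⟨V, i, hxV, f, h.trans (congrArg (toShf X.quotPresheaf V) hf)⟩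
  have hval : ∀ (V : Opens X.M.carrier) (i : V ≤ U) (ξ : (X.E k).smoothDual V),
      res (shf X.quotPresheaf) i s = toShf X.quotPresheaf V (genQ V k ξ) → ∀ y : V,
        DualAlg.comp (X.isCoalg y) k (val U ⟨y, i y.2⟩ s) = ξ.1 y := by
    intro V i ξ hξ y
    have h := (val_res i y s).symm.trans ((congrArg (val V y) hξ).trans (val_genQ V y k ξ))
    rw [h, DualAlg.comp_gen_self]
  let ζ : ∀ x : U, Module.Dual ℝ ((X.E k).fiber x) := fun x =>
    DualAlg.comp (X.isCoalg x) k (val U x s)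
  have hζ : (X.E k).IsSmoothDual U ζ := VBundle.isSmoothDual_of_locally fun x hx => by
    obtain ⟨V, i, hxV, ξ, hξ⟩ := hloc x hx
    have : (fun y : V => ζ ⟨y, i y.2⟩) = ξ.1 := funext fun y => hval V i ξ hξ y
    exact ⟨V, i, hxV, this ▸ ξ.2⟩
  refine ⟨⟨ζ, hζ⟩, ?_⟩
  refine shf_eq_of_locally_eq (T := TopCat.of X.M.carrier) _ _ fun x hx => ?_
  obtain ⟨V, i, hxV, ξ, hξ⟩ := hloc x hx
  refine ⟨V, i, hxV, hξ.trans ?_⟩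
  refine Eq.trans ?_ (res_toShf (P := X.quotPresheaf) i _).symm
  refine congrArg (toShf X.quotPresheaf V) (Eq.trans ?_ (res_genQ i k _).symm)
  congr 1
  apply Subtype.ext
  funext y
  exact (hval V i ξ hξ y).symm

/-- A morphism from the sheaf `Γ_{Sym E*} / I_μ` is determined by its values on functions and on
sections of the dual bundles. -/
theorem shf_hom_ext {Q : TopCat.Presheaf (AlgCat.{0} ℝ) (TopCat.of X.M.carrier)}
    (hQ : Presheaf.IsSheaf (Opens.grothendieckTopology (TopCat.of X.M.carrier)) Q)
    {a b : shf X.quotPresheaf ⟶ Q}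
    (hfun : ∀ (U : Opens X.M.carrier) f, (a.app (op U)).hom (toShf X.quotPresheaf U (funQ U f)) =
      (b.app (op U)).hom (toShf X.quotPresheaf U (funQ U f)))
    (hgen : ∀ (U : Opens X.M.carrier) k ξ,
      (a.app (op U)).hom (toShf X.quotPresheaf U (genQ U k ξ)) =
        (b.app (op U)).hom (toShf X.quotPresheaf U (genQ U k ξ))) : a = b := by
  refine hom_ext_of_toShf hQ fun U p => ?_
  obtain ⟨s, rfl⟩ := X.quotMk_surjective U p
  refine eq_of_locally_eq ⟨Q, hQ⟩ _ _ fun x hx => ?_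
  obtain ⟨V, i, hxV, hs⟩ := s.2 x hx
  refine ⟨V, i, hxV, ?_⟩
  have h : ∀ c : shf X.quotPresheaf ⟶ Q,
      res Q i ((c.app (op U)).hom (toShf X.quotPresheaf U (X.quotMk U s))) =
        (c.app (op V)).hom (toShf X.quotPresheaf V (X.quotMk V (restrictSym i s))) := by
    intro c
    refine (app_res c i _).symm.trans (congrArg (c.app (op V)).hom ?_)
    exact (res_toShf (P := X.quotPresheaf) i _).trans
      (congrArg (toShf X.quotPresheaf V) (restrictQuot_mk i s))
  refine (h a).trans (Eq.trans ?_ (h b).symm)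
  let F : (shf X.quotPresheaf ⟶ Q) → X.symSec V →ₐ[ℝ] Q.obj (op V) := fun c =>
    (c.app (op V)).hom.comp ((toS V).comp (X.quotMk V))
  have hall : ∀ t ∈ ⨆ l, X.monSym l V, F a t = F b t := by
    intro t ht
    induction ht using Submodule.iSup_induction' with
    | mem k t ht =>
      induction ht using Submodule.span_induction with
      | mem t ht =>
        obtain ⟨f, L, -, rfl⟩ := ht
        rw [map_mul, map_mul, map_list_prod, map_list_prod, List.map_map, List.map_map]
        have h₁ : F a (funSym V f) = F b (funSym V f) := hfun V f
        have h₂ : ∀ q : Σ i, (X.E i).smoothDual V, F a (genSym V q.1 q.2) =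
          F b (genSym V q.1 q.2) := fun q => hgen V q.1 q.2
        rw [h₁]
        congr 2
        exact List.map_congr_left fun q _ => h₂ q
      | zero => rw [map_zero, map_zero]
      | add x y _ _ h₁ h₂ => rw [map_add, map_add, h₁, h₂]
      | smul r x _ h => rw [map_smul, map_smul, h]
    | zero => rw [map_zero, map_zero]
    | add x y _ _ h₁ h₂ => rw [map_add, map_add, h₁, h₂]
  exact hall _ (mem_iSup_monSym hs)

end CoalgBundle

/-! ### Local frames and extension of functionals -/

namespace VBundle

variable {M : Mfd} {E : VBundle M}

/-- The domain of the preferred trivialization at a point. -/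
def nhd (E : VBundle M) (x : M.carrier) : Opens M.carrier :=
  ⟨(trivializationAt (EuclideanSpace ℝ (Fin E.rank)) E.fiber x).baseSet,
    (trivializationAt (EuclideanSpace ℝ (Fin E.rank)) E.fiber x).open_baseSet⟩

theorem mem_nhd (E : VBundle M) (x : M.carrier) : x ∈ E.nhd x :=
  FiberBundle.mem_baseSet_trivializationAt' x

/-- The local frame of the dual bundle near a point. -/
def coframeAt (E : VBundle M) (x : M.carrier) (k : Fin E.rank) : E.smoothDual (E.nhd x) :=
  ⟨fun y => coframe (trivializationAt (EuclideanSpace ℝ (Fin E.rank)) E.fiber x) y k,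
    isSmoothDual_coframe le_rfl k⟩

theorem coframeAt_frameVec (x : M.carrier) (k l : Fin E.rank) :
    (E.coframeAt x k).1 ⟨x, E.mem_nhd x⟩
      (frameVec (trivializationAt (EuclideanSpace ℝ (Fin E.rank)) E.fiber x) x l) =
        if l = k then 1 else 0 := by
  refine (coframe_apply (E.mem_nhd x) k _).trans ?_
  change ((trivializationAt (EuclideanSpace ℝ (Fin E.rank)) E.fiber x)
    ⟨x, Bundle.Trivialization.symm _ x _⟩).2 k = _
  rw [Bundle.Trivialization.apply_mk_symm _ (E.mem_nhd x)]
  simp [eq_comm]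

/-- The extension of an element of the dual of a fibre to a local section of the dual bundle. -/
def extDual (x : M.carrier) : Module.Dual ℝ (E.fiber x) →ₗ[ℝ] E.smoothDual (E.nhd x) :=
  ∑ k, (Module.Dual.eval ℝ _ (frameVec (trivializationAt (EuclideanSpace ℝ (Fin E.rank))
    E.fiber x) x k)).smulRight (E.coframeAt x k)

theorem extDual_eq (x : M.carrier) (ξ : Module.Dual ℝ (E.fiber x)) :
    extDual x ξ = ∑ k, ξ (frameVec (trivializationAt (EuclideanSpace ℝ (Fin E.rank))
      E.fiber x) x k) • E.coframeAt x k := by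
  simp [extDual]

theorem smoothDual_sum_apply {U : Opens M.carrier} {κ : Type} (s : Finset κ)
    (ξ : κ → E.smoothDual U) (y : U) : (∑ k ∈ s, ξ k).1 y = ∑ k ∈ s, (ξ k).1 y :=
  map_sum (LinearMap.proj y ∘ₗ (E.smoothDual U).subtype) ξ s

theorem extDual_apply (x : M.carrier) (ξ : Module.Dual ℝ (E.fiber x)) :
    (extDual x ξ).1 ⟨x, E.mem_nhd x⟩ = ξ := by
  rw [extDual_eq, smoothDual_sum_apply]
  exact (eq_sum_coframe (E.mem_nhd x) ξ).symm

/-- Near a point, a smooth section is a combination of the local frame. -/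
theorem exists_eq_sum_coframeAt {x : M.carrier} {U : Opens M.carrier} (hU : U ≤ E.nhd x)
    (ξ : E.smoothDual U) : ∃ f : Fin E.rank → C^∞⟮𝓡 M.dim, U; 𝓘(ℝ, ℝ), ℝ⟯,
      ξ = ∑ k, funSmul (f k) (resDual hU (E.coframeAt x k)) := by
  refine ⟨fun k => ⟨_, IsSmoothDual.contMDiff_frameVec
    (e := trivializationAt (EuclideanSpace ℝ (Fin E.rank)) E.fiber x) hU ξ.2 k⟩, ?_⟩
  apply Subtype.ext
  funext y
  rw [smoothDual_sum_apply]
  exact eq_sum_coframe (hU y.2) (ξ.1 y)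

theorem eq_of_forall_dual {y : M.carrier} {v w : E.fiber y}
    (h : ∀ ξ : Module.Dual ℝ (E.fiber y), ξ v = ξ w) : v = w :=
  (Module.evalEquiv ℝ (E.fiber y)).injective (LinearMap.ext h)

end VBundle

namespace CoalgBundle

variable {n : ℕ} {X Y : CoalgBundle n}

/-! ### The geometrization functor is faithful -/

theorem pullQuot_genQ (f : X ⟶ Y) (U : Opens Y.M.carrier) (i : Fin n)
    (ξ : (Y.E i).smoothDual U) : pullQuot f U (genQ U i ξ) =
      genQ (pre f U) i ⟨fun x => (f.map i x).dualMap (ξ.1 ⟨f.base x, x.2⟩),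
        contMDiff_pullDual f ξ.2⟩ :=
  (pullQuot_mk f U _).trans (congrArg (X.quotMk _) (Subtype.ext (pullAll_genSec f i ξ.1)))

theorem pullQuot_funQ (f : X ⟶ Y) (U : Opens Y.M.carrier) (a : Y.Fun U) :
    pullQuot f U (funQ U a) =
      funQ (pre f U) ⟨fun x => a ⟨f.base x, x.2⟩, contMDiff_pullFun f a.contMDiff⟩ :=
  (pullQuot_mk f U _).trans (congrArg (X.quotMk _) (Subtype.ext (pullAll_funSec f a)))

/-- The fibre maps are recovered from the pullback of local extensions of the functionals on the
fibres. -/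
theorem toGrMfdMap_injective {f g : X ⟶ Y} (h : toGrMfdMap f = toGrMfdMap g) : f = g := by
  have hb : f.base = g.base :=
    congrArg (fun k : X.toGrMfd ⟶ Y.toGrMfd => GrMfd.baseMap k.toHom) h
  obtain ⟨b, hbs, mf, hmf, hcf⟩ := f
  obtain ⟨b', hbs', mg, hmg, hcg⟩ := g
  change b = b' at hb
  subst hb
  let f : X ⟶ Y := ⟨b, hbs, mf, hmf, hcf⟩
  let g : X ⟶ Y := ⟨b, hbs', mg, hmg, hcg⟩
  have hc : pullSheaf f = pullSheaf g := by
    have h' := congrArg (fun k : X.toGrMfd ⟶ Y.toGrMfd => k.toHom.hom) h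
    exact eq_of_heq (AlgebraicGeometry.PresheafedSpace.Hom.mk.inj h').2
  have hm : mf = mg := by
    funext i x
    refine LinearMap.ext fun w => VBundle.eq_of_forall_dual fun η => ?_
    let V := (Y.E i).nhd (b x)
    let ξ := VBundle.extDual (b x) η
    have h₁ := congrArg (fun a => (a.app (op V)).hom (toShf Y.quotPresheaf V (genQ V i ξ))) hc
    have h₂ := (pullSheaf_toShf f V _).symm.trans (h₁.trans (pullSheaf_toShf g V _))
    rw [pullQuot_genQ, pullQuot_genQ] at h₂
    have h₃ := congrArg (fun ζ => ζ.1 ⟨x, (Y.E i).mem_nhd (b x)⟩ w) (genQ_injective h₂)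
    have h₄ : ξ.1 ⟨b x, (Y.E i).mem_nhd (b x)⟩ = η := VBundle.extDual_apply _ η
    change ξ.1 ⟨b x, _⟩ (mf i x w) = ξ.1 ⟨b x, _⟩ (mg i x w) at h₃
    rwa [h₄] at h₃
  subst hm
  rfl

/-! ### The geometrization functor is full -/

section Full

variable (ψ : X.toGrMfd ⟶ Y.toGrMfd)

/-- The map of the bases of a morphism of graded manifolds. -/
def bs (x : X.M.carrier) : Y.M.carrier := GrMfd.baseMap ψ.toHom x

theorem contMDiff_bs : ContMDiff (𝓡 X.M.dim) (𝓡 Y.M.dim) ∞ (bs ψ) := ψ.smooth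

/-- The preimage of an open set. -/
def preB (U : Opens Y.M.carrier) : Opens X.M.carrier :=
  (Opens.map ψ.toHom.hom.base).obj U

/-- The pullback of functions by a morphism of graded manifolds. -/
def pullC (U : Opens Y.M.carrier) : (shf Y.quotPresheaf).obj (op U) →ₐ[ℝ]
    (shf X.quotPresheaf).obj (op (preB ψ U)) :=
  (ψ.toHom.hom.c.app (op U)).hom

theorem pullC_res {U V : Opens Y.M.carrier} (i : V ≤ U) (s : (shf Y.quotPresheaf).obj (op U)) :
    pullC ψ V (res (shf Y.quotPresheaf) i s) =
      res (shf X.quotPresheaf) (U := preB ψ U) (V := preB ψ V) (fun _ hx => i hx)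
        (pullC ψ U s) :=
  app_res ψ.toHom.hom.c i s

theorem pullC_mem {l : ℕ} {U : Opens Y.M.carrier} {s : (shf Y.quotPresheaf).obj (op U)}
    (hs : s ∈ Y.sheafGrading.deg l U) : pullC ψ U s ∈ X.sheafGrading.deg l (preB ψ U) :=
  ψ.deg_mem l U s hs

/-- The composition of a smooth function and a morphism of graded manifolds. -/
def compBs {U : Opens Y.M.carrier} (f : Y.Fun U) : X.Fun (preB ψ U) :=
  ⟨fun x => f ⟨bs ψ x, x.2⟩, by
    refine ContMDiff.comp f.contMDiff (f := fun x : preB ψ U => (⟨bs ψ x, x.2⟩ : U)) ?_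
    rw [← ContMDiff.subtypeVal_comp_iff]
    exact (contMDiff_bs ψ).comp contMDiff_subtype_val⟩

theorem toS_res {U V : Opens X.M.carrier} (i : V ≤ U) (p : X.Quot U) :
    res (shf X.quotPresheaf) i (toS U p) = toS V (restrictQuot i p) :=
  res_toShf (P := X.quotPresheaf) i p

/-- The pullback of smooth functions by a morphism of graded manifolds is the composition with its map
of the bases: the pullback is of degree zero, hence a function, with values that
`eq_of_map_eq_algebraMap` determines. -/
theorem pullC_funQ (U : Opens Y.M.carrier) (f : Y.Fun U) :
    pullC ψ U (toS U (funQ U f)) = toS (preB ψ U) (funQ _ (compBs ψ f)) := by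
  obtain ⟨g, hg⟩ := exists_eq_funQ (pullC_mem ψ (l := 0) (U := U)
    (locallyIn_toShf (funQ_mem U f) : toS U (funQ U f) ∈ Y.sheafGrading.deg 0 U))
  refine Eq.trans hg (congrArg (fun a => toS (preB ψ U) (funQ _ a)) ?_)
  refine ContMDiffMap.ext fun x => ?_
  let v : ∀ V : Opens Y.M.carrier, bs ψ x ∈ V → Y.Fun V →ₐ[ℝ] DualAlg (X.isCoalg x) :=
    fun V hV => (val (preB ψ V) ⟨x, hV⟩).comp ((pullC ψ V).comp ((toS V).comp (funQ V)))
  refine eq_of_map_eq_algebraMap v ?_ x.2 f ?_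
  · intro V W i hy a
    change val (preB ψ W) ⟨x, hy⟩ (pullC ψ W (toS W (funQ W (GrMfd.restrictSmooth Y.M i a)))) =
      val (preB ψ V) ⟨x, i hy⟩ (pullC ψ V (toS V (funQ V a)))
    have h := (pullC_res ψ i (toS V (funQ V a))).symm
    have h' : res (shf Y.quotPresheaf) i (toS V (funQ V a)) =
        toS W (funQ W (GrMfd.restrictSmooth Y.M i a)) :=
      (toS_res i _).trans (congrArg (toS W) (res_funQ i a))
    rw [h'] at h
    rw [← h]
    exact val_res (X := X) (U := preB ψ V) (V := preB ψ W) (fun _ hx => i hx) ⟨x, hy⟩ _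
  · exact (congrArg (val (preB ψ U) x) hg).trans (val_funQ (preB ψ U) x g)

/-- The pullback of a section of a dual bundle is a section of a dual bundle, by its degree. -/
theorem exists_pullC_genQ (U : Opens Y.M.carrier) (i : Fin n) (ξ : (Y.E i).smoothDual U) :
    ∃ ζ, pullC ψ U (toS U (genQ U i ξ)) = toS (preB ψ U) (genQ _ i ζ) :=
  exists_eq_genQ (pullC_mem ψ (l := wt i) (U := U)
    (locallyIn_toShf (genQ_mem U i ξ) : toS U (genQ U i ξ) ∈ Y.sheafGrading.deg (wt i) U))

/-- The pullback of sections of the dual bundles by a morphism of graded manifolds, evaluated in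
a point. -/
def pullAt (U : Opens Y.M.carrier) (x : preB ψ U) (i : Fin n) :
    (Y.E i).smoothDual U →ₗ[ℝ] Module.Dual ℝ ((X.E i).fiber x) :=
  DualAlg.comp (X.isCoalg x) i ∘ₗ (val (preB ψ U) x).toLinearMap ∘ₗ (pullC ψ U).toLinearMap ∘ₗ
    (toS U).toLinearMap ∘ₗ genQ U i

theorem pullAt_res {U V : Opens Y.M.carrier} (h : V ≤ U) (x : preB ψ V) (i : Fin n)
    (ξ : (Y.E i).smoothDual U) :
    pullAt ψ V x i (VBundle.resDual h ξ) = pullAt ψ U ⟨x, h x.2⟩ i ξ := by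
  refine congrArg (DualAlg.comp (X.isCoalg x) i) ?_
  change val (preB ψ V) x (pullC ψ V (toS V (genQ V i (VBundle.resDual h ξ)))) =
    val (preB ψ U) ⟨x, h x.2⟩ (pullC ψ U (toS U (genQ U i ξ)))
  have h₁ : toS V (genQ V i (VBundle.resDual h ξ)) =
      res (shf Y.quotPresheaf) h (toS U (genQ U i ξ)) :=
    ((toS_res h _).trans (congrArg (toS V) (res_genQ h i ξ))).symm
  rw [h₁, pullC_res]
  exact val_res (X := X) (U := preB ψ U) (V := preB ψ V) (fun _ hx => h hx) x _

theorem pullC_genQ_eq (U : Opens Y.M.carrier) (x : preB ψ U) (i : Fin n)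
    (ξ : (Y.E i).smoothDual U) : val (preB ψ U) x (pullC ψ U (toS U (genQ U i ξ))) =
      DualAlg.gen (X.isCoalg x) i (pullAt ψ U x i ξ) := by
  obtain ⟨ζ, hζ⟩ := exists_pullC_genQ ψ U i ξ
  have h := (congrArg (val (preB ψ U) x) hζ).trans (val_genQ (preB ψ U) x i ζ)
  have h' : pullAt ψ U x i ξ = ζ.1 x :=
    (congrArg (DualAlg.comp (X.isCoalg x) i) h).trans (DualAlg.comp_gen_self i _)
  rw [h, h']

theorem pullAt_funSmul (U : Opens Y.M.carrier) (x : preB ψ U) (i : Fin n) (f : Y.Fun U)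
    (ξ : (Y.E i).smoothDual U) :
    pullAt ψ U x i (VBundle.funSmul f ξ) = f ⟨bs ψ x, x.2⟩ • pullAt ψ U x i ξ := by
  change DualAlg.comp (X.isCoalg x) i (val (preB ψ U) x (pullC ψ U (toS U (genQ U i _)))) = _
  rw [← funQ_mul_genQ, map_mul, map_mul, map_mul, pullC_funQ]
  have h : val (preB ψ U) x (toS (preB ψ U) (funQ _ (compBs ψ f))) = _ :=
    val_funQ (preB ψ U) x (compBs ψ f)
  rw [h, ← Algebra.smul_def, map_smul]
  rfl

/-- The map of fibres, on the dual spaces, of a morphism of graded manifolds. -/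
def fibDual (i : Fin n) (x : X.M.carrier) :
    Module.Dual ℝ ((Y.E i).fiber (bs ψ x)) →ₗ[ℝ] Module.Dual ℝ ((X.E i).fiber x) :=
  pullAt ψ ((Y.E i).nhd (bs ψ x)) ⟨x, (Y.E i).mem_nhd (bs ψ x)⟩ i ∘ₗ VBundle.extDual (bs ψ x)

/-- The pullback of sections is pointwise: it is linear over the smooth functions, and locally every
section is a combination of the frame. -/
theorem pullAt_eq (U : Opens Y.M.carrier) (x : preB ψ U) (i : Fin n)
    (ξ : (Y.E i).smoothDual U) : pullAt ψ U x i ξ = fibDual ψ i x (ξ.1 ⟨bs ψ x, x.2⟩) := by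
  let V : Opens Y.M.carrier := U ⊓ (Y.E i).nhd (bs ψ x)
  have hVU : V ≤ U := inf_le_left
  have hVN : V ≤ (Y.E i).nhd (bs ψ x) := inf_le_right
  have hx : bs ψ x ∈ V := ⟨x.2, (Y.E i).mem_nhd (bs ψ x)⟩
  rw [← pullAt_res ψ hVU ⟨x, hx⟩ i ξ]
  rw [fibDual, LinearMap.comp_apply]
  rw [← pullAt_res ψ hVN ⟨x, hx⟩ i]
  obtain ⟨f, hf⟩ := VBundle.exists_eq_sum_coframeAt hVN (VBundle.resDual hVU ξ)
  have hξ : ξ.1 ⟨bs ψ x, x.2⟩ = ∑ k, f k ⟨bs ψ x, hx⟩ •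
      ((Y.E i).coframeAt (bs ψ x) k).1 ⟨bs ψ x, (Y.E i).mem_nhd (bs ψ x)⟩ := by
    have h := congrArg (fun ζ => ζ.1 ⟨bs ψ x, hx⟩) hf
    simp only [VBundle.smoothDual_sum_apply] at h
    exact h
  have hext : ∀ k, VBundle.extDual (bs ψ x)
      (((Y.E i).coframeAt (bs ψ x) k).1 ⟨bs ψ x, (Y.E i).mem_nhd (bs ψ x)⟩) =
        (Y.E i).coframeAt (bs ψ x) k := by
    intro k
    rw [VBundle.extDual_eq, Finset.sum_eq_single k]
    · rw [VBundle.coframeAt_frameVec, if_pos rfl, one_smul]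
    · intro l _ hl
      rw [VBundle.coframeAt_frameVec, if_neg hl, zero_smul]
    · simp
  rw [hf, hξ, map_sum, map_sum, map_sum, map_sum]
  refine Finset.sum_congr rfl fun k _ => ?_
  rw [pullAt_funSmul, map_smul, map_smul, map_smul, hext]

/-- The map of fibres of a morphism of graded manifolds. -/
def fib (i : Fin n) (x : X.M.carrier) : (X.E i).fiber x →ₗ[ℝ] (Y.E i).fiber (bs ψ x) :=
  (Module.evalEquiv ℝ ((Y.E i).fiber (bs ψ x))).symm.toLinearMap ∘ₗ (fibDual ψ i x).dualMap ∘ₗ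
    Module.Dual.eval ℝ ((X.E i).fiber x)

theorem dual_fib (i : Fin n) (x : X.M.carrier) (v : (X.E i).fiber x)
    (η : Module.Dual ℝ ((Y.E i).fiber (bs ψ x))) : η (fib ψ i x v) = fibDual ψ i x η v :=
  Module.apply_evalEquiv_symm_apply ℝ _ η _

theorem fib_dualMap (i : Fin n) (x : X.M.carrier) : (fib ψ i x).dualMap = fibDual ψ i x :=
  LinearMap.ext fun η => LinearMap.ext fun v => dual_fib ψ i x v η

theorem isSmoothDual_fibDual {U : Opens Y.M.carrier} {i : Fin n} (ξ : (Y.E i).smoothDual U) :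
    (X.E i).IsSmoothDual (preB ψ U) (fun x => fibDual ψ i x (ξ.1 ⟨bs ψ x, x.2⟩)) := by
  obtain ⟨ζ, hζ⟩ := exists_pullC_genQ ψ U i ξ
  have h : (fun x : preB ψ U => fibDual ψ i x (ξ.1 ⟨bs ψ x, x.2⟩)) = ζ.1 := by
    funext x
    rw [← pullAt_eq]
    exact (congrArg (fun s => DualAlg.comp (X.isCoalg x) i (val (preB ψ U) x s)) hζ).trans
      ((congrArg _ (val_genQ (preB ψ U) x i ζ)).trans (DualAlg.comp_gen_self i _))
  exact h ▸ ζ.2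

theorem pullC_genQ (U : Opens Y.M.carrier) (i : Fin n) (ξ : (Y.E i).smoothDual U) :
    pullC ψ U (toS U (genQ U i ξ)) = toS (preB ψ U) (genQ _ i
      ⟨fun x => fibDual ψ i x (ξ.1 ⟨bs ψ x, x.2⟩), isSmoothDual_fibDual ψ ξ⟩) := by
  obtain ⟨ζ, hζ⟩ := exists_pullC_genQ ψ U i ξ
  refine hζ.trans (congrArg (fun a => toS (preB ψ U) (genQ _ i a)) (Subtype.ext ?_))
  funext x
  refine Eq.trans ?_ (pullAt_eq ψ U x i ξ)
  exact ((congrArg (fun s => DualAlg.comp (X.isCoalg x) i (val (preB ψ U) x s)) hζ).trans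
      ((congrArg _ (val_genQ (preB ψ U) x i ζ)).trans (DualAlg.comp_gen_self i _))).symm

/-- The fibre maps are smooth since their coordinates are the pullbacks of the local frame. -/
theorem contMDiff_fib (i : Fin n) : ContMDiff (X.E i).model (Y.E i).model ∞
    (fun p : (X.E i).Total => (⟨bs ψ p.proj, fib ψ i p.proj p.snd⟩ : (Y.E i).Total)) := by
  intro p₀
  rw [Bundle.contMDiffAt_totalSpace]
  refine ⟨((contMDiff_bs ψ).comp (Bundle.contMDiff_proj (X.E i).fiber)).contMDiffAt, ?_⟩
  let y₀ := bs ψ p₀.proj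
  let V := (Y.E i).nhd y₀
  let e := trivializationAt (EuclideanSpace ℝ (Fin (Y.E i).rank)) (Y.E i).fiber y₀
  change ContMDiffAt _ _ _ (fun p : (X.E i).Total => (e ⟨bs ψ p.proj, fib ψ i p.proj p.snd⟩).2) p₀
  have hp₀ : p₀ ∈ (X.E i).totalOver (preB ψ V) := (Y.E i).mem_nhd y₀
  rw [← contMDiffAt_subtype_iff (U := (X.E i).totalOver (preB ψ V)) (x := ⟨p₀, hp₀⟩)]
  have hcoord : ∀ k, ContMDiff (X.E i).model 𝓘(ℝ, ℝ) ∞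
      (fun p : (X.E i).totalOver (preB ψ V) =>
        (e ⟨bs ψ p.1.proj, fib ψ i p.1.proj p.1.snd⟩).2 k) := by
    intro k
    refine ContMDiff.congr (isSmoothDual_fibDual ψ ((Y.E i).coframeAt y₀ k)) fun p => ?_
    rw [← dual_fib]
    exact (VBundle.coframe_apply (e := e) p.2 k _).symm
  have h := ((EuclideanSpace.equiv (Fin (Y.E i).rank) ℝ).symm : (Fin (Y.E i).rank → ℝ) →L[ℝ]
    EuclideanSpace ℝ (Fin (Y.E i).rank)).contMDiff.comp (contMDiff_pi_space.2 hcoord)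
  exact h.contMDiffAt

theorem conv_inc_eq {E : Fin n → Type} [∀ i, AddCommGroup (E i)] [∀ i, Module ℝ (E i)]
    (μ : Tot E →ₗ[ℝ] Tot E ⊗[ℝ] Tot E) (i j k : Fin n) (ξ : Module.Dual ℝ (E i))
    (η : Module.Dual ℝ (E j)) (w : E k) :
    pair₂ (ext₁ i ξ) (ext₁ j η) (μ (inc E k w)) = dualMul μ i j k ξ η w := rfl

theorem fibDual_dualMul (x : X.M.carrier) {i j k : Fin n} (hk : wt i + wt j = wt k)
    (ξ : Module.Dual ℝ ((Y.E i).fiber (bs ψ x))) (η : Module.Dual ℝ ((Y.E j).fiber (bs ψ x))) :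
    fibDual ψ k x (dualMul (Y.μ (bs ψ x)) i j k ξ η) =
      dualMul (X.μ x) i j k (fibDual ψ i x ξ) (fibDual ψ j x η) := by
  let V : Opens Y.M.carrier := (Y.E i).nhd (bs ψ x) ⊓ (Y.E j).nhd (bs ψ x)
  have hx : bs ψ x ∈ V := ⟨(Y.E i).mem_nhd (bs ψ x), (Y.E j).mem_nhd (bs ψ x)⟩
  let a := VBundle.resDual (V := V) inf_le_left (VBundle.extDual (bs ψ x) ξ)
  let b := VBundle.resDual (V := V) inf_le_right (VBundle.extDual (bs ψ x) η)
  have ha : a.1 ⟨bs ψ x, hx⟩ = ξ := VBundle.extDual_apply _ ξ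
  have hb : b.1 ⟨bs ψ x, hx⟩ = η := VBundle.extDual_apply _ η
  have h := congrArg (fun q => val (preB ψ V) ⟨x, hx⟩ (pullC ψ V (toS V q)))
    (genQ_mul_genQ hk a b)
  simp only [map_mul] at h
  rw [pullC_genQ_eq, pullC_genQ_eq, pullC_genQ_eq, pullAt_eq, pullAt_eq, pullAt_eq,
    DualAlg.gen_mul_gen hk] at h
  have h' := congrArg (DualAlg.comp (X.isCoalg x) k) h
  rw [DualAlg.comp_gen_self, DualAlg.comp_gen_self, ha, hb] at h'
  change _ = fibDual ψ k x (dualMul (Y.μ (bs ψ x)) i j k (a.1 ⟨bs ψ x, hx⟩) (b.1 ⟨bs ψ x, hx⟩))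
    at h'
  rw [ha, hb] at h'
  exact h'.symm

/-- The morphism of coalgebra bundles of a morphism of graded manifolds. -/
def ofGrMfdHom : X ⟶ Y where
  base := bs ψ
  smooth_base := contMDiff_bs ψ
  map := fib ψ
  smooth_map := contMDiff_fib ψ
  comul x v := by
    refine tensor_ext fun i j ξ η => ?_
    rw [pair₂_map]
    have hlin : pair₂ (ext₁ i ξ) (ext₁ j η) ∘ₗ Y.μ (bs ψ x) ∘ₗ totMap (fun i => fib ψ i x) =
        pair₂ (ext₁ i ξ ∘ₗ totMap fun i => fib ψ i x) (ext₁ j η ∘ₗ totMap fun i => fib ψ i x) ∘ₗ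
          X.μ x := by
      refine dual_tot_ext fun k => LinearMap.ext fun w => ?_
      change pair₂ (ext₁ i ξ) (ext₁ j η) (Y.μ (bs ψ x) (totMap (fun i => fib ψ i x) (inc _ k w))) =
        dualMul (X.μ x) i j k ((fib ψ i x).dualMap ξ) ((fib ψ j x).dualMap η) w
      rw [totMap_inc, conv_inc_eq, fib_dualMap, fib_dualMap]
      by_cases hk : wt i + wt j = wt k
      · rw [← fibDual_dualMul ψ x hk, ← dual_fib]
      · rw [dualMul_eq_zero (X.isCoalg x) hk, dualMul_eq_zero (Y.isCoalg _) hk]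
        rfl
    exact LinearMap.congr_fun hlin v

theorem toGrMfdMap_ofGrMfdHom : toGrMfdMap (ofGrMfdHom ψ) = ψ := by
  apply GrMfd.Hom.ext'
  apply InducedCategory.hom_ext
  refine AlgebraicGeometry.PresheafedSpace.hext _ _ rfl (heq_of_eq ?_)
  refine shf_hom_ext (TopCat.Sheaf.pushforward_sheaf_of_sheaf (baseHom (ofGrMfdHom ψ))
    X.toGrMfd.C.property) (fun U f => ?_) fun U k ξ => ?_
  · refine (pullSheaf_toShf (ofGrMfdHom ψ) U _).trans ?_
    rw [pullQuot_funQ]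
    exact (pullC_funQ ψ U f).symm
  · refine (pullSheaf_toShf (ofGrMfdHom ψ) U _).trans ?_
    rw [pullQuot_genQ]
    refine Eq.trans ?_ (pullC_genQ ψ U k ξ).symm
    refine congrArg (fun a => toS (preB ψ U) (genQ (preB ψ U) k a)) (Subtype.ext ?_)
    funext x
    exact LinearMap.congr_fun (fib_dualMap ψ k x) _

end Full

instance geometrization_faithful : (geometrization n).Faithful where
  map_injective h := toGrMfdMap_injective h

instance geometrization_full : (geometrization n).Full where
  map_surjective ψ := ⟨ofGrMfdHom ψ, toGrMfdMap_ofGrMfdHom ψ⟩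


end CoalgBundle

/-! ### Comparison of sheaves through a common sheaf of functions -/

section Compare

variable {T : TopCat.{0}}

theorem shfVal_injective {R : T → Type} [∀ x, Ring (R x)] [∀ x, Algebra ℝ (R x)]
    {P : TopCat.Presheaf (AlgCat.{0} ℝ) T} {v : ∀ (U : Opens T) (x : U), P.obj (op U) →ₐ[ℝ] R x}
    {hv : ∀ (U V : Opens T) (i : V ≤ U) (x : V) (s : P.obj (op U)),
      v V x (res P i s) = v U ⟨x, i x.2⟩ s}
    (hinj : ∀ (U : Opens T) (p q : P.obj (op U)), (∀ x, v U x p = v U x q) → p = q)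
    {U : Opens T} {s t : (shf P).obj (op U)} (h : ∀ x, shfVal v hv U x s = shfVal v hv U x t) :
    s = t := by
  refine shf_eq_of_locally_eq s t fun x hx => ?_
  obtain ⟨V, i, hxV, p, hp⟩ := exists_locally_eq_toShf P s hx
  obtain ⟨W, j, hxW, q, hq⟩ := exists_locally_eq_toShf P t hx
  let N := V ⊓ W
  have hN : N ≤ U := inf_le_left.trans i
  have h₁ : res (shf P) hN s = toShf P N (res P inf_le_left p) := by
    rw [← res_toShf, ← hp, res_res]
  have h₂ : res (shf P) hN t = toShf P N (res P inf_le_right q) := by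
    rw [← res_toShf, ← hq, res_res]
  refine ⟨N, hN, ⟨hxV, hxW⟩, ?_⟩
  rw [h₁, h₂]
  congr 1
  refine hinj _ _ _ fun y => ?_
  rw [← shfVal_toShf (hv := hv), ← shfVal_toShf (hv := hv), ← h₁, ← h₂, shfVal_res, shfVal_res, h]

variable {C D Q : TopCat.Presheaf (AlgCat.{0} ℝ) T}

/-- Sections of a sheaf `D` embedded in a sheaf `Q` can be found locally. -/
theorem exists_preimage_of_locally (hD : TopCat.Presheaf.IsSheaf D)
    (hQ : TopCat.Presheaf.IsSheaf Q) (b : D ⟶ Q)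
    (hb : ∀ U : Opens T, Function.Injective (b.app (op U)).hom) {U : Opens T} (q : Q.obj (op U))
    (h : ∀ x ∈ U, ∃ (V : Opens T) (i : V ≤ U), x ∈ V ∧ ∃ t, (b.app (op V)).hom t = res Q i q) :
    ∃ t, (b.app (op U)).hom t = q := by
  choose! V i hxV t ht using h
  obtain ⟨s, hs, -⟩ := TopCat.Sheaf.existsUnique_gluing' ⟨D, hD⟩ (fun x : U => V x) U
    (fun x => homOfLE (i x x.2)) (fun x hx => Opens.mem_iSup.2 ⟨⟨x, hx⟩, hxV x hx⟩)
    (fun x => t x) (by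
      intro x y
      apply hb
      refine (app_res b (inf_le_left : V x ⊓ V y ≤ V x) _).trans
        (Eq.trans ?_ (app_res b (inf_le_right : V x ⊓ V y ≤ V y) _).symm)
      rw [ht x x.2, ht y y.2, res_res, res_res])
  refine ⟨s, eq_of_locally_eq ⟨Q, hQ⟩ _ _ fun x hx => ⟨V x, i x hx, hxV x hx, ?_⟩⟩
  refine (app_res b (i x hx) s).symm.trans (Eq.trans ?_ (ht x hx))
  exact congrArg (b.app (op (V x))).hom (hs ⟨x, hx⟩)

theorem exists_lift_of_locally (hD : TopCat.Presheaf.IsSheaf D)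
    (hQ : TopCat.Presheaf.IsSheaf Q) (a : C ⟶ Q) (b : D ⟶ Q)
    (hb : ∀ U : Opens T, Function.Injective (b.app (op U)).hom)
    (h : ∀ (U : Opens T) (s : C.obj (op U)), ∀ x ∈ U, ∃ (V : Opens T) (i : V ≤ U), x ∈ V ∧
      ∃ t, (b.app (op V)).hom t = res Q i ((a.app (op U)).hom s)) :
    ∃ f : C ⟶ D, ∀ (U : Opens T) s, (b.app (op U)).hom ((f.app (op U)).hom s) =
      (a.app (op U)).hom s := by
  have hex : ∀ (U : Opens T) (s : C.obj (op U)), ∃ t, (b.app (op U)).hom t =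
      (a.app (op U)).hom s := fun U s =>
    exists_preimage_of_locally hD hQ b hb _ (h U s)
  choose f hf using hex
  let F : ∀ U : Opens T, C.obj (op U) →ₐ[ℝ] D.obj (op U) := fun U =>
    { toFun := f U
      map_one' := hb U (by rw [hf, map_one, map_one])
      map_mul' := fun x y => hb U (by rw [hf, map_mul, map_mul, hf, hf])
      map_zero' := hb U (by rw [hf, map_zero, map_zero])
      map_add' := fun x y => hb U (by rw [hf, map_add, map_add, hf, hf])
      commutes' := fun r => hb U (by rw [hf, AlgHom.commutes, AlgHom.commutes]) }
  refine ⟨{ app := fun U => AlgCat.ofHom (F U.unop), naturality := ?_ }, fun U s => hf U s⟩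
  intro U V i
  apply AlgCat.hom_ext
  apply AlgHom.ext
  intro s
  apply hb V.unop
  have h₁ : (b.app (op V.unop)).hom (f V.unop (res C i.unop.le s)) =
      res Q i.unop.le ((a.app (op U.unop)).hom s) :=
    (hf _ _).trans (app_res a i.unop.le s)
  have h₂ : (b.app (op V.unop)).hom (res D i.unop.le (f U.unop s)) =
      res Q i.unop.le ((a.app (op U.unop)).hom s) :=
    (app_res b i.unop.le _).trans (congrArg _ (hf _ _))
  exact h₁.trans h₂.symm

/-- Two sheaves embedded in a third one are isomorphic if they locally have the same sections. -/
theorem exists_iso_of_locally (hC : TopCat.Presheaf.IsSheaf C) (hD : TopCat.Presheaf.IsSheaf D)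
    (hQ : TopCat.Presheaf.IsSheaf Q) (a : C ⟶ Q) (b : D ⟶ Q)
    (ha : ∀ U : Opens T, Function.Injective (a.app (op U)).hom)
    (hb : ∀ U : Opens T, Function.Injective (b.app (op U)).hom)
    (h : ∀ (U : Opens T) (s : C.obj (op U)), ∀ x ∈ U, ∃ (V : Opens T) (i : V ≤ U), x ∈ V ∧
      ∃ t, (b.app (op V)).hom t = res Q i ((a.app (op U)).hom s))
    (h' : ∀ (U : Opens T) (s : D.obj (op U)), ∀ x ∈ U, ∃ (V : Opens T) (i : V ≤ U), x ∈ V ∧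
      ∃ t, (a.app (op V)).hom t = res Q i ((b.app (op U)).hom s)) :
    ∃ e : C ≅ D, ∀ (U : Opens T) s, (b.app (op U)).hom ((e.hom.app (op U)).hom s) =
      (a.app (op U)).hom s := by
  obtain ⟨f, hf⟩ := exists_lift_of_locally hD hQ a b hb h
  obtain ⟨g, hg⟩ := exists_lift_of_locally hC hQ b a ha h'
  refine ⟨⟨f, g, ?_, ?_⟩, hf⟩
  · apply NatTrans.ext
    funext U
    apply AlgCat.hom_ext
    apply AlgHom.ext
    intro s
    exact ha U.unop ((hg U.unop _).trans (hf U.unop s))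
  · apply NatTrans.ext
    funext U
    apply AlgCat.hom_ext
    apply AlgHom.ext
    intro s
    exact hb U.unop ((hf U.unop _).trans (hg U.unop s))

end Compare

/-! ### Values of the functions on the model space -/

namespace GrMfd

variable {M : Mfd} {n : ℕ} {m : Fin n → ℕ}

/-- The sections of the model presheaf. -/
abbrev Model (M : Mfd) {n : ℕ} (m : Fin n → ℕ) (W : Opens M.carrier) : Type :=
  C^∞⟮𝓡 M.dim, W; 𝓘(ℝ, ℝ), ℝ⟯ ⊗[ℝ] GSym (fun i => Fin (m i) → ℝ)

/-- The value at a point of a section of the model presheaf. -/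
def modelEval (m : Fin n → ℕ) {W : Opens M.carrier} (y : W) :
    Model M m W →ₐ[ℝ] GSym (fun i => Fin (m i) → ℝ) :=
  Algebra.TensorProduct.lift
    ((Algebra.ofId ℝ (GSym fun i => Fin (m i) → ℝ)).comp
      { toFun := fun f : C^∞⟮𝓡 M.dim, W; 𝓘(ℝ, ℝ), ℝ⟯ => f y
        map_one' := rfl
        map_mul' := fun _ _ => rfl
        map_zero' := rfl
        map_add' := fun _ _ => rfl
        commutes' := fun _ => rfl }) (AlgHom.id ℝ _)
    (fun f b => Algebra.commutes (f y) b)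

theorem modelEval_tmul {W : Opens M.carrier} (y : W) (f : C^∞⟮𝓡 M.dim, W; 𝓘(ℝ, ℝ), ℝ⟯)
    (b : GSym (fun i => Fin (m i) → ℝ)) : modelEval m y (f ⊗ₜ b) = f y • b := by
  refine (Algebra.TensorProduct.lift_tmul _ _ _ _ _).trans ?_
  exact (Algebra.smul_def (f y) b).symm

theorem modelEval_res {W W' : Opens M.carrier} (i : W' ≤ W) (y : W') (t : Model M m W) :
    modelEval m y (res (modelPresheaf M m) i t) = modelEval m ⟨y, i y.2⟩ t := by
  have h : (modelEval m y).comp (Algebra.TensorProduct.map (restrictSmooth M i)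
      (AlgHom.id ℝ _)) = modelEval m (⟨y, i y.2⟩ : W) := by
    apply Algebra.TensorProduct.ext'
    intro f b
    rw [AlgHom.comp_apply, Algebra.TensorProduct.map_tmul, modelEval_tmul, modelEval_tmul]
    rfl
  exact DFunLike.congr_fun h t

theorem modelEval_injective {W : Opens M.carrier} {s t : Model M m W}
    (h : ∀ y : W, modelEval m y s = modelEval m y t) : s = t := by
  let β := Module.Free.chooseBasis ℝ (GSym (fun i => Fin (m i) → ℝ))
  have key : ∀ (y : W) (t : Model M m W) k,
      (TensorProduct.equivFinsuppOfBasisRight β t k) y = β.repr (modelEval m y t) k := by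
    intro y t k
    induction t using TensorProduct.induction_on with
    | zero => simp
    | tmul f b =>
      rw [TensorProduct.equivFinsuppOfBasisRight_apply_tmul_apply, modelEval_tmul, map_smul]
      exact mul_comm _ _
    | add s t hs ht =>
      rw [map_add, map_add, map_add, Finsupp.add_apply, Finsupp.add_apply, ← hs, ← ht]
      rfl
  apply (TensorProduct.equivFinsuppOfBasisRight β).injective
  ext k y
  rw [key, key, h]

theorem modelEval_mem {l : ℕ} {W : Opens M.carrier} {t : Model M m W}
    (ht : t ∈ modelDeg M m l W) (y : W) :
    modelEval m y t ∈ GSym.deg (fun i => Fin (m i) → ℝ) l := by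
  induction ht using Submodule.span_induction with
  | mem t ht =>
    obtain ⟨f, b, hb, rfl⟩ := ht
    rw [modelEval_tmul]
    exact Submodule.smul_mem _ _ hb
  | zero => rw [map_zero]; exact zero_mem _
  | add s t _ _ h₁ h₂ => rw [map_add]; exact add_mem h₁ h₂
  | smul r t _ h => rw [map_smul]; exact Submodule.smul_mem _ r h

theorem iSup_modelDeg (W : Opens M.carrier) : ⨆ l, modelDeg M m l W = ⊤ := by
  rw [eq_top_iff]
  intro t _
  induction t using TensorProduct.induction_on with
  | zero => exact zero_mem _
  | tmul f b =>
    obtain ⟨s, N, hs, rfl⟩ := GSym.exists_sum_deg b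
    rw [TensorProduct.tmul_sum]
    exact Submodule.sum_mem _ fun l _ => Submodule.mem_iSup_of_mem l
      (Submodule.subset_span ⟨f, s l, hs l, rfl⟩)
  | add s t hs ht => exact add_mem (hs trivial) (ht trivial)

theorem mem_modelDeg {l : ℕ} {W : Opens M.carrier} {t : Model M m W}
    (ht : ∀ y : W, modelEval m y t ∈ GSym.deg (fun i => Fin (m i) → ℝ) l) :
    t ∈ modelDeg M m l W := by
  have hs : t ∈ ⨆ l, modelDeg M m l W := by rw [iSup_modelDeg]; trivial
  obtain ⟨f, hf, hsum⟩ := (Submodule.mem_iSup_iff_exists_finsupp _ _).1 hs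
  let N : ℕ := f.support.sup id + 1
  have hN : ∑ k ∈ Finset.range N, f k = t := by
    rw [← hsum]
    refine (Finsupp.sum_of_support_subset f (fun k hk => Finset.mem_range.2
      (Nat.lt_succ_of_le (Finset.le_sup (f := id) hk))) (fun _ y => y) (fun _ _ => rfl)).symm
  have hzero : ∀ k ∈ Finset.range N, k ≠ l → f k = 0 := by
    intro k hk hkl
    refine modelEval_injective fun y => ?_
    rw [map_zero]
    refine iSupIndep.eq_of_sum_mem GSym.iSupIndep_deg (s := fun k => modelEval m y (f k))
      (fun k => modelEval_mem (hf k) y) (k := l) (N := N) ?_ hk hkl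
    rw [← map_sum, hN]
    exact ht y
  rw [← hN]
  refine Submodule.sum_mem _ fun k hk => ?_
  by_cases hkl : k = l
  · exact hkl ▸ hf k
  · rw [hzero k hk hkl]
    exact zero_mem _

/-- A point of an open subset of the open subset `U`, as a point of the manifold. -/
abbrev ptOf {U : Opens M.carrier} {W : Opens (TopCat.of U)} (y : W) : (openFunctor U).obj W :=
  ⟨y.1.1, ⟨y.1, y.2, rfl⟩⟩

/-- The value at a point of a section of the sheafification of the model presheaf. -/
def modelVal (m : Fin n → ℕ) (U : Opens M.carrier) (W : Opens (TopCat.of U)) (y : W) :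
    (shf (restrictTo (modelPresheaf M m) U)).obj (op W) →ₐ[ℝ] GSym (fun i => Fin (m i) → ℝ) :=
  shfVal (T := TopCat.of U) (P := restrictTo (modelPresheaf M m) U)
    (R := fun _ => GSym (fun i => Fin (m i) → ℝ)) (fun _ y => modelEval m (ptOf y))
    (fun _ _ i y t => modelEval_res (((openFunctor U).map (homOfLE i)).le) (ptOf y) t) W y

variable {U : Opens M.carrier}

theorem modelVal_toShf (W : Opens (TopCat.of U)) (y : W)
    (t : (restrictTo (modelPresheaf M m) U).obj (op W)) :
    modelVal m U W y (toShf (restrictTo (modelPresheaf M m) U) W t) = modelEval m (ptOf y) t :=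
  shfVal_toShf (T := TopCat.of U) (P := restrictTo (modelPresheaf M m) U)
    (R := fun _ => GSym (fun i => Fin (m i) → ℝ)) (v := fun _ y => modelEval m (ptOf y))
    (hv := fun _ _ i y t => modelEval_res (((openFunctor U).map (homOfLE i)).le) (ptOf y) t) W y t

theorem modelVal_res {W W' : Opens (TopCat.of U)} (i : W' ≤ W) (y : W')
    (s : (shf (restrictTo (modelPresheaf M m) U)).obj (op W)) :
    modelVal m U W' y (res (shf (restrictTo (modelPresheaf M m) U)) i s) =
      modelVal m U W ⟨y, i y.2⟩ s :=
  shfVal_res (T := TopCat.of U) (P := restrictTo (modelPresheaf M m) U)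
    (R := fun _ => GSym (fun i => Fin (m i) → ℝ)) (v := fun _ y => modelEval m (ptOf y))
    (hv := fun _ _ i y t => modelEval_res (((openFunctor U).map (homOfLE i)).le) (ptOf y) t) i y s

theorem modelVal_injective {W : Opens (TopCat.of U)}
    {s t : (shf (restrictTo (modelPresheaf M m) U)).obj (op W)}
    (h : ∀ y : W, modelVal m U W y s = modelVal m U W y t) : s = t :=
  shfVal_injective (T := TopCat.of U) (P := restrictTo (modelPresheaf M m) U)
    (R := fun _ => GSym (fun i => Fin (m i) → ℝ)) (v := fun _ y => modelEval m (ptOf y))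
    (hv := fun _ _ i y t => modelEval_res (((openFunctor U).map (homOfLE i)).le) (ptOf y) t)
    (fun W' p q hpq => modelEval_injective (W := (openFunctor U).obj W') (by
      rintro ⟨_, y, hy, rfl⟩
      exact hpq ⟨y, hy⟩)) h

/-- Homogeneity of sections of the model sheaf can be tested in each point. -/
theorem locallyIn_modelDeg_iff {l : ℕ} {W : Opens (TopCat.of U)}
    {s : (shf (restrictTo (modelPresheaf M m) U)).obj (op W)} :
    LocallyIn (restrictTo (modelPresheaf M m) U)
      (fun W' => modelDeg M m l ((openFunctor U).obj W')) W s ↔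
        ∀ y : W, modelVal m U W y s ∈ GSym.deg (fun i => Fin (m i) → ℝ) l := by
  constructor
  · intro h y
    obtain ⟨V, i, hyV, p, hp, hs⟩ := h y y.2
    have h₁ := modelVal_res i ⟨y, hyV⟩ s
    rw [← h₁]
    have h₂ := (congrArg (modelVal m U V ⟨y, hyV⟩) hs).trans (modelVal_toShf V ⟨y, hyV⟩ p)
    exact h₂ ▸ modelEval_mem hp _
  · intro h x hx
    obtain ⟨V, i, hxV, p, hp⟩ := exists_locally_eq_toShf _ s hx
    refine ⟨V, i, hxV, p, mem_modelDeg ?_, hp⟩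
    rintro ⟨_, y, hy, rfl⟩
    have h₁ := (congrArg (modelVal m U V ⟨y, hy⟩) hp).trans (modelVal_toShf V ⟨y, hy⟩ p)
    rw [modelVal_res] at h₁
    exact h₁ ▸ h _

end GrMfd

/-! ### Local descriptions of the sheaf of functions of a coalgebra bundle -/

/-- A morphism from a graded symmetric algebra that preserves the degree of the generators preserves
all degrees. -/
theorem GSym.algHom_mem {n : ℕ} {V : Fin n → Type} [∀ i, AddCommGroup (V i)]
    [∀ i, Module ℝ (V i)] {A : Type} [Ring A] [Algebra ℝ A] (F : GSym V →ₐ[ℝ] A)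
    (d : ℕ → Submodule ℝ A) (one : 1 ∈ d 0)
    (mul : ∀ k l a b, a ∈ d k → b ∈ d l → a * b ∈ d (k + l))
    (gen : ∀ i v, F (GSym.ι i v) ∈ d (wt i)) {l : ℕ} {x : GSym V} (hx : x ∈ GSym.deg V l) :
    F x ∈ d l := by
  induction hx using Submodule.span_induction with
  | mem b hb =>
    obtain ⟨L, rfl, rfl⟩ := hb
    induction L with
    | nil => simpa using one
    | cons q L ih =>
      rw [List.map_cons, List.map_cons, List.prod_cons, List.sum_cons, map_mul]
      exact mul _ _ _ _ (gen q.1 q.2) ih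
  | zero => rw [map_zero]; exact zero_mem _
  | add s t _ _ h₁ h₂ => rw [map_add]; exact add_mem h₁ h₂
  | smul r t _ h => rw [map_smul]; exact Submodule.smul_mem _ r h

namespace CoalgBundle

variable {n : ℕ} {X : CoalgBundle n} {m : Fin n → ℕ}

section Phi

variable {U : Opens X.M.carrier} (v : ∀ i, Fin (m i) → (X.E i).smoothDual U)

/-- The linear maps to the fibres of the dual bundles given by smooth sections. -/
def jAt (y : U) (i : Fin n) : (Fin (m i) → ℝ) →ₗ[ℝ] Module.Dual ℝ ((X.E i).fiber y) :=
  Fintype.linearCombination ℝ fun a => (v i a).1 y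

variable {W : Opens X.M.carrier} (h : W ≤ U)

/-- The linear maps to the smooth sections of the dual bundles given by smooth sections. -/
def secLin (i : Fin n) : (Fin (m i) → ℝ) →ₗ[ℝ] (X.E i).smoothDual W :=
  Fintype.linearCombination ℝ fun a => VBundle.resDual h (v i a)

theorem secLin_apply (i : Fin n) (c : Fin (m i) → ℝ) (y : W) :
    (secLin v h i c).1 y = jAt v ⟨y, h y.2⟩ i c := by
  rw [secLin, Fintype.linearCombination_apply, VBundle.smoothDual_sum_apply, jAt,
    Fintype.linearCombination_apply]
  rfl

/-- The polynomials in the given sections of the dual bundles. -/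
def symQ : GSym (fun i => Fin (m i) → ℝ) →ₐ[ℝ] X.Quot W :=
  GSym.lift (fun i => genQ W i ∘ₗ secLin v h i) fun i j _ _ => genQ_comm i j _ _

theorem symQ_ι (i : Fin n) (c : Fin (m i) → ℝ) :
    symQ v h (GSym.ι (V := fun i => Fin (m i) → ℝ) i c) = genQ W i (secLin v h i c) :=
  GSym.lift_ι (V := fun i => Fin (m i) → ℝ) _ _ i c

/-- The polynomials in the given sections of the dual bundles, with smooth coefficients. -/
def phi : GrMfd.Model X.M m W →ₐ[ℝ] X.Quot W :=
  Algebra.TensorProduct.lift (funQ W) (symQ v h) fun f _ => funQ_comm f _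

theorem phi_tmul (f : X.Fun W) (b : GSym (fun i => Fin (m i) → ℝ)) :
    phi v h (f ⊗ₜ b) = funQ W f * symQ v h b :=
  Algebra.TensorProduct.lift_tmul _ _ _ _ _

theorem quotVal_symQ (y : W) (b : GSym (fun i => Fin (m i) → ℝ)) :
    quotVal W y (symQ v h b) = toDual (X.isCoalg y) (jAt v ⟨y, h y.2⟩) b := by
  have key : (quotVal W y).comp (symQ v h) = toDual (X.isCoalg y) (jAt v ⟨y, h y.2⟩) := by
    refine GSym.hom_ext fun i c => ?_
    rw [AlgHom.comp_apply, symQ_ι, quotVal_genQ, secLin_apply]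
    exact (toDual_ι (V := fun i => Fin (m i) → ℝ) i c).symm
  exact DFunLike.congr_fun key b

theorem symQ_mem {l : ℕ} {b : GSym (fun i => Fin (m i) → ℝ)} (hb : b ∈ GSym.deg _ l) :
    symQ v h b ∈ X.quotDeg l W :=
  GSym.algHom_mem (V := fun i => Fin (m i) → ℝ) (symQ v h) (fun l => X.quotDeg l W)
    (X.quotDeg_one W) (fun _ _ _ _ => X.quotDeg_mul)
    (fun i c => (symQ_ι v h i c).symm ▸ genQ_mem W i _) hb

theorem phi_mem {l : ℕ} {t : GrMfd.Model X.M m W} (ht : t ∈ GrMfd.modelDeg X.M m l W) :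
    phi v h t ∈ X.quotDeg l W := by
  induction ht using Submodule.span_induction with
  | mem t ht =>
    obtain ⟨f, b, hb, rfl⟩ := ht
    rw [phi_tmul]
    have := X.quotDeg_mul (funQ_mem W f) (symQ_mem v h hb)
    rwa [zero_add] at this
  | zero => rw [map_zero]; exact zero_mem _
  | add s t _ _ h₁ h₂ => rw [map_add]; exact add_mem h₁ h₂
  | smul r t _ h => rw [map_smul]; exact Submodule.smul_mem _ r h

theorem exists_symQ_eq_genQ {i : Fin n} (b : GSym.deg (fun i => Fin (m i) → ℝ) (wt i)) :
    ∃ ζ : (X.E i).smoothDual W, toS W (symQ v h b.1) = toS W (genQ W i ζ) ∧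
      ∀ y : W, ζ.1 y = toDualDeg (X.isCoalg y) (jAt v ⟨y, h y.2⟩) i b := by
  obtain ⟨ζ, hζ⟩ := exists_eq_genQ (X := X) (U := W) (k := i) (s := toS W (symQ v h b.1))
    (locallyIn_toShf (symQ_mem v h b.2))
  refine ⟨ζ, hζ, fun y => ?_⟩
  have h₁ : val W y (toS W (symQ v h b.1)) = _ := val_toShf W y _
  rw [quotVal_symQ] at h₁
  have h₂ := h₁.symm.trans ((congrArg (val W y) hζ).trans (val_genQ W y i ζ))
  rw [← gen_toDualDeg] at h₂
  have h₃ := congrArg (DualAlg.comp (X.isCoalg y) i) h₂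
  rw [DualAlg.comp_gen_self, DualAlg.comp_gen_self] at h₃
  exact h₃.symm

variable (hJ : ∀ (y : U) (i : Fin n), Function.Bijective (toDualDeg (X.isCoalg y) (jAt v y) i))

include hJ

theorem genQ_mem_range {x : X.M.carrier} (hx : x ∈ W) (i : Fin n) (ξ : (X.E i).smoothDual W) :
    toS W (genQ W i ξ) ∈ ((toS W).comp (phi v h)).range := by
  let β := Module.finBasis ℝ (GSym.deg (fun i => Fin (m i) → ℝ) (wt i))
  let J := fun y : W => LinearEquiv.ofBijective _ (hJ ⟨y, h y.2⟩ i)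
  choose ζ hζ hζJ using fun k => exists_symQ_eq_genQ v h (β k)
  have hcard : Fintype.card (Fin (Module.finrank ℝ
      (GSym.deg (fun i => Fin (m i) → ℝ) (wt i)))) = (X.E i).rank := by
    rw [Fintype.card_fin, (J ⟨x, hx⟩).finrank_eq, Subspace.dual_finrank_eq]
    exact VBundle.finrank_fiber x
  have hlin : ∀ y : W, LinearIndependent ℝ fun k => (ζ k).1 y := by
    intro y
    have h₁ : (fun k => (ζ k).1 y) = (J y).toLinearMap ∘ β := funext fun k => hζJ k y
    rw [h₁]
    exact β.linearIndependent.map' (J y).toLinearMap (J y).ker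
  let f : Fin _ → W → ℝ := fun k y => β.repr ((J y).symm (ξ.1 y)) k
  have hf : ∀ y, ξ.1 y = ∑ k, f k y • (ζ k).1 y := by
    intro y
    have h₁ := congrArg (J y) (β.sum_repr ((J y).symm (ξ.1 y)))
    rw [LinearEquiv.apply_symm_apply, map_sum] at h₁
    rw [← h₁]
    refine Finset.sum_congr rfl fun k _ => ?_
    rw [map_smul, hζJ]
    rfl
  have hsm := VBundle.contMDiff_coeff (E := X.E i) (fun k => (ζ k).1) (fun k => (ζ k).2) hcard
    hlin ξ.2 hf
  let F : Fin _ → X.Fun W := fun k => ⟨f k, hsm k⟩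
  refine ⟨∑ k, F k ⊗ₜ (β k).1, ?_⟩
  have hξ : ξ = ∑ k, VBundle.funSmul (F k) (ζ k) := by
    apply Subtype.ext
    funext y
    rw [VBundle.smoothDual_sum_apply]
    exact hf y
  rw [hξ, map_sum, map_sum, map_sum]
  refine Finset.sum_congr rfl fun k _ => ?_
  rw [← funQ_mul_genQ, map_mul, ← hζ k, ← map_mul, ← phi_tmul]
  rfl

/-- If smooth sections generate the algebras dual to the coalgebras freely in degrees up to `n`, then
the functions locally are polynomials in these sections, with smooth coefficients. -/
theorem exists_locally_eq_phi (s : (shf X.quotPresheaf).obj (op W)) {x : X.M.carrier}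
    (hx : x ∈ W) : ∃ (V : Opens X.M.carrier) (i : V ≤ W), x ∈ V ∧ ∃ t,
      res (shf X.quotPresheaf) i s = toS V (phi v (i.trans h) t) := by
  obtain ⟨V, i, hxV, p, hp⟩ := exists_locally_eq_toShf X.quotPresheaf s hx
  obtain ⟨q, rfl⟩ := X.quotMk_surjective V p
  obtain ⟨V', i', hxV', hq⟩ := q.2 x hxV
  have hV : V' ≤ U := (i'.trans i).trans h
  refine ⟨V', i'.trans i, hxV', ?_⟩
  have hmem : ∀ r ∈ ⨆ l, X.monSym l V',
      toS V' (X.quotMk V' r) ∈ ((toS V').comp (phi v hV)).range := by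
    intro r hr
    induction hr using Submodule.iSup_induction' with
    | mem k t ht =>
      induction ht using Submodule.span_induction with
      | mem t ht =>
        obtain ⟨f, L, -, rfl⟩ := ht
        rw [map_mul, map_mul, map_list_prod, map_list_prod]
        refine mul_mem ⟨f ⊗ₜ 1, ?_⟩ (list_prod_mem ?_)
        · change toS V' (phi v hV _) = toS V' (funQ V' f)
          rw [phi_tmul, map_one, mul_one]
        · intro a ha
          simp only [List.map_map, List.mem_map] at ha
          obtain ⟨q, -, rfl⟩ := ha
          exact genQ_mem_range v hV hJ hxV' q.1 q.2
      | zero => rw [map_zero, map_zero]; exact zero_mem _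
      | add x y _ _ h₁ h₂ => rw [map_add, map_add]; exact add_mem h₁ h₂
      | smul r x _ h => rw [map_smul, map_smul]; exact Subalgebra.smul_mem _ h r
    | zero => rw [map_zero, map_zero]; exact zero_mem _
    | add x y _ _ h₁ h₂ => rw [map_add, map_add]; exact add_mem h₁ h₂
  obtain ⟨t, ht⟩ := hmem _ (mem_iSup_monSym hq)
  refine ⟨t, Eq.trans ?_ ht.symm⟩
  refine (res_res (shf X.quotPresheaf) i i' s).symm.trans ?_
  refine (congrArg (res (shf X.quotPresheaf) i') hp).trans ?_
  exact (toS_res i' _).trans (congrArg (toS V') (restrictQuot_mk i' q))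

end Phi

/-! ### Values in a fixed algebra -/

/-- Linear maps from the fibres of the dual bundles to a fixed graded symmetric algebra that are
multiplicative as far as the product dual to the comultiplication is concerned. -/
structure FibreMap (X : CoalgBundle n) (m : Fin n → ℕ) where
  map : ∀ (y : X.M.carrier) (i : Fin n),
    Module.Dual ℝ ((X.E i).fiber y) →ₗ[ℝ] GSym (fun i => Fin (m i) → ℝ)
  mem : ∀ y i ξ, map y i ξ ∈ GSym.deg (fun i => Fin (m i) → ℝ) (wt i)
  mul : ∀ y i j k ξ η, wt i + wt j = wt k →
    map y k (dualMul (X.μ y) i j k ξ η) = map y i ξ * map y j η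

namespace FibreMap

variable (K : FibreMap X m)

/-- The value at a point of the elements of the quotient algebra. -/
def quotVal (U : Opens X.M.carrier) (y : U) : X.Quot U →ₐ[ℝ] GSym (fun i => Fin (m i) → ℝ) :=
  quotLift ((GSym.lift (K.map y) fun i j ξ η => GSym.mul_comm' (K.mem y i ξ) (K.mem y j η)).comp
    ((Pi.evalAlgHom ℝ (fun y : U => X.symFiber y) y).comp (X.symSec U).val)) (by
    rintro s t ⟨i, j, k, ξ, η, hk, -, -, hs, ht⟩
    change GSym.lift (K.map y) _ (s.1 y) = GSym.lift (K.map y) _ (t.1 y)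
    rw [hs, ht]
    change GSym.lift (K.map y) _ (GSym.ι i (ξ y) * GSym.ι j (η y)) =
      GSym.lift (K.map y) _ (GSym.ι k _)
    rw [map_mul, GSym.lift_ι, GSym.lift_ι, GSym.lift_ι]
    exact (K.mul y i j k _ _ hk).symm)

theorem quotVal_mk (U : Opens X.M.carrier) (y : U) (s : X.symSec U) :
    K.quotVal U y (X.quotMk U s) = GSym.lift (K.map y)
      (fun i j ξ η => GSym.mul_comm' (K.mem y i ξ) (K.mem y j η)) (s.1 y) :=
  quotLift_mk _ _ s

theorem quotVal_res {U V : Opens X.M.carrier} (i : V ≤ U) (x : V) (p : X.Quot U) :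
    K.quotVal V x (restrictQuot i p) = K.quotVal U ⟨x, i x.2⟩ p := by
  obtain ⟨s, rfl⟩ := X.quotMk_surjective U p
  rw [restrictQuot_mk, quotVal_mk, quotVal_mk]
  rfl

theorem quotVal_funQ (U : Opens X.M.carrier) (x : U) (f : X.Fun U) :
    K.quotVal U x (funQ U f) = algebraMap ℝ _ (f x) :=
  (K.quotVal_mk U x _).trans (AlgHom.commutes _ _)

theorem quotVal_genQ (U : Opens X.M.carrier) (x : U) (i : Fin n) (ξ : (X.E i).smoothDual U) :
    K.quotVal U x (genQ U i ξ) = K.map x i (ξ.1 x) :=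
  (K.quotVal_mk U x _).trans (GSym.lift_ι _ _ i _)

theorem quotVal_mem {l : ℕ} {U : Opens X.M.carrier} (y : U) {p : X.Quot U}
    (hp : p ∈ X.quotDeg l U) :
    K.quotVal U y p ∈ GSym.deg (fun i => Fin (m i) → ℝ) l := by
  obtain ⟨s, hs, rfl⟩ := hp
  change K.quotVal U y (X.quotMk U s) ∈ _
  rw [quotVal_mk]
  refine GSym.algHom_mem _ (GSym.deg fun i => Fin (m i) → ℝ) GSym.one_mem
    (fun _ _ _ _ => GSym.mul_mem) (fun i ξ => ?_) (hs y)
  rw [GSym.lift_ι]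
  exact K.mem y i ξ

/-- The value at a point of the sections of the sheaf `Γ_{Sym E*} / I_μ`. -/
def val (U : Opens X.M.carrier) (x : U) :
    (shf X.quotPresheaf).obj (op U) →ₐ[ℝ] GSym (fun i => Fin (m i) → ℝ) :=
  shfVal (T := TopCat.of X.M.carrier) (P := X.quotPresheaf)
    (R := fun _ => GSym (fun i => Fin (m i) → ℝ)) (fun U x => K.quotVal U x)
    (fun _ _ i x s => K.quotVal_res i x s) U x

theorem val_res {U V : Opens X.M.carrier} (i : V ≤ U) (x : V)
    (s : (shf X.quotPresheaf).obj (op U)) :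
    K.val V x (res (shf X.quotPresheaf) i s) = K.val U ⟨x, i x.2⟩ s :=
  shfVal_res (T := TopCat.of X.M.carrier) (P := X.quotPresheaf)
    (R := fun _ => GSym (fun i => Fin (m i) → ℝ)) (v := fun U x => K.quotVal U x)
    (hv := fun _ _ i x s => K.quotVal_res i x s) i x s

theorem val_toS (U : Opens X.M.carrier) (x : U) (p : X.Quot U) :
    K.val U x (toS U p) = K.quotVal U x p :=
  shfVal_toShf (T := TopCat.of X.M.carrier) (P := X.quotPresheaf)
    (R := fun _ => GSym (fun i => Fin (m i) → ℝ)) (v := fun U x => K.quotVal U x)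
    (hv := fun _ _ i x s => K.quotVal_res i x s) U x p

theorem val_mem {l : ℕ} {U : Opens X.M.carrier} {s : (shf X.quotPresheaf).obj (op U)}
    (hs : s ∈ X.sheafGrading.deg l U) (y : U) :
    K.val U y s ∈ GSym.deg (fun i => Fin (m i) → ℝ) l := by
  obtain ⟨V, i, hyV, p, hp, h⟩ := hs y y.2
  have h₁ := K.val_res i ⟨y, hyV⟩ s
  rw [← h₁]
  have h₂ := (congrArg (K.val V ⟨y, hyV⟩) h).trans (K.val_toS V ⟨y, hyV⟩ p)
  exact h₂ ▸ K.quotVal_mem _ hp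

variable {U : Opens X.M.carrier} (v : ∀ i, Fin (m i) → (X.E i).smoothDual U)
  (A : ∀ _ : U, GSym (fun i => Fin (m i) → ℝ) →ₐ[ℝ] GSym (fun i => Fin (m i) → ℝ))
  (hA : ∀ (y : U) (i : Fin n) (c : Fin (m i) → ℝ),
    A y (GSym.ι (V := fun i => Fin (m i) → ℝ) i c) = K.map y i (jAt v y i c))

include hA

theorem val_phi {W : Opens X.M.carrier} (h : W ≤ U) (t : GrMfd.Model X.M m W) (y : W) :
    K.val W y (toS W (phi v h t)) = A ⟨y, h y.2⟩ (GrMfd.modelEval m y t) := by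
  rw [val_toS]
  have h₁ : (K.quotVal W y).comp (symQ v h) = A ⟨y, h y.2⟩ := by
    refine GSym.hom_ext fun i c => ?_
    rw [AlgHom.comp_apply, symQ_ι, quotVal_genQ, secLin_apply, hA]
  have h₂ : (K.quotVal W y).comp (phi v h) = (A ⟨y, h y.2⟩).comp (GrMfd.modelEval m y) := by
    apply Algebra.TensorProduct.ext'
    intro f b
    rw [AlgHom.comp_apply, AlgHom.comp_apply, phi_tmul, GrMfd.modelEval_tmul, map_mul,
      quotVal_funQ, map_smul, Algebra.smul_def, ← h₁]
    rfl
  exact DFunLike.congr_fun h₂ t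

variable (hJ : ∀ (y : U) (i : Fin n), Function.Bijective (toDualDeg (X.isCoalg y) (jAt v y) i))

include hJ

theorem val_injective (hinj : ∀ y, Function.Injective (A y)) {W : Opens X.M.carrier} (h : W ≤ U)
    {s t : (shf X.quotPresheaf).obj (op W)} (hst : ∀ y : W, K.val W y s = K.val W y t) :
    s = t := by
  refine shf_eq_of_locally_eq (T := TopCat.of X.M.carrier) s t fun x hx => ?_
  obtain ⟨V, i, hxV, r, hr⟩ := exists_locally_eq_phi v h hJ (s - t) hx
  refine ⟨V, i, hxV, sub_eq_zero.1 ?_⟩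
  rw [← map_sub]
  refine hr.trans ?_
  have hr0 : r = 0 := by
    refine GrMfd.modelEval_injective fun y => hinj ⟨y, h (i y.2)⟩ ?_
    rw [← K.val_phi v A hA (i.trans h) r y, ← hr, K.val_res, map_sub, hst, sub_self, map_zero,
      map_zero]
  rw [hr0, map_zero, map_zero]

theorem mem_deg_of_val_mem {l : ℕ}
    (hdeg : ∀ y b, A y b ∈ GSym.deg (fun i => Fin (m i) → ℝ) l →
      b ∈ GSym.deg (fun i => Fin (m i) → ℝ) l) {W : Opens X.M.carrier} (h : W ≤ U)
    {s : (shf X.quotPresheaf).obj (op W)}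
    (hs : ∀ y : W, K.val W y s ∈ GSym.deg (fun i => Fin (m i) → ℝ) l) :
    s ∈ X.sheafGrading.deg l W := by
  intro x hx
  obtain ⟨V, i, hxV, r, hr⟩ := exists_locally_eq_phi v h hJ s hx
  refine ⟨V, i, hxV, phi v (i.trans h) r, phi_mem v _ (GrMfd.mem_modelDeg fun y => ?_), hr⟩
  refine hdeg ⟨y, h (i y.2)⟩ _ ?_
  rw [← K.val_phi v A hA (i.trans h) r y, ← hr, K.val_res]
  exact hs _

end FibreMap

end CoalgBundle

/-! ### Open subsets of open subsets -/

/-- The part of an open subset of the manifold in the open subset `U`. -/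
def Mfd.inter {M : Mfd} (U V : Opens M.carrier) : Opens (TopCat.of U) :=
  ⟨Subtype.val ⁻¹' V, V.isOpen.preimage continuous_subtype_val⟩

theorem Mfd.openFunctor_inter_le {M : Mfd} (U V : Opens M.carrier) :
    (GrMfd.openFunctor U).obj (Mfd.inter U V) ≤ V := by
  rintro _ ⟨y, hy, rfl⟩
  exact hy

theorem Mfd.inter_le {M : Mfd} {U V : Opens M.carrier} {W : Opens (TopCat.of U)}
    (h : V ≤ (GrMfd.openFunctor U).obj W) : Mfd.inter U V ≤ W := by
  intro y hy
  obtain ⟨z, hz, hzy⟩ := h hy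
  exact Subtype.ext hzy ▸ hz

namespace CoalgBundle

variable {n : ℕ} {X : CoalgBundle n} {m : Fin n → ℕ}

/-! ### The functions of an admissible bundle form a graded manifold -/

section Chart

variable {U : Opens X.M.carrier} (v : ∀ i, Fin (m i) → (X.E i).smoothDual U)
  (hJ : ∀ (y : U) (i : Fin n), Function.Bijective (toDualDeg (X.isCoalg y) (jAt v y) i))

open Classical in
/-- The fibre maps given by sections that generate the dual algebras freely in degrees up to `n`;
they are zero outside of the domain of the sections. -/
def FibreMap.ofFrame : FibreMap X m where
  map y i := if hy : y ∈ U then (GSym.deg (fun i => Fin (m i) → ℝ) (wt i)).subtype ∘ₗ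
    (LinearEquiv.ofBijective _ (hJ ⟨y, hy⟩ i)).symm.toLinearMap else 0
  mem y i ξ := by
    split_ifs with hy
    · exact Subtype.property _
    · exact zero_mem _
  mul y i j k ξ η hk := by
    by_cases hy : y ∈ U
    · simp only [dif_pos hy]
      obtain ⟨s, rfl⟩ := (hJ ⟨y, hy⟩ i).2 ξ
      obtain ⟨t, rfl⟩ := (hJ ⟨y, hy⟩ j).2 η
      have h := toDualDeg_mul (h := X.isCoalg y) (j := jAt v ⟨y, hy⟩) hk s t
      have hs : ∀ i (s : GSym.deg (fun i => Fin (m i) → ℝ) (wt i)),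
          (LinearEquiv.ofBijective _ (hJ ⟨y, hy⟩ i)).symm
            (toDualDeg (X.isCoalg y) (jAt v ⟨y, hy⟩) i s) = s := fun i s =>
        (LinearEquiv.ofBijective _ (hJ ⟨y, hy⟩ i)).symm_apply_apply s
      simp only [LinearMap.comp_apply, LinearEquiv.coe_coe]
      rw [← h, hs, hs, hs]
      rfl
    · simp only [dif_neg hy, LinearMap.zero_apply, mul_zero]

theorem FibreMap.ofFrame_jAt (y : U) (i : Fin n) (c : Fin (m i) → ℝ) :
    (FibreMap.ofFrame v hJ).map y i (jAt v y i c) = GSym.ι (V := fun i => Fin (m i) → ℝ) i c := by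
  have h := (toDualDeg_ι (h := X.isCoalg y) (j := jAt v y) i c).symm
  simp only [FibreMap.ofFrame, dif_pos y.2]
  rw [h]
  exact congrArg Subtype.val ((LinearEquiv.ofBijective _ (hJ y i)).symm_apply_apply _)

include hJ in
/-- Smooth sections that generate the dual algebras freely in degrees up to `n` give a chart. -/
theorem exists_chart : ∃ e : GrMfd.restrictTo (shf X.quotPresheaf) U ≅
    shf (T := TopCat.of U) (GrMfd.restrictTo (GrMfd.modelPresheaf X.M m) U),
    ∀ (l : ℕ) (W : Opens (TopCat.of U))
      (s : (GrMfd.restrictTo (shf X.quotPresheaf) U).obj (op W)),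
        s ∈ X.sheafGrading.deg l ((GrMfd.openFunctor U).obj W) ↔
          LocallyIn (GrMfd.restrictTo (GrMfd.modelPresheaf X.M m) U)
            (fun W' => GrMfd.modelDeg X.M m l ((GrMfd.openFunctor U).obj W')) W
            ((e.hom.app (op W)).hom s) := by
  let K := FibreMap.ofFrame v hJ
  let A : ∀ y : U, GSym (fun i => Fin (m i) → ℝ) →ₐ[ℝ] GSym (fun i => Fin (m i) → ℝ) :=
    fun _ => AlgHom.id ℝ _
  have hA : ∀ (y : U) (i : Fin n) (c : Fin (m i) → ℝ),
      A y (GSym.ι (V := fun i => Fin (m i) → ℝ) i c) = K.map y i (jAt v y i c) :=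
    fun y i c => (FibreMap.ofFrame_jAt v hJ y i c).symm
  let R : TopCat.of U → Type := fun _ => GSym (fun i => Fin (m i) → ℝ)
  let C := GrMfd.restrictTo (shf X.quotPresheaf) U
  let D := shf (T := TopCat.of U) (GrMfd.restrictTo (GrMfd.modelPresheaf X.M m) U)
  have hle : ∀ W : Opens (TopCat.of U), (GrMfd.openFunctor U).obj W ≤ U := by
    rintro W _ ⟨y, -, rfl⟩
    exact y.2
  let a : C ⟶ funPresheaf R := toFunPresheaf
    (fun W y => K.val ((GrMfd.openFunctor U).obj W) (GrMfd.ptOf y))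
    (fun _ _ i y s => K.val_res (((GrMfd.openFunctor U).map (homOfLE i)).le) (GrMfd.ptOf y) s)
  let b : D ⟶ funPresheaf R := toFunPresheaf (fun W y => GrMfd.modelVal m U W y)
    (fun _ _ i y s => GrMfd.modelVal_res i y s)
  have hC : TopCat.Presheaf.IsSheaf C :=
    TopCat.Presheaf.isSheaf_of_isOpenEmbedding (Opens.isOpenEmbedding (X := TopCat.of X.M.carrier) U)
      X.toGrMfd.C.property
  have hD : TopCat.Presheaf.IsSheaf D := ((presheafToSheaf (Opens.grothendieckTopology (TopCat.of U))
    (AlgCat.{0} ℝ)).obj (GrMfd.restrictTo (GrMfd.modelPresheaf X.M m) U)).property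
  have ha : ∀ W : Opens (TopCat.of U), Function.Injective (a.app (op W)).hom := by
    intro W s t hst
    refine K.val_injective v A hA hJ (fun _ => Function.injective_id) (hle W) ?_
    rintro ⟨_, y, hy, rfl⟩
    exact congrFun hst ⟨y, hy⟩
  have hb : ∀ W : Opens (TopCat.of U), Function.Injective (b.app (op W)).hom := by
    intro W s t hst
    exact GrMfd.modelVal_injective fun y => congrFun hst y
  have hab : ∀ (W : Opens (TopCat.of U)) (s : C.obj (op W)), ∀ x ∈ W,
      ∃ (V : Opens (TopCat.of U)) (i : V ≤ W), x ∈ V ∧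
        ∃ t, (b.app (op V)).hom t = res (funPresheaf R) i ((a.app (op W)).hom s) := by
    intro W s x hx
    obtain ⟨V, i, hxV, t, ht⟩ := exists_locally_eq_phi v (hle W) hJ s (x := x.1) ⟨x, hx, rfl⟩
    refine ⟨Mfd.inter U V, Mfd.inter_le i, hxV, toShf (T := TopCat.of U) _ _
      (res (GrMfd.modelPresheaf X.M m) (Mfd.openFunctor_inter_le U V) t), ?_⟩
    funext y
    have h₁ := (GrMfd.modelVal_toShf (m := m) (Mfd.inter U V) y
      (res (GrMfd.modelPresheaf X.M m) (Mfd.openFunctor_inter_le U V) t)).trans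
        (GrMfd.modelEval_res (Mfd.openFunctor_inter_le U V) (GrMfd.ptOf y) t)
    have h₂ := K.val_phi v A hA (i.trans (hle W)) t ⟨y.1.1, y.2⟩
    rw [← ht, K.val_res] at h₂
    exact h₁.trans h₂.symm
  have hba : ∀ (W : Opens (TopCat.of U)) (s : D.obj (op W)), ∀ x ∈ W,
      ∃ (V : Opens (TopCat.of U)) (i : V ≤ W), x ∈ V ∧
        ∃ t, (a.app (op V)).hom t = res (funPresheaf R) i ((b.app (op W)).hom s) := by
    intro W s x hx
    obtain ⟨V, i, hxV, t, ht⟩ := exists_locally_eq_toShf _ s hx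
    refine ⟨V, i, hxV, toS ((GrMfd.openFunctor U).obj V) (phi v (hle V) t), ?_⟩
    funext y
    have h₁ := K.val_phi v A hA (hle V) t (GrMfd.ptOf y)
    have h₂ := GrMfd.modelVal_toShf (m := m) V y t
    rw [← ht, GrMfd.modelVal_res] at h₂
    exact h₁.trans h₂.symm
  obtain ⟨e, he⟩ := exists_iso_of_locally hC hD (funPresheaf_isSheaf R) a b ha hb hab hba
  refine ⟨e, fun l W s => ?_⟩
  rw [GrMfd.locallyIn_modelDeg_iff]
  have h : ∀ y : W, GrMfd.modelVal m U W y ((e.hom.app (op W)).hom s) =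
      K.val ((GrMfd.openFunctor U).obj W) (GrMfd.ptOf y) s := fun y => congrFun (he W s) y
  constructor
  · intro hs y
    rw [h]
    exact K.val_mem hs _
  · intro hs
    refine K.mem_deg_of_val_mem v A hA hJ (fun _ _ hb => hb) (hle W) ?_
    rintro ⟨_, y, hy, rfl⟩
    exact h ⟨y, hy⟩ ▸ hs ⟨y, hy⟩

end Chart

theorem finrank_deg_of_bijective {x : X.M.carrier}
    {j : ∀ i, (Fin (m i) → ℝ) →ₗ[ℝ] Module.Dual ℝ ((X.E i).fiber x)} {i : Fin n}
    (hJ : Function.Bijective (toDualDeg (X.isCoalg x) j i)) :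
    Module.finrank ℝ (GSym.deg (fun i => Fin (m i) → ℝ) (wt i)) = (X.E i).rank := by
  rw [(LinearEquiv.ofBijective _ hJ).finrank_eq, Subspace.dual_finrank_eq]
  exact VBundle.finrank_fiber x

/-- Generators of the dual algebra in one point extend to smooth sections that generate the dual
algebras in the neighbouring points. -/
theorem exists_frame (x : X.M.carrier)
    (j : ∀ i, (Fin (m i) → ℝ) →ₗ[ℝ] Module.Dual ℝ ((X.E i).fiber x))
    (hJ : ∀ i, Function.Bijective (toDualDeg (X.isCoalg x) j i)) :
    ∃ U : Opens X.M.carrier, x ∈ U ∧ ∃ v : ∀ i, Fin (m i) → (X.E i).smoothDual U,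
      ∀ (y : U) (i : Fin n), Function.Bijective (toDualDeg (X.isCoalg y) (jAt v y) i) := by
  let U₀ : Opens X.M.carrier := ⟨⋂ i, (X.E i).nhd x, isOpen_iInter_of_finite fun i =>
    ((X.E i).nhd x).isOpen⟩
  have hU₀ : ∀ i, U₀ ≤ (X.E i).nhd x := fun i y hy => Set.mem_iInter.1 hy i
  have hx₀ : x ∈ U₀ := Set.mem_iInter.2 fun i => (X.E i).mem_nhd x
  let v : ∀ i, Fin (m i) → (X.E i).smoothDual U₀ := fun i a =>
    VBundle.resDual (hU₀ i) (VBundle.extDual x (j i (Pi.single a 1)))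
  have hv : jAt v ⟨x, hx₀⟩ = j := by
    funext i
    refine LinearMap.pi_ext' fun a => LinearMap.ext_ring ?_
    rw [LinearMap.comp_apply, LinearMap.comp_apply, LinearMap.single_apply, jAt,
      Fintype.linearCombination_apply_single, one_smul]
    exact VBundle.extDual_apply x _
  let β := fun i : Fin n => Module.finBasis ℝ (GSym.deg (fun i => Fin (m i) → ℝ) (wt i))
  choose ζ hζ hζJ using fun i k => exists_symQ_eq_genQ v le_rfl (β i k)
  have hcard : ∀ i, Fintype.card (Fin (Module.finrank ℝ
      (GSym.deg (fun i => Fin (m i) → ℝ) (wt i)))) = (X.E i).rank := fun i => by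
    rw [Fintype.card_fin]
    exact finrank_deg_of_bijective (hJ i)
  have hlin : ∀ i, LinearIndependent ℝ fun k => (ζ i k).1 ⟨x, hx₀⟩ := fun i => by
    have h₁ : (fun k => (ζ i k).1 ⟨x, hx₀⟩) = toDualDeg (X.isCoalg x) j i ∘ β i :=
      funext fun k => (hζJ i k ⟨x, hx₀⟩).trans
        (congrArg (fun j => toDualDeg (X.isCoalg x) j i (β i k)) hv)
    rw [h₁]
    exact (β i).linearIndependent.map' _ (LinearMap.ker_eq_bot.2 (hJ i).1)
  choose V hV hxV hVlin using fun i => VBundle.exists_linearIndependent (E := X.E i)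
    (fun k => (ζ i k).1) (fun k => (ζ i k).2) (hcard i) (hlin i)
  let U : Opens X.M.carrier := U₀ ⊓ ⟨⋂ i, V i, isOpen_iInter_of_finite fun i => (V i).isOpen⟩
  have hUV : ∀ i, U ≤ V i := fun i y hy => Set.mem_iInter.1 hy.2 i
  have hUU₀ : U ≤ U₀ := inf_le_left
  refine ⟨U, ⟨hx₀, Set.mem_iInter.2 hxV⟩, fun i a => VBundle.resDual hUU₀ (v i a), fun y i => ?_⟩
  have h₁ : LinearIndependent ℝ fun k => (ζ i k).1 ⟨y, hUU₀ y.2⟩ := hVlin i ⟨y, hUV i y.2⟩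
  have h₂ : (fun k => (ζ i k).1 ⟨y, hUU₀ y.2⟩) =
      toDualDeg (X.isCoalg y) (jAt v ⟨y, hUU₀ y.2⟩) i ∘ β i :=
    funext fun k => hζJ i k ⟨y, hUU₀ y.2⟩
  rw [h₂] at h₁
  have hinj : Function.Injective (toDualDeg (X.isCoalg y) (jAt v ⟨y, hUU₀ y.2⟩) i) := by
    rw [← LinearMap.ker_eq_bot, LinearMap.ker_eq_bot']
    intro s hs
    rw [← (β i).sum_repr s, map_sum] at hs
    simp only [map_smul] at hs
    have h₃ := Fintype.linearIndependent_iff.1 h₁ _ hs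
    rw [← (β i).sum_repr s]
    exact Finset.sum_eq_zero fun k _ => by rw [h₃ k, zero_smul]
  have hfin : Module.finrank ℝ (GSym.deg (fun i => Fin (m i) → ℝ) (wt i)) =
      Module.finrank ℝ (Module.Dual ℝ ((X.E i).fiber y)) := by
    rw [Subspace.dual_finrank_eq, VBundle.finrank_fiber, ← hcard i, Fintype.card_fin]
  exact ⟨hinj, (LinearMap.injective_iff_surjective_of_finrank_eq_finrank hfin).1 hinj⟩

/-- In a point, a complement of the decomposable functionals generates the dual algebra freely. The
numbers of generators do not depend on the point, since they are determined by the ranks of the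
bundles. -/
theorem isNMfd_of_isAdmissible (hX : IsAdmissible n X) : GrMfd.IsNMfd n X.toGrMfd := by
  have hpt : ∀ x : X.M.carrier, ∃ (m : Fin n → ℕ)
      (j : ∀ i, (Fin (m i) → ℝ) →ₗ[ℝ] Module.Dual ℝ ((X.E i).fiber x)),
        ∀ i, Function.Bijective (toDualDeg (X.isCoalg x) j i) := by
    intro x
    obtain ⟨m, j, hinj, hspan⟩ := exists_complement_dualDec (X.μ x)
    exact ⟨m, j, toDualDeg_bijective (X.isCoalg x) (fun i hi => (hX x i hi).ge) j hinj hspan⟩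
  choose m j hJ using hpt
  have hm : ∀ x y, m x = m y := fun x y => GSym.eq_of_finrank_deg_eq fun i =>
    (finrank_deg_of_bijective (hJ x i)).trans (finrank_deg_of_bijective (hJ y i)).symm
  obtain ⟨m₀, hm₀⟩ : ∃ m₀, ∀ x, m x = m₀ := by
    rcases isEmpty_or_nonempty X.M.carrier with h | ⟨⟨x⟩⟩
    · exact ⟨0, fun x => (h.false x).elim⟩
    · exact ⟨m x, fun y => hm y x⟩
  refine ⟨m₀, fun x => ?_⟩
  obtain ⟨U, hxU, v, hv⟩ := exists_frame x (j x) (hJ x)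
  rw [← hm₀ x]
  exact ⟨U, hxU, exists_chart v hv⟩

end CoalgBundle

instance GSym.instNontrivial {n : ℕ} {V : Fin n → Type} [∀ i, AddCommGroup (V i)]
    [∀ i, Module ℝ (V i)] : Nontrivial (GSym V) :=
  (GSym.lift (A := ℝ) (V := V) (fun _ => 0) (by intros; simp)).toRingHom.domain_nontrivial

namespace GrMfd

variable {n : ℕ}

/-! ### Charts of graded manifolds -/

/-- A chart of a graded manifold: an isomorphism with the model over an open subset. -/
structure Chart (Z : GrMfd) (m : Fin n → ℕ) where
  U : Opens Z.M.carrier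
  e : restrictTo Z.C.obj U ≅ shf (T := TopCat.of U) (restrictTo (modelPresheaf Z.M m) U)
  mem_iff : ∀ (l : ℕ) (W : Opens (TopCat.of U)) (s : (restrictTo Z.C.obj U).obj (op W)),
    s ∈ Z.grading.deg l ((openFunctor U).obj W) ↔
      LocallyIn (restrictTo (modelPresheaf Z.M m) U)
        (fun W' => modelDeg Z.M m l ((openFunctor U).obj W')) W ((e.hom.app (op W)).hom s)

namespace Chart

variable {Z : GrMfd} {m : Fin n → ℕ} (a : Chart Z m)

/-- The isomorphism of a chart on the sections over a part of its domain. -/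
def toModel (W : Opens (TopCat.of a.U)) : Z.C.obj.obj (op ((openFunctor a.U).obj W)) →ₐ[ℝ]
    (shf (T := TopCat.of a.U) (restrictTo (modelPresheaf Z.M m) a.U)).obj (op W) :=
  (a.e.hom.app (op W)).hom

/-- The inverse of the isomorphism of a chart on the sections over a part of its domain. -/
def ofModel (W : Opens (TopCat.of a.U)) :
    (shf (T := TopCat.of a.U) (restrictTo (modelPresheaf Z.M m) a.U)).obj (op W) →ₐ[ℝ]
      Z.C.obj.obj (op ((openFunctor a.U).obj W)) :=
  (a.e.inv.app (op W)).hom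

theorem toModel_ofModel (W : Opens (TopCat.of a.U))
    (r : (shf (T := TopCat.of a.U) (restrictTo (modelPresheaf Z.M m) a.U)).obj (op W)) :
    a.toModel W (a.ofModel W r) = r :=
  congrArg (fun f : shf (T := TopCat.of a.U) (restrictTo (modelPresheaf Z.M m) a.U) ⟶ _ =>
    (f.app (op W)).hom r) a.e.inv_hom_id

theorem ofModel_toModel (W : Opens (TopCat.of a.U))
    (r : Z.C.obj.obj (op ((openFunctor a.U).obj W))) :
    a.ofModel W (a.toModel W r) = r :=
  congrArg (fun f : restrictTo Z.C.obj a.U ⟶ restrictTo Z.C.obj a.U =>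
    (f.app (op W)).hom r) a.e.hom_inv_id

theorem toModel_res {W W' : Opens (TopCat.of a.U)} (i : W' ≤ W)
    (i' : (openFunctor a.U).obj W' ≤ (openFunctor a.U).obj W)
    (s : Z.C.obj.obj (op ((openFunctor a.U).obj W))) :
    a.toModel W' (res Z.C.obj i' s) =
      res (shf (T := TopCat.of a.U) (restrictTo (modelPresheaf Z.M m) a.U)) i (a.toModel W s) :=
  app_res a.e.hom i s

theorem openFunctor_mono {W W' : Opens (TopCat.of a.U)} (i : W' ≤ W) :
    (openFunctor a.U).obj W' ≤ (openFunctor a.U).obj W :=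
  ((openFunctor a.U).map (homOfLE i)).le

/-- The value of a section of the structure sheaf at a point, in a chart. -/
def val (W : Opens Z.M.carrier) (y : Z.M.carrier) (hy : y ∈ W) (ha : y ∈ a.U) :
    Z.C.obj.obj (op W) →ₐ[ℝ] GSym (fun i => Fin (m i) → ℝ) :=
  (modelVal m a.U (Mfd.inter a.U W) ⟨⟨y, ha⟩, hy⟩).comp
    ((a.toModel (Mfd.inter a.U W)).comp (res Z.C.obj (Mfd.openFunctor_inter_le a.U W)))

theorem val_eq (W : Opens (TopCat.of a.U)) (y : Z.M.carrier) (ha : y ∈ a.U)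
    (hy : (⟨y, ha⟩ : a.U) ∈ W) (hy' : y ∈ (openFunctor a.U).obj W)
    (s : Z.C.obj.obj (op ((openFunctor a.U).obj W))) :
    a.val ((openFunctor a.U).obj W) y hy' ha s = modelVal m a.U W ⟨⟨y, ha⟩, hy⟩ (a.toModel W s) := by
  have hW : Mfd.inter a.U ((openFunctor a.U).obj W) ≤ W := Mfd.inter_le le_rfl
  refine Eq.trans ?_ (modelVal_res hW ⟨⟨y, ha⟩, hy'⟩ (a.toModel W s))
  exact congrArg (modelVal m a.U _ _) (a.toModel_res hW (a.openFunctor_mono hW) s)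

theorem val_res {W W' : Opens Z.M.carrier} (i : W' ≤ W) (y : Z.M.carrier) (hy : y ∈ W')
    (ha : y ∈ a.U) (s : Z.C.obj.obj (op W)) :
    a.val W' y hy ha (res Z.C.obj i s) = a.val W y (i hy) ha s := by
  have hi : Mfd.inter a.U W' ≤ Mfd.inter a.U W := fun z hz => i hz
  refine Eq.trans ?_ (modelVal_res hi ⟨⟨y, ha⟩, hy⟩
    (a.toModel (Mfd.inter a.U W) (res Z.C.obj (Mfd.openFunctor_inter_le a.U W) s)))
  refine congrArg (modelVal m a.U _ _) (Eq.trans ?_ (a.toModel_res hi (a.openFunctor_mono hi) _))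
  refine congrArg (a.toModel (Mfd.inter a.U W')) ?_
  exact (res_res Z.C.obj i (Mfd.openFunctor_inter_le a.U W') s).trans
    (res_res Z.C.obj (Mfd.openFunctor_inter_le a.U W) (a.openFunctor_mono hi) s).symm

theorem openFunctor_obj_inter {V : Opens Z.M.carrier} (hV : V ≤ a.U) :
    V ≤ (openFunctor a.U).obj (Mfd.inter a.U V) :=
  fun y hy => ⟨⟨y, hV hy⟩, hy, rfl⟩

theorem res_self {W : Opens Z.M.carrier} (h : W ≤ W) (s : Z.C.obj.obj (op W)) :
    res Z.C.obj h s = s :=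
  congrArg (fun f => AlgCat.Hom.hom f s) (Z.C.obj.map_id (op W))

theorem val_injective {W : Opens Z.M.carrier} (hW : W ≤ a.U) {s t : Z.C.obj.obj (op W)}
    (h : ∀ (y : Z.M.carrier) (hy : y ∈ W), a.val W y hy (hW hy) s = a.val W y hy (hW hy) t) :
    s = t := by
  have h₁ : res Z.C.obj (Mfd.openFunctor_inter_le a.U W) s =
      res Z.C.obj (Mfd.openFunctor_inter_le a.U W) t := by
    rw [← a.ofModel_toModel _ (res Z.C.obj (Mfd.openFunctor_inter_le a.U W) s),
      ← a.ofModel_toModel _ (res Z.C.obj (Mfd.openFunctor_inter_le a.U W) t)]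
    exact congrArg _ (modelVal_injective fun y => h y.1.1 y.2)
  have h₂ := congrArg (res Z.C.obj (a.openFunctor_obj_inter hW)) h₁
  rwa [res_res, res_res, res_self, res_self] at h₂

/-- The section of the structure sheaf given by a section of the model presheaf. -/
def sec {V : Opens Z.M.carrier} (hV : V ≤ a.U) : Model Z.M m V →ₐ[ℝ] Z.C.obj.obj (op V) :=
  (res Z.C.obj (a.openFunctor_obj_inter hV)).comp
    ((a.ofModel (Mfd.inter a.U V)).comp
      ((toShf (T := TopCat.of a.U) (restrictTo (modelPresheaf Z.M m) a.U) (Mfd.inter a.U V)).comp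
        (res (modelPresheaf Z.M m) (Mfd.openFunctor_inter_le a.U V))))

theorem val_sec {V : Opens Z.M.carrier} (hV : V ≤ a.U) (t : Model Z.M m V) (y : Z.M.carrier)
    (hy : y ∈ V) (ha : y ∈ a.U) : a.val V y hy ha (a.sec hV t) = modelEval m (⟨y, hy⟩ : V) t := by
  refine (a.val_res (a.openFunctor_obj_inter hV) y hy ha _).trans ?_
  refine (a.val_eq (Mfd.inter a.U V) y ha hy _ _).trans ?_
  refine (congrArg (modelVal m a.U _ _) (a.toModel_ofModel _ _)).trans ?_
  refine (modelVal_toShf _ _ _).trans ?_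
  exact modelEval_res (Mfd.openFunctor_inter_le a.U V) _ t

theorem sec_res {V V' : Opens Z.M.carrier} (hV : V ≤ a.U) (hV' : V' ≤ a.U) (i : V' ≤ V)
    (t : Model Z.M m V) :
    res Z.C.obj i (a.sec hV t) = a.sec hV' (res (modelPresheaf Z.M m) i t) := by
  refine a.val_injective hV' fun y hy => ?_
  rw [val_res, val_sec]
  exact ((a.val_sec hV' _ y hy _).trans (modelEval_res i ⟨y, hy⟩ t)).symm

theorem exists_locally_eq_sec {W : Opens Z.M.carrier} (s : Z.C.obj.obj (op W)) {y : Z.M.carrier}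
    (hy : y ∈ W) (hya : y ∈ a.U) : ∃ (V : Opens Z.M.carrier) (i : V ≤ W) (hV : V ≤ a.U),
      y ∈ V ∧ ∃ t, res Z.C.obj i s = a.sec hV t := by
  obtain ⟨V, i, hyV, t, ht⟩ := exists_locally_eq_toShf
    (restrictTo (modelPresheaf Z.M m) a.U) (a.toModel (Mfd.inter a.U W)
      (res Z.C.obj (Mfd.openFunctor_inter_le a.U W) s)) (x := ⟨y, hya⟩) hy
  have hV : (openFunctor a.U).obj V ≤ a.U := by
    rintro _ ⟨z, -, rfl⟩
    exact z.2
  have hi : (openFunctor a.U).obj V ≤ W := by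
    rintro _ ⟨z, hz, rfl⟩
    exact i hz
  refine ⟨(openFunctor a.U).obj V, hi, hV, ⟨⟨y, hya⟩, hyV, rfl⟩, t, ?_⟩
  refine a.val_injective hV fun z hz => ?_
  have hz' : (⟨z, hV hz⟩ : a.U) ∈ V := by
    obtain ⟨w, hw, rfl⟩ := hz
    exact hw
  refine (a.val_res hi z hz _ s).trans (Eq.trans ?_ (a.val_sec hV t z hz _).symm)
  have h₁ := congrArg (modelVal m a.U V ⟨⟨z, hV hz⟩, hz'⟩) ht
  exact (modelVal_res i ⟨⟨z, hV hz⟩, hz'⟩ _).symm.trans (h₁.trans (modelVal_toShf V _ t))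

theorem val_mem {l : ℕ} {W : Opens Z.M.carrier} {s : Z.C.obj.obj (op W)}
    (hs : s ∈ Z.grading.deg l W) (y : Z.M.carrier) (hy : y ∈ W) (ha : y ∈ a.U) :
    a.val W y hy ha s ∈ GSym.deg (fun i => Fin (m i) → ℝ) l := by
  have h₁ := Z.grading.restrict_mem l _ _ (Mfd.openFunctor_inter_le a.U W) s hs
  have h₂ := (a.mem_iff l (Mfd.inter a.U W) _).1 h₁
  exact locallyIn_modelDeg_iff.1 h₂ ⟨⟨y, ha⟩, hy⟩

theorem mem_deg_of_val_mem {l : ℕ} {W : Opens Z.M.carrier} (hW : W ≤ a.U)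
    {s : Z.C.obj.obj (op W)} (hs : ∀ (y : Z.M.carrier) (hy : y ∈ W),
      a.val W y hy (hW hy) s ∈ GSym.deg (fun i => Fin (m i) → ℝ) l) :
    s ∈ Z.grading.deg l W := by
  have h₁ : res Z.C.obj (Mfd.openFunctor_inter_le a.U W) s ∈
      Z.grading.deg l ((openFunctor a.U).obj (Mfd.inter a.U W)) :=
    (a.mem_iff l (Mfd.inter a.U W) _).2 (locallyIn_modelDeg_iff.2 fun y => hs y.1.1 y.2)
  have h₂ := Z.grading.restrict_mem l _ _ (a.openFunctor_obj_inter hW) _ h₁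
  have h₄ := (res_res Z.C.obj (Mfd.openFunctor_inter_le a.U W) (a.openFunctor_obj_inter hW) s).trans
    (res_self _ s)
  exact h₄ ▸ h₂

/-! ### Transition maps -/

variable (b c : Chart Z m)

/-- Smooth functions do not depend on the chart: an element of degree zero is a smooth function,
and its value at a point can be recovered from the invertibility of the elements of degree zero. -/
theorem val_sec_fun {V : Opens Z.M.carrier} (hV : V ≤ a.U) (f : C^∞⟮𝓡 Z.M.dim, V; 𝓘(ℝ, ℝ), ℝ⟯)
    (y : Z.M.carrier) (hy : y ∈ V) (hb : y ∈ b.U) :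
    b.val V y hy hb (a.sec hV (f ⊗ₜ 1)) = algebraMap ℝ _ (f ⟨y, hy⟩) := by
  have hmem : a.sec hV (f ⊗ₜ 1) ∈ Z.grading.deg 0 V := by
    refine a.mem_deg_of_val_mem hV fun y hy => ?_
    rw [val_sec, modelEval_tmul]
    exact Submodule.smul_mem _ _ GSym.one_mem
  obtain ⟨r, hr⟩ := GSym.mem_deg_zero (b.val_mem hmem y hy hb)
  let w : ∀ W : Opens Z.M.carrier, y ∈ W → C^∞⟮𝓡 Z.M.dim, W; 𝓘(ℝ, ℝ), ℝ⟯ →ₐ[ℝ]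
      GSym fun i => Fin (m i) → ℝ := fun W hW =>
    (b.val (W ⊓ a.U) y ⟨hW, hV hy⟩ hb).comp ((a.sec inf_le_right).comp
      (Algebra.TensorProduct.includeLeft.comp (restrictSmooth Z.M inf_le_left)))
  have key : ∀ (V W : Opens Z.M.carrier) (i : W ≤ V) (hV : V ≤ a.U) (hW : W ≤ a.U) (hy : y ∈ W)
      (f : C^∞⟮𝓡 Z.M.dim, V; 𝓘(ℝ, ℝ), ℝ⟯),
      b.val W y hy hb (a.sec hW (restrictSmooth Z.M i f ⊗ₜ 1)) =
        b.val V y (i hy) hb (a.sec hV (f ⊗ₜ 1)) := by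
    intro V W i hV hW hy f
    refine Eq.trans ?_ (b.val_res i y hy hb (a.sec hV (f ⊗ₜ 1)))
    refine congrArg (b.val W y hy hb) ?_
    exact ((a.sec_res hV hW i (f ⊗ₜ 1)).trans (congrArg (a.sec hW)
      (Algebra.TensorProduct.map_tmul _ _ _ _))).symm
  have hw : ∀ (W W' : Opens Z.M.carrier) (i : W' ≤ W) (hy : y ∈ W') g,
      w W' hy (restrictSmooth Z.M i g) = w W (i hy) g := by
    intro W W' i hy g
    exact key (W ⊓ a.U) (W' ⊓ a.U) (inf_le_inf_right _ i) inf_le_right inf_le_right _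
      (restrictSmooth Z.M inf_le_left g)
  have hr' : w V hy f = algebraMap ℝ _ r :=
    (key V (V ⊓ a.U) inf_le_left hV inf_le_right ⟨hy, hV hy⟩ f).trans hr
  rw [hr, eq_of_map_eq_algebraMap w hw hy f hr']

/-- The transition map from the chart `a` to the chart `b` at a point. -/
def trans (y : Z.M.carrier) (ha : y ∈ a.U) (hb : y ∈ b.U) :
    GSym (fun i => Fin (m i) → ℝ) →ₐ[ℝ] GSym (fun i => Fin (m i) → ℝ) :=
  (b.val a.U y ha hb).comp ((a.sec le_rfl).comp Algebra.TensorProduct.includeRight)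

theorem trans_modelEval {V : Opens Z.M.carrier} (hV : V ≤ a.U) (t : Model Z.M m V)
    (y : Z.M.carrier) (hy : y ∈ V) (hb : y ∈ b.U) :
    b.val V y hy hb (a.sec hV t) = a.trans b y (hV hy) hb (modelEval m (⟨y, hy⟩ : V) t) := by
  have h : (b.val V y hy hb).comp (a.sec hV) =
      (a.trans b y (hV hy) hb).comp (modelEval m (⟨y, hy⟩ : V)) := by
    apply Algebra.TensorProduct.ext'
    intro f s
    have h₁ : f ⊗ₜ s = (f ⊗ₜ 1 : Model Z.M m V) * (1 ⊗ₜ s) := by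
      rw [Algebra.TensorProduct.tmul_mul_tmul, one_mul, mul_one]
    have h₂ : b.val V y hy hb (a.sec hV (1 ⊗ₜ s)) = a.trans b y (hV hy) hb s := by
      refine Eq.trans ?_ (b.val_res hV y hy hb (a.sec le_rfl (1 ⊗ₜ s)))
      refine congrArg (b.val V y hy hb) ?_
      refine ((a.sec_res le_rfl hV hV (1 ⊗ₜ s)).trans (congrArg (a.sec hV) ?_)).symm
      exact (Algebra.TensorProduct.map_tmul _ _ _ _).trans (congrArg (· ⊗ₜ[ℝ] s) (map_one _))
    rw [AlgHom.comp_apply, AlgHom.comp_apply, modelEval_tmul, h₁, map_mul, map_mul, val_sec_fun,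
      h₂, map_smul, Algebra.smul_def]
  exact DFunLike.congr_fun h t

theorem trans_val {W : Opens Z.M.carrier} (s : Z.C.obj.obj (op W)) (y : Z.M.carrier) (hy : y ∈ W)
    (ha : y ∈ a.U) (hb : y ∈ b.U) :
    a.trans b y ha hb (a.val W y hy ha s) = b.val W y hy hb s := by
  obtain ⟨V, i, hV, hyV, t, ht⟩ := a.exists_locally_eq_sec s hy ha
  have h₁ := a.val_res i y hyV ha s
  have h₂ := b.val_res i y hyV hb s
  rw [ht] at h₁ h₂
  rw [val_sec] at h₁
  rw [trans_modelEval] at h₂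
  rw [← h₁, ← h₂]

theorem val_sec_one (s : GSym fun i => Fin (m i) → ℝ) (y : Z.M.carrier) (ha : y ∈ a.U) :
    a.val a.U y ha ha (a.sec le_rfl (1 ⊗ₜ s)) = s := by
  rw [val_sec, modelEval_tmul]
  exact one_smul ℝ s

theorem trans_self (y : Z.M.carrier) (ha ha' : y ∈ a.U) (s : GSym fun i => Fin (m i) → ℝ) :
    a.trans a y ha ha' s = s :=
  a.val_sec_one s y ha

theorem trans_trans (y : Z.M.carrier) (ha : y ∈ a.U) (hb : y ∈ b.U) (hc : y ∈ c.U)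
    (s : GSym fun i => Fin (m i) → ℝ) :
    b.trans c y hb hc (a.trans b y ha hb s) = a.trans c y ha hc s :=
  b.trans_val c (a.sec le_rfl (1 ⊗ₜ s)) y ha hb hc

theorem trans_trans_self (y : Z.M.carrier) (ha : y ∈ a.U) (hb : y ∈ b.U)
    (s : GSym fun i => Fin (m i) → ℝ) : b.trans a y hb ha (a.trans b y ha hb s) = s :=
  (a.trans_trans b a y ha hb ha s).trans (a.trans_self y ha ha s)

theorem trans_injective (y : Z.M.carrier) (ha : y ∈ a.U) (hb : y ∈ b.U) :
    Function.Injective (a.trans b y ha hb) :=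
  Function.LeftInverse.injective (a.trans_trans_self b y ha hb)

theorem trans_mem {l : ℕ} (y : Z.M.carrier) (ha : y ∈ a.U) (hb : y ∈ b.U)
    {s : GSym fun i => Fin (m i) → ℝ} (hs : s ∈ GSym.deg (fun i => Fin (m i) → ℝ) l) :
    a.trans b y ha hb s ∈ GSym.deg (fun i => Fin (m i) → ℝ) l := by
  refine b.val_mem (a.mem_deg_of_val_mem le_rfl fun z hz => ?_) y ha hb
  exact (a.val_sec_one s z hz).symm ▸ hs

theorem mem_of_trans_mem {l : ℕ} (y : Z.M.carrier) (ha : y ∈ a.U) (hb : y ∈ b.U)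
    {s : GSym fun i => Fin (m i) → ℝ}
    (hs : a.trans b y ha hb s ∈ GSym.deg (fun i => Fin (m i) → ℝ) l) :
    s ∈ GSym.deg (fun i => Fin (m i) → ℝ) l :=
  a.trans_trans_self b y ha hb s ▸ b.trans_mem a y hb ha hs

theorem contMDiff_modelEval (lam : (GSym fun i => Fin (m i) → ℝ) →ₗ[ℝ] ℝ)
    {V : Opens Z.M.carrier} (t : Model Z.M m V) :
    ContMDiff (𝓡 Z.M.dim) 𝓘(ℝ, ℝ) ∞ (fun y : V => lam (modelEval m y t)) := by
  induction t using TensorProduct.induction_on with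
  | zero => simpa using contMDiff_const
  | tmul f s =>
    simp only [modelEval_tmul, map_smul, smul_eq_mul]
    exact f.contMDiff.mul contMDiff_const
  | add s t hs ht =>
    simp only [map_add]
    exact hs.add ht

theorem contMDiff_trans (lam : (GSym fun i => Fin (m i) → ℝ) →ₗ[ℝ] ℝ)
    (s : GSym fun i => Fin (m i) → ℝ) : ContMDiff (𝓡 Z.M.dim) 𝓘(ℝ, ℝ) ∞
      (fun y : (a.U ⊓ b.U : Opens Z.M.carrier) => lam (a.trans b y y.2.1 y.2.2 s)) := by
  refine contMDiff_of_locally fun x hx => ?_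
  obtain ⟨V, i, hV, hxV, t, ht⟩ := b.exists_locally_eq_sec (a.sec le_rfl (1 ⊗ₜ s)) hx.1 hx.2
  refine ⟨V, fun y hy => ⟨i hy, hV hy⟩, hxV, (contMDiff_modelEval lam t).congr fun y => ?_⟩
  have h := b.val_res i y y.2 (hV y.2) (a.sec le_rfl (1 ⊗ₜ s))
  rw [ht, val_sec] at h
  exact congrArg lam h.symm

end Chart

end GrMfd

/-! ### The coalgebra dual to a truncated graded symmetric algebra -/

section DualCoalg

variable {n : ℕ} {V : Fin n → Type} [∀ i, AddCommGroup (V i)] [∀ i, Module ℝ (V i)]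
variable {E : Fin n → Type} [∀ i, AddCommGroup (E i)] [∀ i, Module ℝ (E i)]

theorem tensor_ext_three [∀ i, FiniteDimensional ℝ (E i)] {s t : Tot E ⊗[ℝ] (Tot E ⊗[ℝ] Tot E)}
    (h : ∀ (i j k : Fin n) (ξ : Module.Dual ℝ (E i)) (η : Module.Dual ℝ (E j))
      (ζ : Module.Dual ℝ (E k)), pair₂ (ext₁ i ξ) (pair₂ (ext₁ j η) (ext₁ k ζ)) s =
        pair₂ (ext₁ i ξ) (pair₂ (ext₁ j η) (ext₁ k ζ)) t) : s = t := by
  let b := Pi.basis fun i => Module.finBasis ℝ (E i)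
  let co : (Σ i, Fin (Module.finrank ℝ (E i))) → Module.Dual ℝ (Tot E) :=
    fun c => ext₁ c.1 ((Module.finBasis ℝ (E c.1)).coord c.2)
  have hco : ∀ c x, b.repr x c = co c x := fun c x => Pi.basis_repr _ _ _
  apply (b.tensorProduct (b.tensorProduct b)).repr.injective
  ext ⟨c, d, e⟩
  have key : ∀ s, (b.tensorProduct (b.tensorProduct b)).repr s (c, d, e) =
      pair₂ (co c) (pair₂ (co d) (co e)) s := by
    intro s
    have : Finsupp.lapply (c, d, e) ∘ₗ (b.tensorProduct (b.tensorProduct b)).repr.toLinearMap =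
        pair₂ (co c) (pair₂ (co d) (co e)) := by
      apply TensorProduct.ext'
      intro x y
      induction y with
      | zero => rw [TensorProduct.tmul_zero, map_zero, map_zero]
      | add y z hy hz => rw [TensorProduct.tmul_add, map_add, map_add, hy, hz]
      | tmul y z =>
        rw [LinearMap.comp_apply, LinearEquiv.coe_coe, Finsupp.lapply_apply,
          Module.Basis.tensorProduct_repr_tmul_apply, Module.Basis.tensorProduct_repr_tmul_apply,
          hco, hco, hco, pair₂_tmul, pair₂_tmul, smul_eq_mul, smul_eq_mul]
        ring
    exact LinearMap.congr_fun this s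
  rw [key, key]
  exact h _ _ _ _ _ _

/-- The product of homogeneous elements of the graded symmetric algebra. -/
def mulDeg {a b c : ℕ} (h : a + b = c) :
    GSym.deg V a →ₗ[ℝ] GSym.deg V b →ₗ[ℝ] GSym.deg V c :=
  LinearMap.mk₂ ℝ (fun s t => ⟨s.1 * t.1, h ▸ GSym.mul_mem s.2 t.2⟩)
    (fun _ _ _ => Subtype.ext (add_mul _ _ _)) (fun _ _ _ => Subtype.ext (smul_mul_assoc _ _ _))
    (fun _ _ _ => Subtype.ext (mul_add _ _ _)) (fun _ _ _ => Subtype.ext (mul_smul_comm _ _ _))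

variable (Q : ∀ i : Fin n, GSym.deg V (wt i) ≃ₗ[ℝ] Module.Dual ℝ (E i))

/-- The product of the graded symmetric algebra transported to the duals `(E i)*` and evaluated at
an element of `E k`. -/
def dualProd (k : Fin n) (w : E k) (i j : Fin n) :
    Module.Dual ℝ (E i) →ₗ[ℝ] Module.Dual ℝ (E j) →ₗ[ℝ] ℝ :=
  if h : wt i + wt j = wt k then
    ((mulDeg h).compl₁₂ (Q i).symm.toLinearMap (Q j).symm.toLinearMap).compr₂
      (LinearMap.applyₗ w ∘ₗ (Q k).toLinearMap)
  else 0

theorem dualProd_apply {i j k : Fin n} (h : wt i + wt j = wt k) (w : E k)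
    (s : GSym.deg V (wt i)) (t : GSym.deg V (wt j)) :
    dualProd Q k w i j (Q i s) (Q j t) = Q k (mulDeg h s t) w := by
  simp [dualProd, h]

theorem dualProd_eq_zero {i j k : Fin n} (h : wt i + wt j ≠ wt k) (w : E k) :
    dualProd Q k w i j = 0 :=
  dif_neg h

theorem dualProd_add (k : Fin n) (w w' : E k) (i j : Fin n) (ξ : Module.Dual ℝ (E i))
    (η : Module.Dual ℝ (E j)) :
    dualProd Q k (w + w') i j ξ η = dualProd Q k w i j ξ η + dualProd Q k w' i j ξ η := by
  by_cases h : wt i + wt j = wt k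
  · simp [dualProd, h]
  · simp [dualProd, h]

theorem dualProd_smul (k : Fin n) (r : ℝ) (w : E k) (i j : Fin n) (ξ : Module.Dual ℝ (E i))
    (η : Module.Dual ℝ (E j)) :
    dualProd Q k (r • w) i j ξ η = r * dualProd Q k w i j ξ η := by
  by_cases h : wt i + wt j = wt k
  · simp [dualProd, h]
  · simp [dualProd, h]

variable [∀ i, FiniteDimensional ℝ (E i)]

theorem exists_comul : ∃ μ : Tot E →ₗ[ℝ] Tot E ⊗[ℝ] Tot E,
    (∀ (k : Fin n) (w : E k) (i j : Fin n) (ξ : Module.Dual ℝ (E i)) (η : Module.Dual ℝ (E j)),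
      dualMul μ i j k ξ η w = dualProd Q k w i j ξ η) ∧
    ∀ (k : Fin n) (w : E k), μ (inc E k w) ∈ tensorWt E (wt k) := by
  choose e he hwt using fun (k : Fin n) (w : E k) => exists_tensor (dualProd Q k w)
  let μ' : ∀ k, E k →ₗ[ℝ] Tot E ⊗[ℝ] Tot E := fun k =>
    { toFun := e k
      map_add' := fun w w' => tensor_ext fun i j ξ η => by
        rw [map_add, he, he, he, dualProd_add]
      map_smul' := fun r w => tensor_ext fun i j ξ η => by
        rw [map_smul, he, he, dualProd_smul]; rfl }
  let μ : Tot E →ₗ[ℝ] Tot E ⊗[ℝ] Tot E := ∑ k, μ' k ∘ₗ prj E k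
  have hμ : ∀ k w, μ (inc E k w) = e k w := by
    intro k w
    rw [LinearMap.sum_apply, Finset.sum_eq_single k]
    · change e k (Pi.single k w k) = e k w
      rw [Pi.single_eq_same]
    · intro l _ hl
      change μ' l (Pi.single k w l) = 0
      rw [Pi.single_eq_of_ne hl, map_zero]
    · simp
  refine ⟨μ, fun k w i j ξ η => ?_, fun k w => ?_⟩
  · change pair₂ (ext₁ i ξ) (ext₁ j η) (μ (inc E k w)) = _
    rw [hμ, he]
  · rw [hμ]
    exact hwt k w _ fun i j hij => dualProd_eq_zero Q hij w

variable {μ : Tot E →ₗ[ℝ] Tot E ⊗[ℝ] Tot E}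

omit [∀ i, FiniteDimensional ℝ (E i)] in
theorem conv_eq_of_dualMul_eq (hμ : ∀ k w i j ξ η,
      dualMul μ i j k ξ η w = dualProd Q k w i j ξ η) {i j k : Fin n} (h : wt i + wt j = wt k)
    (s : GSym.deg V (wt i)) (t : GSym.deg V (wt j)) :
    conv μ (ext₁ i (Q i s)) (ext₁ j (Q j t)) = ext₁ k (Q k (mulDeg h s t)) := by
  refine dual_tot_ext fun l => LinearMap.ext fun w => ?_
  refine (hμ l w i j _ _).trans ?_
  by_cases hl : l = k
  · subst hl
    rw [ext₁_inc_self, dualProd_apply]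
  · rw [ext₁_inc_ne hl, dualProd_eq_zero Q (fun h' => hl (wt_injective (h'.symm.trans h)))]
    rfl

omit [∀ i, FiniteDimensional ℝ (E i)] in
theorem conv_eq_zero_of_dualMul_eq (hμ : ∀ k w i j ξ η,
      dualMul μ i j k ξ η w = dualProd Q k w i j ξ η) {i j : Fin n} (h : ¬ wt i + wt j ≤ n)
    (ξ : Module.Dual ℝ (E i)) (η : Module.Dual ℝ (E j)) : conv μ (ext₁ i ξ) (ext₁ j η) = 0 := by
  refine dual_tot_ext fun l => LinearMap.ext fun w => ?_
  refine (hμ l w i j _ _).trans ?_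
  rw [dualProd_eq_zero Q (fun h' => h (h'.le.trans (wt_le l)))]
  rfl

/-- The products of degree at most `n` in a graded symmetric algebra are dual to a coalgebra. -/
theorem exists_isCoalg : ∃ μ : Tot E →ₗ[ℝ] Tot E ⊗[ℝ] Tot E, IsCoalg μ ∧
    ∀ (i j k : Fin n) (h : wt i + wt j = wt k) (s : GSym.deg V (wt i)) (t : GSym.deg V (wt j)),
      dualMul μ i j k (Q i s) (Q j t) = Q k (mulDeg h s t) := by
  obtain ⟨μ, hμ, hdeg⟩ := exists_comul Q
  have hpos : ∀ i j : Fin n, 0 < wt i + wt j := fun i j => Nat.add_pos_left (wt_pos i) _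
  refine ⟨μ, ⟨hdeg, ?_, ?_⟩, fun i j k h s t => LinearMap.ext fun w =>
    (hμ k w i j _ _).trans (dualProd_apply Q h w s t)⟩
  · refine LinearMap.pi_ext fun l w => tensor_ext_three fun i j k ξ η ζ => ?_
    obtain ⟨s, rfl⟩ := (Q i).surjective ξ
    obtain ⟨t, rfl⟩ := (Q j).surjective η
    obtain ⟨u, rfl⟩ := (Q k).surjective ζ
    have hl : pair₂ (ext₁ i (Q i s)) (pair₂ (ext₁ j (Q j t)) (ext₁ k (Q k u)))
        (((TensorProduct.assoc ℝ (Tot E) (Tot E) (Tot E)).toLinearMap ∘ₗ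
          μ.rTensor (Tot E) ∘ₗ μ) (inc E l w)) =
        conv μ (conv μ (ext₁ i (Q i s)) (ext₁ j (Q j t))) (ext₁ k (Q k u)) (inc E l w) := by
      change _ = pair₂ (conv μ _ _) _ (μ (inc E l w))
      rw [pair₂_conv_left, pair₂_assoc]
      rfl
    have hr : pair₂ (ext₁ i (Q i s)) (pair₂ (ext₁ j (Q j t)) (ext₁ k (Q k u)))
        ((μ.lTensor (Tot E) ∘ₗ μ) (inc E l w)) =
        conv μ (ext₁ i (Q i s)) (conv μ (ext₁ j (Q j t)) (ext₁ k (Q k u))) (inc E l w) := by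
      change _ = pair₂ _ (conv μ _ _) (μ (inc E l w))
      rw [pair₂_conv_right]
      rfl
    refine hl.trans (Eq.trans ?_ hr.symm)
    by_cases hs : wt i + wt j + wt k = wt l
    · have hn := wt_le l
      have hi := wt_pos i
      have hk := wt_pos k
      obtain ⟨p, hp⟩ := exists_wt_eq (n := n) (hpos i j) (by omega)
      obtain ⟨q, hq⟩ := exists_wt_eq (n := n) (hpos j k) (by omega)
      rw [conv_eq_of_dualMul_eq Q hμ hp.symm, conv_eq_of_dualMul_eq Q hμ hq.symm,
        conv_eq_of_dualMul_eq Q hμ (k := l) (by omega),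
        conv_eq_of_dualMul_eq Q hμ (k := l) (by omega)]
      congr 3
      exact Subtype.ext (mul_assoc _ _ _)
    · have h₁ : conv μ (conv μ (ext₁ i (Q i s)) (ext₁ j (Q j t))) (ext₁ k (Q k u)) (inc E l w) =
          0 := by
        by_cases hij : wt i + wt j ≤ n
        · obtain ⟨p, hp⟩ := exists_wt_eq (hpos i j) hij
          rw [conv_eq_of_dualMul_eq Q hμ hp.symm]
          refine (hμ l w p k _ _).trans ?_
          rw [dualProd_eq_zero Q (by omega)]
          rfl
        · rw [conv_eq_zero_of_dualMul_eq Q hμ hij, conv_zero_left]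
          rfl
      have h₂ : conv μ (ext₁ i (Q i s)) (conv μ (ext₁ j (Q j t)) (ext₁ k (Q k u))) (inc E l w) =
          0 := by
        by_cases hjk : wt j + wt k ≤ n
        · obtain ⟨p, hp⟩ := exists_wt_eq (hpos j k) hjk
          rw [conv_eq_of_dualMul_eq Q hμ hp.symm]
          refine (hμ l w i p _ _).trans ?_
          rw [dualProd_eq_zero Q (by omega)]
          rfl
        · rw [conv_eq_zero_of_dualMul_eq Q hμ hjk, conv_zero_right]
          rfl
      rw [h₁, h₂]
  · refine LinearMap.pi_ext fun l w => tensor_ext fun i j ξ η => ?_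
    obtain ⟨s, rfl⟩ := (Q i).surjective ξ
    obtain ⟨t, rfl⟩ := (Q j).surjective η
    refine (pair₂_braid i j _ _ _).trans ?_
    change _ * dualMul μ j i l (Q j t) (Q i s) w = dualMul μ i j l (Q i s) (Q j t) w
    rw [hμ, hμ]
    by_cases h : wt i + wt j = wt l
    · have h' : wt j + wt i = wt l := (add_comm _ _).trans h
      have hst : mulDeg h s t = ((-1 : ℝ) ^ (wt i * wt j)) • mulDeg h' t s :=
        Subtype.ext (GSym.mul_comm' s.2 t.2)
      rw [dualProd_apply Q h, dualProd_apply Q h', hst, map_smul]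
      rfl
    · rw [dualProd_eq_zero Q h, dualProd_eq_zero Q (by rwa [add_comm]), LinearMap.zero_apply,
        LinearMap.zero_apply, mul_zero]
      rfl

omit [∀ i, FiniteDimensional ℝ (E i)] in
/-- A family of multiplicative maps is determined by its values on the generators. -/
theorem toDualDeg_eq (h : IsCoalg μ) (P : ∀ i : Fin n, GSym.deg V (wt i) →ₗ[ℝ] Module.Dual ℝ (E i))
    (hP : ∀ (i j k : Fin n) (h : wt i + wt j = wt k) (s : GSym.deg V (wt i))
      (t : GSym.deg V (wt j)), dualMul μ i j k (P i s) (P j t) = P k (mulDeg h s t))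
    (j : ∀ i, V i →ₗ[ℝ] Module.Dual ℝ (E i))
    (hj : ∀ i v, j i v = P i ⟨GSym.ι i v, GSym.ι_mem i v⟩) (i : Fin n) :
    toDualDeg h j i = P i := by
  have key : ∀ (l : ℕ) (i : Fin n), wt i = l → ∀ s : GSym.deg V (wt i),
      toDualDeg h j i s = P i s := by
    intro l
    induction l using Nat.strong_induction_on with
    | _ l ih =>
      rintro i rfl ⟨s, hs⟩
      suffices H : ∀ hs : s ∈ GSym.deg V (wt i), toDualDeg h j i ⟨s, hs⟩ = P i ⟨s, hs⟩ from H hs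
      -- homogeneity is part of the induction: the summands have the same degree
      suffices H : s ∈ GSym.deg V (wt i) ∧
          ∀ hs : s ∈ GSym.deg V (wt i), toDualDeg h j i ⟨s, hs⟩ = P i ⟨s, hs⟩ from H.2
      refine GSym.deg_induction (p := fun s => s ∈ GSym.deg V (wt i) ∧
          ∀ hs : s ∈ GSym.deg V (wt i), toDualDeg h j i ⟨s, hs⟩ = P i ⟨s, hs⟩)
        (wt_pos i) ?_ ⟨zero_mem _, fun _ => ?_⟩ ?_ hs
      · intro a v k x hk hx
        refine ⟨hk ▸ GSym.mul_mem (GSym.ι_mem a v) hx, fun hs => ?_⟩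
        rcases Nat.eq_zero_or_pos k with rfl | hk0
        · obtain rfl : a = i := wt_injective (by omega)
          obtain ⟨c, rfl⟩ := GSym.mem_deg_zero hx
          have hc : (⟨GSym.ι a v * algebraMap ℝ _ c, hs⟩ : GSym.deg V (wt a)) =
              c • ⟨GSym.ι a v, GSym.ι_mem a v⟩ := by
            refine Subtype.ext ?_
            change GSym.ι a v * algebraMap ℝ _ c = c • GSym.ι a v
            rw [← Algebra.commutes, ← Algebra.smul_def]
          rw [hc, map_smul, map_smul, toDualDeg_ι, hj]
        · have hi := wt_le i
          have ha := wt_pos a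
          obtain ⟨b, rfl⟩ := exists_wt_eq (n := n) hk0 (by omega)
          have h₁ := toDualDeg_mul (h := h) (j := j) hk ⟨GSym.ι a v, GSym.ι_mem a v⟩ ⟨x, hx⟩
          rw [toDualDeg_ι, ih (wt b) (by omega) b rfl, hj, hP _ _ _ hk] at h₁
          exact h₁
      · exact (map_zero _).trans (map_zero _).symm
      · rintro x y ⟨hx, hx'⟩ ⟨hy, hy'⟩
        refine ⟨add_mem hx hy, fun hs => ?_⟩
        have h₁ : (⟨x + y, hs⟩ : GSym.deg V (wt i)) = ⟨x, hx⟩ + ⟨y, hy⟩ := rfl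
        rw [h₁, map_add, map_add, hx' hx, hy' hy]
  exact LinearMap.ext fun s => key _ i rfl s

end DualCoalg

/-! ### Preduals of finite-dimensional spaces -/

section PreDual

variable (S : Type) [AddCommGroup S] [Module ℝ S] [FiniteDimensional ℝ S]

/-- A Euclidean space whose dual space is identified with `S`, by the choice of a basis. -/
abbrev PreDual : Type := EuclideanSpace ℝ (Fin (Module.finrank ℝ S))

/-- The identification of `S` with the dual space of `PreDual S`. -/
def preDualEquiv : S ≃ₗ[ℝ] Module.Dual ℝ (PreDual S) :=
  (Module.finBasis ℝ S).equiv
    (EuclideanSpace.basisFun (Fin (Module.finrank ℝ S)) ℝ).toBasis.dualBasis (Equiv.refl _)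

variable {S}

theorem preDualEquiv_apply (s : S) (v : PreDual S) :
    preDualEquiv S s v = ∑ k, (Module.finBasis ℝ S).repr s k * v k := by
  conv_lhs => rw [← (Module.finBasis ℝ S).sum_repr s]
  rw [map_sum, LinearMap.sum_apply]
  refine Finset.sum_congr rfl fun k _ => ?_
  rw [map_smul, preDualEquiv, Module.Basis.equiv_apply, LinearMap.smul_apply, smul_eq_mul]
  congr 1
  simp

theorem preDual_ext {v w : PreDual S} (h : ∀ s, preDualEquiv S s v = preDualEquiv S s w) :
    v = w := by
  refine (Module.forall_dual_apply_eq_zero_iff ℝ (v - w)).1 (fun ξ => ?_) |> sub_eq_zero.1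
  obtain ⟨s, rfl⟩ := (preDualEquiv S).surjective ξ
  rw [map_sub, h, sub_self]

/-- The map whose dual is a given endomorphism of `S`. -/
def preDualMap (T : S →ₗ[ℝ] S) : PreDual S →L[ℝ] PreDual S :=
  ∑ k, ∑ l, (Module.finBasis ℝ S).repr (T (Module.finBasis ℝ S k)) l •
    (EuclideanSpace.proj l : PreDual S →L[ℝ] ℝ).smulRight (EuclideanSpace.single k (1 : ℝ))

theorem preDualEquiv_preDualMap (T : S →ₗ[ℝ] S) (s : S) (v : PreDual S) :
    preDualEquiv S s (preDualMap T v) = preDualEquiv S (T s) v := by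
  have key : (LinearMap.applyₗ (preDualMap T v)) ∘ₗ (preDualEquiv S).toLinearMap =
      LinearMap.applyₗ v ∘ₗ (preDualEquiv S).toLinearMap ∘ₗ T := by
    refine (Module.finBasis ℝ S).ext fun k => ?_
    change preDualEquiv S (Module.finBasis ℝ S k) (preDualMap T v) =
      preDualEquiv S (T (Module.finBasis ℝ S k)) v
    rw [preDualEquiv_apply, preDualEquiv_apply]
    simp only [Module.Basis.repr_self]
    rw [Finset.sum_eq_single k]
    · simp [preDualMap, Finsupp.single_eq_same, Pi.single_apply, Finset.sum_ite_eq]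
    · intro l _ hl
      rw [Finsupp.single_eq_of_ne hl, zero_mul]
    · simp
  exact LinearMap.congr_fun key s

end PreDual

namespace GrMfd

variable {n : ℕ} {Z : GrMfd} {m : Fin n → ℕ}

/-! ### The bundles of a graded manifold -/

/-- The homogeneous parts of the graded symmetric algebra of the model. -/
abbrev modelPart (m : Fin n → ℕ) (i : Fin n) : Submodule ℝ (GSym fun i => Fin (m i) → ℝ) :=
  GSym.deg (fun i => Fin (m i) → ℝ) (wt i)

/-- The component of a transition map. -/
def Chart.transDeg (a b : Chart Z m) (y : Z.M.carrier) (ha : y ∈ a.U) (hb : y ∈ b.U) (i : Fin n) :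
    modelPart m i →ₗ[ℝ] modelPart m i :=
  (a.trans b y ha hb).toLinearMap.restrict fun _ hs => a.trans_mem b y ha hb hs

/-- An atlas of charts indexed by the points of the manifold. -/
structure Atlas (Z : GrMfd) (m : Fin n → ℕ) where
  chart : Z.M.carrier → Chart Z m
  mem : ∀ x, x ∈ (chart x).U

theorem exists_atlas (h : IsNMfd n Z) : ∃ m : Fin n → ℕ, Nonempty (Atlas Z m) := by
  obtain ⟨m, hm⟩ := h
  choose U hU e he using hm
  exact ⟨m, ⟨⟨fun x => ⟨U x, e x, he x⟩, hU⟩⟩⟩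

namespace Atlas

variable (A : Atlas Z m)

open Classical in
/-- The coordinate changes of the bundle `E i`, dual to the transition maps of the charts. -/
def coordChange (i : Fin n) (a b : Z.M.carrier) (y : Z.M.carrier) :
    PreDual (modelPart m i) →L[ℝ] PreDual (modelPart m i) :=
  if h : y ∈ (A.chart a).U ∧ y ∈ (A.chart b).U then
    preDualMap ((A.chart b).transDeg (A.chart a) y h.2 h.1 i) else 0

theorem preDualEquiv_coordChange {i : Fin n} {a b y : Z.M.carrier} (ha : y ∈ (A.chart a).U)
    (hb : y ∈ (A.chart b).U) (s : modelPart m i) (v : PreDual (modelPart m i)) :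
    preDualEquiv (modelPart m i) s (A.coordChange i a b y v) =
      preDualEquiv (modelPart m i) ((A.chart b).transDeg (A.chart a) y hb ha i s) v := by
  rw [coordChange, dif_pos ⟨ha, hb⟩, preDualEquiv_preDualMap]

theorem contMDiffOn_coordChange (i : Fin n) (a b : Z.M.carrier) :
    ContMDiffOn (𝓡 Z.M.dim)
      𝓘(ℝ, PreDual (modelPart m i) →L[ℝ] PreDual (modelPart m i)) ∞ (A.coordChange i a b)
      ((A.chart a).U ∩ (A.chart b).U) := by
  have h : ContMDiff (𝓡 Z.M.dim)
      𝓘(ℝ, PreDual (modelPart m i) →L[ℝ] PreDual (modelPart m i)) ∞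
      (fun y : ((A.chart b).U ⊓ (A.chart a).U : Opens Z.M.carrier) => A.coordChange i a b y) := by
    have h₁ : ∀ y : ((A.chart b).U ⊓ (A.chart a).U : Opens Z.M.carrier), A.coordChange i a b y =
        preDualMap ((A.chart b).transDeg (A.chart a) y y.2.1 y.2.2 i) := fun y => by
      rw [coordChange, dif_pos ⟨y.2.2, y.2.1⟩]
    simp only [h₁, preDualMap]
    refine contMDiff_finsetSum fun k _ => contMDiff_finsetSum fun l _ => ?_
    have hc : ContMDiff (𝓡 Z.M.dim) 𝓘(ℝ, ℝ) ∞
        (fun y : ((A.chart b).U ⊓ (A.chart a).U : Opens Z.M.carrier) =>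
          (Module.finBasis ℝ (modelPart m i)).repr ((A.chart b).transDeg (A.chart a) y y.2.1 y.2.2 i
            (Module.finBasis ℝ (modelPart m i) k)) l) := by
      obtain ⟨lam, hlam⟩ := LinearMap.exists_extend
        (Finsupp.lapply l ∘ₗ (Module.finBasis ℝ (modelPart m i)).repr.toLinearMap)
      refine ((A.chart b).contMDiff_trans (A.chart a) lam
        (Module.finBasis ℝ (modelPart m i) k).1).congr fun y => ?_
      exact (LinearMap.congr_fun hlam ((A.chart b).transDeg (A.chart a) y y.2.1 y.2.2 i
        (Module.finBasis ℝ (modelPart m i) k))).symm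
    exact hc.smul contMDiff_const
  intro x hx
  have h₂ := (contMDiffAt_subtype_iff (U := (A.chart b).U ⊓ (A.chart a).U)
    (f := A.coordChange i a b) (x := ⟨x, hx.2, hx.1⟩)).1 (h ⟨x, hx.2, hx.1⟩)
  exact h₂.contMDiffWithinAt

/-- The vector bundle `E i`, given by its coordinate changes. -/
def core (i : Fin n) : VectorBundleCore ℝ Z.M.carrier (PreDual (modelPart m i)) Z.M.carrier where
  baseSet a := (A.chart a).U
  isOpen_baseSet a := (A.chart a).U.isOpen
  indexAt x := x
  mem_baseSet_at := A.mem
  coordChange := A.coordChange i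
  coordChange_self a y hy v := by
    refine preDual_ext fun s => ?_
    rw [A.preDualEquiv_coordChange hy hy]
    congr 2
    exact Subtype.ext ((A.chart a).trans_self y hy hy s)
  continuousOn_coordChange a b := (A.contMDiffOn_coordChange i a b).continuousOn
  coordChange_comp a b c y hy v := by
    refine preDual_ext fun s => ?_
    rw [A.preDualEquiv_coordChange hy.1.2 hy.2, A.preDualEquiv_coordChange hy.1.1 hy.1.2,
      A.preDualEquiv_coordChange hy.1.1 hy.2]
    congr 2
    exact Subtype.ext ((A.chart c).trans_trans (A.chart b) (A.chart a) y hy.2 hy.1.2 hy.1.1 s)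

instance (i : Fin n) : (A.core i).IsContMDiff (𝓡 Z.M.dim) ∞ :=
  ⟨A.contMDiffOn_coordChange i⟩

/-- The vector bundle `E i` of a graded manifold. -/
def bundle (i : Fin n) : VBundle Z.M where
  rank := Module.finrank ℝ (modelPart m i)
  fiber := (A.core i).Fiber

/-- The identification of the dual of the fibre of `E i` with the homogeneous part of the model. -/
def fiberEquiv (y : Z.M.carrier) (i : Fin n) :
    modelPart m i ≃ₗ[ℝ] Module.Dual ℝ ((A.bundle i).fiber y) :=
  preDualEquiv (modelPart m i)

/-- The section of the dual of `E i` given by a homogeneous element of the model, over the domain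
of a chart. -/
def frame (x y : Z.M.carrier) (hy : y ∈ (A.chart x).U) (i : Fin n) :
    modelPart m i →ₗ[ℝ] Module.Dual ℝ ((A.bundle i).fiber y) :=
  (A.fiberEquiv y i).toLinearMap ∘ₗ (A.chart x).transDeg (A.chart y) y hy (A.mem y) i

theorem isSmoothDual_frame (x : Z.M.carrier) (i : Fin n) (s : modelPart m i) :
    (A.bundle i).IsSmoothDual (A.chart x).U (fun y => A.frame x y y.2 i s) := by
  let e : (A.bundle i).Triv := (A.core i).localTriv x
  have : MemTrivializationAtlas e := ⟨⟨x, rfl⟩⟩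
  have hU : ((A.chart x).U : Set Z.M.carrier) ⊆ e.baseSet := fun y hy => hy
  have h := VBundle.isSmoothDual_sum (E := A.bundle i) (U := (A.chart x).U) Finset.univ
    (ξ := fun k y => (Module.finBasis ℝ (modelPart m i)).repr s k • VBundle.coframe e y k)
    fun k _ => (VBundle.isSmoothDual_coframe hU k).const_smul
  have heq : (fun y : (A.chart x).U => A.frame x y y.2 i s) = fun y =>
      ∑ k, (Module.finBasis ℝ (modelPart m i)).repr s k • VBundle.coframe e y.1 k := by
    funext y
    refine LinearMap.ext fun v => ?_
    rw [LinearMap.sum_apply]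
    refine (A.preDualEquiv_coordChange (A.mem y) y.2 s v).symm.trans ?_
    refine (preDualEquiv_apply s _).trans (Finset.sum_congr rfl fun k _ => ?_)
    refine Eq.trans ?_ (congrArg
      ((Module.finBasis ℝ (modelPart m i)).repr s k * ·)
      (VBundle.coframe_apply (hU y.2) k v).symm)
    rfl
  exact heq ▸ h

end Atlas

end GrMfd

namespace GrMfd.Atlas

variable {n : ℕ} {Z : GrMfd} {m : Fin n → ℕ} (A : Atlas Z m)

/-! ### The coalgebra bundle of a graded manifold -/

theorem frame_apply (x y : Z.M.carrier) (hy : y ∈ (A.chart x).U) (i : Fin n) (s : modelPart m i) :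
    A.frame x y hy i s =
      A.fiberEquiv y i ((A.chart x).transDeg (A.chart y) y hy (A.mem y) i s) := rfl

theorem frame_bijective (x y : Z.M.carrier) (hy : y ∈ (A.chart x).U) (i : Fin n) :
    Function.Bijective (A.frame x y hy i) := by
  refine (A.fiberEquiv y i).bijective.comp (Function.bijective_iff_has_inverse.2
    ⟨(A.chart y).transDeg (A.chart x) y (A.mem y) hy i, fun s => ?_, fun s => ?_⟩)
  · exact Subtype.ext ((A.chart x).trans_trans_self (A.chart y) y hy (A.mem y) s)
  · exact Subtype.ext ((A.chart y).trans_trans_self (A.chart x) y (A.mem y) hy s)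

/-- The comultiplication on the fibre at a point, dual to the product of the model. -/
def comul (y : Z.M.carrier) : Tot (fun i => (A.bundle i).fiber y) →ₗ[ℝ]
    Tot (fun i => (A.bundle i).fiber y) ⊗[ℝ] Tot (fun i => (A.bundle i).fiber y) :=
  (exists_isCoalg (A.fiberEquiv y)).choose

theorem isCoalg_comul (y : Z.M.carrier) : IsCoalg (A.comul y) :=
  (exists_isCoalg (A.fiberEquiv y)).choose_spec.1

theorem dualMul_fiberEquiv (y : Z.M.carrier) (i j k : Fin n) (h : wt i + wt j = wt k)
    (s : modelPart m i) (t : modelPart m j) :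
    dualMul (A.comul y) i j k (A.fiberEquiv y i s) (A.fiberEquiv y j t) =
      A.fiberEquiv y k (mulDeg h s t) :=
  (exists_isCoalg (A.fiberEquiv y)).choose_spec.2 i j k h s t

theorem dualMul_frame (x y : Z.M.carrier) (hy : y ∈ (A.chart x).U) (i j k : Fin n)
    (h : wt i + wt j = wt k) (s : modelPart m i) (t : modelPart m j) :
    dualMul (A.comul y) i j k (A.frame x y hy i s) (A.frame x y hy j t) =
      A.frame x y hy k (mulDeg h s t) := by
  rw [frame_apply, frame_apply, dualMul_fiberEquiv _ _ _ _ _ h, frame_apply]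
  refine congrArg (A.fiberEquiv y k) (Subtype.ext ?_)
  exact (map_mul ((A.chart x).trans (A.chart y) y hy (A.mem y)) s.1 t.1).symm

/-- The homogeneous parts of the model give smooth frames of the dual bundles over the charts. -/
theorem exists_coeff (x : Z.M.carrier) {V : Opens Z.M.carrier} (hV : V ≤ (A.chart x).U)
    {i : Fin n} {ξ : ∀ y : V, Module.Dual ℝ ((A.bundle i).fiber y)}
    (hξ : (A.bundle i).IsSmoothDual V ξ) :
    ∃ f : Fin (Module.finrank ℝ (modelPart m i)) → V → ℝ,
      (∀ a, ContMDiff (𝓡 Z.M.dim) 𝓘(ℝ, ℝ) ∞ (f a)) ∧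
      ∀ y : V, ξ y = A.frame x y (hV y.2) i
        (∑ a, f a y • Module.finBasis ℝ (modelPart m i) a) := by
  let J := fun y : V => LinearEquiv.ofBijective _ (A.frame_bijective x y (hV y.2) i)
  let β := Module.finBasis ℝ (modelPart m i)
  let f : Fin (Module.finrank ℝ (modelPart m i)) → V → ℝ := fun a y => β.repr ((J y).symm (ξ y)) a
  have hf : ∀ y : V, ξ y = A.frame x y (hV y.2) i (∑ a, f a y • β a) := fun y => by
    rw [β.sum_repr]
    exact ((J y).apply_symm_apply (ξ y)).symm
  refine ⟨f, ?_, hf⟩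
  refine VBundle.contMDiff_coeff (E := A.bundle i) (fun a y => A.frame x y (hV y.2) i (β a))
    (fun a => (A.isSmoothDual_frame x i (β a)).restrict hV) (Fintype.card_fin _) (fun y => ?_) hξ
    fun y => ?_
  · exact β.linearIndependent.map' (J y).toLinearMap (J y).ker
  · rw [hf y, map_sum]
    exact Finset.sum_congr rfl fun a _ => map_smul _ _ _

/-- The coalgebra bundle of a graded manifold with an atlas. -/
abbrev coalg : CoalgBundle n where
  M := Z.M
  E := A.bundle
  μ := A.comul
  isCoalg := A.isCoalg_comul
  smooth_μ U i j k ξ η hξ hη := by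
    by_cases h : wt i + wt j = wt k
    · refine VBundle.isSmoothDual_of_locally fun x hx => ?_
      let V : Opens Z.M.carrier := U ⊓ (A.chart x).U
      have hVU : V ≤ U := inf_le_left
      have hV : V ≤ (A.chart x).U := inf_le_right
      refine ⟨V, hVU, ⟨hx, A.mem x⟩, ?_⟩
      obtain ⟨f, hf, hf'⟩ := A.exists_coeff x hV (hξ.restrict hVU)
      obtain ⟨g, hg, hg'⟩ := A.exists_coeff x hV (hη.restrict hVU)
      have hsm := VBundle.isSmoothDual_sum (E := A.bundle k) (U := V) Finset.univ
        (ξ := fun a y => ∑ b, (f a y * g b y) • A.frame x y (hV y.2) k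
          (mulDeg h (Module.finBasis ℝ (modelPart m i) a) (Module.finBasis ℝ (modelPart m j) b)))
        fun a _ => VBundle.isSmoothDual_sum _ fun b _ => VBundle.IsSmoothDual.smul
          ((hf a).mul (hg b)) ((A.isSmoothDual_frame x k _).restrict hV)
      have heq : (fun y : V => dualMul (A.comul y) i j k (ξ ⟨y, hVU y.2⟩) (η ⟨y, hVU y.2⟩)) =
          fun y => ∑ a, ∑ b, (f a y * g b y) • A.frame x y (hV y.2) k (mulDeg h
            (Module.finBasis ℝ (modelPart m i) a) (Module.finBasis ℝ (modelPart m j) b)) := by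
        funext y
        rw [hf' y, hg' y, A.dualMul_frame x y (hV y.2) i j k h]
        simp only [map_sum, LinearMap.sum_apply, map_smul, LinearMap.smul_apply,
          Finset.smul_sum, smul_smul]
        rw [Finset.sum_comm]
        simp only [mul_comm]
      exact heq ▸ hsm
    · have heq : (fun y : U => dualMul (A.comul y) i j k (ξ y) (η y)) = fun _ => 0 :=
        funext fun y => dualMul_eq_zero (A.isCoalg_comul y) h _ _
      exact heq ▸ VBundle.isSmoothDual_zero

/-- The inclusion of the generators of the model in its homogeneous parts. -/
def modelGen (m : Fin n → ℕ) (i : Fin n) : (Fin (m i) → ℝ) →ₗ[ℝ] modelPart m i :=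
  (GSym.ι (V := fun i => Fin (m i) → ℝ) i).codRestrict _ fun v =>
    GSym.ι_mem (V := fun i => Fin (m i) → ℝ) i v

/-- In a chart, the duals of the fibres are the homogeneous parts of the model, and the generators of
the model generate them freely. -/
theorem isAdmissible_coalg : CoalgBundle.IsAdmissible n A.coalg := by
  intro y i _
  refine le_antisymm (range_le_coassocSpace (A.isCoalg_comul y) i) ?_
  let j : ∀ i, (Fin (m i) → ℝ) →ₗ[ℝ] Module.Dual ℝ ((A.bundle i).fiber y) :=
    fun i => (A.fiberEquiv y i).toLinearMap ∘ₗ modelGen m i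
  refine coassocSpace_le_range (V := fun i => Fin (m i) → ℝ) (A.isCoalg_comul y) j (fun i => ?_) i
  have h := toDualDeg_eq (V := fun i => Fin (m i) → ℝ) (A.isCoalg_comul y)
    (fun i => (A.fiberEquiv y i).toLinearMap) (A.dualMul_fiberEquiv y) j (fun _ _ => rfl) i
  rw [h]
  exact (A.fiberEquiv y i).bijective

/-- The sections of the duals of the bundles given by the generators of the model. -/
def genFrame (x : Z.M.carrier) (i : Fin n) (a : Fin (m i)) :
    (A.coalg.E i).smoothDual (A.chart x).U :=
  ⟨fun y => A.frame x y y.2 i (modelGen m i (Pi.single a 1)), A.isSmoothDual_frame x i _⟩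

theorem jAt_genFrame (x : Z.M.carrier) (y : (A.chart x).U) (i : Fin n) :
    CoalgBundle.jAt (A.genFrame x) y i = A.frame x y y.2 i ∘ₗ modelGen m i := by
  refine LinearMap.pi_ext' fun a => LinearMap.ext_ring ?_
  rw [LinearMap.comp_apply, LinearMap.comp_apply, LinearMap.single_apply, CoalgBundle.jAt,
    Fintype.linearCombination_apply_single, one_smul]
  rfl

theorem toDualDeg_jAt_genFrame (x : Z.M.carrier) (y : (A.chart x).U) (i : Fin n) :
    Function.Bijective (toDualDeg (A.coalg.isCoalg y) (CoalgBundle.jAt (A.genFrame x) y) i) := by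
  have h := toDualDeg_eq (V := fun i => Fin (m i) → ℝ) (A.isCoalg_comul y)
    (fun i => A.frame x y y.2 i) (A.dualMul_frame x y y.2) (CoalgBundle.jAt (A.genFrame x) y)
    (fun i v => LinearMap.congr_fun (A.jAt_genFrame x y i) v) i
  have h' := A.frame_bijective x y y.2 i
  rw [← h] at h'
  exact h'

/-- The identification of the duals of the fibres with the homogeneous parts of the model. -/
def fibreMap : CoalgBundle.FibreMap A.coalg m where
  map y i := (modelPart m i).subtype ∘ₗ (A.fiberEquiv y i).symm.toLinearMap
  mem y i ξ := ((A.fiberEquiv y i).symm ξ).2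
  mul y i j k ξ η h := by
    obtain ⟨s, rfl⟩ := (A.fiberEquiv y i).surjective ξ
    obtain ⟨t, rfl⟩ := (A.fiberEquiv y j).surjective η
    have h₁ := congrArg (A.fiberEquiv y k).symm (A.dualMul_fiberEquiv y i j k h s t)
    rw [LinearEquiv.symm_apply_apply] at h₁
    refine (congrArg Subtype.val h₁).trans ?_
    simp only [LinearMap.comp_apply, LinearEquiv.coe_coe, LinearEquiv.symm_apply_apply]
    rfl

theorem trans_ι (x : Z.M.carrier) (y : (A.chart x).U) (i : Fin n) (c : Fin (m i) → ℝ) :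
    (A.chart x).trans (A.chart y) y y.2 (A.mem y) (GSym.ι (V := fun i => Fin (m i) → ℝ) i c) =
      A.fibreMap.map y i (CoalgBundle.jAt (A.genFrame x) y i c) := by
  have h := congrArg (A.fiberEquiv y i).symm (LinearMap.congr_fun (A.jAt_genFrame x y i) c)
  rw [LinearMap.comp_apply, frame_apply, LinearEquiv.symm_apply_apply] at h
  exact (congrArg Subtype.val h).symm

end GrMfd.Atlas

namespace GrMfd

variable {n : ℕ} {Z : GrMfd} {m : Fin n → ℕ}

/-! ### Every graded manifold comes from an admissible coalgebra bundle -/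

theorem eq_of_locally_eq_res {W : Opens Z.M.carrier} {s t : Z.C.obj.obj (op W)}
    (h : ∀ x ∈ W, ∃ (V : Opens Z.M.carrier) (i : V ≤ W), x ∈ V ∧
      res Z.C.obj i s = res Z.C.obj i t) : s = t :=
  eq_of_locally_eq Z.C s t h

namespace Atlas

variable (A : Atlas Z m)

/-- The value of a section at a point, in the chart that belongs to the point. -/
def val (W : Opens Z.M.carrier) (y : W) :
    Z.C.obj.obj (op W) →ₐ[ℝ] GSym (fun i => Fin (m i) → ℝ) :=
  (A.chart y).val W y y.2 (A.mem y)

theorem val_res {W W' : Opens Z.M.carrier} (i : W' ≤ W) (y : W') (s : Z.C.obj.obj (op W)) :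
    A.val W' y (res Z.C.obj i s) = A.val W ⟨y, i y.2⟩ s :=
  (A.chart y).val_res i y y.2 (A.mem y) s

theorem trans_chart_val (x : Z.M.carrier) {W : Opens Z.M.carrier} (s : Z.C.obj.obj (op W)) (y : W)
    (hy : y.1 ∈ (A.chart x).U) : (A.chart x).trans (A.chart y) y hy (A.mem y)
      ((A.chart x).val W y y.2 hy s) = A.val W y s :=
  (A.chart x).trans_val (A.chart y) s y y.2 hy (A.mem y)

theorem val_sec (x : Z.M.carrier) {V : Opens Z.M.carrier} (hV : V ≤ (A.chart x).U)
    (t : Model Z.M m V) (y : V) : A.val V y ((A.chart x).sec hV t) =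
      (A.chart x).trans (A.chart y) y (hV y.2) (A.mem y) (modelEval m y t) :=
  (A.chart x).trans_modelEval (A.chart y) hV t y y.2 (A.mem y)

theorem val_injective {W : Opens Z.M.carrier} {s t : Z.C.obj.obj (op W)}
    (h : ∀ y : W, A.val W y s = A.val W y t) : s = t := by
  refine eq_of_locally_eq_res fun x hx => ⟨W ⊓ (A.chart x).U, inf_le_left, ⟨hx, A.mem x⟩, ?_⟩
  refine (A.chart x).val_injective inf_le_right fun y hy => ?_
  rw [Chart.val_res, Chart.val_res]
  refine (A.chart x).trans_injective (A.chart y) y hy.2 (A.mem y) ?_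
  exact (A.trans_chart_val x s ⟨y, hy.1⟩ hy.2).trans
    ((h ⟨y, hy.1⟩).trans (A.trans_chart_val x t ⟨y, hy.1⟩ hy.2).symm)

theorem mem_deg_iff {l : ℕ} {W : Opens Z.M.carrier} {s : Z.C.obj.obj (op W)} :
    s ∈ Z.grading.deg l W ↔ ∀ y : W, A.val W y s ∈ GSym.deg (fun i => Fin (m i) → ℝ) l := by
  refine ⟨fun hs y => (A.chart y).val_mem hs y y.2 (A.mem y), fun h => ?_⟩
  refine Z.grading.mem_of_locally_mem l W s fun x hx =>
    ⟨W ⊓ (A.chart x).U, inf_le_left, ⟨hx, A.mem x⟩, ?_⟩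
  refine (A.chart x).mem_deg_of_val_mem inf_le_right fun y hy => ?_
  have h₁ := (A.chart x).val_res (inf_le_left : W ⊓ (A.chart x).U ≤ W) y hy hy.2 s
  refine (congrArg (· ∈ GSym.deg (fun i => Fin (m i) → ℝ) l) h₁).mpr ?_
  refine (A.chart x).mem_of_trans_mem (A.chart y) y hy.2 (A.mem y) ?_
  exact (congrArg (· ∈ GSym.deg (fun i => Fin (m i) → ℝ) l)
    (A.trans_chart_val x s ⟨y, hy.1⟩ hy.2)).mpr (h ⟨y, hy.1⟩)

/-- The value at a point of the sections of the sheaf of functions of the coalgebra bundle. -/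
abbrev coalgVal (W : Opens Z.M.carrier) (y : W) :
    (shf A.coalg.quotPresheaf).obj (op W) →ₐ[ℝ] GSym (fun i => Fin (m i) → ℝ) :=
  A.fibreMap.val W y

theorem coalgVal_res {W W' : Opens Z.M.carrier} (i : W' ≤ W) (y : W')
    (s : (shf A.coalg.quotPresheaf).obj (op W)) :
    A.coalgVal W' y (res (shf A.coalg.quotPresheaf) i s) = A.coalgVal W ⟨y, i y.2⟩ s :=
  A.fibreMap.val_res i y s

theorem coalgVal_phi (x : Z.M.carrier) {V : Opens Z.M.carrier} (hV : V ≤ (A.chart x).U)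
    (t : Model Z.M m V) (y : V) :
    A.coalgVal V y (CoalgBundle.toS (X := A.coalg) V (CoalgBundle.phi (X := A.coalg) (A.genFrame x) hV t)) =
      (A.chart x).trans (A.chart y) y (hV y.2) (A.mem y) (modelEval m y t) :=
  A.fibreMap.val_phi (A.genFrame x)
    (fun y => (A.chart x).trans (A.chart y) y y.2 (A.mem y)) (A.trans_ι x) hV t y

theorem coalgVal_injective {W : Opens Z.M.carrier} {s t : (shf A.coalg.quotPresheaf).obj (op W)}
    (h : ∀ y : W, A.coalgVal W y s = A.coalgVal W y t) : s = t := by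
  refine shf_eq_of_locally_eq (T := TopCat.of Z.M.carrier) s t fun x hx =>
    ⟨W ⊓ (A.chart x).U, inf_le_left, ⟨hx, A.mem x⟩, ?_⟩
  refine A.fibreMap.val_injective (A.genFrame x)
    (fun y => (A.chart x).trans (A.chart y) y y.2 (A.mem y)) (A.trans_ι x)
    (A.toDualDeg_jAt_genFrame x)
    (fun y => (A.chart x).trans_injective (A.chart y) y y.2 (A.mem y)) inf_le_right fun y => ?_
  exact (A.coalgVal_res inf_le_left y s).trans ((h _).trans (A.coalgVal_res inf_le_left y t).symm)

theorem mem_coalg_deg_iff {l : ℕ} {W : Opens Z.M.carrier}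
    {s : (shf A.coalg.quotPresheaf).obj (op W)} :
    s ∈ A.coalg.sheafGrading.deg l W ↔
      ∀ y : W, A.coalgVal W y s ∈ GSym.deg (fun i => Fin (m i) → ℝ) l := by
  refine ⟨fun hs y => A.fibreMap.val_mem hs y, fun h => ?_⟩
  refine A.coalg.sheafGrading.mem_of_locally_mem l W s fun x hx =>
    ⟨W ⊓ (A.chart x).U, inf_le_left, ⟨hx, A.mem x⟩, ?_⟩
  refine A.fibreMap.mem_deg_of_val_mem (A.genFrame x)
    (fun y => (A.chart x).trans (A.chart y) y y.2 (A.mem y)) (A.trans_ι x)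
    (A.toDualDeg_jAt_genFrame x)
    (fun y _ hb => (A.chart x).mem_of_trans_mem (A.chart y) y y.2 (A.mem y) hb) inf_le_right
    fun y => ?_
  exact (congrArg (· ∈ GSym.deg (fun i => Fin (m i) → ℝ) l)
    (A.coalgVal_res inf_le_left y s)).mpr (h _)

/-- The functions of the coalgebra bundle of a graded manifold are the given ones: both sheaves are
the same sheaf of functions with values in the graded symmetric algebra. -/
theorem exists_iso : ∃ e : Z.C.obj ≅ shf A.coalg.quotPresheaf,
    ∀ (W : Opens Z.M.carrier) (s : Z.C.obj.obj (op W)) (y : W),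
      A.coalgVal W y ((e.hom.app (op W)).hom s) = A.val W y s := by
  let R : TopCat.of Z.M.carrier → Type := fun _ => GSym (fun i => Fin (m i) → ℝ)
  let a : Z.C.obj ⟶ funPresheaf R := toFunPresheaf (fun W y => A.val W y)
    (fun _ _ i y s => A.val_res i y s)
  let b : shf A.coalg.quotPresheaf ⟶ funPresheaf R := toFunPresheaf (fun W y => A.coalgVal W y)
    (fun _ _ i y s => A.coalgVal_res i y s)
  have ha : ∀ W : Opens Z.M.carrier, Function.Injective (a.app (op W)).hom :=
    fun W s t hst => A.val_injective fun y => congrFun hst y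
  have hb : ∀ W : Opens Z.M.carrier, Function.Injective (b.app (op W)).hom :=
    fun W s t hst => A.coalgVal_injective fun y => congrFun hst y
  have hab : ∀ (W : Opens Z.M.carrier) (s : Z.C.obj.obj (op W)), ∀ x ∈ W,
      ∃ (V : Opens Z.M.carrier) (i : V ≤ W), x ∈ V ∧
        ∃ t, (b.app (op V)).hom t = res (funPresheaf R) i ((a.app (op W)).hom s) := by
    intro W s x hx
    obtain ⟨V, i, hV, hxV, t, ht⟩ := (A.chart x).exists_locally_eq_sec s hx (A.mem x)
    refine ⟨V, i, hxV, CoalgBundle.toS (X := A.coalg) V (CoalgBundle.phi (X := A.coalg) (A.genFrame x) hV t), ?_⟩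
    funext y
    refine (A.coalgVal_phi x hV t y).trans ?_
    refine (A.val_sec x hV t y).symm.trans ?_
    exact (congrArg (A.val V y) ht).symm.trans (A.val_res i y s)
  have hba : ∀ (W : Opens Z.M.carrier) (s : (shf A.coalg.quotPresheaf).obj (op W)), ∀ x ∈ W,
      ∃ (V : Opens Z.M.carrier) (i : V ≤ W), x ∈ V ∧
        ∃ t, (a.app (op V)).hom t = res (funPresheaf R) i ((b.app (op W)).hom s) := by
    intro W s x hx
    have hW : W ⊓ (A.chart x).U ≤ W := inf_le_left
    have hU : W ⊓ (A.chart x).U ≤ (A.chart x).U := inf_le_right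
    obtain ⟨V, i, hxV, t, ht⟩ := CoalgBundle.exists_locally_eq_phi (A.genFrame x) hU
      (A.toDualDeg_jAt_genFrame x) (res (shf A.coalg.quotPresheaf) hW s) (x := x) ⟨hx, A.mem x⟩
    refine ⟨V, i.trans hW, hxV, (A.chart x).sec (i.trans hU) t, ?_⟩
    funext y
    refine (A.val_sec x (i.trans hU) t y).trans ?_
    refine (A.coalgVal_phi x (i.trans hU) t y).symm.trans ?_
    refine (congrArg (A.coalgVal V y) ht).symm.trans ?_
    exact (A.coalgVal_res i y _).trans (A.coalgVal_res hW _ s)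
  obtain ⟨e, he⟩ := exists_iso_of_locally Z.C.property A.coalg.toGrMfd.C.property
    (funPresheaf_isSheaf R) a b ha hb hab hba
  exact ⟨e, fun W s y => congrFun (he W s) y⟩

end Atlas

/-- A degree-preserving morphism of the sheaves of two graded manifolds over the same manifold, as a
morphism over the identity in the opposite direction. -/
def homOfSheafHom {M : Mfd} {C D : TopCat.Sheaf (AlgCat.{0} ℝ) (TopCat.of M.carrier)}
    {g : SheafGrading C} {g' : SheafGrading D} (f : D.obj ⟶ C.obj)
    (hf : ∀ (l : ℕ) (U : Opens M.carrier) (s : D.obj.obj (op U)), s ∈ g'.deg l U →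
      (f.app (op U)).hom s ∈ g.deg l U) : (⟨M, C, g⟩ : GrMfd) ⟶ ⟨M, D, g'⟩ where
  toHom := InducedCategory.homMk ⟨𝟙 _, f⟩
  smooth := contMDiff_id
  deg_mem l U s hs := hf l U s hs

/-- Graded manifolds over the same manifold are isomorphic if their graded sheaves are. -/
def isoOfSheafIso {M : Mfd} {C D : TopCat.Sheaf (AlgCat.{0} ℝ) (TopCat.of M.carrier)}
    {g : SheafGrading C} {g' : SheafGrading D} (e : D.obj ≅ C.obj)
    (he : ∀ (l : ℕ) (U : Opens M.carrier) (s : D.obj.obj (op U)), s ∈ g'.deg l U ↔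
      (e.hom.app (op U)).hom s ∈ g.deg l U) : (⟨M, C, g⟩ : GrMfd) ≅ ⟨M, D, g'⟩ where
  hom := homOfSheafHom e.hom fun l U s hs => (he l U s).1 hs
  inv := homOfSheafHom e.inv fun l U s hs => (he l U _).2 (by
    have h : (e.hom.app (op U)).hom ((e.inv.app (op U)).hom s) = s :=
      congrArg (fun f : C.obj ⟶ C.obj => (f.app (op U)).hom s) e.inv_hom_id
    exact h.symm ▸ hs)
  hom_inv_id := by
    apply GrMfd.Hom.ext'
    apply InducedCategory.hom_ext
    refine AlgebraicGeometry.PresheafedSpace.hext _ _ rfl (heq_of_eq ?_)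
    exact e.inv_hom_id
  inv_hom_id := by
    apply GrMfd.Hom.ext'
    apply InducedCategory.hom_ext
    refine AlgebraicGeometry.PresheafedSpace.hext _ _ rfl (heq_of_eq ?_)
    exact e.hom_inv_id

theorem exists_iso_toGrMfd (h : IsNMfd n Z) :
    ∃ X : CoalgBundle n, CoalgBundle.IsAdmissible n X ∧ Nonempty (X.toGrMfd ≅ Z) := by
  obtain ⟨m, ⟨A⟩⟩ := exists_atlas h
  obtain ⟨e, he⟩ := A.exists_iso
  refine ⟨A.coalg, A.isAdmissible_coalg, ⟨?_⟩⟩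
  refine isoOfSheafIso (M := Z.M) (C := A.coalg.toGrMfd.C) (D := Z.C) (g := A.coalg.sheafGrading)
    (g' := Z.grading) e fun l U s => ?_
  refine A.mem_deg_iff.trans (Iff.trans ?_ A.mem_coalg_deg_iff.symm)
  exact forall_congr' fun y => (congrArg (· ∈ GSym.deg (fun i => Fin (m i) → ℝ) l)
    (he U s y)).symm.to_iff

end GrMfd

end NMan

end

theorem mainTheorem2 (n : ℕ) :
    ∃ h : ∀ X : (NMan.CoalgBundle.IsAdmissible n).FullSubcategory,
        NMan.GrMfd.IsNMfd n
          (((NMan.CoalgBundle.IsAdmissible n).ι ⋙ NMan.CoalgBundle.geometrization n).obj X),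
      ((NMan.GrMfd.IsNMfd n).lift
        ((NMan.CoalgBundle.IsAdmissible n).ι ⋙ NMan.CoalgBundle.geometrization n)
          h).IsEquivalence := by
  have h : ∀ X : (NMan.CoalgBundle.IsAdmissible n).FullSubcategory,
      NMan.GrMfd.IsNMfd n
        (((NMan.CoalgBundle.IsAdmissible n).ι ⋙ NMan.CoalgBundle.geometrization n).obj X) :=
    fun X => NMan.CoalgBundle.isNMfd_of_isAdmissible X.property
  have hfaithful : ((NMan.GrMfd.IsNMfd n).lift
      ((NMan.CoalgBundle.IsAdmissible n).ι ⋙ NMan.CoalgBundle.geometrization n) h).Faithful :=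
    inferInstance
  have hfull : ((NMan.GrMfd.IsNMfd n).lift
      ((NMan.CoalgBundle.IsAdmissible n).ι ⋙ NMan.CoalgBundle.geometrization n) h).Full :=
    inferInstance
  refine ⟨h, { faithful := hfaithful, full := hfull, essSurj := ⟨fun Z => ?_⟩ }⟩
  obtain ⟨X, hX, ⟨e⟩⟩ := NMan.GrMfd.exists_iso_toGrMfd Z.property
  exact ⟨⟨X, hX⟩, ⟨(NMan.GrMfd.IsNMfd n).isoMk e⟩⟩
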